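/- \textbf{Setting.} Feynman graphs have one scalar type of edge and vertices of any valence $\ge 3$; a graph is 1PI if it is connected, is not a tree, and stays connected when any one internal line is cut. We consider 1PI graphs with at least one external leg. Let $H$ be the free commutative $\mathbb C$-algebra on isomorphism classes of 1PI graphs (isomorphisms may permute external legs), with the coproduct of the core Hopf algebra $\Delta\Gamma=\Gamma\otimes\mathbb I+\mathbb I\otimes\Gamma+\sum_{\emptyset\subsetneq\gamma\subsetneq\Gamma}\gamma\otimes\Gamma/\gamma$, the sum being over disjoint unions $\gamma$ of 1PI subgraphs; in $\Gamma/\gamma$ each component of $\gamma$ shrinks to a vertex, or, if it has two external legs, to a piece of line. For $n\ge2$ let $s_n=-1$ if $n=2$ and $s_n=1$ otherwise, and $$X^n=\mathbb I+s_n\sum_\Gamma g^{L(\Gamma)}\frac{\Gamma}{\mathrm{Sym}(\Gamma)}=\sum_{l\ge0}g^lX^n_l\in H[[g]],$$ the sum being over 1PI graphs with $n$ fixed external legs; $L(\Gamma)$ is the number of loops and $\mathrm{Sym}(\Gamma)$ the number of automorphisms fixing the legs. For $m\ge3$ let $Q^{(m)}=\big[X^m/(X^2)^{m/2}\big]^{1/(m-2)}=\sum_l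 g^lQ^{(m)}_l$, let $I\subset H$ be the ideal generated by all $Q^{(m)}_l-Q^{(m')}_l$ ($m,m'\ge3$, $l\ge0$), let $\tilde H=H/I$ with projection $\pi$, let $Q$ be the common class of the $Q^{(m)}$ in $\tilde H[[g]]$, and put $X_{l,n}=X^nQ^{2l}\in\tilde H[[g]]$, with coefficients $(X_{l,n})_k$. \textbf{Grafting operators.} For a 1PI graph $\gamma$ and a monomial $h$ in $H$ put $$B_+^\gamma(h)=\sum_\Gamma\frac{\mathbf{bij}(\gamma,h,\Gamma)}{|h|_\vee}\,\frac1{\mathrm{maxf}(\Gamma)}\,\frac1{(\gamma|h)}\,\Gamma ,$$ extended linearly to $H$ (terms without insertion place are $0$). Here $(\gamma|h)$ is the number of insertion places of $h$ in $\gamma$ (at most one component of $h$ at a vertex, whose valence is its number of legs; a finite sequence of components with two legs on each internal line; all components are used), $|h|_\vee$ is the number of distinct graphs obtained by permuting the external legs of the components of $h$, $\mathbf{bij}(\gamma,h,\Gamma)$ is the number of insertions of $h$ into $\gamma$ (a place with an identification of the legs, up to isomorphisms of the inserted graphs) that give $\Gamma$, and $\mathrm{maxf}(\Gamma)$ is the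 number of disjoint unions $f\subsetneq\Gamma$ of 1PI subgraphs (possibly empty) with $\Gamma/f$ primitive; $\gamma$ is primitive if $\Delta\gamma=\gamma\otimes\mathbb I+\mathbb I\otimes\gamma$. For $\gamma$ with vertex set $V(\gamma)$ and internal lines $E(\gamma)$ let $X^{[\gamma]}=\prod_{v\in V(\gamma)}X^{\mathrm{val}(v)}\prod_{e\in E(\gamma)}(X^2)^{-1}\in H[[g]]$, with coefficients $X^{[\gamma]}_k$. \textbf{Theorem.} The coproduct of $H$ induces an algebra map $\Delta:\tilde H\to\tilde H\otimes\tilde H$, and all $Q^{(m)}$ have the same class in $\tilde H[[g]]$. If $\gamma$ is a 1PI graph with $n\ge2$ fixed legs and $l$ loops, then $X^{[\gamma]}$ is a lift of $X_{l,n}$, that is, $\pi(X^{[\gamma]})=X_{l,n}$. There are linear maps $B_+^{l;n}:\tilde H\to\tilde H$ which on the coefficients of $X_{l,n}$ are given by $\sum_\gamma\frac1{\mathrm{Sym}(\gamma)}B_+^\gamma$, each $B_+^\gamma$ acting on the lift that fits $\gamma$, $$B_+^{l;n}\big((X_{l,n})_k\big)=\pi\Big(\sum_{\gamma}\tfrac1{\mathrm{Sym}(\gamma)}B_+^\gamma\big(X^{[\gamma]}_k\big)\Big)\qquad(n\ge2,\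 l,k\ge0),$$ with the sum over primitive $\gamma$ with $l$ loops and $n$ fixed legs, such that for all $n\ge2$, applying $\Delta$ and $B_+^{l;n}$ coefficientwise in $g$: \begin{enumerate} \item $X^n=\mathbb I+s_n\sum_{l\ge1}g^l\,B_+^{l;n}(X_{l,n})$ in $\tilde H[[g]]$. \item $\Delta\big(B_+^{l;n}(X_{l,n})\big)=B_+^{l;n}(X_{l,n})\otimes\mathbb I+(\mathrm{id}\otimes B_+^{l;n})\Delta(X_{l,n})$ for all $l$, and the last term has coefficients $(\pi\otimes\pi)\sum_\gamma\frac1{\mathrm{Sym}(\gamma)}(\mathrm{id}\otimes B_+^\gamma)\Delta(X^{[\gamma]}_k)$, with the same sum over $\gamma$. \item $\Delta(X^n_l)=\sum_{j=0}^l\mathrm{Pol}^n_{j}\otimes X^n_{l-j}$ in $\tilde H\otimes\tilde H$ for all $l\ge 0$, where $\mathrm{Pol}^n_{j}=\mathrm{Pol}^n_{j,l}$ is the coefficient of $g^j$ in $X^nQ^{2l-2j}$ and is a polynomial in the $X^{k}_m$ ($k\ge2$, $m\ge0$) which is homogeneous of degree $j$ if $X^k_m$ has degree $m$. \end{enumerate}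 -/

import Mathlib

open scoped TensorProduct

noncomputable section

namespace CoreHopf

/-! ## Feynman graphs with one scalar edge type

A graph is a finite set of half-edges with two equivalence relations: "at the same vertex" and
"on the same line". A half-edge that is alone on its line is an external leg. -/

/-- Half-edge data of a graph. -/
structure PreGraph : Type 1 where
  HE : Type
  [fin : Finite HE]
  vert : Setoid HE
  line : Setoid HE

attribute [instance] PreGraph.fin

namespace PreGraph

variable (G : PreGraph)

/-- External legs: half-edges that are alone on their line. -/
def IsLeg (d : G.HE) : Prop := ∀ e, G.line.r d e → e = d

def Leg : Type := {d : G.HE // G.IsLeg d}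

abbrev Vertex : Type := Quotient G.vert

/-- The half-edges at a vertex. -/
def Prong (v : G.Vertex) : Type := {d : G.HE // (Quotient.mk G.vert d) = v}

/-- Internal lines. -/
def IntLine : Type := {q : Quotient G.line // ∃ d, Quotient.mk G.line d = q ∧ ¬ G.IsLeg d}

def internal : Set G.HE := {d | ¬ G.IsLeg d}

/-- The number `E` of external lines. -/
def numLegs : ℕ := Nat.card G.Leg
/-- The number `V` of vertices. -/
def numVerts : ℕ := Nat.card G.Vertex
/-- The number `I` of internal lines. -/
def numInt : ℕ := Nat.card G.IntLine
def valence (v : G.Vertex) : ℕ := Nat.card (G.Prong v)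

/-- The number of loops of a connected graph, `L = I - V + 1`. -/
def loops : ℕ := G.numInt + 1 - G.numVerts

/-- Lie on a common line all of whose two ends are in `S` (or be equal): the line relation
after all lines outside `S` have been cut. -/
def lineOn (S : Set G.HE) : Setoid G.HE where
  r d e := d = e ∨ (d ∈ S ∧ e ∈ S ∧ G.line.r d e)
  iseqv :=
    { refl := fun _ => Or.inl rfl
      symm := by
        rintro d e (rfl | ⟨h1, h2, h3⟩)
        · exact Or.inl rfl
        · exact Or.inr ⟨h2, h1, G.line.iseqv.symm h3⟩
      trans := by
        rintro d e f (rfl | ⟨h1, h2, h3⟩) (rfl | ⟨h4, h5, h6⟩)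
        · exact Or.inl rfl
        · exact Or.inr ⟨h4, h5, h6⟩
        · exact Or.inr ⟨h1, h2, h3⟩
        · exact Or.inr ⟨h1, h5, G.line.iseqv.trans h3 h6⟩ }

/-- One-particle irreducible Feynman graphs: every vertex has valence at least three, every line
has one or two ends, the graph is connected, is not a tree, stays connected when any one internal
line is cut, and has at least one external leg. -/
structure IsOnePI : Prop where
  line_le_two : ∀ d, Set.ncard {e | G.line.r d e} ≤ 2
  three_le_valence : ∀ v, 3 ≤ G.valence v
  connected : G.vert ⊔ G.line = ⊤
  not_tree : 0 < G.loops
  connected_of_cut : ∀ d, ¬ G.IsLeg d → G.vert ⊔ G.lineOn {e | ¬ G.line.r d e} = ⊤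
  has_leg : 0 < G.numLegs

/-- Isomorphisms of graphs (external legs may be permuted). -/
structure Iso (G K : PreGraph) where
  toEquiv : G.HE ≃ K.HE
  vert_iff : ∀ a b, G.vert.r a b ↔ K.vert.r (toEquiv a) (toEquiv b)
  line_iff : ∀ a b, G.line.r a b ↔ K.line.r (toEquiv a) (toEquiv b)

def Iso.refl : Iso G G := ⟨Equiv.refl _, fun _ _ => Iff.rfl, fun _ _ => Iff.rfl⟩

def Iso.symm {G K : PreGraph} (f : Iso G K) : Iso K G :=
  ⟨f.toEquiv.symm, fun a b => by rw [f.vert_iff]; simp, fun a b => by rw [f.line_iff]; simp⟩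

def Iso.trans {G K M : PreGraph} (f : Iso G K) (g : Iso K M) : Iso G M :=
  ⟨f.toEquiv.trans g.toEquiv,
    fun a b => (f.vert_iff a b).trans (g.vert_iff _ _),
    fun a b => (f.line_iff a b).trans (g.line_iff _ _)⟩

/-! ### Subgraphs and contraction

A subgraph is given by its set `S` of internal half-edges (a union of internal lines of `G`); its
components are the classes of `compRel S` that meet `S`. A component contains all half-edges of `G`
at its vertices, and those outside `S` are its external legs. -/

def compRel (S : Set G.HE) : Setoid G.HE := G.vert ⊔ G.lineOn S

/-- The component `c` as a graph of its own. -/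
def comp (S : Set G.HE) (c : Quotient (G.compRel S)) : PreGraph where
  HE := {d : G.HE // Quotient.mk (G.compRel S) d = c}
  vert := G.vert.comap Subtype.val
  line := (G.lineOn S).comap Subtype.val

def SubComp (S : Set G.HE) : Type :=
  {c : Quotient (G.compRel S) // ∃ d ∈ S, Quotient.mk (G.compRel S) d = c}

/-- `S` is a (possibly empty) disjoint union of 1PI subgraphs. -/
structure IsSubgraph (S : Set G.HE) : Prop where
  subset_internal : S ⊆ G.internal
  line_closed : ∀ d e, G.line.r d e → d ∈ S → e ∈ S
  onePI : ∀ c : G.SubComp S, (G.comp S c.1).IsOnePI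

/-- Relates the two outer half-edges of a component with exactly two external legs. -/
def through (S : Set G.HE) : Setoid G.HE where
  r d e := d = e ∨ (d ∉ S ∧ e ∉ S ∧ (G.compRel S).r d e ∧
    (G.comp S (Quotient.mk (G.compRel S) d)).numLegs = 2)
  iseqv :=
    { refl := fun _ => Or.inl rfl
      symm := by
        rintro d e (rfl | ⟨h1, h2, h3, h4⟩)
        · exact Or.inl rfl
        · refine Or.inr ⟨h2, h1, (G.compRel S).iseqv.symm h3, ?_⟩
          have h : Quotient.mk (G.compRel S) d = Quotient.mk (G.compRel S) e := Quotient.sound h3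
          rw [← h]; exact h4
      trans := by
        rintro d e f (rfl | ⟨h1, h2, h3, h4⟩) (rfl | ⟨h5, h6, h7, h8⟩)
        · exact Or.inl rfl
        · exact Or.inr ⟨h5, h6, h7, h8⟩
        · exact Or.inr ⟨h1, h2, h3, h4⟩
        · exact Or.inr ⟨h1, h6, (G.compRel S).iseqv.trans h3 h7, h4⟩ }

/-- The contracted graph `Γ/γ`: every component of `γ` is shrunk to a vertex, except that a
component with exactly two external legs is shrunk to a piece of line, so that the two lines that
enter it merge (this produces no vertices of valence two). -/
def contract (S : Set G.HE) : PreGraph where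
  HE := {d : G.HE // d ∉ S ∧ (G.comp S (Quotient.mk (G.compRel S) d)).numLegs ≠ 2}
  vert := (G.compRel S).comap Subtype.val
  line := (G.line ⊔ G.through S).comap Subtype.val

end PreGraph

/-! ## Isomorphism classes, with free or with fixed external legs -/

instance graphSetoid : Setoid {G : PreGraph // G.IsOnePI} where
  r G K := Nonempty (PreGraph.Iso G.1 K.1)
  iseqv := ⟨fun G => ⟨PreGraph.Iso.refl G.1⟩, fun ⟨f⟩ => ⟨f.symm⟩, fun ⟨f⟩ ⟨g⟩ => ⟨f.trans g⟩⟩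

/-- Isomorphism classes of 1PI graphs: the generators of the core Hopf algebra. -/
def Graph : Type 1 := Quotient graphSetoid

namespace Graph

def mk (G : PreGraph) (h : G.IsOnePI) : Graph := Quotient.mk graphSetoid ⟨G, h⟩
/-- A representative. -/
def rep (c : Graph) : PreGraph := (Quotient.out c).1
def numLegs (c : Graph) : ℕ := c.rep.numLegs

end Graph

/-- A graph whose external legs are labelled by `P`. -/
structure Legged (P : Type) : Type 1 where
  graph : PreGraph
  leg : P ≃ graph.Leg

/-- Isomorphisms that fix the labels of the external legs. -/
structure Legged.Iso {P : Type} (G K : Legged P) where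
  iso : PreGraph.Iso G.graph K.graph
  fix : ∀ p, iso.toEquiv (G.leg p).1 = (K.leg p).1

/-- The tree graph with a single vertex and external legs `P`. -/
def corolla (P : Type) [Finite P] : Legged P where
  graph := { HE := P, vert := ⊤, line := ⊥ }
  leg :=
    { toFun := fun p => ⟨p, fun _ h => Eq.symm h⟩
      invFun := fun d => d.1
      left_inv := fun _ => rfl
      right_inv := fun _ => rfl }

instance leggedSetoid (P : Type) : Setoid {G : Legged P // G.graph.IsOnePI} where
  r G K := Nonempty (Legged.Iso G.1 K.1)
  iseqv :=
    { refl := fun G => ⟨⟨PreGraph.Iso.refl _, fun _ => rfl⟩⟩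
      symm := by
        rintro G K ⟨f⟩
        refine ⟨⟨f.iso.symm, fun p => ?_⟩⟩
        rw [← f.fix p]
        exact f.iso.toEquiv.symm_apply_apply _
      trans := by
        rintro G K M ⟨f⟩ ⟨g⟩
        refine ⟨⟨f.iso.trans g.iso, fun p => ?_⟩⟩
        rw [← g.fix p, ← f.fix p]
        rfl }

/-- Isomorphism classes of 1PI graphs with external legs labelled by `P`. -/
def LGraph (P : Type) : Type 1 := Quotient (leggedSetoid P)

namespace LGraph

variable {P : Type}

/-- A representative. -/
def rep (q : LGraph P) : Legged P := (Quotient.out q).1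

/-- Forget the labels of the external legs. -/
def forget (q : LGraph P) : Graph := Graph.mk q.rep.graph (Quotient.out q).2

def loops (q : LGraph P) : ℕ := q.rep.graph.loops

/-- The symmetry factor: the number of automorphisms that fix the external legs. -/
def sym (q : LGraph P) : ℕ := Nat.card (Legged.Iso q.rep q.rep)

end LGraph

/-! ## The core Hopf algebra -/

/-- The free commutative algebra on 1PI graphs. -/
abbrev H : Type 1 := MvPolynomial Graph ℂ

/-- The element of `H` given by a 1PI graph. -/
def gen (G : PreGraph) : H := by
  classical exact if h : G.IsOnePI then MvPolynomial.X (Graph.mk G h) else 0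

/-- A disjoint union of 1PI subgraphs as a monomial in `H`. -/
def subMonomial (G : PreGraph) (S : Set G.HE) : H := ∏ᶠ c : G.SubComp S, gen (G.comp S c.1)

/-- The coproduct. -/
def Δ : H →ₐ[ℂ] H ⊗[ℂ] H :=
  MvPolynomial.aeval fun c : Graph =>
    (MvPolynomial.X c : H) ⊗ₜ[ℂ] (1 : H) + (1 : H) ⊗ₜ[ℂ] (MvPolynomial.X c : H) +
      ∑ᶠ S : {S : Set c.rep.HE // c.rep.IsSubgraph S ∧ S ≠ ∅ ∧ S ≠ c.rep.internal},
        subMonomial c.rep S.1 ⊗ₜ[ℂ] gen (c.rep.contract S.1)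

/-- Primitive graphs. -/
def Graph.IsPrimitive (c : Graph) : Prop :=
  Δ (MvPolynomial.X c) =
    (MvPolynomial.X c : H) ⊗ₜ[ℂ] (1 : H) + (1 : H) ⊗ₜ[ℂ] (MvPolynomial.X c : H)

/-! ## Green's functions, as power series in the coupling whose exponent counts loops -/

/-- `-1` for the propagator, `+1` for all other amplitudes. -/
def sgn (n : ℕ) : ℂ := if n = 2 then -1 else 1

/-- The 1PI Green's function with `n` external legs, `1 ± ∑ g^|Γ| Γ / Sym Γ`. -/
def X (n : ℕ) : PowerSeries H :=
  1 + sgn n • PowerSeries.mk fun L =>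
    ∑ᶠ q : {q : LGraph (Fin n) // q.loops = L}, ((q.1.sym : ℂ)⁻¹) • (MvPolynomial.X q.1.forget : H)

/-- The formal power `f ^ a` of a power series `f` with constant coefficient `1`, by the binomial
series. -/
def fpow (f : PowerSeries H) (a : ℂ) : PowerSeries H :=
  PowerSeries.mk fun N =>
    ∑ k ∈ Finset.range (N + 1), Ring.choose a k • PowerSeries.coeff N ((f - 1) ^ k)

/-- The coupling `Q^{(m)} = [X^m / (X^2)^{m/2}]^{1/(m-2)}`, for `m ≥ 3`. -/
def Q (m : ℕ) : PowerSeries H :=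
  fpow (X m * fpow (X 2) (-((m : ℂ) / 2))) (1 / ((m : ℂ) - 2))

/-- The ideal generated by all `Q^{(m)}_l - Q^{(n)}_l`. -/
def I : Ideal H :=
  Ideal.span {x | ∃ m n l : ℕ, 3 ≤ m ∧ 3 ≤ n ∧
    x = PowerSeries.coeff l (Q m) - PowerSeries.coeff l (Q n)}

/-- The quotient `H / I`. -/
abbrev Ht : Type 1 := H ⧸ I

def proj : H →ₐ[ℂ] Ht := Ideal.Quotient.mkₐ ℂ I

/-- The class of a power series over `H`. -/
def projS : PowerSeries H →+* PowerSeries Ht := PowerSeries.map proj.toRingHom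

/-- `X_{l,n} = X^n Q^{2l}` in the quotient, where `Q` is the common class of all `Q^{(m)}`. -/
def Xl (l n : ℕ) : PowerSeries Ht := projS (X n) * projS (Q 3) ^ (2 * l)

/-! ## Insertion of graphs into a graph -/

namespace PreGraph

variable (G : PreGraph)

/-- The other end of an internal line. -/
def partner (d : G.HE) : G.HE := by
  classical exact if h : ∃ e, G.line.r d e ∧ e ≠ d then h.choose else d

/-- A chosen first end of an internal line. -/
def firstEnd (q : G.IntLine) : G.HE := Quotient.out q.1

/-- The other end of an internal line. -/
def secondEnd (q : G.IntLine) : G.HE := G.partner (G.firstEnd q)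

/-- An insertion into `G`: at a vertex nothing or one 1PI graph whose external legs are
identified with the half-edges at this vertex; on an internal line a finite sequence of 1PI graphs
with two external legs, `false` towards the first end of the line and `true` towards the other. -/
structure Insertion : Type 1 where
  vtx : ∀ v : G.Vertex, Option (LGraph (G.Prong v))
  chain : G.IntLine → List (LGraph Bool)

/-- An insertion place: which graphs are inserted where, without the identification of legs. -/
structure Place : Type 1 where
  vtx : ∀ v : G.Vertex, Option {c : Graph // c.numLegs = G.valence v}
  chain : G.IntLine → List {c : Graph // c.numLegs = 2}

instance (v : G.Vertex) : Finite (G.Prong v) := inferInstanceAs (Finite (Subtype _))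
instance : Finite G.IntLine := inferInstanceAs (Finite (Subtype _))

variable {G}

/-- The product of the graphs that are inserted. -/
def Insertion.content (D : G.Insertion) : Graph →₀ ℕ :=
  (∑ᶠ v, (D.vtx v).elim 0 fun q => Finsupp.single q.forget 1) +
    ∑ᶠ q, ((D.chain q).map fun k => Finsupp.single k.forget 1).sum

/-- The product of the graphs that are inserted. -/
def Place.content (D : G.Place) : Graph →₀ ℕ :=
  (∑ᶠ v, (D.vtx v).elim 0 fun c => Finsupp.single c.1 1) +
    ∑ᶠ q, ((D.chain q).map fun c => Finsupp.single c.1 1).sum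

namespace Insertion

variable (D : G.Insertion)

/-- The pieces of the glued graph: one for each vertex, one for each graph on a line. -/
abbrev Site : Type := G.Vertex ⊕ (Σ q : G.IntLine, Fin (D.chain q).length)

def SiteProng : D.Site → Type
  | Sum.inl v => G.Prong v
  | Sum.inr _ => Bool

def piece : (x : D.Site) → Legged (D.SiteProng x)
  | Sum.inl v => (D.vtx v).elim (corolla (G.Prong v)) fun q => q.rep
  | Sum.inr y => ((D.chain y.1).get y.2).rep

/-- Half-edges of the glued graph. -/
abbrev GlueHE : Type := Σ x : D.Site, (D.piece x).graph.HE

/-- The half-edge of the glued graph at a prong of a site. -/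
def att (p : Σ x : D.Site, D.SiteProng x) : D.GlueHE := ⟨p.1, ((D.piece p.1).leg p.2).1⟩

/-- The prong at which the `i`-th segment of a line begins. -/
def src (q : G.IntLine) (i : Fin ((D.chain q).length + 1)) : Σ x : D.Site, D.SiteProng x :=
  Fin.cases (motive := fun _ => Σ x : D.Site, D.SiteProng x)
    ⟨Sum.inl (Quotient.mk G.vert (G.firstEnd q)), ⟨G.firstEnd q, rfl⟩⟩
    (fun j => ⟨Sum.inr ⟨q, j⟩, true⟩) i

/-- The prong at which the `i`-th segment of a line ends. -/
def tgt (q : G.IntLine) (i : Fin ((D.chain q).length + 1)) : Σ x : D.Site, D.SiteProng x :=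
  Fin.lastCases (motive := fun _ => Σ x : D.Site, D.SiteProng x)
    ⟨Sum.inl (Quotient.mk G.vert (G.secondEnd q)), ⟨G.secondEnd q, rfl⟩⟩
    (fun j => ⟨Sum.inr ⟨q, j⟩, false⟩) i

inductive GlueVert : D.GlueHE → D.GlueHE → Prop
  | inner (x : D.Site) (a b : (D.piece x).graph.HE) (h : (D.piece x).graph.vert.r a b) :
      GlueVert ⟨x, a⟩ ⟨x, b⟩

inductive GlueLine : D.GlueHE → D.GlueHE → Prop
  | inner (x : D.Site) (a b : (D.piece x).graph.HE) (h : (D.piece x).graph.line.r a b) :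
      GlueLine ⟨x, a⟩ ⟨x, b⟩
  | wire (q : G.IntLine) (i : Fin ((D.chain q).length + 1)) :
      GlueLine (D.att (D.src q i)) (D.att (D.tgt q i))

/-- The graph that results from the insertion. -/
def glue : PreGraph where
  HE := D.GlueHE
  vert := Relation.EqvGen.setoid D.GlueVert
  line := Relation.EqvGen.setoid D.GlueLine

end Insertion

/-- `G` is a primitive 1PI graph. -/
def IsPrimitive (G : PreGraph) : Prop := ∃ h : G.IsOnePI, (Graph.mk G h).IsPrimitive

end PreGraph

/-! ## Grafting operators -/

/-- The number of distinct graphs obtained by permuting the external legs of a graph. -/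
def Graph.vee (c : Graph) : ℕ := Nat.card {q : LGraph (Fin c.numLegs) // q.forget = c}

/-- `|h|_∨` for a product `h` of graphs. -/
def vee (h : Graph →₀ ℕ) : ℕ := h.prod fun c k => c.vee ^ k

/-- The number of maximal forests: disjoint unions of 1PI proper subgraphs (the empty one
included) with primitive cograph. -/
def maxf (c : Graph) : ℕ :=
  Nat.card {S : Set c.rep.HE // c.rep.IsSubgraph S ∧ S ≠ c.rep.internal ∧
    (c.rep.contract S).IsPrimitive}

/-- `(γ|h)`: the number of insertion places for `h` in `γ`. -/
def places (G : PreGraph) (h : Graph →₀ ℕ) : ℕ := Nat.card {D : G.Place // D.content = h}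

/-- `bij(γ,h,Γ)`: the number of insertions of `h` into `γ` with result `Γ`. -/
def bij (G : PreGraph) (h : Graph →₀ ℕ) (c : Graph) : ℕ :=
  Nat.card {D : G.Insertion // D.content = h ∧ Nonempty (PreGraph.Iso D.glue c.rep)}

/-- The grafting operator `B_+^γ`. -/
def graft {n : ℕ} (γ : LGraph (Fin n)) : H →ₗ[ℂ] H :=
  (MvPolynomial.basisMonomials Graph ℂ).constr ℂ fun h =>
    ∑ᶠ c : Graph, ((bij γ.rep.graph h c : ℂ) / (vee h : ℂ) * (1 / (maxf c : ℂ)) *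
      (1 / (places γ.rep.graph h : ℂ))) • (MvPolynomial.X c : H)

/-- The product `∏_v X^{val v} / ∏_e X^2` over vertices and internal lines of `γ`: the full Green's
functions that fit the insertion places of `γ`. It is a lift of `X_{l,n}` to `H`. -/
def fitted {n : ℕ} (γ : LGraph (Fin n)) : PowerSeries H :=
  (∏ᶠ v : γ.rep.graph.Vertex, X (γ.rep.graph.valence v)) *
    fpow (X 2) (-(γ.rep.graph.numInt : ℂ))

/-- Primitive graphs with `l` loops and `n` fixed external legs. -/
def Prim (l n : ℕ) : Type 1 := {γ : LGraph (Fin n) // γ.forget.IsPrimitive ∧ γ.loops = l}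

/-- `∑_γ (1 / Sym γ) B_+^γ` applied to the coefficient of order `k` of `X_{l,n}`, where each
`B_+^γ` acts on the lift that fits `γ`. -/
def graftSum (l n k : ℕ) : H :=
  ∑ᶠ γ : Prim l n, ((γ.1.sym : ℂ)⁻¹) • graft γ.1 (PowerSeries.coeff k (fitted γ.1))

/-- `∑_γ (1 / Sym γ) (id ⊗ B_+^γ) Δ` applied to the coefficient of order `k` of `X_{l,n}`, where each
term acts on the lift that fits `γ`. -/
def graftSumΔ (l n k : ℕ) : H ⊗[ℂ] H :=
  ∑ᶠ γ : Prim l n, ((γ.1.sym : ℂ)⁻¹) •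
    TensorProduct.map LinearMap.id (graft γ.1) (Δ (PowerSeries.coeff k (fitted γ.1)))

end CoreHopf

end

open scoped TensorProduct

noncomputable section

namespace CoreHopf

/-! Three facts carry the theorem: a correspondence between subgraphs and insertions, the Euler
characteristic, and the stability of a certain form of coproduct under complex powers.

Subgraphs and insertions. Fix a graph Γ with labelled legs. An identification of Γ with the result
of an insertion into γ amounts to a proper subgraph S of Γ, an identification of γ with Γ/S, and
leg-fixing automorphisms of the inserted graphs (`PreGraph.decompIso`,
`PreGraph.Insertion.contractIso`, `PreGraph.Insertion.card_identifications`). Double counting turns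
a sum over proper subgraphs of Γ, divided by Sym Γ, into a sum over insertions with result Γ,
weighted by the inverse symmetry factors of γ and of all inserted graphs (`Legged.sum_ins`). On the
other hand the sum of these weighted insertions into a fixed γ is exactly the product of Green's
functions that fits γ: at a vertex nothing or one graph, on a line a geometric series, which the
sign of the propagator turns into an inverse (`fitted_eq`). Hence the coproduct of a Green's
function has on the left of each γ the fitted product (`Δ_green`).

Primitivity. Every 1PI graph has a proper subgraph whose cograph has one loop
(`PreGraph.IsOnePI.exists_contract_loops`). So the primitive graphs are those with one loop, and
only l = 1 contributes. The same double counting, restricted to one-loop γ, gives total weight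
maxf(Γ)/Sym(Γ) to the insertions with result Γ. In the grafting operator the factors |h|_∨ and (γ|h)
together count all insertions of h (`PreGraph.card_insertion`), so the operator is an average over
insertions, and the factor 1/maxf leaves each Γ with weight 1/Sym Γ. This is `graftSum_one`, from
which the Dyson-Schwinger equation follows.

The quotient. Modulo I one has X^m = Q^(m-2) (X^2)^(m/2). In the fitted product the exponents add up
by the Euler characteristic, and the result X^n Q^(2l) depends only on the numbers of legs and loops
(`projS_fitted`). With the left factor in the quotient, the coproduct therefore multiplies a Green's
function by itself with g replaced by g Q^2. This form is stable under products and complex powers,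
so it holds for every Q^(m). Hence the generators of I have vanishing coproduct in the quotient
(`Δr_eq_zero`), and the coproduct descends.

The operators. The coefficients of X_{1,n} are linearly independent in the quotient
(`linearIndependent_coeff_Xl`), so the values required of the grafting operator are consistent and
extend linearly. Independence is tested on characters that send X^m to u^(m/n): they send every
Q^(m) to 1 and X_{1,n} to the arbitrary series u. The cocycle identity is then a comparison of two
explicit sums.

Identities for complex powers are proved throughout by observing that coefficients are polynomial in
the exponent and checking natural exponents. -/

/-! ### Equivalence relations and the number of their classes -/

theorem quot_eq {α : Type*} (s : Setoid α) {a b : α} :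
    Quotient.mk s a = Quotient.mk s b ↔ s.r a b :=
  ⟨fun h => Quotient.exact h, fun h => Quotient.sound h⟩

/-- The kernel of `f` is an equivalence relation that contains both relations, hence their join.
Connectedness arguments use this with `f` a predicate, so that the conclusion is an equality of
propositions. -/
theorem sup_eq_top_const {α β : Type*} {r s : Setoid α} (h : r ⊔ s = ⊤) (f : α → β)
    (hr : ∀ a b, r.r a b → f a = f b) (hs : ∀ a b, s.r a b → f a = f b) (a b : α) :
    f a = f b := by
  have : r ⊔ s ≤ Setoid.ker f := sup_le (fun {a b} h => hr a b h) (fun {a b} h => hs a b h)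
  rw [h] at this
  exact this trivial

theorem sup_eq_top_map {α β : Type*} {r s : Setoid α} {r' s' : Setoid β} (f : α ≃ β)
    (hr : ∀ a b, r.r a b → r'.r (f a) (f b)) (hs : ∀ a b, s.r a b → s'.r (f a) (f b))
    (h : r ⊔ s = ⊤) : r' ⊔ s' = ⊤ := by
  have : r ⊔ s ≤ (r' ⊔ s').comap f :=
    sup_le (fun {a b} h => (le_sup_left : r' ≤ r' ⊔ s') (hr a b h))
      (fun {a b} h => (le_sup_right : s' ≤ r' ⊔ s') (hs a b h))
  rw [h] at this
  refine eq_top_iff.2 fun {a b} _ => ?_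
  have h2 : ((r' ⊔ s').comap f) (f.symm a) (f.symm b) := this trivial
  simpa [Setoid.comap_rel] using h2

/-- On a class of `r ⊔ s`, the restrictions of `r` and `s` generate everything. -/
theorem comap_sup_comap_eq_top {α : Type*} {r s u : Setoid α} (hu : r ⊔ s = u) (c : Quotient u) :
    r.comap (Subtype.val : {x : α // Quotient.mk u x = c} → α) ⊔ s.comap Subtype.val = ⊤ := by
  subst hu
  set t := r.comap (Subtype.val : {x : α // Quotient.mk (r ⊔ s) x = c} → α) ⊔
    s.comap Subtype.val with ht
  -- Outside the class `c` everything is related, inside it the relation is `t`. It contains `r` and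
  -- `s`, since neither of them leaves a class of the join, and so it contains the join.
  let w : Setoid α :=
    { r := fun x y => (Quotient.mk (r ⊔ s) x ≠ c ∧ Quotient.mk (r ⊔ s) y ≠ c) ∨
        ∃ hx hy, t ⟨x, hx⟩ ⟨y, hy⟩
      iseqv :=
        { refl := fun x => by
            by_cases h : Quotient.mk (r ⊔ s) x = c
            · exact Or.inr ⟨h, h, t.refl _⟩
            · exact Or.inl ⟨h, h⟩
          symm := by
            rintro x y (⟨h, h'⟩ | ⟨h, h', h2⟩)
            · exact Or.inl ⟨h', h⟩
            · exact Or.inr ⟨h', h, t.symm h2⟩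
          trans := by
            rintro x y z (⟨h, h'⟩ | ⟨h, h', h2⟩) (⟨k, k'⟩ | ⟨k, k', k2⟩)
            · exact Or.inl ⟨h, k'⟩
            · exact absurd k h'
            · exact absurd h' k
            · exact Or.inr ⟨h, k', t.trans h2 k2⟩ } }
  have key : ∀ v : Setoid α, v ≤ r ⊔ s → v.comap Subtype.val ≤ t → v ≤ w := by
    intro v hv hvt x y hxy
    have e : Quotient.mk (r ⊔ s) x = Quotient.mk (r ⊔ s) y := Quotient.sound (hv hxy)
    by_cases h : Quotient.mk (r ⊔ s) x = c
    · exact Or.inr ⟨h, e ▸ h, hvt hxy⟩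
    · exact Or.inl ⟨h, e ▸ h⟩
  have hw : r ⊔ s ≤ w := sup_le (key r le_sup_left le_sup_left) (key s le_sup_right le_sup_right)
  refine eq_top_iff.2 ?_
  rintro ⟨x, hx⟩ ⟨y, hy⟩ -
  rcases hw (Quotient.exact (hx.trans hy.symm)) with ⟨h, -⟩ | ⟨_, _, h⟩
  · exact absurd hx h
  · exact h

/-- The equivalence relation obtained by merging the classes of `a` and `b`. -/
def mergeSetoid {α : Type*} (r : Setoid α) (a b : α) : Setoid α where
  r x y := r x y ∨ (r x a ∧ r b y) ∨ (r x b ∧ r a y)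
  iseqv :=
    { refl := fun x => Or.inl (r.refl x)
      symm := by
        rintro x y (h | ⟨h, h'⟩ | ⟨h, h'⟩)
        · exact Or.inl (r.symm h)
        · exact Or.inr (Or.inr ⟨r.symm h', r.symm h⟩)
        · exact Or.inr (Or.inl ⟨r.symm h', r.symm h⟩)
      trans := by
        rintro x y z (h | ⟨h, h'⟩ | ⟨h, h'⟩) (k | ⟨k, k'⟩ | ⟨k, k'⟩)
        · exact Or.inl (r.trans h k)
        · exact Or.inr (Or.inl ⟨r.trans h k, k'⟩)
        · exact Or.inr (Or.inr ⟨r.trans h k, k'⟩)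
        · exact Or.inr (Or.inl ⟨h, r.trans h' k⟩)
        · exact Or.inr (Or.inl ⟨h, k'⟩)
        · exact Or.inl (r.trans h k')
        · exact Or.inr (Or.inr ⟨h, r.trans h' k⟩)
        · exact Or.inl (r.trans h k')
        · exact Or.inr (Or.inr ⟨h, k'⟩) }

/-- Send the class of `a` to `none` and every other class to its class in the coarser relation. This
is injective: two classes that are merged are those of `a` and `b`, and one of them goes to `none`.
-/
theorem card_quotient_le_merge {α : Type*} [Finite α] {r r' : Setoid α} {a b : α}
    (h' : r' ≤ mergeSetoid r a b) : Nat.card (Quotient r) ≤ Nat.card (Quotient r') + 1 := by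
  classical
  by_cases hrr : ∀ x y, r x y → r' x y
  swap
  -- Here classes of `r` need not map to classes of `r'`. The join of the two replaces `r'`: it is
  -- still contained in the merged relation and has at most as many classes as `r'`.
  · push Not at hrr
    have hsub : Nat.card (Quotient r) ≤ Nat.card (Option (Quotient r')) := by
      have hle : r ≤ r ⊔ r' := le_sup_left
      let g : Quotient r → Option (Quotient (r ⊔ r')) := fun x =>
        if x = Quotient.mk r a then none else some (Quotient.map' id (fun _ _ h => hle h) x)
      have hg : Function.Injective g := by
        intro x y hxy
        induction x using Quotient.inductionOn with | _ x
        induction y using Quotient.inductionOn with | _ y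
        simp only [g] at hxy
        split_ifs at hxy with h1 h2 h2
        · exact h1.trans h2.symm
        · have h3 : (r ⊔ r') x y := Quotient.exact (Option.some.inj hxy)
          have h4 : r ⊔ r' ≤ mergeSetoid r a b := sup_le (fun {_ _} h => Or.inl h) h'
          rcases h4 h3 with h | ⟨h, -⟩ | ⟨-, h⟩
          · exact Quotient.sound h
          · exact absurd (Quotient.sound h) h1
          · exact absurd (Quotient.sound (r.symm h)) h2
      refine (Nat.card_le_card_of_injective g hg).trans ?_
      rw [Finite.card_option, Finite.card_option]
      have : Function.Surjective (Quotient.map' (s₁ := r') (s₂ := r ⊔ r') id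
          (fun _ _ h => (le_sup_right : r' ≤ r ⊔ r') h)) := by
        intro y
        induction y using Quotient.inductionOn with | _ y
        exact ⟨Quotient.mk r' y, rfl⟩
      exact Nat.add_le_add_right (Nat.card_le_card_of_surjective _ this) 1
    simpa [Finite.card_option] using hsub
  · let g : Quotient r → Option (Quotient r') := fun x =>
      if x = Quotient.mk r a then none else some (Quotient.map' id (fun _ _ h => hrr _ _ h) x)
    have hg : Function.Injective g := by
      intro x y hxy
      induction x using Quotient.inductionOn with | _ x
      induction y using Quotient.inductionOn with | _ y
      simp only [g] at hxy
      split_ifs at hxy with h1 h2 h2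
      · exact h1.trans h2.symm
      · have h3 : r' x y := Quotient.exact (Option.some.inj hxy)
        rcases h' h3 with h | ⟨h, -⟩ | ⟨-, h⟩
        · exact Quotient.sound h
        · exact absurd (Quotient.sound h) h1
        · exact absurd (Quotient.sound (r.symm h)) h2
    simpa [Finite.card_option] using Nat.card_le_card_of_injective g hg

theorem card_quotient_lt_of_merge {α : Type*} [Finite α] {r r' : Setoid α} (hrr : r ≤ r') {a b : α}
    (hab : r' a b) (h : ¬ r a b) : Nat.card (Quotient r') < Nat.card (Quotient r) := by
  let g : Quotient r → Quotient r' := Quotient.map' id (fun _ _ h => hrr h)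
  have hs : Function.Surjective g := by
    intro y
    induction y using Quotient.inductionOn with | _ y
    exact ⟨Quotient.mk r y, rfl⟩
  by_contra hlt
  have := (hs.bijective_of_nat_card_le (not_lt.1 hlt)).1
  exact h (Quotient.exact (this (show g (Quotient.mk r a) = g (Quotient.mk r b) from
    Quotient.sound hab)))

/-! ### Half-edges, partners and internal lines -/

namespace PreGraph

variable {G K M : PreGraph}

instance : Finite G.Leg := inferInstanceAs (Finite (Subtype _))

/-- Every line has at most two ends. -/
def LineLE (G : PreGraph) : Prop := ∀ d, Set.ncard {e | G.line.r d e} ≤ 2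

theorem IsOnePI.lineLE (h : G.IsOnePI) : G.LineLE := h.line_le_two

theorem not_isLeg_iff {d : G.HE} : ¬ G.IsLeg d ↔ ∃ e, G.line.r d e ∧ e ≠ d := by
  simp [IsLeg]

theorem line_partner (d : G.HE) : G.line.r d (G.partner d) := by
  unfold partner
  split_ifs with h
  · exact h.choose_spec.1
  · exact G.line.iseqv.refl d

theorem partner_ne_iff {d : G.HE} : G.partner d ≠ d ↔ ¬ G.IsLeg d := by
  rw [not_isLeg_iff]
  constructor
  · exact fun h => ⟨_, line_partner d, h⟩
  · intro h
    unfold partner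
    rw [dif_pos h]
    exact h.choose_spec.2

theorem IsLeg.partner {d : G.HE} (h : G.IsLeg d) : G.partner d = d := h _ (line_partner d)

theorem LineLE.line_iff (h : G.LineLE) {d e : G.HE} :
    G.line.r d e ↔ e = d ∨ e = G.partner d := by
  constructor
  · intro hde
    by_contra hne
    push Not at hne
    have hp : G.partner d ≠ d := partner_ne_iff.2 (not_isLeg_iff.2 ⟨e, hde, hne.1⟩)
    have h3 : Set.ncard ({d, e, G.partner d} : Set G.HE) = 3 :=
      Set.ncard_eq_three.2 ⟨d, e, G.partner d, hne.1.symm, hp.symm, hne.2, rfl⟩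
    have hle : Set.ncard ({d, e, G.partner d} : Set G.HE) ≤ Set.ncard {e | G.line.r d e} := by
      apply Set.ncard_le_ncard _ (Set.toFinite _)
      rintro x (rfl | rfl | rfl)
      · exact G.line.iseqv.refl _
      · exact hde
      · exact line_partner d
    have := h d
    omega
  · rintro (rfl | rfl)
    · exact G.line.iseqv.refl _
    · exact line_partner d

theorem LineLE.partner_partner (h : G.LineLE) (d : G.HE) : G.partner (G.partner d) = d := by
  by_cases hd : G.IsLeg d
  · rw [hd.partner, hd.partner]
  · have h1 := partner_ne_iff.2 hd
    have h2 := G.line.iseqv.symm (line_partner d)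
    rcases h.line_iff.1 h2 with h3 | h3
    · exact absurd h3.symm h1
    · exact h3.symm

theorem LineLE.isLeg_partner (h : G.LineLE) {d : G.HE} :
    G.IsLeg (G.partner d) ↔ G.IsLeg d := by
  rw [← not_iff_not, ← partner_ne_iff, ← partner_ne_iff, h.partner_partner, ne_comm]

/-- The internal line through a half-edge. -/
def toIntLine (d : G.HE) (h : ¬ G.IsLeg d) : G.IntLine := ⟨Quotient.mk G.line d, d, rfl, h⟩

theorem not_isLeg_of_line {d e : G.HE} (h : G.line.r d e) (hd : ¬ G.IsLeg d) : ¬ G.IsLeg e := by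
  intro he
  have : d = e := he d (G.line.iseqv.symm h)
  exact hd (this ▸ he)

theorem firstEnd_mk (q : G.IntLine) : Quotient.mk G.line (G.firstEnd q) = q.1 := Quotient.out_eq q.1

theorem firstEnd_not_isLeg (q : G.IntLine) : ¬ G.IsLeg (G.firstEnd q) := by
  obtain ⟨d, h, hd⟩ := q.2
  exact not_isLeg_of_line (Quotient.exact (h.trans (firstEnd_mk q).symm)) hd

theorem secondEnd_mk (q : G.IntLine) : Quotient.mk G.line (G.secondEnd q) = q.1 := by
  rw [← firstEnd_mk q]
  exact Quotient.sound (G.line.iseqv.symm (line_partner _))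

theorem secondEnd_ne (q : G.IntLine) : G.secondEnd q ≠ G.firstEnd q :=
  partner_ne_iff.2 (firstEnd_not_isLeg q)

theorem secondEnd_not_isLeg (q : G.IntLine) : ¬ G.IsLeg (G.secondEnd q) :=
  not_isLeg_of_line (line_partner _) (firstEnd_not_isLeg q)

theorem LineLE.eq_firstEnd_or (h : G.LineLE) {d : G.HE} {q : G.IntLine}
    (hd : Quotient.mk G.line d = q.1) : d = G.firstEnd q ∨ d = G.secondEnd q :=
  h.line_iff.1 (Quotient.exact ((firstEnd_mk q).trans hd.symm))

theorem LineLE.card_internal (h : G.LineLE) : G.internal.ncard = 2 * G.numInt := by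
  classical
  have := Fintype.ofFinite G.IntLine
  let f : {d : G.HE // ¬ G.IsLeg d} → G.IntLine := fun d => toIntLine d.1 d.2
  have hf : ∀ q, Nat.card {x // f x = q} = 2 := by
    intro q
    rw [Nat.card_eq_two_iff]
    refine ⟨⟨⟨G.firstEnd q, firstEnd_not_isLeg q⟩, Subtype.ext (firstEnd_mk q)⟩,
      ⟨⟨G.secondEnd q, secondEnd_not_isLeg q⟩, Subtype.ext (secondEnd_mk q)⟩, ?_, ?_⟩
    · intro h
      exact secondEnd_ne q (congrArg (fun x => x.1.1) h).symm
    · ext ⟨⟨d, hd⟩, hx⟩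
      simp only [Set.mem_insert_iff, Set.mem_singleton_iff, Set.mem_univ, iff_true]
      rcases h.eq_firstEnd_or (congrArg Subtype.val hx : Quotient.mk G.line d = q.1) with h1 | h1
      · exact Or.inl (Subtype.ext (Subtype.ext h1))
      · exact Or.inr (Subtype.ext (Subtype.ext h1))
  have h1 : Nat.card {d : G.HE // ¬ G.IsLeg d} = 2 * G.numInt := by
    rw [← Nat.card_congr (Equiv.sigmaFiberEquiv f), Nat.card_sigma, Finset.sum_congr rfl
      (fun q _ => hf q), Finset.sum_const, numInt, Nat.card_eq_fintype_card, Finset.card_univ]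
    ring
  exact h1

theorem card_HE_eq (G : PreGraph) : Nat.card G.HE = G.internal.ncard + G.numLegs := by
  classical
  rw [← Nat.card_congr (Equiv.sumCompl G.IsLeg), Nat.card_sum, add_comm]
  rfl

theorem LineLE.card_HE (h : G.LineLE) : Nat.card G.HE = 2 * G.numInt + G.numLegs := by
  rw [card_HE_eq, h.card_internal]

theorem card_HE_eq_sum_valence [Fintype G.Vertex] : Nat.card G.HE = ∑ v, G.valence v := by
  rw [← Nat.card_congr (Equiv.sigmaFiberEquiv (Quotient.mk G.vert)), Nat.card_sigma]
  rfl

/-! ### Transport along isomorphisms -/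

namespace Iso

theorem isLeg_iff (f : Iso G K) (d : G.HE) : K.IsLeg (f.toEquiv d) ↔ G.IsLeg d := by
  constructor
  · intro h e he
    exact f.toEquiv.injective (h _ ((f.line_iff _ _).1 he))
  · intro h e he
    obtain ⟨e, rfl⟩ := f.toEquiv.surjective e
    rw [h e ((f.line_iff _ _).2 he)]

def legEquiv (f : Iso G K) : G.Leg ≃ K.Leg :=
  f.toEquiv.subtypeEquiv fun d => (f.isLeg_iff d).symm

def vertexEquiv (f : Iso G K) : G.Vertex ≃ K.Vertex := Quotient.congr f.toEquiv f.vert_iff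

def intLineEquiv (f : Iso G K) : G.IntLine ≃ K.IntLine :=
  (Quotient.congr f.toEquiv f.line_iff).subtypeEquiv fun q => by
    constructor
    · rintro ⟨d, rfl, hd⟩
      exact ⟨f.toEquiv d, rfl, (f.isLeg_iff d).not.2 hd⟩
    · rintro ⟨d, hd, hd'⟩
      refine ⟨f.toEquiv.symm d, ?_, ?_⟩
      · apply (Quotient.congr (ra := G.line) (rb := K.line) f.toEquiv f.line_iff).injective
        rw [← hd]
        exact congrArg (Quotient.mk K.line) (f.toEquiv.apply_symm_apply d)
      · rw [← f.isLeg_iff, f.toEquiv.apply_symm_apply]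
        exact hd'

theorem numLegs_eq (f : Iso G K) : G.numLegs = K.numLegs := Nat.card_congr f.legEquiv
theorem numVerts_eq (f : Iso G K) : G.numVerts = K.numVerts := Nat.card_congr f.vertexEquiv
theorem numInt_eq (f : Iso G K) : G.numInt = K.numInt := Nat.card_congr f.intLineEquiv

theorem loops_eq (f : Iso G K) : G.loops = K.loops := by
  rw [loops, loops, f.numInt_eq, f.numVerts_eq]

theorem lineLE (f : Iso G K) (h : G.LineLE) : K.LineLE := by
  intro d
  obtain ⟨d, rfl⟩ := f.toEquiv.surjective d
  have : {e | K.line.r (f.toEquiv d) e} = f.toEquiv '' {e | G.line.r d e} := by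
    ext e
    obtain ⟨e, rfl⟩ := f.toEquiv.surjective e
    simp [← f.line_iff]
  rw [this, Set.ncard_image_of_injective _ f.toEquiv.injective]
  exact h d

theorem valence_eq (f : Iso G K) (d : G.HE) :
    G.valence (Quotient.mk _ d) = K.valence (Quotient.mk _ (f.toEquiv d)) := by
  refine Nat.card_congr (f.toEquiv.subtypeEquiv fun e => ?_)
  rw [quot_eq, quot_eq]
  exact f.vert_iff _ _

theorem isOnePI (f : Iso G K) (h : G.IsOnePI) : K.IsOnePI where
  line_le_two := f.lineLE h.line_le_two
  three_le_valence v := by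
    induction v using Quotient.inductionOn with | _ d
    obtain ⟨d, rfl⟩ := f.toEquiv.surjective d
    exact (h.three_le_valence _).trans (f.valence_eq d).le
  connected := sup_eq_top_map f.toEquiv (fun a b => (f.vert_iff a b).1)
    (fun a b => (f.line_iff a b).1) h.connected
  not_tree := f.loops_eq ▸ h.not_tree
  connected_of_cut d hd := by
    obtain ⟨d, rfl⟩ := f.toEquiv.surjective d
    refine sup_eq_top_map f.toEquiv (fun a b => (f.vert_iff a b).1) ?_
      (h.connected_of_cut d ((f.isLeg_iff d).not.1 hd))
    rintro a b (rfl | ⟨h1, h2, h3⟩)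
    · exact Or.inl rfl
    · exact Or.inr ⟨(f.line_iff _ _).not.1 h1, (f.line_iff _ _).not.1 h2, (f.line_iff _ _).1 h3⟩
  has_leg := f.numLegs_eq ▸ h.has_leg

@[simp] theorem symm_apply_apply (f : Iso G K) (d : G.HE) : f.symm.toEquiv (f.toEquiv d) = d :=
  f.toEquiv.symm_apply_apply d

@[simp] theorem apply_symm_apply (f : Iso G K) (d : K.HE) : f.toEquiv (f.symm.toEquiv d) = d :=
  f.toEquiv.apply_symm_apply d

theorem ext_toEquiv {f g : Iso G K} (h : f.toEquiv = g.toEquiv) : f = g := by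
  cases f; cases g; cases h; rfl

theorem toEquiv_injective : Function.Injective (toEquiv : Iso G K → (G.HE ≃ K.HE)) :=
  fun _ _ h => ext_toEquiv h

instance : Finite (Iso G K) := Finite.of_injective _ toEquiv_injective

end Iso

/-! ### Counting components -/

/-- A union of internal lines. -/
structure IsLineSet (G : PreGraph) (S : Set G.HE) : Prop where
  subset_internal : S ⊆ G.internal
  line_closed : ∀ d e, G.line.r d e → d ∈ S → e ∈ S

theorem IsSubgraph.isLineSet {S : Set G.HE} (h : G.IsSubgraph S) : G.IsLineSet S :=
  ⟨h.subset_internal, h.line_closed⟩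

theorem isLineSet_internal (G : PreGraph) : G.IsLineSet G.internal :=
  ⟨subset_rfl, fun _ _ h hd => not_isLeg_of_line h hd⟩

/-- `S` without the line through `d`. -/
def cut (S : Set G.HE) (d : G.HE) : Set G.HE := {e | e ∈ S ∧ ¬ G.line.r d e}

theorem IsLineSet.cut {S : Set G.HE} (h : G.IsLineSet S) (d : G.HE) : G.IsLineSet (cut S d) :=
  ⟨fun _ he => h.subset_internal he.1, fun e e' hee' he => ⟨h.line_closed _ _ hee' he.1,
    fun hd => he.2 (G.line.iseqv.trans hd (G.line.iseqv.symm hee'))⟩⟩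

theorem lineOn_mono {S T : Set G.HE} (h : S ⊆ T) : G.lineOn S ≤ G.lineOn T := by
  rintro a b (rfl | ⟨h1, h2, h3⟩)
  · exact Or.inl rfl
  · exact Or.inr ⟨h h1, h h2, h3⟩

theorem compRel_mono {S T : Set G.HE} (h : S ⊆ T) : G.compRel S ≤ G.compRel T :=
  sup_le_sup_left (lineOn_mono h) _

theorem vert_le_compRel (S : Set G.HE) : G.vert ≤ G.compRel S := le_sup_left
theorem lineOn_le_compRel (S : Set G.HE) : G.lineOn S ≤ G.compRel S := le_sup_right

theorem compRel_empty : G.compRel ∅ = G.vert := by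
  refine sup_eq_left.2 ?_
  rintro a b (rfl | ⟨h1, -⟩)
  · exact G.vert.refl _
  · exact absurd h1 (Set.notMem_empty _)

/-- Restoring one cut line links only its two ends, so it merges at most the two components in which
they lie. -/
theorem LineLE.compRel_le_merge (h : G.LineLE) (S : Set G.HE) (d : G.HE) :
    G.compRel S ≤ mergeSetoid (G.compRel (cut S d)) d (G.partner d) := by
  refine sup_le (fun {a b} hab => Or.inl (vert_le_compRel _ hab)) ?_
  rintro a b (rfl | ⟨h1, h2, h3⟩)
  · exact Or.inl (Setoid.refl' _ _)
  by_cases hd : G.line.r d a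
  · have hd' := G.line.iseqv.trans hd h3
    rcases h.line_iff.1 hd with rfl | rfl <;> rcases h.line_iff.1 hd' with rfl | rfl
    · exact Or.inl (Setoid.refl' _ _)
    · exact Or.inr (Or.inl ⟨Setoid.refl' _ _, Setoid.refl' _ _⟩)
    · exact Or.inr (Or.inr ⟨Setoid.refl' _ _, Setoid.refl' _ _⟩)
    · exact Or.inl (Setoid.refl' _ _)
  · refine Or.inl (lineOn_le_compRel _ (Or.inr ⟨⟨h1, hd⟩, ⟨h2, fun hb => hd ?_⟩, h3⟩))
    exact G.line.iseqv.trans hb (G.line.iseqv.symm h3)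

/-- The number of components, single vertices included. -/
def numComps (G : PreGraph) (S : Set G.HE) : ℕ := Nat.card (Quotient (G.compRel S))

theorem LineLE.ncard_cut (h : G.LineLE) {S : Set G.HE} (hS : G.IsLineSet S) {d : G.HE}
    (hd : d ∈ S) : S.ncard = (cut S d).ncard + 2 := by
  have hp : G.partner d ≠ d := partner_ne_iff.2 (hS.subset_internal hd)
  have h1 : S = cut S d ∪ {d, G.partner d} := by
    ext e
    constructor
    · intro he
      by_cases hde : G.line.r d e
      · exact Or.inr (h.line_iff.1 hde)
      · exact Or.inl ⟨he, hde⟩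
    · rintro (he | rfl | rfl)
      · exact he.1
      · exact hd
      · exact hS.line_closed _ _ (line_partner _) hd
  conv_lhs => rw [h1]
  rw [Set.ncard_union_eq, Set.ncard_pair hp.symm]
  rw [Set.disjoint_right]
  intro e he
  exact fun h2 => h2.2 (h.line_iff.2 he)

theorem LineLE.numComps_cut_le (h : G.LineLE) (S : Set G.HE) (d : G.HE) :
    G.numComps (cut S d) ≤ G.numComps S + 1 :=
  card_quotient_le_merge (h.compRel_le_merge S d)

theorem numComps_lt_of_bridge {S : Set G.HE} {d : G.HE} (hd : d ∈ S) (hp : G.partner d ∈ S)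
    (hb : ¬ (G.compRel (cut S d)).r d (G.partner d)) :
    G.numComps S < G.numComps (cut S d) :=
  card_quotient_lt_of_merge (compRel_mono fun _ h => h.1)
    (lineOn_le_compRel _ (Or.inr ⟨hd, hp, line_partner d⟩)) hb

/-- Lines minus vertices plus components is the loop number of a line set and cannot be negative:
without lines it is zero, and each new line lowers the number of components by at most one. The
factors of two arise because `S` consists of half-edges. -/
theorem LineLE.two_mul_numVerts_le (h : G.LineLE) {S : Set G.HE} (hS : G.IsLineSet S) :
    2 * G.numVerts ≤ S.ncard + 2 * G.numComps S := by
  induction hn : S.ncard using Nat.strong_induction_on generalizing S with | _ n ih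
  subst hn
  rcases S.eq_empty_or_nonempty with rfl | ⟨d, hd⟩
  · rw [numComps, compRel_empty]
    exact Nat.le_add_left _ _
  · have h1 := h.ncard_cut hS hd
    have h2 := ih _ (by omega) (hS.cut d) rfl
    have h3 := h.numComps_cut_le S d
    omega

/-- The set on the right lacks the external legs as well, but those are related only to themselves.
-/
theorem lineOn_compl_le (d : G.HE) :
    G.lineOn {e | ¬ G.line.r d e} ≤ G.lineOn (cut G.internal d) := by
  rintro a b (rfl | ⟨h1, h2, h3⟩)
  · exact Or.inl rfl
  · by_cases hab : a = b
    · exact Or.inl hab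
    · refine Or.inr ⟨⟨not_isLeg_iff.2 ⟨b, h3, Ne.symm hab⟩, h1⟩,
        ⟨not_isLeg_iff.2 ⟨a, G.line.iseqv.symm h3, hab⟩, h2⟩, h3⟩

theorem numComps_eq_one_of_eq_top {S : Set G.HE} [Nonempty G.HE] (h : G.compRel S = ⊤) :
    G.numComps S = 1 := by
  rw [numComps, h]
  have : Subsingleton (Quotient (⊤ : Setoid G.HE)) :=
    ⟨fun x y => Quotient.inductionOn₂ x y fun a b => Quotient.sound trivial⟩
  have : Nonempty (Quotient (⊤ : Setoid G.HE)) := ⟨Quotient.mk _ (Classical.arbitrary _)⟩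
  exact Nat.card_eq_one_iff_unique.2 ⟨inferInstance, inferInstance⟩

/-- After the cut a connected graph on all vertices remains, so the other internal lines number at
least `V - 1`; the cut line is one more. -/
theorem LineLE.loops_pos_of_cut (h : G.LineLE) {d : G.HE} (hd : ¬ G.IsLeg d)
    (hc : G.vert ⊔ G.lineOn {e | ¬ G.line.r d e} = ⊤) : 0 < G.loops := by
  have h0 : G.compRel (PreGraph.cut G.internal d) = ⊤ :=
    eq_top_iff.2 (hc ▸ sup_le_sup_left (lineOn_compl_le d) _)
  have h1 := h.two_mul_numVerts_le (G.isLineSet_internal.cut d)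
  have : Nonempty G.HE := ⟨d⟩
  rw [numComps_eq_one_of_eq_top h0] at h1
  have h2 := h.ncard_cut G.isLineSet_internal hd
  have h3 := h.card_internal
  unfold loops
  omega

theorem loops_pos_exists_internal (h : 0 < G.loops) (hc : G.vert ⊔ G.line = ⊤) [Nonempty G.HE] :
    ∃ d, ¬ G.IsLeg d := by
  by_contra hcon
  push Not at hcon
  have h1 : G.numInt = 0 := by
    rw [numInt, Nat.card_eq_zero]
    refine Or.inl ⟨fun q => ?_⟩
    exact firstEnd_not_isLeg q (hcon _)
  have h2 : 0 < G.numVerts := by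
    rw [numVerts]
    have : Nonempty G.Vertex := ⟨Quotient.mk _ (Classical.arbitrary _)⟩
    exact Nat.card_pos
  unfold loops at h
  omega

theorem IsOnePI.nonempty_leg (h : G.IsOnePI) : Nonempty G.Leg := (Nat.card_pos_iff.1 h.has_leg).1

theorem IsOnePI.nonempty_HE (h : G.IsOnePI) : Nonempty G.HE := ⟨h.nonempty_leg.some.1⟩

theorem IsOnePI.exists_internal (h : G.IsOnePI) : ∃ d, ¬ G.IsLeg d :=
  haveI := h.nonempty_HE
  loops_pos_exists_internal h.not_tree h.connected

/-- The induction principle for connected graphs. It serves to show that a component with no way out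
is everything, and that a map onto a graph is surjective. -/
theorem vert_bot_of_cut (h : G.vert ⊔ G.line = ⊤) {c : G.HE → Prop} {a : G.HE} (ha : c a)
    (hv : ∀ a b, G.vert.r a b → c a → c b) (hl : ∀ a b, G.line.r a b → c a → c b) (b : G.HE) :
    c b := by
  have := sup_eq_top_const h c
    (fun a b hab => propext ⟨hv a b hab, hv b a (G.vert.iseqv.symm hab)⟩)
    (fun a b hab => propext ⟨hl a b hab, hl b a (G.line.iseqv.symm hab)⟩) a b
  exact this ▸ ha

theorem comp_mk {S : Set G.HE} {c : Quotient (G.compRel S)} (d : (G.comp S c).HE) :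
    Quotient.mk (G.compRel S) d.1 = c := d.2

theorem comp_vert_iff {S : Set G.HE} {c : Quotient (G.compRel S)} {d e : (G.comp S c).HE} :
    Quotient.mk (G.comp S c).vert d = Quotient.mk (G.comp S c).vert e ↔
      Quotient.mk G.vert d.1 = Quotient.mk G.vert e.1 :=
  (quot_eq _).trans (quot_eq G.vert).symm

theorem comp_isLeg_iff {S : Set G.HE} (hS : G.IsLineSet S) (c : Quotient (G.compRel S))
    (d : (G.comp S c).HE) : (G.comp S c).IsLeg d ↔ d.1 ∉ S := by
  constructor
  · intro h hd
    have h1 := hS.line_closed _ _ (line_partner d.1) hd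
    have h2 : (G.lineOn S).r d.1 (G.partner d.1) := Or.inr ⟨hd, h1, line_partner _⟩
    have h3 : Quotient.mk (G.compRel S) (G.partner d.1) = c := by
      exact (Quotient.sound (lineOn_le_compRel S h2)).symm.trans (comp_mk d)
    have := h ⟨_, h3⟩ h2
    exact partner_ne_iff.2 (hS.subset_internal hd) (congrArg Subtype.val this)
  · rintro h e (he | ⟨he, -⟩)
    · exact Subtype.ext he.symm
    · exact absurd he h

theorem comp_connected (S : Set G.HE) (c : Quotient (G.compRel S)) :
    (G.comp S c).vert ⊔ (G.comp S c).line = ⊤ :=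
  comap_sup_comap_eq_top rfl c

theorem comp_lineLE (h : G.LineLE) (S : Set G.HE) (c : Quotient (G.compRel S)) :
    (G.comp S c).LineLE := by
  intro d
  refine le_trans (Set.ncard_le_ncard_of_injOn Subtype.val ?_ Subtype.val_injective.injOn
    (Set.toFinite _)) (h d.1)
  rintro e (he | ⟨-, -, he⟩)
  · exact he ▸ G.line.iseqv.refl _
  · exact he

theorem comp_valence (S : Set G.HE) (c : Quotient (G.compRel S)) (d : (G.comp S c).HE) :
    (G.comp S c).valence (Quotient.mk _ d) = G.valence (Quotient.mk _ d.1) := by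
  refine Nat.card_congr ⟨fun e => ⟨e.1.1, comp_vert_iff.1 e.2⟩,
    fun e => ⟨⟨e.1, ?_⟩, comp_vert_iff.2 e.2⟩, fun e => rfl, fun e => rfl⟩
  exact (Quotient.sound (vert_le_compRel S (Quotient.exact e.2))).trans (comp_mk d)

/-- A line that is not a bridge can be cut without changing the components, so each component stays
connected under cuts and, having a line, has a loop. A component without external legs would be
closed under all lines of `G`, hence be all of `G`, which has an external leg. -/
theorem IsOnePI.isSubgraph_of_bridgeless (h : G.IsOnePI) {S : Set G.HE} (hS : G.IsLineSet S)
    (hb : ∀ d ∈ S, (G.compRel (PreGraph.cut S d)).r d (G.partner d)) : G.IsSubgraph S := by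
  refine ⟨hS.subset_internal, hS.line_closed, ?_⟩
  rintro ⟨c, s, hs, hsc⟩
  have hL := comp_lineLE h.lineLE S c
  have hcut : ∀ d, ¬ (G.comp S c).IsLeg d →
      (G.comp S c).vert ⊔ (G.comp S c).lineOn {e | ¬ (G.comp S c).line.r d e} = ⊤ := by
    intro d hd
    rw [comp_isLeg_iff hS, not_not] at hd
    have h1 : G.vert ⊔ G.lineOn (PreGraph.cut S d.1) = G.compRel S := by
      refine le_antisymm (compRel_mono fun _ h => h.1) ?_
      refine (h.lineLE.compRel_le_merge S d.1).trans ?_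
      rintro a b (h2 | ⟨h2, h3⟩ | ⟨h2, h3⟩)
      · exact h2
      · exact Setoid.trans' _ h2 (Setoid.trans' _ (hb _ hd) h3)
      · exact Setoid.trans' _ h2 (Setoid.trans' _ (Setoid.symm' _ (hb _ hd)) h3)
    refine eq_top_iff.2 ((comap_sup_comap_eq_top h1 c).symm.le.trans (sup_le_sup_left ?_ _))
    rintro a b (h2 | ⟨h2, h3, h4⟩)
    · exact Or.inl (Subtype.ext h2)
    · refine Or.inr ⟨?_, ?_, Or.inr ⟨h2.1, h3.1, h4⟩⟩
      · rintro (h5 | ⟨-, -, h5⟩)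
        · exact h2.2 (h5 ▸ G.line.iseqv.refl _)
        · exact h2.2 h5
      · rintro (h5 | ⟨-, -, h5⟩)
        · exact h3.2 (h5 ▸ G.line.iseqv.refl _)
        · exact h3.2 h5
  refine ⟨hL, ?_, comp_connected S c, ?_, hcut, ?_⟩
  · intro v
    induction v using Quotient.inductionOn with | _ d
    exact (h.three_le_valence _).trans (comp_valence S c d).ge
  · have : ¬ (G.comp S c).IsLeg ⟨s, hsc⟩ := fun hl => (comp_isLeg_iff hS c _).1 hl hs
    exact hL.loops_pos_of_cut this (hcut _ this)
  · rw [numLegs, Nat.card_pos_iff]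
    refine ⟨?_, inferInstance⟩
    by_contra hne
    have hin : ∀ d, Quotient.mk (G.compRel S) d = c → d ∈ S := by
      intro d hd
      by_contra hdS
      exact hne ⟨⟨⟨d, hd⟩, (comp_isLeg_iff hS c _).2 hdS⟩⟩
    obtain ⟨l⟩ := h.nonempty_leg
    have hl := vert_bot_of_cut h.connected (c := fun d => Quotient.mk (G.compRel S) d = c) hsc
      (fun a b hab ha => (Quotient.sound (vert_le_compRel S hab)).symm.trans ha)
      (fun a b hab ha => (Quotient.sound (lineOn_le_compRel S
        (Or.inr ⟨hin a ha, hS.line_closed _ _ hab (hin a ha), hab⟩))).symm.trans ha) l.1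
    exact hS.subset_internal (hin _ hl) l.2

/-- A bridgeless set of lines with one loop less than the whole graph. -/
theorem IsOnePI.exists_subgraph (h : G.IsOnePI) : ∃ S, G.IsSubgraph S ∧ S ≠ G.internal ∧
    (S.ncard + 2 * G.numComps S = 2 * G.numInt) := by
  classical
  have hL := h.lineLE
  obtain ⟨d0, hd0⟩ := h.exists_internal
  have := h.nonempty_HE
  have hint := hL.card_internal
  have hcomp : ∀ d, ¬ G.IsLeg d → G.numComps (PreGraph.cut G.internal d) = 1 := fun d hd =>
    numComps_eq_one_of_eq_top (eq_top_iff.2 (h.connected_of_cut d hd ▸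
      sup_le_sup_left (lineOn_compl_le d) _))
  have hint1 : G.numComps G.internal = 1 := by
    apply numComps_eq_one_of_eq_top
    refine eq_top_iff.2 (le_trans ?_ (compRel_mono (fun _ h => h.1 : PreGraph.cut G.internal d0 ⊆ _)))
    exact h.connected_of_cut d0 hd0 ▸ sup_le_sup_left (lineOn_compl_le d0) _
  -- A line set of minimal size among those with loop number at least `I - V`, one less than that of
  -- the graph. Deleting any one internal line from the whole graph shows that such sets exist.
  let P : ℕ → Prop := fun n => ∃ S : Set G.HE, S.ncard = n ∧ G.IsLineSet S ∧
    2 * G.numInt ≤ S.ncard + 2 * G.numComps S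
  have hcut := hL.ncard_cut G.isLineSet_internal hd0
  have hex : ∃ n, P n := ⟨_, PreGraph.cut G.internal d0, rfl, G.isLineSet_internal.cut d0, by
    rw [hcomp d0 hd0]; omega⟩
  obtain ⟨S, hSn, hS, hf⟩ := Nat.find_spec hex
  have hmin : ∀ T : Set G.HE, G.IsLineSet T → 2 * G.numInt ≤ T.ncard + 2 * G.numComps T →
      S.ncard ≤ T.ncard := fun T h1 h2 => hSn ▸ Nat.find_min' hex ⟨T, rfl, h1, h2⟩
  have hlt : ∀ d ∈ S, (PreGraph.cut S d).ncard + 2 * G.numComps (PreGraph.cut S d) <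
      2 * G.numInt := by
    intro d hd
    by_contra hcon
    have := hmin _ (hS.cut d) (not_lt.1 hcon)
    have := hL.ncard_cut hS hd
    omega
  refine ⟨S, h.isSubgraph_of_bridgeless hS ?_, ?_, ?_⟩
  -- Deleting a bridge removes two half-edges and gains a component, so it preserves the bound and
  -- contradicts minimality.
  · intro d hd
    by_contra hbr
    have h1 := numComps_lt_of_bridge hd (hS.line_closed _ _ (line_partner d) hd) hbr
    have h2 := hlt d hd
    have h3 := hL.ncard_cut hS hd
    omega
  · rintro rfl
    have := hmin _ (G.isLineSet_internal.cut d0) (by rw [hcomp d0 hd0]; omega)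
    omega
  · rcases S.eq_empty_or_nonempty with rfl | ⟨d, hd⟩
    · have h1 := hL.two_mul_numVerts_le G.isLineSet_internal
      rw [hint1] at h1
      have h2 : G.numComps ∅ = G.numVerts := by rw [numComps, compRel_empty]; rfl
      have h3 := h.not_tree
      have h4 := hL.two_mul_numVerts_le (G.isLineSet_internal.cut d0)
      rw [hcomp d0 hd0] at h4
      simp only [Set.ncard_empty, h2] at hf ⊢
      omega
    · have h2 := hlt d hd
      have h3 := hL.ncard_cut hS hd
      have h4 : G.numComps S ≤ G.numComps (PreGraph.cut S d) :=
        Nat.card_le_card_of_surjective (Quotient.map' id (fun _ _ h => compRel_mono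
          (fun _ h => h.1) h)) (fun y => Quotient.inductionOn y fun y => ⟨Quotient.mk _ y, rfl⟩)
      -- Parity sharpens the strict inequality for the cut set by two, which is what the restored
      -- line can add.
      have h5 : 2 ∣ (PreGraph.cut S d).ncard := by
        have : ∀ n, ∀ T : Set G.HE, T.ncard = n → G.IsLineSet T → 2 ∣ n := by
          intro n
          induction n using Nat.strong_induction_on with | _ n ih
          rintro T rfl hT
          rcases T.eq_empty_or_nonempty with rfl | ⟨e, he⟩
          · simp
          · have h6 := hL.ncard_cut hT he
            have := ih _ (by omega) _ rfl (hT.cut e)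
            omega
        exact this _ _ rfl (hS.cut d)
      omega

end PreGraph

/-! ### The graph with one vertex and no internal line -/

section Corolla

variable {P : Type} [Finite P]

theorem corolla_isLeg (d : (corolla P).graph.HE) : (corolla P).graph.IsLeg d :=
  fun _ h => Eq.symm h

theorem corolla_lineLE : (corolla P).graph.LineLE := by
  intro d
  have : {e | (corolla P).graph.line.r d e} = {d} := by
    ext e
    exact ⟨fun h => Eq.symm h, fun h => Eq.symm h⟩
  rw [this, Set.ncard_singleton]
  exact one_le_two

theorem corolla_connected : (corolla P).graph.vert ⊔ (corolla P).graph.line = ⊤ :=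
  top_sup_eq _

theorem corolla_numInt : (corolla P).graph.numInt = 0 :=
  Nat.card_eq_zero.2 (Or.inl ⟨fun q => PreGraph.firstEnd_not_isLeg q (corolla_isLeg _)⟩)

theorem corolla_numVerts [Nonempty P] : (corolla P).graph.numVerts = 1 := by
  have : Subsingleton (corolla P).graph.Vertex :=
    ⟨fun x y => Quotient.inductionOn₂ x y fun a b => Quotient.sound trivial⟩
  have : Nonempty (corolla P).graph.Vertex :=
    ⟨Quotient.mk (corolla P).graph.vert (Classical.arbitrary P)⟩
  exact Nat.card_eq_one_iff_unique.2 ⟨inferInstance, inferInstance⟩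

theorem corolla_valence (v : (corolla P).graph.Vertex) :
    (corolla P).graph.valence v = Nat.card P := by
  induction v using Quotient.inductionOn with | _ d
  exact Nat.card_congr ⟨fun e => e.1, fun e => ⟨e, Quotient.sound trivial⟩,
    fun _ => rfl, fun _ => rfl⟩

end Corolla

namespace LGraph

variable {P : Type}

theorem rep_onePI (q : LGraph P) : q.rep.graph.IsOnePI := (Quotient.out q).2

end LGraph

/-! ### The result of an insertion -/

namespace PreGraph.Insertion

variable {γ : PreGraph} (D : γ.Insertion)

/-! ### Prongs and wires -/

/-- The prong of a half-edge. -/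
def pr (d : γ.HE) : Σ x : D.Site, D.SiteProng x := ⟨Sum.inl (Quotient.mk γ.vert d), ⟨d, rfl⟩⟩

/-- The half-edge at a prong of a vertex. -/
def prongHE : (Σ x : D.Site, D.SiteProng x) → Option γ.HE
  | ⟨Sum.inl _, p⟩ => some p.1
  | ⟨Sum.inr _, _⟩ => none

theorem pr_injective : Function.Injective D.pr := fun d d' h =>
  Option.some.inj (congrArg D.prongHE h : some d = some d')

theorem inl_prong (v : γ.Vertex) (p : D.SiteProng (Sum.inl v)) :
    (⟨Sum.inl v, p⟩ : Σ x : D.Site, D.SiteProng x) = D.pr p.1 := by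
  obtain ⟨d, rfl⟩ := p
  rfl

theorem src_zero (q : γ.IntLine) : D.src q 0 = D.pr (γ.firstEnd q) := rfl

theorem src_succ (q : γ.IntLine) (j : Fin (D.chain q).length) :
    D.src q j.succ = ⟨Sum.inr ⟨q, j⟩, true⟩ := rfl

theorem tgt_last (q : γ.IntLine) : D.tgt q (Fin.last _) = D.pr (γ.secondEnd q) :=
  Fin.lastCases_last

theorem tgt_castSucc (q : γ.IntLine) (j : Fin (D.chain q).length) :
    D.tgt q j.castSucc = ⟨Sum.inr ⟨q, j⟩, false⟩ :=
  Fin.lastCases_castSucc j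

theorem firstEnd_injective : Function.Injective γ.firstEnd := fun q q' h =>
  Subtype.ext ((firstEnd_mk q).symm.trans ((congrArg _ h).trans (firstEnd_mk q')))

theorem secondEnd_injective : Function.Injective γ.secondEnd := fun q q' h =>
  Subtype.ext ((secondEnd_mk q).symm.trans ((congrArg _ h).trans (secondEnd_mk q')))

/-- The segments into which the lines are divided. -/
abbrev Wire : Type := Σ q : γ.IntLine, Fin ((D.chain q).length + 1)

theorem src_injective : Function.Injective fun w : D.Wire => D.src w.1 w.2 := by
  rintro ⟨q, i⟩ ⟨q', i'⟩ h
  change D.src q i = D.src q' i' at h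
  induction i using Fin.cases with
  | zero =>
    induction i' using Fin.cases with
    | zero =>
      obtain rfl := firstEnd_injective (D.pr_injective h)
      rfl
    | succ j' => exact absurd (congrArg Sigma.fst h) Sum.inl_ne_inr
  | succ j =>
    induction i' using Fin.cases with
    | zero => exact absurd (congrArg Sigma.fst h) Sum.inr_ne_inl
    | succ j' =>
      have h1 : (⟨q, j⟩ : Σ q : γ.IntLine, Fin (D.chain q).length) = ⟨q', j'⟩ :=
        Sum.inr_injective (congrArg Sigma.fst h)
      cases h1
      rfl

theorem tgt_injective : Function.Injective fun w : D.Wire => D.tgt w.1 w.2 := by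
  rintro ⟨q, i⟩ ⟨q', i'⟩ h
  change D.tgt q i = D.tgt q' i' at h
  induction i using Fin.lastCases with
  | last =>
    induction i' using Fin.lastCases with
    | last =>
      rw [tgt_last, tgt_last] at h
      obtain rfl := secondEnd_injective (D.pr_injective h)
      rfl
    | cast j' =>
      rw [tgt_last, tgt_castSucc] at h
      exact absurd (congrArg Sigma.fst h) Sum.inl_ne_inr
  | cast j =>
    induction i' using Fin.lastCases with
    | last =>
      rw [tgt_last, tgt_castSucc] at h
      exact absurd (congrArg Sigma.fst h) Sum.inr_ne_inl
    | cast j' =>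
      rw [tgt_castSucc, tgt_castSucc] at h
      have h1 : (⟨q, j⟩ : Σ q : γ.IntLine, Fin (D.chain q).length) = ⟨q', j'⟩ :=
        Sum.inr_injective (congrArg Sigma.fst h)
      cases h1
      rfl

theorem firstEnd_ne_secondEnd (q q' : γ.IntLine) : γ.firstEnd q ≠ γ.secondEnd q' := by
  intro h
  have : q = q' := Subtype.ext ((firstEnd_mk q).symm.trans ((congrArg _ h).trans (secondEnd_mk q')))
  subst this
  exact secondEnd_ne q h.symm

theorem src_ne_tgt (q q' : γ.IntLine) (i : Fin ((D.chain q).length + 1))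
    (i' : Fin ((D.chain q').length + 1)) : D.src q i ≠ D.tgt q' i' := by
  intro h
  induction i using Fin.cases with
  | zero =>
    induction i' using Fin.lastCases with
    | last =>
      rw [tgt_last] at h
      exact firstEnd_ne_secondEnd _ _ (D.pr_injective h)
    | cast j' =>
      rw [tgt_castSucc] at h
      exact absurd (congrArg Sigma.fst h) Sum.inl_ne_inr
  | succ j =>
    induction i' using Fin.lastCases with
    | last =>
      rw [tgt_last] at h
      exact absurd (congrArg Sigma.fst h) Sum.inr_ne_inl
    | cast j' =>
      rw [tgt_castSucc, src_succ] at h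
      have h1 : (⟨q, j⟩ : Σ q : γ.IntLine, Fin (D.chain q).length) = ⟨q', j'⟩ :=
        Sum.inr_injective (congrArg Sigma.fst h)
      cases h1
      have h2 : (true : Bool) = false := eq_of_heq (Sigma.mk.inj h).2
      exact Bool.noConfusion h2

variable {D} in
-- Together with `src_injective`, `tgt_injective`, `src_ne_tgt` and the disjointness from legs, this
-- says that the wires pair off all prongs except those of the external legs of `γ`.
theorem prong_cases (hL : γ.LineLE) (p : Σ x : D.Site, D.SiteProng x) :
    (∃ d, γ.IsLeg d ∧ p = D.pr d) ∨ (∃ q i, p = D.src q i) ∨ ∃ q i, p = D.tgt q i := by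
  rcases p with ⟨v | ⟨q, j⟩, p⟩
  · rw [inl_prong]
    by_cases hd : γ.IsLeg p.1
    · exact Or.inl ⟨_, hd, rfl⟩
    · rcases hL.eq_firstEnd_or (d := p.1) (q := toIntLine p.1 hd) rfl with h | h
      · exact Or.inr (Or.inl ⟨toIntLine p.1 hd, 0, by rw [src_zero, ← h]⟩)
      · exact Or.inr (Or.inr ⟨toIntLine p.1 hd, Fin.last _, by rw [tgt_last, ← h]⟩)
  · cases (p : Bool) with
    | false => exact Or.inr (Or.inr ⟨q, j.castSucc, (D.tgt_castSucc q j).symm⟩)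
    | true => exact Or.inr (Or.inl ⟨q, j.succ, rfl⟩)

theorem src_ne_leg {d : γ.HE} (hd : γ.IsLeg d) (q : γ.IntLine)
    (i : Fin ((D.chain q).length + 1)) : D.src q i ≠ D.pr d := by
  intro h
  induction i using Fin.cases with
  | zero => exact firstEnd_not_isLeg q ((D.pr_injective h).symm ▸ hd)
  | succ j => exact absurd (congrArg Sigma.fst h) Sum.inr_ne_inl

theorem tgt_ne_leg {d : γ.HE} (hd : γ.IsLeg d) (q : γ.IntLine)
    (i : Fin ((D.chain q).length + 1)) : D.tgt q i ≠ D.pr d := by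
  intro h
  induction i using Fin.lastCases with
  | last =>
    rw [tgt_last] at h
    exact secondEnd_not_isLeg q ((D.pr_injective h).symm ▸ hd)
  | cast j =>
    rw [tgt_castSucc] at h
    exact absurd (congrArg Sigma.fst h) Sum.inr_ne_inl

/-! ### The relations of the glued graph -/

theorem att_isLeg (p : Σ x : D.Site, D.SiteProng x) :
    (D.piece p.1).graph.IsLeg (D.att p).2 := ((D.piece p.1).leg p.2).2

theorem att_injective : Function.Injective D.att := by
  rintro ⟨x, p⟩ ⟨y, q⟩ h
  obtain rfl : x = y := congrArg Sigma.fst h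
  have h1 := eq_of_heq (Sigma.mk.inj h).2
  exact congrArg (Sigma.mk x) ((D.piece x).leg.injective (Subtype.ext h1))

/-- Half-edges in the interior of the inserted graphs. -/
def inner : Set D.GlueHE := {p | ¬ (D.piece p.1).graph.IsLeg p.2}

theorem not_inner_iff {p : D.GlueHE} : p ∉ D.inner ↔ ∃ r, p = D.att r := by
  constructor
  · intro h
    have h : (D.piece p.1).graph.IsLeg p.2 := not_not.1 h
    refine ⟨⟨p.1, (D.piece p.1).leg.symm ⟨p.2, h⟩⟩, ?_⟩
    exact congrArg (Sigma.mk p.1)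
      (congrArg Subtype.val ((D.piece p.1).leg.apply_symm_apply ⟨p.2, h⟩)).symm
  · rintro ⟨r, rfl⟩ h
    exact h (D.att_isLeg r)

theorem isLeg_of_att_eq {r : Σ x : D.Site, D.SiteProng x} {x : D.Site}
    {a : (D.piece x).graph.HE} (h : D.att r = ⟨x, a⟩) : (D.piece x).graph.IsLeg a :=
  not_not.1 (D.not_inner_iff.2 ⟨r, h.symm⟩)

theorem glue_vert_iff {p p' : D.GlueHE} : D.glue.vert.r p p' ↔ D.GlueVert p p' := by
  have : Equivalence D.GlueVert :=
    { refl := fun p => .inner p.1 p.2 p.2 ((D.piece p.1).graph.vert.iseqv.refl _)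
      symm := by
        rintro _ _ ⟨x, a, b, h⟩
        exact .inner x b a ((D.piece x).graph.vert.iseqv.symm h)
      trans := by
        rintro _ _ _ ⟨x, a, b, h⟩ ⟨_, _, c, h'⟩
        exact .inner x a c ((D.piece x).graph.vert.iseqv.trans h h') }
  exact this.eqvGen_iff

theorem glue_vert_mk {x : D.Site} {a b : (D.piece x).graph.HE} :
    D.glue.vert.r ⟨x, a⟩ ⟨x, b⟩ ↔ (D.piece x).graph.vert.r a b := by
  rw [glue_vert_iff]
  constructor
  · rintro ⟨_, _, _, h⟩
    exact h
  · exact fun h => .inner x a b h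

theorem glue_vert_site {p p' : D.GlueHE} (h : D.glue.vert.r p p') : p.1 = p'.1 := by
  rw [glue_vert_iff] at h
  cases h
  rfl

theorem eq_att_of_piece_line {r : Σ x : D.Site, D.SiteProng x} {p : D.GlueHE} (h : ∃ x a b,
    D.att r = ⟨x, a⟩ ∧ p = ⟨x, b⟩ ∧ (D.piece x).graph.line.r a b) : p = D.att r := by
  obtain ⟨x, a, b, h1, rfl, h2⟩ := h
  rw [h1, D.isLeg_of_att_eq h1 b h2]

/-- The generating relation, once made reflexive and symmetric, is already transitive: a wire ends
at an external leg of a piece, which is alone on its line inside the piece, and two wires with a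
common end coincide. -/
theorem glue_line_iff {p p' : D.GlueHE} : D.glue.line.r p p' ↔
    (∃ x a b, p = ⟨x, a⟩ ∧ p' = ⟨x, b⟩ ∧ (D.piece x).graph.line.r a b) ∨
    (∃ q i, p = D.att (D.src q i) ∧ p' = D.att (D.tgt q i)) ∨
    ∃ q i, p = D.att (D.tgt q i) ∧ p' = D.att (D.src q i) := by
  constructor
  swap
  · rintro (⟨x, a, b, rfl, rfl, h⟩ | ⟨q, i, rfl, rfl⟩ | ⟨q, i, rfl, rfl⟩)
    · exact .rel _ _ (.inner x a b h)
    · exact .rel _ _ (.wire q i)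
    · exact .symm _ _ (.rel _ _ (.wire q i))
  intro h
  have hleg := @D.eq_att_of_piece_line
  induction h with
  | rel p p' h =>
    cases h with
    | inner x a b h => exact Or.inl ⟨x, a, b, rfl, rfl, h⟩
    | wire q i => exact Or.inr (Or.inl ⟨q, i, rfl, rfl⟩)
  | refl p => exact Or.inl ⟨p.1, p.2, p.2, rfl, rfl, (D.piece p.1).graph.line.iseqv.refl _⟩
  | symm p p' _ ih =>
    rcases ih with ⟨x, a, b, rfl, rfl, h⟩ | ⟨q, i, rfl, rfl⟩ | ⟨q, i, rfl, rfl⟩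
    · exact Or.inl ⟨x, b, a, rfl, rfl, (D.piece x).graph.line.iseqv.symm h⟩
    · exact Or.inr (Or.inr ⟨q, i, rfl, rfl⟩)
    · exact Or.inr (Or.inl ⟨q, i, rfl, rfl⟩)
  | trans p p' p'' _ _ ih ih' =>
    rcases ih with ⟨x, a, b, rfl, rfl, h⟩ | ⟨q, i, rfl, rfl⟩ | ⟨q, i, rfl, rfl⟩
    · rcases ih' with ⟨y, c, d, h1, rfl, h'⟩ | ⟨q, i, h1, rfl⟩ | ⟨q, i, h1, rfl⟩
      · cases h1
        exact Or.inl ⟨x, a, d, rfl, rfl, (D.piece x).graph.line.iseqv.trans h h'⟩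
      · have := hleg ⟨x, b, a, h1.symm, rfl, (D.piece x).graph.line.iseqv.symm h⟩
        exact Or.inr (Or.inl ⟨q, i, this, rfl⟩)
      · have := hleg ⟨x, b, a, h1.symm, rfl, (D.piece x).graph.line.iseqv.symm h⟩
        exact Or.inr (Or.inr ⟨q, i, this, rfl⟩)
    · rcases ih' with h1 | ⟨q', i', h1, rfl⟩ | ⟨q', i', h1, rfl⟩
      · rw [hleg h1]
        exact Or.inr (Or.inl ⟨q, i, rfl, rfl⟩)
      · exact absurd (D.att_injective h1).symm (D.src_ne_tgt _ _ _ _)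
      · have := D.tgt_injective (a₁ := ⟨q, i⟩) (a₂ := ⟨q', i'⟩) (D.att_injective h1)
        cases this
        exact Or.inl ⟨_, _, _, rfl, rfl, (D.piece _).graph.line.iseqv.refl _⟩
    · rcases ih' with h1 | ⟨q', i', h1, rfl⟩ | ⟨q', i', h1, rfl⟩
      · rw [hleg h1]
        exact Or.inr (Or.inr ⟨q, i, rfl, rfl⟩)
      · have := D.src_injective (a₁ := ⟨q, i⟩) (a₂ := ⟨q', i'⟩) (D.att_injective h1)
        cases this
        exact Or.inl ⟨_, _, _, rfl, rfl, (D.piece _).graph.line.iseqv.refl _⟩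
      · exact absurd (D.att_injective h1) (D.src_ne_tgt _ _ _ _)

theorem line_wire (q : γ.IntLine) (i : Fin ((D.chain q).length + 1)) :
    D.glue.line.r (D.att (D.src q i)) (D.att (D.tgt q i)) := .rel _ _ (.wire q i)

theorem line_of_piece {x : D.Site} {a b : (D.piece x).graph.HE}
    (h : (D.piece x).graph.line.r a b) : D.glue.line.r ⟨x, a⟩ ⟨x, b⟩ := .rel _ _ (.inner x a b h)

theorem line_att_src {q : γ.IntLine} {i : Fin ((D.chain q).length + 1)} {p : D.GlueHE} :
    D.glue.line.r (D.att (D.src q i)) p ↔ p = D.att (D.src q i) ∨ p = D.att (D.tgt q i) := by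
  constructor
  · intro h
    rcases D.glue_line_iff.1 h with h1 | ⟨q', i', h1, rfl⟩ | ⟨q', i', h1, rfl⟩
    · exact Or.inl (D.eq_att_of_piece_line h1)
    · have := D.src_injective (a₁ := ⟨q, i⟩) (a₂ := ⟨q', i'⟩) (D.att_injective h1)
      cases this
      exact Or.inr rfl
    · exact absurd (D.att_injective h1) (D.src_ne_tgt _ _ _ _)
  · rintro (rfl | rfl)
    · exact D.glue.line.iseqv.refl _
    · exact D.line_wire q i

theorem line_att_tgt {q : γ.IntLine} {i : Fin ((D.chain q).length + 1)} {p : D.GlueHE} :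
    D.glue.line.r (D.att (D.tgt q i)) p ↔ p = D.att (D.tgt q i) ∨ p = D.att (D.src q i) := by
  constructor
  · intro h
    rcases D.glue_line_iff.1 h with h1 | ⟨q', i', h1, rfl⟩ | ⟨q', i', h1, rfl⟩
    · exact Or.inl (D.eq_att_of_piece_line h1)
    · exact absurd (D.att_injective h1).symm (D.src_ne_tgt _ _ _ _)
    · have := D.tgt_injective (a₁ := ⟨q, i⟩) (a₂ := ⟨q', i'⟩) (D.att_injective h1)
      cases this
      exact Or.inr rfl
  · rintro (rfl | rfl)
    · exact D.glue.line.iseqv.refl _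
    · exact D.glue.line.iseqv.symm (D.line_wire q i)

theorem att_leg_isLeg {d : γ.HE} (hd : γ.IsLeg d) : D.glue.IsLeg (D.att (D.pr d)) := by
  intro p h
  rcases D.glue_line_iff.1 h with h1 | ⟨q', i', h1, rfl⟩ | ⟨q', i', h1, rfl⟩
  · exact D.eq_att_of_piece_line h1
  · exact absurd (D.att_injective h1).symm (D.src_ne_leg hd _ _)
  · exact absurd (D.att_injective h1).symm (D.tgt_ne_leg hd _ _)

theorem line_inner {x : D.Site} {a : (D.piece x).graph.HE} (ha : ¬ (D.piece x).graph.IsLeg a)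
    {p : D.GlueHE} (h : D.glue.line.r ⟨x, a⟩ p) :
    ∃ b, p = ⟨x, b⟩ ∧ (D.piece x).graph.line.r a b := by
  have hi : (⟨x, a⟩ : D.GlueHE) ∈ D.inner := ha
  rcases D.glue_line_iff.1 h with ⟨x, a, b, h1, h2, h3⟩ | ⟨q', i', h1, -⟩ | ⟨q', i', h1, -⟩
  · cases h1
    exact ⟨b, h2, h3⟩
  · exact absurd hi (D.not_inner_iff.2 ⟨_, h1⟩)
  · exact absurd hi (D.not_inner_iff.2 ⟨_, h1⟩)

theorem line_mk_iff {x : D.Site} {a b : (D.piece x).graph.HE}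
    (ha : ¬ (D.piece x).graph.IsLeg a) :
    D.glue.line.r ⟨x, a⟩ ⟨x, b⟩ ↔ (D.piece x).graph.line.r a b := by
  refine ⟨fun h => ?_, D.line_of_piece⟩
  obtain ⟨b', h1, h2⟩ := D.line_inner ha h
  cases h1
  exact h2

theorem inner_not_isLeg {p : D.GlueHE} (h : p ∈ D.inner) : ¬ D.glue.IsLeg p := by
  obtain ⟨b, hb, hne⟩ := not_isLeg_iff.1 h
  refine not_isLeg_iff.2 ⟨⟨p.1, b⟩, D.line_of_piece hb, fun h => hne ?_⟩
  exact eq_of_heq (Sigma.mk.inj h).2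

theorem src_not_isLeg (q : γ.IntLine) (i : Fin ((D.chain q).length + 1)) :
    ¬ D.glue.IsLeg (D.att (D.src q i)) := fun h =>
  D.src_ne_tgt q q i i (D.att_injective (h _ (D.line_wire q i)).symm)

theorem tgt_not_isLeg (q : γ.IntLine) (i : Fin ((D.chain q).length + 1)) :
    ¬ D.glue.IsLeg (D.att (D.tgt q i)) :=
  not_isLeg_of_line (D.line_wire q i) (D.src_not_isLeg q i)

variable {D} in
theorem glue_isLeg_iff (hL : γ.LineLE) {p : D.GlueHE} :
    D.glue.IsLeg p ↔ ∃ d, γ.IsLeg d ∧ p = D.att (D.pr d) := by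
  constructor
  · intro h
    obtain ⟨r, rfl⟩ := D.not_inner_iff.1 fun hi => D.inner_not_isLeg hi h
    rcases prong_cases hL r with ⟨d, hd, rfl⟩ | ⟨q, i, rfl⟩ | ⟨q, i, rfl⟩
    · exact ⟨d, hd, rfl⟩
    · exact absurd h (D.src_not_isLeg q i)
    · exact absurd h (D.tgt_not_isLeg q i)
  · rintro ⟨d, hd, rfl⟩
    exact D.att_leg_isLeg hd

/-! ### Pieces -/

instance (v : γ.Vertex) : Nonempty (γ.Prong v) :=
  Quotient.inductionOn v fun d => ⟨⟨d, rfl⟩⟩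

instance (x : D.Site) : Finite (D.SiteProng x) := by
  cases x
  · exact inferInstanceAs (Finite (γ.Prong _))
  · exact inferInstanceAs (Finite Bool)

instance (x : D.Site) : Nonempty (D.SiteProng x) := by
  cases x
  · exact inferInstanceAs (Nonempty (γ.Prong _))
  · exact inferInstanceAs (Nonempty Bool)

theorem piece_none {v : γ.Vertex} (h : D.vtx v = none) :
    D.piece (Sum.inl v) = corolla (γ.Prong v) := by
  change (D.vtx v).elim _ _ = _
  rw [h]
  rfl

theorem piece_some {v : γ.Vertex} {q : LGraph (γ.Prong v)} (h : D.vtx v = some q) :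
    D.piece (Sum.inl v) = q.rep := by
  change (D.vtx v).elim _ _ = _
  rw [h]
  rfl

theorem piece_cases (x : D.Site) :
    (D.piece x).graph.IsOnePI ∨ ∃ v, x = Sum.inl v ∧ D.vtx v = none := by
  rcases x with v | y
  · cases h : D.vtx v with
    | none => exact Or.inr ⟨v, rfl, h⟩
    | some q =>
      rw [D.piece_some h]
      exact Or.inl q.rep_onePI
  · exact Or.inl (LGraph.rep_onePI _)

theorem piece_lineLE (x : D.Site) : (D.piece x).graph.LineLE := by
  rcases D.piece_cases x with h | ⟨v, rfl, h⟩
  · exact h.lineLE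
  · rw [D.piece_none h]
    exact corolla_lineLE

theorem piece_connected (x : D.Site) : (D.piece x).graph.vert ⊔ (D.piece x).graph.line = ⊤ := by
  rcases D.piece_cases x with h | ⟨v, rfl, h⟩
  · exact h.connected
  · rw [D.piece_none h]
    exact corolla_connected

theorem piece_loops (x : D.Site) : (D.piece x).graph.numInt + 1 =
    (D.piece x).graph.loops + (D.piece x).graph.numVerts := by
  rcases D.piece_cases x with h | ⟨v, rfl, h⟩
  · have := h.not_tree
    unfold loops at *
    omega
  · rw [D.piece_none h, loops, corolla_numInt, corolla_numVerts]

theorem piece_isOnePI {x : D.Site} {a : (D.piece x).graph.HE}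
    (h : ¬ (D.piece x).graph.IsLeg a) : (D.piece x).graph.IsOnePI := by
  rcases D.piece_cases x with h' | ⟨v, rfl, h'⟩
  · exact h'
  · revert a
    rw [D.piece_none h']
    exact fun h => absurd (corolla_isLeg _) h

theorem piece_three_le_valence (hv : ∀ v, 3 ≤ γ.valence v) (x : D.Site)
    (w : (D.piece x).graph.Vertex) : 3 ≤ (D.piece x).graph.valence w := by
  rcases D.piece_cases x with h' | ⟨v, rfl, h'⟩
  · exact h'.three_le_valence w
  · revert w
    rw [D.piece_none h']
    exact fun w => (hv v).trans (corolla_valence w).ge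

theorem piece_numLegs (x : D.Site) : (D.piece x).graph.numLegs = Nat.card (D.SiteProng x) :=
  (Nat.card_congr (D.piece x).leg).symm

/-! ### The glued graph is 1PI -/

variable {D} in
theorem glue_lineLE (hL : γ.LineLE) : D.glue.LineLE := by
  intro p
  have h2 : ∀ s : Set D.GlueHE, ∀ a b, s ⊆ {a, b} → s.ncard ≤ 2 := fun s a b h =>
    (Set.ncard_le_ncard h (Set.toFinite _)).trans ((Set.ncard_insert_le a {b}).trans (by simp))
  by_cases hp : p ∈ D.inner
  · have : {e | D.glue.line.r p e} ⊆ Sigma.mk p.1 '' {b | (D.piece p.1).graph.line.r p.2 b} := by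
      intro e he
      obtain ⟨b, rfl, hb⟩ := D.line_inner (x := p.1) (a := p.2) hp he
      exact ⟨b, hb, rfl⟩
    refine (Set.ncard_le_ncard this (Set.toFinite _)).trans ?_
    exact (Set.ncard_image_le (Set.toFinite _)).trans (D.piece_lineLE p.1 p.2)
  · obtain ⟨r, rfl⟩ := D.not_inner_iff.1 hp
    rcases prong_cases hL r with ⟨d, hd, rfl⟩ | ⟨q, i, rfl⟩ | ⟨q, i, rfl⟩
    · exact h2 _ (D.att (D.pr d)) (D.att (D.pr d)) fun e he => Or.inl (D.att_leg_isLeg hd e he)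
    · exact h2 _ _ _ fun e he => D.line_att_src.1 he
    · exact h2 _ _ _ fun e he => D.line_att_tgt.1 he

section Connect

variable {D} {R : Setoid D.GlueHE} (hp : ∀ x a b, R ⟨x, a⟩ ⟨x, b⟩)
include hp

theorem rel_of_site {p p' : D.GlueHE} (h : p.1 = p'.1) : R p p' := by
  obtain ⟨x, a⟩ := p
  obtain ⟨y, b⟩ := p'
  obtain rfl : x = y := h
  exact hp x a b

/-- A cut wire divides the graphs on its line into those still tied to the first end and those still
tied to the second end. This handles the former, `rel_secondEnd` the latter. -/
theorem rel_firstEnd {q : γ.IntLine} (n : ℕ)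
    (hw : ∀ i : Fin ((D.chain q).length + 1), i.1 < n → R (D.att (D.src q i)) (D.att (D.tgt q i)))
    (i : Fin ((D.chain q).length + 1)) (hi : i.1 ≤ n) :
    R (D.att (D.src q i)) (D.att (D.pr (γ.firstEnd q))) := by
  induction i using Fin.induction with
  | zero => exact R.refl _
  | succ j ih =>
    have hj : j.castSucc.1 < n := by simpa using hi
    refine R.trans ?_ (ih hj.le)
    refine R.trans ?_ (R.symm (hw _ hj))
    rw [src_succ, tgt_castSucc]
    exact hp _ _ _

theorem rel_secondEnd {q : γ.IntLine} (n : ℕ)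
    (hw : ∀ i : Fin ((D.chain q).length + 1), n < i.1 → R (D.att (D.src q i)) (D.att (D.tgt q i)))
    (i : Fin ((D.chain q).length + 1)) (hi : n < i.1) :
    R (D.att (D.src q i)) (D.att (D.pr (γ.secondEnd q))) := by
  induction i using Fin.reverseInduction with
  | last => exact tgt_last D q ▸ hw _ hi
  | cast j ih =>
    have hj : n < j.succ.1 := by
      simp only [Fin.val_castSucc, Fin.val_succ] at hi ⊢
      omega
    refine R.trans (hw _ hi) (R.trans ?_ (ih hj))
    rw [src_succ, tgt_castSucc]
    exact hp _ _ _

theorem rel_ends {q : γ.IntLine}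
    (hw : ∀ i, R (D.att (D.src q i)) (D.att (D.tgt q i))) :
    R (D.att (D.pr (γ.firstEnd q))) (D.att (D.pr (γ.secondEnd q))) :=
  R.trans (R.symm (rel_firstEnd hp _ (fun i _ => hw i) (Fin.last _) le_rfl))
    (tgt_last D q ▸ hw (Fin.last _))

/-- Since `R` joins each piece to a single class, it induces a relation on the half-edges of `γ`,
and connectedness of `γ` can be used. The set `T` stands for the lines of `γ` whose wires are all
intact; the last hypothesis attaches the graphs on lines, including those on a line with a cut. -/
theorem eq_top_of_rel (hL : γ.LineLE) {T : Set γ.HE} (hT : γ.vert ⊔ γ.lineOn T = ⊤)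
    (hw : ∀ q, γ.firstEnd q ∈ T → ∀ i, R (D.att (D.src q i)) (D.att (D.tgt q i)))
    (hTl : ∀ a b, γ.line.r a b → a ∈ T → b ∈ T)
    (hc : ∀ q j a, ∃ d, R ⟨Sum.inr ⟨q, j⟩, a⟩ (D.att (D.pr d))) : R = ⊤ := by
  have h1 : ∀ d e : γ.HE, R (D.att (D.pr d)) (D.att (D.pr e)) := by
    have : γ.vert ⊔ γ.lineOn T ≤ R.comap fun d => D.att (D.pr d) := by
      refine sup_le ?_ ?_
      · intro a b hab
        refine rel_of_site hp ?_
        exact congrArg Sum.inl (Quotient.sound hab)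
      · rintro a b (rfl | ⟨ha, hb, hab⟩)
        · exact R.refl _
        · by_cases hne : a = b
          · subst hne
            exact R.refl _
          have hleg : ¬ γ.IsLeg a := not_isLeg_iff.2 ⟨b, hab, Ne.symm hne⟩
          set q := toIntLine a hleg with hq
          have hf : γ.firstEnd q ∈ T :=
            hTl a _ (Quotient.exact (firstEnd_mk q).symm) ha
          have hfs := rel_ends hp (hw q hf)
          have hqb : Quotient.mk γ.line b = q.1 := (Quotient.sound hab).symm
          rcases hL.eq_firstEnd_or (d := a) (q := q) rfl with h | h <;>
          rcases hL.eq_firstEnd_or (d := b) hqb with h' | h'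
          · exact absurd (h.trans h'.symm) hne
          · rw [h, h']
            exact hfs
          · rw [h, h']
            exact R.symm hfs
          · exact absurd (h.trans h'.symm) hne
    rw [hT] at this
    exact fun d e => this trivial
  have h2 : ∀ p : D.GlueHE, ∃ d, R p (D.att (D.pr d)) := by
    rintro ⟨v | ⟨q, j⟩, a⟩
    · induction v using Quotient.inductionOn with | _ d
      exact ⟨d, rel_of_site hp rfl⟩
    · exact hc q j a
  refine eq_top_iff.2 fun {p p'} _ => ?_
  obtain ⟨d, hd⟩ := h2 p
  obtain ⟨e, he⟩ := h2 p'
  exact R.trans hd (R.trans (h1 d e) (R.symm he))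

theorem eq_top_of_rel_wires (hL : γ.LineLE) (hconn : γ.vert ⊔ γ.line = ⊤)
    (hw : ∀ q i, R (D.att (D.src q i)) (D.att (D.tgt q i))) : R = ⊤ := by
  refine eq_top_of_rel hp hL (T := Set.univ) ?_ (fun q _ => hw q) (fun _ _ _ h => h) ?_
  · exact eq_top_iff.2 (hconn ▸ sup_le_sup_left (fun {a b} h => Or.inr ⟨trivial, trivial, h⟩) _)
  · intro q j a
    refine ⟨γ.firstEnd q, R.trans ?_
      (rel_firstEnd hp _ (fun i _ => hw q i) j.succ (Nat.lt_succ_iff.1 j.succ.2))⟩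
    exact rel_of_site hp rfl

end Connect

theorem rel_piece {R : Setoid D.GlueHE} (hv : D.glue.vert ≤ R) (x : D.Site)
    {s : Setoid (D.piece x).graph.HE} (hs : ∀ a b, s.r a b → R ⟨x, a⟩ ⟨x, b⟩)
    (h : (D.piece x).graph.vert ⊔ s = ⊤) (a b : (D.piece x).graph.HE) : R ⟨x, a⟩ ⟨x, b⟩ := by
  have : (D.piece x).graph.vert ⊔ s ≤ R.comap (Sigma.mk x) :=
    sup_le (fun {a b} hab => hv (D.glue_vert_mk.2 hab)) (fun {a b} hab => hs a b hab)
  rw [h] at this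
  exact this trivial

theorem glue_connected (hL : γ.LineLE) (hconn : γ.vert ⊔ γ.line = ⊤) :
    D.glue.vert ⊔ D.glue.line = ⊤ := by
  refine eq_top_of_rel_wires ?_ hL hconn fun q i =>
    (le_sup_right : D.glue.line ≤ _) (D.line_wire q i)
  exact fun x => D.rel_piece le_sup_left x
    (fun a b h => (le_sup_right : D.glue.line ≤ _) (D.line_of_piece h)) (D.piece_connected x)

/-- `γ` stays connected without the line `q`, and the graphs on `q` hang on to the end that lies on
their side of the cut. -/
theorem glue_connected_of_cut_wire (hγ : γ.IsOnePI) (q : γ.IntLine)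
    (i : Fin ((D.chain q).length + 1)) {p : D.GlueHE}
    (hline : ∀ e, D.glue.line.r p e ↔ e = D.att (D.src q i) ∨ e = D.att (D.tgt q i)) :
    D.glue.vert ⊔ D.glue.lineOn {e | ¬ D.glue.line.r p e} = ⊤ := by
  set R := D.glue.vert ⊔ D.glue.lineOn {e | ¬ D.glue.line.r p e}
  have hR : D.glue.lineOn {e | ¬ D.glue.line.r p e} ≤ R := le_sup_right
  have hp : ∀ x a b, R ⟨x, a⟩ ⟨x, b⟩ := by
    refine fun x => D.rel_piece le_sup_left x (fun a b h => ?_) (D.piece_connected x)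
    by_cases ha : (D.piece x).graph.IsLeg a
    · rw [ha b h]
      exact R.refl _
    · have hb := not_isLeg_of_line h ha
      have hnot : ∀ c, ¬ (D.piece x).graph.IsLeg c → ¬ D.glue.line.r p ⟨x, c⟩ := by
        intro c hc h1
        have hi : (⟨x, c⟩ : D.GlueHE) ∈ D.inner := hc
        rcases (hline _).1 h1 with h2 | h2
        · exact D.not_inner_iff.2 ⟨_, h2⟩ hi
        · exact D.not_inner_iff.2 ⟨_, h2⟩ hi
      exact hR (Or.inr ⟨hnot a ha, hnot b hb, D.line_of_piece h⟩)
  have hw : ∀ q' i', (⟨q', i'⟩ : D.Wire) ≠ ⟨q, i⟩ →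
      R (D.att (D.src q' i')) (D.att (D.tgt q' i')) := by
    intro q' i' hne
    refine hR (Or.inr ⟨fun h => ?_, fun h => ?_, D.line_wire q' i'⟩)
    · rcases (hline _).1 h with h | h
      · exact hne (D.src_injective (a₁ := ⟨q', i'⟩) (a₂ := ⟨q, i⟩) (D.att_injective h))
      · exact D.src_ne_tgt _ _ _ _ (D.att_injective h)
    · rcases (hline _).1 h with h | h
      · exact D.src_ne_tgt _ _ _ _ (D.att_injective h).symm
      · exact hne (D.tgt_injective (a₁ := ⟨q', i'⟩) (a₂ := ⟨q, i⟩) (D.att_injective h))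
  have hwi : ∀ i', i' ≠ i → R (D.att (D.src q i')) (D.att (D.tgt q i')) := by
    intro i' hne
    refine hw q i' fun h => hne ?_
    exact eq_of_heq (Sigma.mk.inj h).2
  refine eq_top_of_rel hp hγ.lineLE (hγ.connected_of_cut _ (firstEnd_not_isLeg q)) ?_ ?_ ?_
  · intro q' hq' i'
    refine hw q' i' fun h => hq' ?_
    obtain rfl : q' = q := congrArg Sigma.fst h
    exact γ.line.iseqv.refl _
  · intro a b hab ha h
    exact ha (γ.line.iseqv.trans h (γ.line.iseqv.symm hab))
  · intro q' j a
    by_cases hq : q' = q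
    · subst hq
      by_cases hji : j.succ.1 ≤ i.1
      · refine ⟨γ.firstEnd q', R.trans (rel_of_site hp (p' := D.att (D.src q' j.succ)) rfl)
          (rel_firstEnd hp i.1 (fun i' h' => hwi i' ?_) j.succ hji)⟩
        rintro rfl
        exact lt_irrefl _ h'
      · refine ⟨γ.secondEnd q', R.trans (rel_of_site hp (p' := D.att (D.src q' j.succ)) rfl)
          (rel_secondEnd hp i.1 (fun i' h' => hwi i' ?_) j.succ (not_le.1 hji))⟩
        rintro rfl
        exact lt_irrefl _ h'
    · refine ⟨γ.firstEnd q', R.trans (rel_of_site hp (p' := D.att (D.src q' j.succ)) rfl)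
          (rel_firstEnd hp _ (fun i' _ => hw q' i' ?_) j.succ (Nat.lt_succ_iff.1 j.succ.2))⟩
      exact fun h => hq (congrArg Sigma.fst h)

/-- A piece with an inner line is itself 1PI and stays connected when that line is cut; all other
pieces and all wires are unaffected. -/
theorem glue_connected_of_cut_inner (hγ : γ.IsOnePI) {p : D.GlueHE} (hi : p ∈ D.inner) :
    D.glue.vert ⊔ D.glue.lineOn {e | ¬ D.glue.line.r p e} = ⊤ := by
  set R := D.glue.vert ⊔ D.glue.lineOn {e | ¬ D.glue.line.r p e}
  have hR : D.glue.lineOn {e | ¬ D.glue.line.r p e} ≤ R := le_sup_right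
  obtain ⟨x, a⟩ := p
  have hp : ∀ y b c, R ⟨y, b⟩ ⟨y, c⟩ := by
    intro y
    by_cases hxy : y = x
    · subst hxy
      refine D.rel_piece le_sup_left y (fun b c h => ?_)
        ((D.piece_isOnePI hi).connected_of_cut a hi)
      rcases h with rfl | ⟨h1, h2, h3⟩
      · exact R.refl _
      · exact hR (Or.inr ⟨fun h => h1 ((D.line_mk_iff hi).1 h), fun h => h2 ((D.line_mk_iff hi).1 h),
          D.line_of_piece h3⟩)
    · refine D.rel_piece le_sup_left y (fun b c h => ?_) (D.piece_connected y)
      have hnot : ∀ c, ¬ D.glue.line.r ⟨x, a⟩ ⟨y, c⟩ := by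
        intro c h
        obtain ⟨b, h1, -⟩ := D.line_inner hi h
        exact hxy (congrArg Sigma.fst h1)
      exact hR (Or.inr ⟨hnot b, hnot c, D.line_of_piece h⟩)
  refine eq_top_of_rel_wires hp hγ.lineLE hγ.connected fun q i => ?_
  have hnot : ∀ r, ¬ D.glue.line.r ⟨x, a⟩ (D.att r) := by
    intro r h
    obtain ⟨b, h1, h2⟩ := D.line_inner hi h
    exact not_isLeg_of_line h2 hi (D.isLeg_of_att_eq h1)
  exact hR (Or.inr ⟨hnot _, hnot _, D.line_wire q i⟩)

theorem glue_three_le_valence (hv : ∀ v, 3 ≤ γ.valence v) (w : D.glue.Vertex) :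
    3 ≤ D.glue.valence w := by
  induction w using Quotient.inductionOn with | _ p
  obtain ⟨x, a⟩ := p
  refine (D.piece_three_le_valence hv x (Quotient.mk _ a)).trans ?_
  refine Nat.card_le_card_of_injective (α := (D.piece x).graph.Prong (Quotient.mk _ a))
    (fun b => (⟨⟨x, b.1⟩, Quotient.sound (D.glue_vert_mk.2 (Quotient.exact b.2))⟩ :
      D.glue.Prong (Quotient.mk _ ⟨x, a⟩))) ?_
  intro b c h
  exact Subtype.ext (eq_of_heq (Sigma.mk.inj (congrArg Subtype.val h)).2)

/-- External legs of the glued graph. -/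
def glueLegEquiv (hL : γ.LineLE) : γ.Leg ≃ D.glue.Leg :=
  Equiv.ofBijective (fun d => ⟨D.att (D.pr d.1), D.att_leg_isLeg d.2⟩) <| by
    constructor
    · intro d e h
      exact Subtype.ext (D.pr_injective (D.att_injective (congrArg Subtype.val h)))
    · rintro ⟨p, hp⟩
      obtain ⟨d, hd, rfl⟩ := (glue_isLeg_iff hL).1 hp
      exact ⟨⟨d, hd⟩, rfl⟩

theorem glue_numLegs (hL : γ.LineLE) : D.glue.numLegs = γ.numLegs :=
  (Nat.card_congr (D.glueLegEquiv hL)).symm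

theorem glue_isOnePI (hγ : γ.IsOnePI) : D.glue.IsOnePI where
  line_le_two := glue_lineLE hγ.lineLE
  three_le_valence := D.glue_three_le_valence hγ.three_le_valence
  connected := D.glue_connected hγ.lineLE hγ.connected
  not_tree := by
    obtain ⟨d, hd⟩ := hγ.exists_internal
    exact (glue_lineLE hγ.lineLE).loops_pos_of_cut (D.src_not_isLeg (toIntLine d hd) 0)
      (D.glue_connected_of_cut_wire hγ _ 0 fun e => D.line_att_src)
  connected_of_cut p hp := by
    by_cases hi : p ∈ D.inner
    · exact D.glue_connected_of_cut_inner hγ hi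
    · obtain ⟨r, rfl⟩ := D.not_inner_iff.1 hi
      rcases prong_cases hγ.lineLE r with ⟨d, hd, rfl⟩ | ⟨q, i, rfl⟩ | ⟨q, i, rfl⟩
      · exact absurd (D.att_leg_isLeg hd) hp
      · exact D.glue_connected_of_cut_wire hγ q i fun e => D.line_att_src
      · exact D.glue_connected_of_cut_wire hγ q i fun e => D.line_att_tgt.trans or_comm
  has_leg := D.glue_numLegs hγ.lineLE ▸ hγ.has_leg

/-! ### Loop numbers -/

def glueVertexEquiv : D.glue.Vertex ≃ Σ x : D.Site, (D.piece x).graph.Vertex where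
  toFun := Quotient.lift (fun p : D.GlueHE => (⟨p.1, Quotient.mk _ p.2⟩ :
      Σ x : D.Site, (D.piece x).graph.Vertex)) <| by
    intro p p' h
    have h' := D.glue_vert_iff.1 h
    cases h' with
    | inner x a b hab => exact congrArg (Sigma.mk x) ((quot_eq (D.piece x).graph.vert).2 hab)
  invFun w := Quotient.lift (fun a => Quotient.mk D.glue.vert ⟨w.1, a⟩)
    (fun a b h => Quotient.sound (D.glue_vert_mk.2 h)) w.2
  left_inv w := by
    induction w using Quotient.inductionOn
    rfl
  right_inv := by
    rintro ⟨x, w⟩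
    induction w using Quotient.inductionOn
    rfl

/-- Half-edges of the result are counted in two ways: piece by piece, as twice the inner lines plus
the prongs, and globally, as twice the internal lines plus the external legs. Vertices add up over
the pieces, and `I + 1 = L + V` holds for each piece, the corolla included. -/
theorem glue_loops (hL : γ.LineLE) (hloops : γ.numVerts ≤ γ.numInt + 1) [Fintype D.Site] :
    D.glue.loops = γ.loops + ∑ x, (D.piece x).graph.loops := by
  classical
  have := Fintype.ofFinite γ.Vertex
  have := Fintype.ofFinite γ.IntLine
  have hV : D.glue.numVerts = ∑ x, (D.piece x).graph.numVerts := by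
    rw [numVerts, Nat.card_congr D.glueVertexEquiv, Nat.card_sigma]
    rfl
  have hH : Nat.card D.glue.HE = ∑ x, Nat.card (D.piece x).graph.HE := Nat.card_sigma
  have hx : ∀ x, Nat.card (D.piece x).graph.HE =
      2 * (D.piece x).graph.numInt + Nat.card (D.SiteProng x) := fun x => by
    rw [(D.piece_lineLE x).card_HE, D.piece_numLegs]
  -- The prongs at vertices are all half-edges of `γ`; each graph on a line contributes two more.
  have hP : ∑ x, Nat.card (D.SiteProng x) =
      Nat.card γ.HE + 2 * Fintype.card (Σ q : γ.IntLine, Fin (D.chain q).length) := by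
    have : ∀ i : Fintype D.Site, (Finset.univ (α := D.Site)).sum (fun x => Nat.card (D.SiteProng x)) =
        (@Finset.univ D.Site (instFintypeSum _ _)).sum (fun x => Nat.card (D.SiteProng x)) := by
      intro i
      congr!
    rw [this, Fintype.sum_sum_type, card_HE_eq_sum_valence]
    congr 1
    have : ∀ y, Nat.card (D.SiteProng (Sum.inr y)) = 2 := fun y => (Nat.card_eq_fintype_card (α := Bool)).trans Fintype.card_bool
    simp [this, mul_comm]
  have hS : Fintype.card D.Site =
      γ.numVerts + Fintype.card (Σ q : γ.IntLine, Fin (D.chain q).length) := by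
    rw [← Nat.card_eq_fintype_card, Nat.card_sum, Nat.card_eq_fintype_card (α := Sigma _)]
    rfl
  have hl : ∑ x, ((D.piece x).graph.numInt + 1) =
      ∑ x, ((D.piece x).graph.loops + (D.piece x).graph.numVerts) :=
    Finset.sum_congr rfl fun x _ => D.piece_loops x
  rw [Finset.sum_add_distrib, Finset.sum_add_distrib, Finset.sum_const, smul_eq_mul, mul_one,
    Finset.card_univ, hS, ← hV] at hl
  have hI := (glue_lineLE (D := D) hL).card_HE
  rw [hH, Finset.sum_congr rfl fun x _ => hx x, Finset.sum_add_distrib, hP, hL.card_HE,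
    ← Finset.mul_sum, D.glue_numLegs hL] at hI
  unfold loops at hl ⊢
  omega

end PreGraph.Insertion

namespace PreGraph.Insertion

variable {γ : PreGraph} {D : γ.Insertion}

/-! ### The inserted graphs as a subgraph of the result -/

section EdgeSet

variable {Γ : PreGraph} (φ : Iso D.glue Γ)

/-- The half-edges of the inserted graphs, in a graph that is identified with the result. -/
def edgeSet : Set Γ.HE := {g | φ.symm.toEquiv g ∈ D.inner}

theorem exists_rep (g : Γ.HE) : ∃ p : D.GlueHE, φ.toEquiv p = g := φ.toEquiv.surjective g

theorem symm_apply_rep (p : D.GlueHE) : φ.symm.toEquiv (φ.toEquiv p) = p := φ.symm_apply_apply p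

theorem mem_edgeSet {p : D.GlueHE} : φ.toEquiv p ∈ edgeSet φ ↔ p ∈ D.inner := by
  change φ.symm.toEquiv (φ.toEquiv p) ∈ D.inner ↔ _
  rw [symm_apply_rep]
  exact Iff.rfl

theorem isLineSet_edgeSet : Γ.IsLineSet (edgeSet φ) := by
  constructor
  · intro g hg
    obtain ⟨p, rfl⟩ := exists_rep φ g
    exact (φ.isLeg_iff p).not.2 (D.inner_not_isLeg ((mem_edgeSet φ).1 hg))
  · intro g g' h hg
    obtain ⟨p, rfl⟩ := exists_rep φ g
    obtain ⟨p', rfl⟩ := exists_rep φ g'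
    rw [mem_edgeSet] at hg ⊢
    obtain ⟨b, rfl, hb⟩ := D.line_inner (x := p.1) (a := p.2) hg ((φ.line_iff _ _).2 h)
    exact not_isLeg_of_line hb hg

/-- Neither vertices nor inner lines lead out of a site, and a piece is connected by its own lines.
So the components are the sites, a vertex without insertion being a component of its own. -/
theorem compRel_edgeSet {p p' : D.GlueHE} :
    (Γ.compRel (edgeSet φ)).r (φ.toEquiv p) (φ.toEquiv p') ↔ p.1 = p'.1 := by
  constructor
  · intro h
    have : Γ.compRel (edgeSet φ) ≤ Setoid.ker fun g => (φ.symm.toEquiv g).1 := by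
      refine sup_le ?_ ?_
      · intro g g' h
        obtain ⟨p, rfl⟩ := exists_rep φ g
        obtain ⟨p', rfl⟩ := exists_rep φ g'
        rw [Setoid.ker_def, symm_apply_rep, symm_apply_rep]
        exact D.glue_vert_site ((φ.vert_iff _ _).2 h)
      · rintro g g' (rfl | ⟨h1, -, h⟩)
        · exact Setoid.refl' _ _
        obtain ⟨p, rfl⟩ := exists_rep φ g
        obtain ⟨p', rfl⟩ := exists_rep φ g'
        rw [mem_edgeSet] at h1
        obtain ⟨b, rfl, -⟩ := D.line_inner (x := p.1) (a := p.2) h1 ((φ.line_iff _ _).2 h)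
        rw [Setoid.ker_def, symm_apply_rep, symm_apply_rep]
    have h1 := this h
    rwa [Setoid.ker_def, symm_apply_rep, symm_apply_rep] at h1
  · intro h
    have key : ∀ x a b, ((Γ.compRel (edgeSet φ)).comap φ.toEquiv) ⟨x, a⟩ ⟨x, b⟩ := by
      refine fun x => D.rel_piece (fun {p p'} h => vert_le_compRel _ ((φ.vert_iff _ _).1 h)) x
        (fun a b h => ?_) (D.piece_connected x)
      by_cases ha : (D.piece x).graph.IsLeg a
      · rw [ha b h]
        exact Setoid.refl' _ _
      · exact lineOn_le_compRel _ (Or.inr ⟨(mem_edgeSet φ).2 ha,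
          (mem_edgeSet φ).2 (not_isLeg_of_line h ha), (φ.line_iff _ _).1 (D.line_of_piece h)⟩)
    exact rel_of_site key h

theorem mk_edgeSet_eq {p p' : D.GlueHE} :
    Quotient.mk (Γ.compRel (edgeSet φ)) (φ.toEquiv p) = Quotient.mk _ (φ.toEquiv p') ↔
      p.1 = p'.1 := (quot_eq _).trans (compRel_edgeSet φ)

/-- The components of the subgraph are the inserted graphs. -/
def compIso (x : D.Site) (a : (D.piece x).graph.HE) :
    Iso (D.piece x).graph (Γ.comp (edgeSet φ) (Quotient.mk _ (φ.toEquiv ⟨x, a⟩))) where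
  toEquiv := Equiv.ofBijective
    (fun b => (⟨φ.toEquiv ⟨x, b⟩, (mk_edgeSet_eq φ).2 rfl⟩ :
      {d : Γ.HE // Quotient.mk (Γ.compRel (edgeSet φ)) d = Quotient.mk _ (φ.toEquiv ⟨x, a⟩)})) <| by
    constructor
    · intro b c h
      exact eq_of_heq (Sigma.mk.inj (φ.toEquiv.injective (congrArg Subtype.val h))).2
    · rintro ⟨g, hg⟩
      obtain ⟨⟨y, b⟩, rfl⟩ := exists_rep φ g
      obtain rfl : y = x := (mk_edgeSet_eq φ).1 hg
      exact ⟨b, rfl⟩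
  vert_iff b c := D.glue_vert_mk.symm.trans (φ.vert_iff _ _)
  line_iff b c := by
    constructor
    · intro h
      by_cases hb : (D.piece x).graph.IsLeg b
      · exact hb c h ▸ Or.inl rfl
      · exact Or.inr ⟨(mem_edgeSet φ).2 hb, (mem_edgeSet φ).2 (not_isLeg_of_line h hb),
          (φ.line_iff _ _).1 (D.line_of_piece h)⟩
    · rintro (h | ⟨h1, -, h2⟩)
      · have := eq_of_heq (Sigma.mk.inj (φ.toEquiv.injective h)).2
        exact this ▸ (D.piece x).graph.line.iseqv.refl _
      · exact (D.line_mk_iff ((mem_edgeSet φ).1 h1)).1 ((φ.line_iff _ _).2 h2)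

theorem comp_edgeSet_numLegs (p : D.GlueHE) :
    (Γ.comp (edgeSet φ) (Quotient.mk _ (φ.toEquiv p))).numLegs = Nat.card (D.SiteProng p.1) := by
  rw [← (compIso φ p.1 p.2).numLegs_eq, D.piece_numLegs]

theorem isSubgraph_edgeSet : Γ.IsSubgraph (edgeSet φ) := by
  refine ⟨(isLineSet_edgeSet φ).1, (isLineSet_edgeSet φ).2, ?_⟩
  rintro ⟨_, g, hg, rfl⟩
  obtain ⟨⟨x, a⟩, rfl⟩ := exists_rep φ g
  exact (compIso φ x a).isOnePI (D.piece_isOnePI ((mem_edgeSet φ).1 hg))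

theorem edgeSet_ne_internal (h : ∃ d, ¬ γ.IsLeg d) : edgeSet φ ≠ Γ.internal := by
  obtain ⟨d, hd⟩ := h
  intro h
  have h1 : φ.toEquiv (D.att (D.src (toIntLine d hd) 0)) ∈ Γ.internal :=
    (φ.isLeg_iff _).not.2 (D.src_not_isLeg _ _)
  rw [← h, mem_edgeSet] at h1
  exact D.not_inner_iff.2 ⟨_, rfl⟩ h1

theorem numComps_edgeSet : Γ.numComps (edgeSet φ) = Nat.card D.Site := by
  refine (Nat.card_congr (Equiv.ofBijective (fun x : D.Site =>
    Quotient.mk (Γ.compRel (edgeSet φ)) (φ.toEquiv (D.att ⟨x, Classical.arbitrary _⟩))) ?_)).symm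
  constructor
  · intro x y h
    exact (mk_edgeSet_eq φ).1 h
  · intro c
    induction c using Quotient.inductionOn with | _ g
    obtain ⟨⟨x, a⟩, rfl⟩ := exists_rep φ g
    exact ⟨x, (mk_edgeSet_eq φ).2 rfl⟩

theorem ncard_edgeSet [Fintype D.Site] :
    (edgeSet φ).ncard = ∑ x, 2 * (D.piece x).graph.numInt := by
  have h1 : (edgeSet φ).ncard = D.inner.ncard := by
    refine Eq.trans ?_ (Set.ncard_image_of_injective D.inner φ.toEquiv.injective)
    congr 1
    ext g
    obtain ⟨p, rfl⟩ := exists_rep φ g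
    rw [mem_edgeSet]
    exact (φ.toEquiv.injective.mem_set_image).symm
  have h2 : D.inner.ncard = Nat.card (Σ x : D.Site, {a // ¬ (D.piece x).graph.IsLeg a}) :=
    Nat.card_congr ⟨fun p => ⟨p.1.1, p.1.2, p.2⟩, fun p => ⟨⟨p.1, p.2.1⟩, p.2.2⟩,
      fun _ => rfl, fun _ => rfl⟩
  rw [h1, h2, Nat.card_sigma]
  exact Finset.sum_congr rfl fun x _ => (D.piece_lineLE x).card_internal

/-- The number of loops of the inserted graphs in terms of the subgraph. -/
theorem edgeSet_loops [Fintype D.Site] : (edgeSet φ).ncard + 2 * Γ.numComps (edgeSet φ) =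
    2 * ∑ x, (D.piece x).graph.loops + 2 * Γ.numVerts := by
  have hV : Γ.numVerts = ∑ x, (D.piece x).graph.numVerts := by
    rw [← φ.numVerts_eq, numVerts, Nat.card_congr D.glueVertexEquiv, Nat.card_sigma]
    rfl
  have hl : ∑ x, ((D.piece x).graph.numInt + 1) =
      ∑ x, ((D.piece x).graph.loops + (D.piece x).graph.numVerts) :=
    Finset.sum_congr rfl fun x _ => D.piece_loops x
  rw [Finset.sum_add_distrib, Finset.sum_add_distrib, Finset.sum_const, smul_eq_mul, mul_one,
    Finset.card_univ] at hl
  rw [ncard_edgeSet, numComps_edgeSet, Nat.card_eq_fintype_card, ← Finset.mul_sum, hV]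
  omega

variable (D) in
/-- The line on which a prong lies. -/
def lineOf : (Σ x : D.Site, D.SiteProng x) → Quotient γ.line
  | ⟨Sum.inl _, p⟩ => Quotient.mk γ.line p.1
  | ⟨Sum.inr y, _⟩ => y.1.1

theorem lineOf_src (q : γ.IntLine) (i : Fin ((D.chain q).length + 1)) :
    D.lineOf (D.src q i) = q.1 := by
  induction i using Fin.cases with
  | zero => exact firstEnd_mk q
  | succ j => rfl

theorem lineOf_tgt (q : γ.IntLine) (i : Fin ((D.chain q).length + 1)) :
    D.lineOf (D.tgt q i) = q.1 := by
  induction i using Fin.lastCases with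
  | last => rw [tgt_last]; exact secondEnd_mk q
  | cast j => rw [tgt_castSucc]; rfl

open Classical in
variable (D) in
/-- The line of `γ` on which an outer half-edge lies. -/
def outerLine (p : D.GlueHE) : Option (Quotient γ.line) :=
  if h : ∃ r, p = D.att r then some (D.lineOf h.choose) else none

theorem outerLine_att (r : Σ x : D.Site, D.SiteProng x) :
    D.outerLine (D.att r) = some (D.lineOf r) := by
  have h : ∃ r', D.att r = D.att r' := ⟨r, rfl⟩
  rw [outerLine, dif_pos h, ← D.att_injective h.choose_spec]

theorem outerLine_inner {p : D.GlueHE} (h : p ∈ D.inner) : D.outerLine p = none :=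
  dif_neg fun h' => D.not_inner_iff.2 h' h

theorem outerLine_line {p p' : D.GlueHE} (h : D.glue.line.r p p') :
    D.outerLine p = D.outerLine p' := by
  rcases D.glue_line_iff.1 h with ⟨x, a, b, rfl, rfl, h1⟩ | ⟨q, i, rfl, rfl⟩ | ⟨q, i, rfl, rfl⟩
  · by_cases ha : (D.piece x).graph.IsLeg a
    · rw [ha b h1]
    · rw [outerLine_inner (p := ⟨x, a⟩) ha,
        outerLine_inner (p := ⟨x, b⟩) (not_isLeg_of_line h1 ha)]
  · rw [outerLine_att, outerLine_att, lineOf_src, lineOf_tgt]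
  · rw [outerLine_att, outerLine_att, lineOf_src, lineOf_tgt]

theorem through_edgeSet {y : Σ q : γ.IntLine, Fin (D.chain q).length} (b b' : Bool) :
    (Γ.through (edgeSet φ)).r (φ.toEquiv (D.att ⟨Sum.inr y, b⟩))
      (φ.toEquiv (D.att ⟨Sum.inr y, b'⟩)) := by
  refine Or.inr ⟨?_, ?_, (compRel_edgeSet φ).2 rfl, ?_⟩
  · rw [mem_edgeSet]; exact D.not_inner_iff.2 ⟨_, rfl⟩
  · rw [mem_edgeSet]; exact D.not_inner_iff.2 ⟨_, rfl⟩
  · rw [comp_edgeSet_numLegs]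
    exact (Nat.card_eq_fintype_card (α := Bool)).trans Fintype.card_bool

variable (hv : ∀ v, 3 ≤ γ.valence v)
include hv

/-- Contraction of the graphs on a line fuses its wires into one line. Conversely, the line of `γ`
to which an outer half-edge belongs is an invariant: it is constant along wires and across a
component with two legs. Such a component is a graph on a line, because vertices of `γ` have valence
at least three. -/
theorem contract_line_iff (hL : γ.LineLE) (d d' : γ.HE) : γ.line.r d d' ↔
    (Γ.line ⊔ Γ.through (edgeSet φ)).r (φ.toEquiv (D.att (D.pr d)))
      (φ.toEquiv (D.att (D.pr d'))) := by
  set R := Γ.line ⊔ Γ.through (edgeSet φ) with hR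
  constructor
  · intro h
    by_cases hd : d = d'
    · subst hd; exact R.iseqv.refl _
    have hleg : ¬ γ.IsLeg d := not_isLeg_iff.2 ⟨d', h, Ne.symm hd⟩
    set q := toIntLine d hleg
    have hw : ∀ i, R (φ.toEquiv (D.att (D.src q i))) (φ.toEquiv (D.att (D.tgt q i))) := fun i =>
      (le_sup_left : Γ.line ≤ R) ((φ.line_iff _ _).1 (D.line_wire q i))
    have key : ∀ i, R (φ.toEquiv (D.att (D.src q i)))
        (φ.toEquiv (D.att (D.pr (γ.firstEnd q)))) := by
      intro i
      induction i using Fin.induction with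
      | zero => exact Setoid.refl' _ _
      | succ j ih =>
        refine R.trans ?_ ih
        refine R.trans ?_ (R.symm (hw _))
        rw [src_succ, tgt_castSucc]
        exact (le_sup_right : Γ.through _ ≤ R) (through_edgeSet φ _ _)
    have hfs : R (φ.toEquiv (D.att (D.pr (γ.firstEnd q))))
        (φ.toEquiv (D.att (D.pr (γ.secondEnd q)))) :=
      R.trans (R.symm (key (Fin.last _))) (tgt_last D q ▸ hw (Fin.last _))
    rcases hL.eq_firstEnd_or (d := d) (q := q) rfl with h1 | h1 <;>
      rcases hL.eq_firstEnd_or (d := d') (q := q) (Quotient.sound h).symm with h2 | h2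
    · exact absurd (h1.trans h2.symm) hd
    · rw [h1, h2]; exact hfs
    · rw [h1, h2]; exact R.symm hfs
    · exact absurd (h1.trans h2.symm) hd
  · intro h
    have : R ≤ Setoid.ker fun g => D.outerLine (φ.symm.toEquiv g) := by
      refine sup_le ?_ ?_
      · intro g g' h
        obtain ⟨p, rfl⟩ := exists_rep φ g
        obtain ⟨p', rfl⟩ := exists_rep φ g'
        rw [Setoid.ker_def, symm_apply_rep, symm_apply_rep]
        exact outerLine_line ((φ.line_iff _ _).2 h)
      · rintro g g' (rfl | ⟨h1, h2, h3, h4⟩)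
        · exact Setoid.refl' _ _
        obtain ⟨p, rfl⟩ := exists_rep φ g
        obtain ⟨p', rfl⟩ := exists_rep φ g'
        rw [mem_edgeSet] at h1 h2
        obtain ⟨⟨x, r⟩, rfl⟩ := D.not_inner_iff.1 h1
        obtain ⟨⟨x', r'⟩, rfl⟩ := D.not_inner_iff.1 h2
        obtain rfl : x = x' := (compRel_edgeSet φ).1 h3
        rw [comp_edgeSet_numLegs] at h4
        have h5 : ∀ r r' : D.SiteProng x, D.lineOf ⟨x, r⟩ = D.lineOf ⟨x, r'⟩ := by
          rcases x with v | y
          · have := hv v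
            have h6 : γ.valence v = 2 := h4
            omega
          · exact fun _ _ => rfl
        rw [Setoid.ker_def, symm_apply_rep, symm_apply_rep, outerLine_att, outerLine_att, h5 r r']
    have h1 := this h
    rw [Setoid.ker_def, symm_apply_rep, symm_apply_rep, outerLine_att, outerLine_att] at h1
    exact Quotient.exact (Option.some.inj h1)

/-- Contraction of the inserted graphs gives back the graph. -/
def contractIso (hL : γ.LineLE) : Iso γ (Γ.contract (edgeSet φ)) where
  toEquiv := Equiv.ofBijective
    (fun d => (⟨φ.toEquiv (D.att (D.pr d)), by
      constructor
      · rw [mem_edgeSet]; exact D.not_inner_iff.2 ⟨_, rfl⟩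
      · rw [comp_edgeSet_numLegs]
        have h1 : Nat.card (D.SiteProng (D.att (D.pr d)).1) = γ.valence (Quotient.mk _ d) := rfl
        have := hv (Quotient.mk _ d)
        omega⟩ : {d : Γ.HE // d ∉ edgeSet φ ∧
          (Γ.comp (edgeSet φ) (Quotient.mk (Γ.compRel (edgeSet φ)) d)).numLegs ≠ 2})) <| by
    constructor
    · intro d e h
      exact D.pr_injective (D.att_injective (φ.toEquiv.injective (congrArg Subtype.val h)))
    · rintro ⟨g, hg, hg'⟩
      obtain ⟨p, rfl⟩ := exists_rep φ g
      rw [mem_edgeSet] at hg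
      obtain ⟨⟨x, r⟩, rfl⟩ := D.not_inner_iff.1 hg
      rw [comp_edgeSet_numLegs] at hg'
      rcases x with v | y
      · exact ⟨r.1, Subtype.ext (congrArg (fun r => φ.toEquiv (D.att r)) (D.inl_prong v r).symm)⟩
      · exact absurd ((Nat.card_eq_fintype_card (α := Bool)).trans Fintype.card_bool) hg'
  vert_iff d e := by
    refine Iff.trans ?_ (compRel_edgeSet φ).symm
    constructor
    · exact fun h => congrArg Sum.inl (Quotient.sound h)
    · exact fun h => Quotient.exact (Sum.inl_injective h)
  line_iff d e := contract_line_iff φ hv hL d e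

end EdgeSet

/-! ### If the result is 1PI, so is the graph -/

section Converse

variable (D) in
/-- A function on the glued graph from a relation on half-edges of `γ`; a graph on a line is
assigned to one end of this line. -/
def siteFun (R : Setoid γ.HE) (hR : γ.vert ≤ R) (e : γ.IntLine → γ.HE) : D.Site → Quotient R
  | Sum.inl v => Quotient.map' id (fun _ _ h => hR h) v
  | Sum.inr y => Quotient.mk R (e y.1)

theorem siteFun_src {R : Setoid γ.HE} {hR : γ.vert ≤ R} {e : γ.IntLine → γ.HE} (q : γ.IntLine)
    {i : Fin ((D.chain q).length + 1)} (hi : i ≠ 0) :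
    D.siteFun R hR e (D.src q i).1 = Quotient.mk R (e q) := by
  induction i using Fin.cases with
  | zero => exact absurd rfl hi
  | succ j => rfl

theorem siteFun_tgt {R : Setoid γ.HE} {hR : γ.vert ≤ R} {e : γ.IntLine → γ.HE} (q : γ.IntLine)
    (he : R (e q) (γ.secondEnd q)) (i : Fin ((D.chain q).length + 1)) :
    D.siteFun R hR e (D.tgt q i).1 = Quotient.mk R (e q) := by
  induction i using Fin.lastCases with
  | last => rw [tgt_last]; exact (Quotient.sound he).symm
  | cast j => rw [tgt_castSucc]; rfl

/-- Suppose the first wire of a line of `γ` is cut in the result. Collapse each site to its class in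
`γ` without that line, where graphs on a line go to the second end of the line. Every remaining wire
stays within one class, so connectedness of the cut result passes to the cut `γ`. The use is for
cographs, which are known to be 1PI only after a 1PI graph has been recognised as an insertion into
them. -/
theorem isOnePI_of_glue (hL : γ.LineLE) (hv : ∀ v, 3 ≤ γ.valence v) (hne : ∃ d, ¬ γ.IsLeg d)
    (hg : D.glue.IsOnePI) : γ.IsOnePI := by
  have hcut : ∀ d, ¬ γ.IsLeg d → γ.vert ⊔ γ.lineOn {e | ¬ γ.line.r d e} = ⊤ := by
    intro d hd
    set R := γ.vert ⊔ γ.lineOn {e | ¬ γ.line.r d e} with hR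
    set q0 := toIntLine d hd
    have hfs : ∀ q, q ≠ q0 → R (γ.firstEnd q) (γ.secondEnd q) := by
      intro q hq
      refine (le_sup_right : γ.lineOn _ ≤ R) (Or.inr ⟨fun h => hq ?_, fun h => hq ?_,
        line_partner _⟩)
      · exact Subtype.ext ((firstEnd_mk q).symm.trans (Quotient.sound h).symm)
      · exact Subtype.ext ((secondEnd_mk q).symm.trans (Quotient.sound h).symm)
    set f : D.Site → Quotient R := D.siteFun R le_sup_left γ.secondEnd
    have hc := sup_eq_top_const (hg.connected_of_cut _ (D.src_not_isLeg q0 0))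
      (fun p : D.GlueHE => f p.1) (fun p p' h => congrArg f (D.glue_vert_site h)) (by
        have hw : ∀ q i, (⟨q, i⟩ : D.Wire) ≠ ⟨q0, 0⟩ →
            f (D.att (D.src q i)).1 = f (D.att (D.tgt q i)).1 := by
          intro q i hqi
          refine Eq.trans ?_ (siteFun_tgt q (R.refl _) i).symm
          by_cases hi : i = 0
          · subst hi
            have : q ≠ q0 := by
              rintro rfl
              exact hqi rfl
            exact Quotient.sound (hfs q this)
          · exact siteFun_src q hi
        rintro p p' (rfl | ⟨h1, h2, h3⟩)
        · rfl
        rcases D.glue_line_iff.1 h3 with ⟨x, a, b, rfl, rfl, h4⟩ | ⟨q, i, rfl, rfl⟩ | ⟨q, i, rfl, rfl⟩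
        · rfl
        · refine hw q i fun h => h1 ?_
          cases h
          exact D.glue.line.iseqv.refl _
        · refine (hw q i fun h => h2 ?_).symm
          cases h
          exact D.glue.line.iseqv.refl _)
    refine eq_top_iff.2 fun {a b} _ => ?_
    exact Quotient.exact (hc (D.att (D.pr a)) (D.att (D.pr b)))
  obtain ⟨d, hd⟩ := hne
  refine ⟨hL, hv, ?_, hL.loops_pos_of_cut hd (hcut d hd), hcut, ?_⟩
  · refine eq_top_iff.2 (hcut d hd ▸ sup_le_sup_left ?_ _)
    rintro a b (rfl | ⟨-, -, h⟩)
    · exact γ.line.refl _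
    · exact h
  · exact D.glue_numLegs hL ▸ hg.has_leg

end Converse

end PreGraph.Insertion

theorem LGraph.mk_rep_iso {P : Type} (G : Legged P) (h : G.graph.IsOnePI) :
    Nonempty (Legged.Iso (LGraph.rep (Quotient.mk (leggedSetoid P) ⟨G, h⟩)) G) :=
  Quotient.exact (Quotient.out_eq (Quotient.mk (leggedSetoid P) ⟨G, h⟩))

/-! ### Contraction of a proper subgraph -/

namespace PreGraph

variable {Γ : PreGraph} {S : Set Γ.HE}

/-! ### Components with two external legs -/

/-- The component through `d` has two external legs. -/
def IsTwo (Γ : PreGraph) (S : Set Γ.HE) (d : Γ.HE) : Prop :=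
  (Γ.comp S (Quotient.mk (Γ.compRel S) d)).numLegs = 2

theorem isTwo_congr {d e : Γ.HE} (h : (Γ.compRel S).r d e) : Γ.IsTwo S d ↔ Γ.IsTwo S e := by
  have : Quotient.mk (Γ.compRel S) d = Quotient.mk (Γ.compRel S) e := Quotient.sound h
  rw [IsTwo, IsTwo, this]

theorem IsLineSet.partner_mem_iff (hS : Γ.IsLineSet S) (hL : Γ.LineLE) {d : Γ.HE} :
    Γ.partner d ∈ S ↔ d ∈ S :=
  ⟨fun h => hS.line_closed _ _ (Γ.line.iseqv.symm (line_partner d)) h,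
    fun h => hS.line_closed _ _ (line_partner d) h⟩

/-- The other outer half-edge of a component with two external legs. -/
def tau (Γ : PreGraph) (S : Set Γ.HE) (d : Γ.HE) : Γ.HE := by
  classical exact if h : ∃ e, e ≠ d ∧ (Γ.through S).r d e then h.choose else d

theorem through_tau (d : Γ.HE) : (Γ.through S).r d (Γ.tau S d) := by
  unfold tau
  split_ifs with h
  · exact h.choose_spec.2
  · exact (Γ.through S).iseqv.refl d

theorem IsLineSet.exists_other (hS : Γ.IsLineSet S) {d : Γ.HE} (hd : d ∉ S) (h2 : Γ.IsTwo S d) :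
    ∃ e, e ∉ S ∧ e ≠ d ∧ (Γ.compRel S).r d e ∧ ∀ f, f ∉ S → (Γ.compRel S).r d f → f = d ∨ f = e := by
  have hleg := comp_isLeg_iff hS (Quotient.mk (Γ.compRel S) d)
  obtain ⟨⟨⟨e, he⟩, he'⟩, hne, huniq⟩ :=
    (Nat.card_eq_two_iff' (⟨⟨d, rfl⟩, (hleg _).2 hd⟩ :
      (Γ.comp S (Quotient.mk (Γ.compRel S) d)).Leg)).1 h2
  refine ⟨e, (hleg _).1 he', fun h => hne (Subtype.ext (Subtype.ext h)),
    Quotient.exact he.symm, fun f hf hdf => ?_⟩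
  by_cases hfd : f = d
  · exact Or.inl hfd
  · right
    have := huniq ⟨⟨f, (Quotient.sound hdf).symm⟩, (hleg _).2 hf⟩
      (fun h => hfd (congrArg (fun x => x.1.1) h))
    exact congrArg (fun x => x.1.1) this

theorem IsLineSet.tau_ne_iff (hS : Γ.IsLineSet S) {d : Γ.HE} :
    Γ.tau S d ≠ d ↔ d ∉ S ∧ Γ.IsTwo S d := by
  constructor
  · intro h
    rcases through_tau (S := S) d with h1 | ⟨h1, -, -, h2⟩
    · exact absurd h1.symm h
    · exact ⟨h1, h2⟩
  · rintro ⟨hd, h2⟩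
    obtain ⟨e, he, hne, hde, -⟩ := hS.exists_other hd h2
    have h : ∃ e, e ≠ d ∧ (Γ.through S).r d e := ⟨e, hne, Or.inr ⟨hd, he, hde, h2⟩⟩
    unfold tau
    rw [dif_pos h]
    exact h.choose_spec.1

theorem IsLineSet.through_iff (hS : Γ.IsLineSet S) {d e : Γ.HE} :
    (Γ.through S).r d e ↔ e = d ∨ e = Γ.tau S d := by
  constructor
  · rintro (h | ⟨h1, h2, h3, h4⟩)
    · exact Or.inl h.symm
    · obtain ⟨f, -, -, -, huniq⟩ := hS.exists_other h1 h4
      have ht := hS.tau_ne_iff.2 ⟨h1, h4⟩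
      rcases through_tau (S := S) d with h | ⟨-, h5, h6, -⟩
      · exact absurd h.symm ht
      · rcases huniq _ h5 h6 with h7 | h7
        · exact absurd h7 ht
        · rw [h7]
          exact huniq _ h2 h3
  · rintro (rfl | rfl)
    · exact (Γ.through S).iseqv.refl _
    · exact through_tau d

theorem IsLineSet.tau_tau (hS : Γ.IsLineSet S) (d : Γ.HE) : Γ.tau S (Γ.tau S d) = d := by
  by_cases h : Γ.tau S d = d
  · rw [h, h]
  · rcases hS.through_iff.1 ((Γ.through S).iseqv.symm (through_tau d)) with h1 | h1
    · exact absurd h1.symm h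
    · exact h1.symm

theorem compRel_tau (d : Γ.HE) : (Γ.compRel S).r d (Γ.tau S d) := by
  rcases through_tau (S := S) d with h | ⟨-, -, h, -⟩
  · rw [← h]
  · exact h

theorem tau_notMem {d : Γ.HE} (hd : d ∉ S) : Γ.tau S d ∉ S := by
  rcases through_tau (S := S) d with h | ⟨-, h, -⟩
  · rwa [← h]
  · exact h

section Contract

variable (h : Γ.IsOnePI) (hS : Γ.IsSubgraph S) (hne : S ≠ Γ.internal)
include h hS hne

/-- A proper subgraph has no component whose outer half-edges are at most one external leg of the
graph and one half-edge more. -/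
theorem not_outer_pair {d e : Γ.HE} (hd : d ∉ S) (hde : (Γ.compRel S).r d e)
    (he : e ∉ S) (hP : ∀ x, x ∉ S → (Γ.compRel S).r d x → x = d ∨ x = e)
    (hleg : Γ.IsLeg d ∨ d = e) : False := by
  have hin : ∀ x y, x ∈ S → Γ.line.r x y → (Γ.compRel S).r d x → (Γ.compRel S).r d y :=
    fun x y hx hxy hdx => (Γ.compRel S).iseqv.trans hdx
      (lineOn_le_compRel S (Or.inr ⟨hx, hS.line_closed _ _ hxy hx, hxy⟩))
  -- If both outer half-edges are external legs of the graph, no line leads out of the component, so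
  -- it is everything and `S` is not proper. Otherwise `e` would lie on a bridge: the graph stays
  -- connected without this line, so the component reaches the other end of `e`, which would be a
  -- further outer half-edge.
  by_cases hel : Γ.IsLeg e
  · have hd' : Γ.IsLeg d := hleg.elim id fun h => h ▸ hel
    have hall := vert_bot_of_cut h.connected (c := fun x => (Γ.compRel S).r d x)
      ((Γ.compRel S).iseqv.refl d)
      (fun a b hab ha => (Γ.compRel S).iseqv.trans ha (vert_le_compRel S hab)) (by
        intro a b hab ha
        by_cases haS : a ∈ S
        · exact hin a b haS hab ha
        · have : Γ.IsLeg a := by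
            rcases hP a haS ha with rfl | rfl
            · exact hd'
            · exact hel
          rw [this b hab]
          exact ha)
    apply hne
    refine subset_antisymm hS.subset_internal fun g hg => ?_
    by_contra hgS
    rcases hP g hgS (hall g) with rfl | rfl
    · exact hg hd'
    · exact hg hel
  · have hall := sup_eq_top_const (h.connected_of_cut e hel) (fun x => (Γ.compRel S).r d x)
      (fun a b hab => propext
        ⟨fun ha => (Γ.compRel S).iseqv.trans ha (vert_le_compRel S hab),
          fun hb => (Γ.compRel S).iseqv.trans hb
            (vert_le_compRel S (Γ.vert.iseqv.symm hab))⟩) (by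
        have key : ∀ a b, ¬ Γ.line.r e a → Γ.line.r a b → (Γ.compRel S).r d a →
            (Γ.compRel S).r d b := by
          intro a b hea hab ha
          by_cases haS : a ∈ S
          · exact hin a b haS hab ha
          · rcases hP a haS ha with rfl | rfl
            · rcases hleg with hl | rfl
              · rw [hl b hab]
              · exact absurd (Γ.line.iseqv.refl _) hea
            · exact absurd (Γ.line.iseqv.refl _) hea
        rintro a b (rfl | ⟨h1, h2, h3⟩)
        · rfl
        · exact propext ⟨key a b h1 h3, key b a h2 (Γ.line.iseqv.symm h3)⟩) d (Γ.partner e)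
    have h1 : (Γ.compRel S).r d (Γ.partner e) := hall ▸ (Γ.compRel S).iseqv.refl d
    have h2 : Γ.partner e ∉ S := (hS.isLineSet.partner_mem_iff h.lineLE).not.2 he
    have h3 := partner_ne_iff.2 hel
    rcases hP _ h2 h1 with h4 | h4
    · rcases hleg with hl | rfl
      · exact hel (h.lineLE.isLeg_partner.1 (h4 ▸ hl))
      · exact h3 h4
    · exact h3 h4

theorem not_isLeg_of_isTwo {d : Γ.HE} (hd : d ∉ S) (h2 : Γ.IsTwo S d) : ¬ Γ.IsLeg d := by
  intro hleg
  obtain ⟨e, he, -, hde, huniq⟩ := hS.isLineSet.exists_other hd h2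
  exact not_outer_pair h hS hne hd hde he huniq (Or.inl hleg)

theorem three_le_numLegs {d : Γ.HE} (hd : d ∉ S) (h2 : ¬ Γ.IsTwo S d) :
    3 ≤ (Γ.comp S (Quotient.mk (Γ.compRel S) d)).numLegs := by
  have hleg := comp_isLeg_iff hS.isLineSet (Quotient.mk (Γ.compRel S) d)
  have h0 : (Γ.comp S (Quotient.mk (Γ.compRel S) d)).numLegs ≠ 0 := by
    have : Nonempty (Γ.comp S (Quotient.mk (Γ.compRel S) d)).Leg := ⟨⟨⟨d, rfl⟩, (hleg _).2 hd⟩⟩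
    exact Nat.card_pos.ne'
  have h1 : (Γ.comp S (Quotient.mk (Γ.compRel S) d)).numLegs ≠ 1 := by
    intro h1
    have hsub := (Nat.card_eq_one_iff_unique.1 h1).1
    refine not_outer_pair h hS hne hd ((Γ.compRel S).iseqv.refl d) hd (fun x hx hdx => ?_)
      (Or.inr rfl)
    have := hsub.elim ⟨⟨x, (Quotient.sound hdx).symm⟩, (hleg _).2 hx⟩ ⟨⟨d, rfl⟩, (hleg _).2 hd⟩
    exact Or.inl (congrArg (fun x => x.1.1) this)
  unfold IsTwo at h2
  omega

/-- A component that avoids `S` is a single vertex, all of whose half-edges are outer; there are at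
least three of them. -/
theorem exists_mem_of_isTwo {z : Γ.HE} (h2 : Γ.IsTwo S z) :
    ∃ s ∈ S, Quotient.mk (Γ.compRel S) s = Quotient.mk (Γ.compRel S) z := by
  by_contra hcon
  push Not at hcon
  have hz : ∀ x, (Γ.compRel S).r z x → Γ.vert.r z x := by
    intro x hx
    have : Γ.compRel S ≤ Setoid.ker fun x => Γ.vert.r z x := by
      refine sup_le (fun {a b} hab => propext ⟨fun ha => Γ.vert.iseqv.trans ha hab,
        fun hb => Γ.vert.iseqv.trans hb (Γ.vert.iseqv.symm hab)⟩) ?_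
      have key : ∀ a, a ∈ S → ¬ Γ.vert.r z a := fun a ha hza =>
        hcon a ha (Quotient.sound (vert_le_compRel S hza)).symm
      rintro a b (rfl | ⟨h1, h2, h3⟩)
      · rfl
      · exact propext ⟨fun ha => absurd ha (key a h1), fun hb => absurd hb (key b h2)⟩
    exact Eq.mp (this hx : Γ.vert.r z z = Γ.vert.r z x) (Γ.vert.iseqv.refl z)
  have h3 := h.three_le_valence (Quotient.mk _ z)
  have h4 : Γ.valence (Quotient.mk _ z) ≤
      (Γ.comp S (Quotient.mk (Γ.compRel S) z)).numLegs := by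
    refine Nat.card_le_card_of_injective (α := Γ.Prong (Quotient.mk _ z))
      (fun p => (⟨⟨p.1, Quotient.sound (vert_le_compRel S (Quotient.exact p.2))⟩,
        (comp_isLeg_iff hS.isLineSet _ _).2 fun hp => hcon p.1 hp
          (Quotient.sound (vert_le_compRel S (Quotient.exact p.2)))⟩ :
        (Γ.comp S (Quotient.mk (Γ.compRel S) z)).Leg)) ?_
    intro p p' hpp
    exact Subtype.ext (congrArg (fun x => x.1.1) hpp)
  unfold IsTwo at h2
  omega

/-! ### Walking along a line of the contracted graph -/

omit hne in
theorem nxt_injective : Function.Injective fun d => Γ.tau S (Γ.partner d) := by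
  intro d e hde
  have h1 : Γ.partner d = Γ.partner e := by
    rw [← hS.isLineSet.tau_tau (Γ.partner d), ← hS.isLineSet.tau_tau (Γ.partner e)]
    exact congrArg _ hde
  rw [← h.lineLE.partner_partner d, h1, h.lineLE.partner_partner]

omit h hS hne in
/-- The exits of the components with two external legs that are met from `a` onwards. -/
def walk (S : Set Γ.HE) (a : Γ.HE) (i : ℕ) : Γ.HE := (fun d => Γ.tau S (Γ.partner d))^[i] a

omit h hS hne in
theorem walk_succ (a : Γ.HE) (i : ℕ) :
    walk S a (i + 1) = Γ.tau S (Γ.partner (walk S a i)) :=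
  Function.iterate_succ_apply' _ _ _

variable {a : Γ.HE} (ha : a ∉ S) (ha2 : ¬ Γ.IsTwo S a)

include ha ha2 in
omit hne in
-- The step of the walk is an injection of a finite set, so the walk returns to `a`. But `tau` fixes
-- `a`, so just before the return the partner already equals `a`, and there `tau` acts trivially.
theorem exists_walk_end :
    ∃ k, Γ.tau S (Γ.partner (walk S a k)) = Γ.partner (walk S a k) := by
  have hta : Γ.tau S a = a := by
    by_contra hcon
    exact ha2 (hS.isLineSet.tau_ne_iff.1 hcon).2
  obtain ⟨N, hN, hNa⟩ := Function.Injective.mem_periodicPts (nxt_injective h hS) a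
  obtain ⟨m, rfl⟩ : ∃ m, N = m + 1 := ⟨N - 1, by omega⟩
  have h1 : walk S a (m + 1) = a := hNa
  rw [walk_succ] at h1
  refine ⟨m, ?_⟩
  have h2 : Γ.partner (walk S a m) = a := by
    rw [← hS.isLineSet.tau_tau (Γ.partner (walk S a m)), h1, hta]
  rw [h2, hta]

omit h hS hne in
open Classical in
/-- The number of components with two external legs on the line that starts at `a`. -/
def walkLength (S : Set Γ.HE) (a : Γ.HE) : ℕ :=
  if h : ∃ k, Γ.tau S (Γ.partner (walk S a k)) = Γ.partner (walk S a k) then Nat.find h else 0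

omit hne in
include ha in
theorem walk_notMem (i : ℕ) : walk S a i ∉ S := by
  induction i with
  | zero => exact ha
  | succ i ih =>
    rw [walk_succ]
    exact tau_notMem ((hS.isLineSet.partner_mem_iff h.lineLE).not.2 ih)

include ha ha2

omit hne in
theorem partner_walk_notMem (i : ℕ) : Γ.partner (walk S a i) ∉ S :=
  (hS.isLineSet.partner_mem_iff h.lineLE).not.2 (walk_notMem h hS ha i)

omit hne in
theorem isTwo_partner_walk {i : ℕ} (hi : i < walkLength S a) :
    Γ.IsTwo S (Γ.partner (walk S a i)) := by
  classical
  have hex := exists_walk_end h hS ha ha2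
  rw [walkLength, dif_pos hex] at hi
  exact (hS.isLineSet.tau_ne_iff.1 (Nat.find_min hex hi)).2

omit hne in
theorem not_isTwo_partner_walk :
    ¬ Γ.IsTwo S (Γ.partner (walk S a (walkLength S a))) := by
  classical
  have hex := exists_walk_end h hS ha ha2
  intro h2
  have h3 := hS.isLineSet.tau_ne_iff.2 ⟨partner_walk_notMem h hS ha ha2 _, h2⟩
  rw [walkLength, dif_pos hex] at h3
  exact h3 (Nat.find_spec hex)

omit hne in
theorem isTwo_walk {i : ℕ} (h0 : i ≠ 0) (hi : i ≤ walkLength S a) : Γ.IsTwo S (walk S a i) := by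
  obtain ⟨j, rfl⟩ := Nat.exists_eq_succ_of_ne_zero h0
  have h2 := isTwo_partner_walk h hS ha ha2 (i := j) (by omega)
  rw [walk_succ]
  exact (isTwo_congr (compRel_tau _)).1 h2

omit hne in
theorem walk_injOn {i j : ℕ} (hij : i < j) (hj : j ≤ walkLength S a) :
    walk S a i ≠ walk S a j := by
  intro hw
  have h1 : walk S a (j - i) = a := by
    apply (nxt_injective h hS).iterate i
    rw [walk, ← Function.iterate_add_apply, Nat.add_sub_cancel' hij.le]
    exact hw.symm
  exact ha2 (h1 ▸ isTwo_walk h hS ha ha2 (i := j - i) (by omega) (by omega))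

variable (hal : ¬ Γ.IsLeg a)
include hal

theorem walk_not_isLeg {i : ℕ} (hi : i ≤ walkLength S a) : ¬ Γ.IsLeg (walk S a i) := by
  by_cases h0 : i = 0
  · subst h0
    exact hal
  · exact not_isLeg_of_isTwo h hS hne (walk_notMem h hS ha i) (isTwo_walk h hS ha ha2 h0 hi)

/-- If the walk ran into its own reversal, moving both positions inwards would give a shorter
instance. It ends either with a half-edge that is its own partner, impossible on an internal line,
or with one fixed by `tau`, impossible at a component with two legs. -/
theorem walk_ne_partner_aux (n : ℕ) : ∀ i j, i ≤ j → j - i ≤ n → j ≤ walkLength S a →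
    walk S a i ≠ Γ.partner (walk S a j) := by
  induction n using Nat.strong_induction_on with | _ n ih
  intro i j hij hn hj hw
  have hw' : Γ.partner (walk S a i) = walk S a j := by rw [hw, h.lineLE.partner_partner]
  rcases Nat.lt_or_ge i j with hlt | hge
  · obtain ⟨m, rfl⟩ : ∃ m, j = m + 1 := ⟨j - 1, by omega⟩
    have h1 : walk S a (i + 1) = Γ.partner (walk S a m) := by
      rw [walk_succ, hw', walk_succ, hS.isLineSet.tau_tau]
    rcases Nat.lt_or_ge i m with h2 | h2
    · exact ih (m - (i + 1)) (by omega) (i + 1) m h2 le_rfl (by omega) h1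
    · obtain rfl : i = m := by omega
      refine hS.isLineSet.tau_ne_iff.2 ⟨walk_notMem h hS ha (i + 1),
        isTwo_walk h hS ha ha2 (by omega) hj⟩ ?_
      conv_lhs => rw [h1]
      exact (walk_succ a i).symm
  · obtain rfl : i = j := le_antisymm hij hge
    exact partner_ne_iff.2 (walk_not_isLeg h hS hne ha ha2 hal hj) hw'

theorem walk_ne_partner {i j : ℕ} (hi : i ≤ walkLength S a) (hj : j ≤ walkLength S a) :
    walk S a i ≠ Γ.partner (walk S a j) := by
  rcases le_total i j with hij | hij
  · exact walk_ne_partner_aux h hS hne ha ha2 hal _ i j hij le_rfl hj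
  · intro hw
    refine walk_ne_partner_aux h hS hne ha ha2 hal _ j i hij le_rfl hi ?_
    rw [hw, h.lineLE.partner_partner]

omit hne hal in
theorem rel_walk (i : ℕ) : (Γ.line ⊔ Γ.through S).r a (walk S a i) := by
  induction i with
  | zero => exact (Γ.line ⊔ Γ.through S).iseqv.refl a
  | succ i ih =>
    rw [walk_succ]
    exact (Γ.line ⊔ Γ.through S).iseqv.trans ih ((Γ.line ⊔ Γ.through S).iseqv.trans
      ((le_sup_left : Γ.line ≤ _) (line_partner _)) ((le_sup_right : Γ.through S ≤ _)
        (through_tau _)))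

omit hne hal in
theorem rel_partner_walk (i : ℕ) : (Γ.line ⊔ Γ.through S).r a (Γ.partner (walk S a i)) :=
  (Γ.line ⊔ Γ.through S).iseqv.trans (rel_walk h hS ha ha2 i)
    ((le_sup_left : Γ.line ≤ _) (line_partner _))

omit hne hal in
-- The half-edges met by the walk are closed under lines and under passing through components with
-- two legs: inside the walk both lead to its neighbours, and at its two ends `tau` is trivial.
theorem exists_walk_of_rel {x : Γ.HE} (hx : (Γ.line ⊔ Γ.through S).r a x) :
    ∃ i ≤ walkLength S a, x = walk S a i ∨ x = Γ.partner (walk S a i) := by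
  set P : Γ.HE → Prop := fun x =>
    ∃ i ≤ walkLength S a, x = walk S a i ∨ x = Γ.partner (walk S a i)
  have hl : ∀ x y, Γ.line.r x y → P x → P y := by
    rintro x y hxy ⟨i, hi, rfl | rfl⟩
    · exact ⟨i, hi, h.lineLE.line_iff.1 hxy⟩
    · rcases h.lineLE.line_iff.1 hxy with rfl | rfl
      · exact ⟨i, hi, Or.inr rfl⟩
      · exact ⟨i, hi, Or.inl (h.lineLE.partner_partner _)⟩
  have ht : ∀ x y, (Γ.through S).r x y → P x → P y := by
    rintro x y hxy ⟨i, hi, hx⟩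
    rcases hS.isLineSet.through_iff.1 hxy with rfl | rfl
    · exact ⟨i, hi, hx⟩
    rcases hx with rfl | rfl
    · cases i with
      | zero =>
        refine ⟨0, hi, Or.inl ?_⟩
        by_contra hcon
        exact ha2 (hS.isLineSet.tau_ne_iff.1 hcon).2
      | succ i =>
        refine ⟨i, by omega, Or.inr ?_⟩
        rw [walk_succ, hS.isLineSet.tau_tau]
    · rcases hi.lt_or_eq with hi' | rfl
      · exact ⟨i + 1, hi', Or.inl (walk_succ a i).symm⟩
      · refine ⟨_, le_rfl, Or.inr ?_⟩
        by_contra hcon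
        exact not_isTwo_partner_walk h hS ha ha2 (hS.isLineSet.tau_ne_iff.1 hcon).2
  have : Γ.line ⊔ Γ.through S ≤ Setoid.ker P :=
    sup_le (fun {x y} hxy => propext ⟨hl x y hxy, hl y x (Γ.line.iseqv.symm hxy)⟩)
      (fun {x y} hxy => propext ⟨ht x y hxy, ht y x ((Γ.through S).iseqv.symm hxy)⟩)
  have h1 : P a = P x := this hx
  exact Eq.mp h1 ⟨0, Nat.zero_le _, Or.inl rfl⟩

omit hne hal in
theorem eq_or_eq_of_rel {x : Γ.HE} (hx : (Γ.line ⊔ Γ.through S).r a x) (hx2 : ¬ Γ.IsTwo S x) :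
    x = a ∨ x = Γ.partner (walk S a (walkLength S a)) := by
  obtain ⟨i, hi, rfl | rfl⟩ := exists_walk_of_rel h hS ha ha2 hx
  · by_cases h0 : i = 0
    · subst h0
      exact Or.inl rfl
    · exact absurd (isTwo_walk h hS ha ha2 h0 hi) hx2
  · rcases hi.lt_or_eq with hi' | rfl
    · exact absurd (isTwo_partner_walk h hS ha ha2 hi') hx2
    · exact Or.inr rfl

end Contract

section ContractProps

variable (h : Γ.IsOnePI) (hS : Γ.IsSubgraph S) (hne : S ≠ Γ.internal)

/-- The half-edge of the graph that is a half-edge of the contracted graph. -/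
abbrev ofContract (d : (Γ.contract S).HE) : Γ.HE := d.1

theorem ofContract_notMem (d : (Γ.contract S).HE) : ofContract d ∉ S := d.2.1
theorem ofContract_not_isTwo (d : (Γ.contract S).HE) : ¬ Γ.IsTwo S (ofContract d) := d.2.2

theorem ofContract_injective : Function.Injective (ofContract (Γ := Γ) (S := S)) :=
  Subtype.val_injective

theorem contract_line_rel {d e : (Γ.contract S).HE} : (Γ.contract S).line.r d e ↔
    (Γ.line ⊔ Γ.through S).r (ofContract d) (ofContract e) := Iff.rfl

theorem contract_vert_rel {d e : (Γ.contract S).HE} : (Γ.contract S).vert.r d e ↔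
    (Γ.compRel S).r (ofContract d) (ofContract e) := Iff.rfl

include h hS hne

/-- From an internal half-edge the walk ends at another half-edge of the contracted graph; it is a
different one because the walk does not run back. From an external leg nothing else is reached. -/
theorem contract_isLeg_iff (d : (Γ.contract S).HE) :
    (Γ.contract S).IsLeg d ↔ Γ.IsLeg (ofContract d) := by
  constructor
  · intro hd
    by_contra hleg
    have h1 := rel_partner_walk h hS (ofContract_notMem d) (ofContract_not_isTwo d)
      (walkLength S (ofContract d))
    have h2 := hd ⟨_, partner_walk_notMem h hS (ofContract_notMem d) (ofContract_not_isTwo d) _,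
      not_isTwo_partner_walk h hS (ofContract_notMem d) (ofContract_not_isTwo d)⟩ h1
    exact walk_ne_partner h hS hne (ofContract_notMem d) (ofContract_not_isTwo d) hleg
      (Nat.zero_le _) le_rfl (congrArg ofContract h2).symm
  · intro hd e he
    have : Γ.line ⊔ Γ.through S ≤ Setoid.ker fun x => x = ofContract d := by
      have hl : ∀ x y, Γ.line.r x y → x = ofContract d → y = ofContract d := by
        rintro x y hxy rfl
        exact hd y hxy
      have ht : ∀ x y, (Γ.through S).r x y → x = ofContract d → y = ofContract d := by
        rintro x y hxy rfl
        rcases hS.isLineSet.through_iff.1 hxy with h1 | h1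
        · exact h1
        · by_contra hcon
          exact ofContract_not_isTwo d (hS.isLineSet.tau_ne_iff.1 (h1 ▸ hcon)).2
      exact sup_le (fun {x y} hxy => propext ⟨hl x y hxy, hl y x (Γ.line.iseqv.symm hxy)⟩)
        (fun {x y} hxy => propext ⟨ht x y hxy, ht y x ((Γ.through S).iseqv.symm hxy)⟩)
    have h1 : (ofContract d = ofContract d) = (ofContract e = ofContract d) := this he
    exact ofContract_injective (h1 ▸ rfl)

theorem contract_lineLE : (Γ.contract S).LineLE := by
  intro d
  by_cases hd : (Γ.contract S).IsLeg d
  · refine (Set.ncard_le_ncard (t := {d}) (fun e he => hd e he) (Set.toFinite _)).trans ?_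
    simp
  · have h1 : {e | (Γ.contract S).line.r d e} ⊆ {d, ⟨_, partner_walk_notMem h hS
        (ofContract_notMem d) (ofContract_not_isTwo d) (walkLength S (ofContract d)),
        not_isTwo_partner_walk h hS (ofContract_notMem d) (ofContract_not_isTwo d)⟩} := by
      intro e he
      rcases eq_or_eq_of_rel h hS (ofContract_notMem d) (ofContract_not_isTwo d)
        (contract_line_rel.1 he) (ofContract_not_isTwo e) with h2 | h2
      · exact Or.inl (ofContract_injective h2)
      · exact Or.inr (ofContract_injective h2)
    exact (Set.ncard_le_ncard h1 (Set.toFinite _)).trans ((Set.ncard_insert_le _ _).trans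
      (Nat.succ_le_succ (Set.ncard_singleton _).le))

theorem contract_three_le_valence (v : (Γ.contract S).Vertex) :
    3 ≤ (Γ.contract S).valence v := by
  induction v using Quotient.inductionOn with | _ d
  refine (three_le_numLegs h hS hne (ofContract_notMem d) (ofContract_not_isTwo d)).trans ?_
  refine Nat.card_le_card_of_injective
    (α := (Γ.comp S (Quotient.mk (Γ.compRel S) (ofContract d))).Leg)
    (fun l => (⟨⟨l.1.1, (comp_isLeg_iff hS.isLineSet _ _).1 l.2, ?_⟩, ?_⟩ :
      (Γ.contract S).Prong (Quotient.mk _ d))) ?_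
  · exact (isTwo_congr (Quotient.exact (comp_mk l.1))).not.2 (ofContract_not_isTwo d)
  · exact Quotient.sound (contract_vert_rel.2 (Quotient.exact (comp_mk l.1)))
  · intro l l' hll
    exact Subtype.ext (Subtype.ext (congrArg (fun x => ofContract x.1) hll))

/-- Otherwise the component at an external leg of `Γ` would have only external legs of `Γ` as outer
half-edges. No line would lead out of it, so it would be all of `Γ` and every internal line would
lie in `S`. -/
theorem contract_exists_internal : ∃ d, ¬ (Γ.contract S).IsLeg d := by
  obtain ⟨g, hg, hgS⟩ : ∃ g ∈ Γ.internal, g ∉ S := by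
    by_contra hcon
    push Not at hcon
    exact hne (subset_antisymm hS.subset_internal hcon)
  by_contra hcon
  push Not at hcon
  have hl : ∀ d : Γ.HE, d ∉ S → ¬ Γ.IsTwo S d → Γ.IsLeg d := fun d h1 h2 =>
    (contract_isLeg_iff h hS hne ⟨d, h1, h2⟩).1 (hcon _)
  obtain ⟨l⟩ := h.nonempty_leg
  have hlS : l.1 ∉ S := fun hl => hS.subset_internal hl l.2
  have hl2 : ¬ Γ.IsTwo S l.1 := fun h2 => not_isLeg_of_isTwo h hS hne hlS h2 l.2
  have hout : ∀ x, x ∉ S → (Γ.compRel S).r l.1 x → Γ.IsLeg x := fun x hx hlx =>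
    hl x hx fun h2 => hl2 ((isTwo_congr hlx).2 h2)
  have hall := vert_bot_of_cut h.connected (c := fun x => (Γ.compRel S).r l.1 x)
    ((Γ.compRel S).iseqv.refl _)
    (fun a b hab ha => (Γ.compRel S).iseqv.trans ha (vert_le_compRel S hab)) (by
      intro a b hab ha
      by_cases haS : a ∈ S
      · exact (Γ.compRel S).iseqv.trans ha (lineOn_le_compRel S
          (Or.inr ⟨haS, hS.line_closed _ _ hab haS, hab⟩))
      · rw [hout a haS ha b hab]
        exact ha)
  exact hg (hout g hgS (hall g))

end ContractProps

end PreGraph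

/-! ### Reconstruction of a graph from a subgraph and its cograph -/

namespace PreGraph

variable {Γ γ : PreGraph} {S : Set Γ.HE}

section Decompose

variable (h : Γ.IsOnePI) (hS : Γ.IsSubgraph S) (hne : S ≠ Γ.internal)
  (ψ : Iso γ (Γ.contract S))

/-! ### The graphs that were inserted at a vertex -/

/-- The half-edge that corresponds to a half-edge of the contracted graph. -/
def base (d : γ.HE) : Γ.HE := ofContract (ψ.toEquiv d)

theorem base_notMem (d : γ.HE) : base ψ d ∉ S := ofContract_notMem _
theorem base_not_isTwo (d : γ.HE) : ¬ Γ.IsTwo S (base ψ d) := ofContract_not_isTwo _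

theorem base_injective : Function.Injective (base ψ) :=
  ofContract_injective.comp ψ.toEquiv.injective

theorem exists_base {g : Γ.HE} (hg : g ∉ S) (h2 : ¬ Γ.IsTwo S g) : ∃ d, base ψ d = g := by
  obtain ⟨d, hd⟩ := ψ.toEquiv.surjective ⟨g, hg, h2⟩
  exact ⟨d, congrArg ofContract hd⟩

theorem base_vert_iff {d e : γ.HE} : (Γ.compRel S).r (base ψ d) (base ψ e) ↔ γ.vert.r d e :=
  (ψ.vert_iff d e).symm

theorem base_line_iff {d e : γ.HE} :
    (Γ.line ⊔ Γ.through S).r (base ψ d) (base ψ e) ↔ γ.line.r d e :=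
  (ψ.line_iff d e).symm

/-- The component at a vertex. -/
def vertexComp (v : γ.Vertex) : Quotient (Γ.compRel S) :=
  Quotient.map' (base ψ) (fun _ _ h => (base_vert_iff ψ).2 h) v

variable (hSl : Γ.IsLineSet S)

/-- The external legs of the component at a vertex. -/
def vertexLeg (v : γ.Vertex) : γ.Prong v ≃ (Γ.comp S (vertexComp ψ v)).Leg :=
  Equiv.ofBijective (fun p => ⟨⟨base ψ p.1, by obtain ⟨d, rfl⟩ := p; rfl⟩,
    (comp_isLeg_iff hSl _ _).2 (base_notMem ψ p.1)⟩) <| by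
  constructor
  · intro p p' hpp
    exact Subtype.ext (base_injective ψ (congrArg (fun x => x.1.1) hpp))
  · rintro ⟨⟨g, hg⟩, hgl⟩
    induction v using Quotient.inductionOn with | _ d
    have hdg : (Γ.compRel S).r (base ψ d) g := Quotient.exact hg.symm
    obtain ⟨e, rfl⟩ := exists_base ψ ((comp_isLeg_iff hSl _ _).1 hgl)
      ((isTwo_congr hdg).not.1 (base_not_isTwo ψ d))
    exact ⟨⟨e, (Quotient.sound ((base_vert_iff ψ).1 hdg)).symm⟩, rfl⟩

/-- The component at a vertex, with its legs labelled. -/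
def vertexPiece (v : γ.Vertex) : Legged (γ.Prong v) := ⟨Γ.comp S (vertexComp ψ v), vertexLeg ψ hSl v⟩

/-- The external legs of a component with two legs. -/
def twoLeg {z : Γ.HE} (hz : z ∉ S) (h2 : Γ.IsTwo S z) :
    Bool ≃ (Γ.comp S (Quotient.mk (Γ.compRel S) z)).Leg :=
  Equiv.ofBijective (fun b => ⟨⟨cond b (Γ.tau S z) z, by
      cases b
      · rfl
      · exact (Quotient.sound (compRel_tau z)).symm⟩, (comp_isLeg_iff hSl _ _).2 (by
      cases b
      · exact hz
      · exact tau_notMem hz)⟩) <| by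
  have hne := hSl.tau_ne_iff.2 ⟨hz, h2⟩
  constructor
  · intro b b' hbb
    have : cond b (Γ.tau S z) z = cond b' (Γ.tau S z) z := congrArg (fun x => x.1.1) hbb
    cases b <;> cases b'
    · rfl
    · exact absurd this.symm hne
    · exact absurd this hne
    · rfl
  · rintro ⟨⟨g, hg⟩, hgl⟩
    have hzg : (Γ.through S).r z g := Or.inr ⟨hz, (comp_isLeg_iff hSl _ _).1 hgl,
      Quotient.exact hg.symm, h2⟩
    rcases hSl.through_iff.1 hzg with rfl | rfl
    · exact ⟨false, rfl⟩
    · exact ⟨true, rfl⟩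

/-- A component with two external legs, with its legs labelled. -/
def twoPiece {z : Γ.HE} (hz : z ∉ S) (h2 : Γ.IsTwo S z) : Legged Bool :=
  ⟨Γ.comp S (Quotient.mk (Γ.compRel S) z), twoLeg hSl hz h2⟩

include h hS hne

theorem twoPiece_isOnePI {z : Γ.HE} (hz : z ∉ S) (h2 : Γ.IsTwo S z) :
    (twoPiece hSl hz h2).graph.IsOnePI :=
  hS.onePI ⟨_, exists_mem_of_isTwo h hS hne h2⟩

/-! ### The insertion -/

open Classical in
/-- The insertion whose result is the given graph. -/
def decomp : γ.Insertion where
  vtx v := if hv : ∃ s ∈ S, Quotient.mk (Γ.compRel S) s = vertexComp ψ v then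
    some (Quotient.mk (leggedSetoid _) ⟨vertexPiece ψ hS.isLineSet v, hS.onePI ⟨_, hv⟩⟩) else none
  chain q := List.ofFn fun i : Fin (walkLength S (base ψ (γ.firstEnd q))) =>
    Quotient.mk (leggedSetoid Bool) ⟨twoPiece hS.isLineSet
        (partner_walk_notMem h hS (base_notMem ψ _) (base_not_isTwo ψ _) i)
        (isTwo_partner_walk h hS (base_notMem ψ _) (base_not_isTwo ψ _) i.2),
      twoPiece_isOnePI h hS hne hS.isLineSet _ _⟩

theorem chain_length (q : γ.IntLine) : ((decomp h hS hne ψ).chain q).length =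
    walkLength S (base ψ (γ.firstEnd q)) := List.length_ofFn

theorem chain_lt {q : γ.IntLine} (i : Fin ((decomp h hS hne ψ).chain q).length) :
    i.1 < walkLength S (base ψ (γ.firstEnd q)) := chain_length h hS hne ψ q ▸ i.2

/-- The pieces of the graph, with their legs labelled. -/
def target : ∀ x : (decomp h hS hne ψ).Site, Legged ((decomp h hS hne ψ).SiteProng x)
  | Sum.inl v => vertexPiece ψ hS.isLineSet v
  | Sum.inr y => twoPiece hS.isLineSet
      (partner_walk_notMem h hS (base_notMem ψ _) (base_not_isTwo ψ _) y.2.1)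
      (isTwo_partner_walk h hS (base_notMem ψ _) (base_not_isTwo ψ _) (chain_lt h hS hne ψ y.2))

/-- The components of the subgraph and the vertices. -/
def siteComp : (decomp h hS hne ψ).Site → Quotient (Γ.compRel S)
  | Sum.inl v => vertexComp ψ v
  | Sum.inr y => Quotient.mk _ (Γ.partner (walk S (base ψ (γ.firstEnd y.1)) y.2.1))

theorem exists_pieceIso (x : (decomp h hS hne ψ).Site) :
    Nonempty (Legged.Iso ((decomp h hS hne ψ).piece x) (target h hS hne ψ x)) := by
  classical
  rcases x with v | ⟨q, i⟩
  · by_cases hv : ∃ s ∈ S, Quotient.mk (Γ.compRel S) s = vertexComp ψ v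
    · have h1 : (decomp h hS hne ψ).vtx v = some (Quotient.mk (leggedSetoid _)
          ⟨vertexPiece ψ hS.isLineSet v, hS.onePI ⟨_, hv⟩⟩) := dif_pos hv
      rw [Insertion.piece_some _ h1]
      exact LGraph.mk_rep_iso _ _
    · have h1 : (decomp h hS hne ψ).vtx v = none := dif_neg hv
      rw [Insertion.piece_none _ h1]
      have hin : ∀ g, Quotient.mk (Γ.compRel S) g = vertexComp ψ v → g ∉ S :=
        fun g hg hgS => hv ⟨g, hgS, hg⟩
      refine ⟨⟨⟨(vertexLeg ψ hS.isLineSet v).trans ⟨fun l => l.1, fun g => ⟨g,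
        (comp_isLeg_iff hS.isLineSet _ _).2 (hin g.1 g.2)⟩, fun _ => rfl, fun _ => rfl⟩,
        fun a b => ⟨fun _ => ?_, fun _ => trivial⟩, fun a b => ⟨?_, ?_⟩⟩, fun p => rfl⟩⟩
      · have hall : ∀ c, vertexComp ψ v = c → (Γ.vert ⊔ Γ.lineOn S) ≤
            Setoid.ker fun x : Γ.HE => Quotient.mk (Γ.compRel S) x = c ∧ Γ.vert.r (base ψ a.1) x := by
          rintro c rfl
          have hv' : ∀ x y, Γ.vert.r x y → (Quotient.mk (Γ.compRel S) x = vertexComp ψ v ∧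
              Γ.vert.r (base ψ a.1) x) → (Quotient.mk (Γ.compRel S) y = vertexComp ψ v ∧
              Γ.vert.r (base ψ a.1) y) := fun x y hxy hx =>
            ⟨(Quotient.sound (vert_le_compRel S hxy)).symm.trans hx.1,
              Γ.vert.iseqv.trans hx.2 hxy⟩
          refine sup_le (fun {x y} hxy => propext ⟨hv' x y hxy, hv' y x (Γ.vert.iseqv.symm hxy)⟩) ?_
          rintro x y (rfl | ⟨h1, h2, -⟩)
          · rfl
          · exact propext ⟨fun hx => absurd h1 (hin x hx.1), fun hy => absurd h2 (hin y hy.1)⟩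
        have ha : Quotient.mk (Γ.compRel S) (base ψ a.1) = vertexComp ψ v :=
          comp_mk (vertexLeg ψ hS.isLineSet v a).1
        have hb : Quotient.mk (Γ.compRel S) (base ψ b.1) = vertexComp ψ v :=
          comp_mk (vertexLeg ψ hS.isLineSet v b).1
        have := hall _ rfl (Quotient.exact (ha.trans hb.symm))
        exact (Eq.mp this ⟨ha, Γ.vert.iseqv.refl _⟩).2
      · intro hab
        have hab : a = b := hab
        subst hab
        exact Or.inl rfl
      · rintro (hab | ⟨hab, -⟩)
        · exact Subtype.ext (base_injective ψ hab)
        · exact absurd hab (base_notMem ψ _)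
  · change Nonempty (Legged.Iso (((decomp h hS hne ψ).chain q).get i).rep _)
    have h1 : ((decomp h hS hne ψ).chain q).get i = Quotient.mk (leggedSetoid Bool)
        ⟨twoPiece hS.isLineSet
          (partner_walk_notMem h hS (base_notMem ψ _) (base_not_isTwo ψ _) i.1)
          (isTwo_partner_walk h hS (base_notMem ψ _) (base_not_isTwo ψ _) (chain_lt h hS hne ψ i)),
          twoPiece_isOnePI h hS hne hS.isLineSet _ _⟩ := by
      rw [List.get_eq_getElem]
      exact List.getElem_ofFn _
    rw [h1]
    exact LGraph.mk_rep_iso _ _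

/-- The identification of a piece of the insertion with a piece of the graph. -/
def pieceIso (x : (decomp h hS hne ψ).Site) :
    Legged.Iso ((decomp h hS hne ψ).piece x) (target h hS hne ψ x) :=
  (exists_pieceIso h hS hne ψ x).some

/-- Half-edges of a piece as half-edges of the graph. -/
def targetHE : ∀ x : (decomp h hS hne ψ).Site, (target h hS hne ψ x).graph.HE → Γ.HE
  | Sum.inl _ => fun a => a.1
  | Sum.inr _ => fun a => a.1

/-- The map from the glued graph. -/
def recon (p : (decomp h hS hne ψ).GlueHE) : Γ.HE :=
  targetHE h hS hne ψ p.1 ((pieceIso h hS hne ψ p.1).iso.toEquiv p.2)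

theorem targetHE_injective (x : (decomp h hS hne ψ).Site) :
    Function.Injective (targetHE h hS hne ψ x) := by
  cases x <;> exact Subtype.val_injective

theorem mk_targetHE (x : (decomp h hS hne ψ).Site) (a : (target h hS hne ψ x).graph.HE) :
    Quotient.mk (Γ.compRel S) (targetHE h hS hne ψ x a) = siteComp h hS hne ψ x := by
  cases x <;> exact a.2

theorem exists_targetHE (x : (decomp h hS hne ψ).Site) (g : Γ.HE)
    (hg : Quotient.mk (Γ.compRel S) g = siteComp h hS hne ψ x) :
    ∃ a, targetHE h hS hne ψ x a = g := by
  cases x <;> exact ⟨⟨g, hg⟩, rfl⟩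

theorem target_vert_iff {x : (decomp h hS hne ψ).Site} {a b : (target h hS hne ψ x).graph.HE} :
    (target h hS hne ψ x).graph.vert.r a b ↔
      Γ.vert.r (targetHE h hS hne ψ x a) (targetHE h hS hne ψ x b) := by
  cases x <;> exact Iff.rfl

theorem target_line_iff {x : (decomp h hS hne ψ).Site} {a b : (target h hS hne ψ x).graph.HE} :
    (target h hS hne ψ x).graph.line.r a b ↔
      (Γ.lineOn S).r (targetHE h hS hne ψ x a) (targetHE h hS hne ψ x b) := by
  cases x <;> exact Iff.rfl

theorem target_isLeg_iff {x : (decomp h hS hne ψ).Site} {a : (target h hS hne ψ x).graph.HE} :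
    (target h hS hne ψ x).graph.IsLeg a ↔ targetHE h hS hne ψ x a ∉ S := by
  cases x <;> exact comp_isLeg_iff hS.isLineSet _ _

theorem recon_mem_iff (p : (decomp h hS hne ψ).GlueHE) :
    recon h hS hne ψ p ∈ S ↔ p ∈ (decomp h hS hne ψ).inner := by
  rw [← not_iff_not, recon, ← target_isLeg_iff, (pieceIso h hS hne ψ p.1).iso.isLeg_iff]
  exact (not_not).symm

theorem mk_recon (p : (decomp h hS hne ψ).GlueHE) :
    Quotient.mk (Γ.compRel S) (recon h hS hne ψ p) = siteComp h hS hne ψ p.1 :=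
  mk_targetHE _ _ _ _ _ _

/-- The half-edge of the graph at a prong. -/
def pos (p : Σ x, (decomp h hS hne ψ).SiteProng x) : Γ.HE :=
  targetHE h hS hne ψ p.1 ((target h hS hne ψ p.1).leg p.2).1

theorem recon_att (p : Σ x, (decomp h hS hne ψ).SiteProng x) :
    recon h hS hne ψ ((decomp h hS hne ψ).att p) = pos h hS hne ψ p :=
  congrArg _ ((pieceIso h hS hne ψ p.1).fix p.2)

theorem pos_pr (d : γ.HE) : pos h hS hne ψ ((decomp h hS hne ψ).pr d) = base ψ d := rfl

theorem pos_inr_true (y : Σ q, Fin ((decomp h hS hne ψ).chain q).length) :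
    pos h hS hne ψ ⟨Sum.inr y, true⟩ = walk S (base ψ (γ.firstEnd y.1)) (y.2.1 + 1) :=
  (walk_succ _ _).symm

theorem base_isLeg_iff (d : γ.HE) : Γ.IsLeg (base ψ d) ↔ γ.IsLeg d :=
  (contract_isLeg_iff h hS hne _).symm.trans (ψ.isLeg_iff d)

theorem base_secondEnd (q : γ.IntLine) : base ψ (γ.secondEnd q) =
    Γ.partner (walk S (base ψ (γ.firstEnd q)) (walkLength S (base ψ (γ.firstEnd q)))) := by
  have h1 : (Γ.line ⊔ Γ.through S).r (base ψ (γ.firstEnd q)) (base ψ (γ.secondEnd q)) :=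
    (base_line_iff ψ).2 (line_partner _)
  rcases eq_or_eq_of_rel h hS (base_notMem ψ _) (base_not_isTwo ψ _) h1
    (base_not_isTwo ψ _) with h2 | h2
  · exact absurd (base_injective ψ h2) (secondEnd_ne q)
  · exact h2

theorem pos_src (q : γ.IntLine) (i : Fin (((decomp h hS hne ψ).chain q).length + 1)) :
    pos h hS hne ψ ((decomp h hS hne ψ).src q i) = walk S (base ψ (γ.firstEnd q)) i.1 := by
  induction i using Fin.cases with
  | zero => rfl
  | succ j => exact pos_inr_true h hS hne ψ ⟨q, j⟩

theorem pos_tgt (q : γ.IntLine) (i : Fin (((decomp h hS hne ψ).chain q).length + 1)) :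
    pos h hS hne ψ ((decomp h hS hne ψ).tgt q i) =
      Γ.partner (walk S (base ψ (γ.firstEnd q)) i.1) := by
  induction i using Fin.lastCases with
  | last =>
    rw [Insertion.tgt_last, pos_pr, base_secondEnd h hS hne, Fin.val_last, chain_length]
  | cast j => rw [Insertion.tgt_castSucc]; rfl

/-- Components at vertices do not have two legs, those on lines do. Two places on lines with the
same component belong to the same line of `γ`, as passing through a component is part of the line
relation after contraction. On one line the walk neither repeats nor reverses itself. -/
theorem siteComp_injective : Function.Injective (siteComp h hS hne ψ) := by
  have htwo : ∀ y, Γ.IsTwo S (pos h hS hne ψ ⟨Sum.inr y, false⟩) := fun y =>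
    isTwo_partner_walk h hS (base_notMem ψ _) (base_not_isTwo ψ _) (chain_lt h hS hne ψ y.2)
  rintro (v | ⟨q, i⟩) (w | ⟨q', i'⟩) hxy
  · induction v using Quotient.inductionOn with | _ d
    induction w using Quotient.inductionOn with | _ e
    exact congrArg Sum.inl (Quotient.sound ((base_vert_iff ψ).1 (Quotient.exact hxy)))
  · induction v using Quotient.inductionOn with | _ d
    exact absurd ((isTwo_congr (Quotient.exact hxy)).2 (htwo ⟨q', i'⟩)) (base_not_isTwo ψ d)
  · induction w using Quotient.inductionOn with | _ d
    exact absurd ((isTwo_congr (Quotient.exact hxy)).1 (htwo ⟨q, i⟩)) (base_not_isTwo ψ d)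
  · have hth : (Γ.through S).r (Γ.partner (walk S (base ψ (γ.firstEnd q)) i.1))
        (Γ.partner (walk S (base ψ (γ.firstEnd q')) i'.1)) :=
      Or.inr ⟨partner_walk_notMem h hS (base_notMem ψ _) (base_not_isTwo ψ _) _,
        partner_walk_notMem h hS (base_notMem ψ _) (base_not_isTwo ψ _) _,
        Quotient.exact hxy, htwo ⟨q, i⟩⟩
    have hrel : ∀ q i, (Γ.line ⊔ Γ.through S).r (base ψ (γ.firstEnd q))
        (Γ.partner (walk S (base ψ (γ.firstEnd q)) i)) := fun q i =>
      rel_partner_walk h hS (base_notMem ψ _) (base_not_isTwo ψ _) i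
    have hqq : γ.line.r (γ.firstEnd q) (γ.firstEnd q') := by
      rw [← base_line_iff ψ]
      exact (Γ.line ⊔ Γ.through S).iseqv.trans (hrel q i.1) ((Γ.line ⊔ Γ.through S).iseqv.trans
        ((le_sup_right : Γ.through S ≤ _) hth)
        ((Γ.line ⊔ Γ.through S).iseqv.symm (hrel q' i'.1)))
    obtain rfl : q = q' := Subtype.ext
      ((firstEnd_mk q).symm.trans ((Quotient.sound hqq).trans (firstEnd_mk q')))
    have hi := chain_lt h hS hne ψ i
    have hi' := chain_lt h hS hne ψ i'
    suffices i = i' by rw [this]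
    rcases hS.isLineSet.through_iff.1 hth with h1 | h1
    · have h2 : walk S (base ψ (γ.firstEnd q)) i'.1 = walk S (base ψ (γ.firstEnd q)) i.1 := by
        rw [← h.lineLE.partner_partner (walk _ _ i'.1), h1, h.lineLE.partner_partner]
      rcases lt_trichotomy i.1 i'.1 with h3 | h3 | h3
      · exact absurd h2.symm
          (walk_injOn h hS (base_notMem ψ _) (base_not_isTwo ψ _) h3 hi'.le)
      · exact Fin.ext h3
      · exact absurd h2
          (walk_injOn h hS (base_notMem ψ _) (base_not_isTwo ψ _) h3 hi.le)
    · rw [← walk_succ] at h1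
      exact absurd h1.symm (walk_ne_partner h hS hne (base_notMem ψ _) (base_not_isTwo ψ _)
        ((base_isLeg_iff h hS hne ψ _).not.2 (firstEnd_not_isLeg q)) (by omega) hi'.le)

theorem recon_injective : Function.Injective (recon h hS hne ψ) := by
  rintro ⟨x, a⟩ ⟨y, b⟩ hab
  obtain rfl : x = y := siteComp_injective h hS hne ψ
    ((mk_recon h hS hne ψ ⟨x, a⟩).symm.trans
      ((congrArg _ hab).trans (mk_recon h hS hne ψ ⟨y, b⟩)))
  exact congrArg (Sigma.mk x) ((pieceIso h hS hne ψ x).iso.toEquiv.injective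
    (targetHE_injective h hS hne ψ x hab))

theorem exists_recon_of_mk {p : (decomp h hS hne ψ).GlueHE} {g : Γ.HE}
    (hg : (Γ.compRel S).r (recon h hS hne ψ p) g) :
    ∃ b, recon h hS hne ψ ⟨p.1, b⟩ = g := by
  obtain ⟨a, ha⟩ := exists_targetHE h hS hne ψ p.1 g
    ((Quotient.sound hg).symm.trans (mk_recon h hS hne ψ p))
  refine ⟨(pieceIso h hS hne ψ p.1).iso.symm.toEquiv a, ?_⟩
  change targetHE h hS hne ψ p.1
    ((pieceIso h hS hne ψ p.1).iso.toEquiv ((pieceIso h hS hne ψ p.1).iso.symm.toEquiv a)) = g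
  rw [Iso.apply_symm_apply]
  exact ha

theorem recon_wire (q : γ.IntLine) (i : Fin (((decomp h hS hne ψ).chain q).length + 1)) :
    recon h hS hne ψ ((decomp h hS hne ψ).att ((decomp h hS hne ψ).tgt q i)) =
      Γ.partner (recon h hS hne ψ ((decomp h hS hne ψ).att ((decomp h hS hne ψ).src q i))) := by
  rw [recon_att, recon_att, pos_src, pos_tgt]

theorem recon_line {p p' : (decomp h hS hne ψ).GlueHE}
    (hpp : (decomp h hS hne ψ).glue.line.r p p') :
    Γ.line.r (recon h hS hne ψ p) (recon h hS hne ψ p') := by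
  rcases (decomp h hS hne ψ).glue_line_iff.1 hpp with
    ⟨x, a, b, rfl, rfl, h1⟩ | ⟨q, i, rfl, rfl⟩ | ⟨q, i, rfl, rfl⟩
  · rcases target_line_iff h hS hne ψ |>.1 (((pieceIso h hS hne ψ x).iso.line_iff a b).1 h1) with
      h2 | ⟨-, -, h2⟩
    · exact Quotient.exact (congrArg (Quotient.mk Γ.line) h2)
    · exact h2
  · rw [recon_wire]
    exact line_partner _
  · rw [recon_wire]
    exact Γ.line.iseqv.symm (line_partner _)

theorem recon_line_mem {p : (decomp h hS hne ψ).GlueHE} {g : Γ.HE}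
    (hg : Γ.line.r (recon h hS hne ψ p) g) :
    ∃ p', recon h hS hne ψ p' = g ∧ (decomp h hS hne ψ).glue.line.r p p' := by
  have hL : γ.LineLE := ψ.symm.lineLE (contract_lineLE h hS hne)
  by_cases hp : p ∈ (decomp h hS hne ψ).inner
  · have hpS := (recon_mem_iff h hS hne ψ p).2 hp
    have h1 : (Γ.lineOn S).r (recon h hS hne ψ p) g :=
      Or.inr ⟨hpS, hS.line_closed _ _ hg hpS, hg⟩
    obtain ⟨b, rfl⟩ := exists_recon_of_mk h hS hne ψ (lineOn_le_compRel S h1)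
    exact ⟨_, rfl, (decomp h hS hne ψ).line_of_piece
      (((pieceIso h hS hne ψ p.1).iso.line_iff _ _).2 ((target_line_iff h hS hne ψ).2 h1))⟩
  · obtain ⟨r, rfl⟩ := (decomp h hS hne ψ).not_inner_iff.1 hp
    rcases Insertion.prong_cases hL r with ⟨d, hd, rfl⟩ | ⟨q, i, rfl⟩ | ⟨q, i, rfl⟩
    · refine ⟨_, ?_, (decomp h hS hne ψ).glue.line.iseqv.refl _⟩
      rw [recon_att, pos_pr] at hg ⊢
      exact ((base_isLeg_iff h hS hne ψ d).2 hd g hg).symm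
    · rcases h.lineLE.line_iff.1 hg with rfl | rfl
      · exact ⟨_, rfl, (decomp h hS hne ψ).glue.line.iseqv.refl _⟩
      · exact ⟨_, recon_wire h hS hne ψ q i, (decomp h hS hne ψ).line_wire q i⟩
    · rcases h.lineLE.line_iff.1 hg with rfl | rfl
      · exact ⟨_, rfl, (decomp h hS hne ψ).glue.line.iseqv.refl _⟩
      · refine ⟨_, ?_, (decomp h hS hne ψ).glue.line.iseqv.symm
          ((decomp h hS hne ψ).line_wire q i)⟩
        rw [recon_wire, h.lineLE.partner_partner]

/-- The image is nonempty and closed under vertices and lines of the connected graph `Γ`. -/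
theorem recon_surjective : Function.Surjective (recon h hS hne ψ) := by
  obtain ⟨d, -⟩ := contract_exists_internal h hS hne
  intro g
  refine vert_bot_of_cut h.connected (c := fun g => ∃ p, recon h hS hne ψ p = g)
    (a := recon h hS hne ψ ((decomp h hS hne ψ).att
      ((decomp h hS hne ψ).pr (ψ.symm.toEquiv d)))) ⟨_, rfl⟩ ?_ ?_ g
  · rintro _ b hab ⟨p, rfl⟩
    obtain ⟨b, hb⟩ := exists_recon_of_mk h hS hne ψ (vert_le_compRel S hab)
    exact ⟨_, hb⟩
  · rintro _ b hab ⟨p, rfl⟩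
    obtain ⟨p', hp', -⟩ := recon_line_mem h hS hne ψ hab
    exact ⟨p', hp'⟩

/-- The graph is the result of the insertion of its subgraph into the contracted graph. -/
def decompIso : Iso (decomp h hS hne ψ).glue Γ where
  toEquiv := Equiv.ofBijective (recon h hS hne ψ)
    ⟨recon_injective h hS hne ψ, recon_surjective h hS hne ψ⟩
  vert_iff := by
    have key : ∀ x a b, (decomp h hS hne ψ).glue.vert.r ⟨x, a⟩ ⟨x, b⟩ ↔
        Γ.vert.r (recon h hS hne ψ ⟨x, a⟩) (recon h hS hne ψ ⟨x, b⟩) := fun x a b =>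
      ((decomp h hS hne ψ).glue_vert_mk).trans
        (((pieceIso h hS hne ψ x).iso.vert_iff a b).trans (target_vert_iff h hS hne ψ))
    rintro ⟨x, a⟩ ⟨y, b⟩
    constructor
    · intro hab
      obtain rfl : x = y := (decomp h hS hne ψ).glue_vert_site hab
      exact (key x a b).1 hab
    · intro hab
      have h1 : Quotient.mk (Γ.compRel S) (recon h hS hne ψ ⟨x, a⟩) =
          Quotient.mk (Γ.compRel S) (recon h hS hne ψ ⟨y, b⟩) :=
        Quotient.sound (vert_le_compRel S hab)
      rw [mk_recon, mk_recon] at h1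
      obtain rfl : x = y := siteComp_injective h hS hne ψ h1
      exact (key x a b).2 hab
  line_iff p p' := by
    refine ⟨recon_line h hS hne ψ, fun hpp => ?_⟩
    obtain ⟨p'', h1, h2⟩ := recon_line_mem h hS hne ψ (p := p) hpp
    rwa [recon_injective h hS hne ψ h1] at h2

theorem decompIso_edgeSet : Insertion.edgeSet (decompIso h hS hne ψ) = S := by
  ext g
  obtain ⟨p, rfl⟩ := Insertion.exists_rep (decompIso h hS hne ψ) g
  rw [Insertion.mem_edgeSet]
  exact (recon_mem_iff h hS hne ψ p).symm

theorem decompIso_pr (d : γ.HE) : (decompIso h hS hne ψ).toEquiv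
    ((decomp h hS hne ψ).att ((decomp h hS hne ψ).pr d)) = base ψ d :=
  (recon_att h hS hne ψ ((decomp h hS hne ψ).pr d)).trans (pos_pr h hS hne ψ d)

end Decompose

/-- `Γ` is the result of an insertion into its cograph, so the descent of the 1PI property from the
result applies. -/
theorem contract_isOnePI (h : Γ.IsOnePI) (hS : Γ.IsSubgraph S) (hne : S ≠ Γ.internal) :
    (Γ.contract S).IsOnePI :=
  Insertion.isOnePI_of_glue (contract_lineLE h hS hne)
    (contract_three_le_valence h hS hne) (contract_exists_internal h hS hne)
    ((decompIso h hS hne (Iso.refl _)).symm.isOnePI h)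

end PreGraph

/-! ### Isomorphisms that fix the legs, and classes of labelled graphs -/

namespace Legged.Iso

variable {P : Type} {G K M : Legged P}

def refl (G : Legged P) : Legged.Iso G G := ⟨PreGraph.Iso.refl _, fun _ => rfl⟩

def symm (f : Legged.Iso G K) : Legged.Iso K G :=
  ⟨f.iso.symm, fun p => by rw [← f.fix p]; exact f.iso.toEquiv.symm_apply_apply _⟩

def trans (f : Legged.Iso G K) (g : Legged.Iso K M) : Legged.Iso G M :=
  ⟨f.iso.trans g.iso, fun p => by rw [← g.fix p, ← f.fix p]; rfl⟩

theorem ext_apply {f g : Legged.Iso G K} (h : ∀ a, f.iso.toEquiv a = g.iso.toEquiv a) : f = g := by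
  obtain ⟨f, hf⟩ := f
  obtain ⟨g, hg⟩ := g
  obtain rfl : f = g := PreGraph.Iso.ext_toEquiv (Equiv.ext h)
  rfl

instance : Finite (Legged.Iso G K) :=
  Finite.of_injective (fun f => f.iso) fun f g h => ext_apply fun a => by
    change f.iso = g.iso at h
    rw [h]

theorem card_congr (f : Legged.Iso G K) : Nat.card (Legged.Iso G M) = Nat.card (Legged.Iso K M) :=
  Nat.card_congr ⟨fun g => f.symm.trans g, fun g => f.trans g,
    fun g => ext_apply fun a => congrArg g.iso.toEquiv (f.iso.symm_apply_apply a),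
    fun g => ext_apply fun a => congrArg g.iso.toEquiv (f.iso.apply_symm_apply a)⟩

theorem card_congr_right (f : Legged.Iso G K) :
    Nat.card (Legged.Iso M G) = Nat.card (Legged.Iso M K) :=
  Nat.card_congr ⟨fun g => g.trans f, fun g => g.trans f.symm,
    fun g => ext_apply fun a => f.iso.symm_apply_apply _,
    fun g => ext_apply fun a => f.iso.apply_symm_apply _⟩

end Legged.Iso

namespace LGraph

variable {P : Type}

/-- The class of a labelled graph. -/
def mk (G : Legged P) (h : G.graph.IsOnePI) : LGraph P := Quotient.mk (leggedSetoid P) ⟨G, h⟩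

theorem mk_eq_mk {G K : Legged P} {hG : G.graph.IsOnePI} {hK : K.graph.IsOnePI} :
    mk G hG = mk K hK ↔ Nonempty (Legged.Iso G K) :=
  ⟨fun h => Quotient.exact h, fun h => Quotient.sound h⟩

theorem mk_rep (q : LGraph P) : mk q.rep q.rep_onePI = q := Quotient.out_eq q

/-- A representative is isomorphic to the graph. -/
def repIso (G : Legged P) (h : G.graph.IsOnePI) : Legged.Iso (mk G h).rep G :=
  (mk_rep_iso G h).some

theorem eq_of_iso {q q' : LGraph P} (h : Nonempty (Legged.Iso q.rep q'.rep)) : q = q' := by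
  rw [← mk_rep q, ← mk_rep q']
  exact mk_eq_mk.2 h

end LGraph

theorem sum_eq_sum_card_fiber {A B M : Type*} [Fintype A] [Fintype B] [AddCommMonoid M]
    (f : A → B) (g : B → M) : ∑ a, g (f a) = ∑ b, Nat.card {a // f a = b} • g b := by
  classical
  rw [← Finset.sum_fiberwise' Finset.univ f g]
  refine Finset.sum_congr rfl fun b _ => ?_
  rw [Finset.sum_const, Nat.card_eq_fintype_card, Fintype.card_subtype]

/-! ### An insertion is determined by its result with marked half-edges -/

namespace PreGraph.Insertion

variable {γ : PreGraph} {D D' : γ.Insertion}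

section Unique

variable (α : Iso D.glue D'.glue) (hi : ∀ p : D.GlueHE, α.toEquiv p ∈ D'.inner ↔ p ∈ D.inner)
  (hp : ∀ d, α.toEquiv (D.att (D.pr d)) = D'.att (D'.pr d))

/-- The image of a half-edge of the glued graph. -/
def app (p : D.GlueHE) : D'.GlueHE := α.toEquiv p

theorem app_injective : Function.Injective (app α) := α.toEquiv.injective
theorem app_surjective : Function.Surjective (app α) := α.toEquiv.surjective

include hi

theorem app_mem_inner {p : D.GlueHE} : app α p ∈ D'.inner ↔ p ∈ D.inner := hi p

theorem app_site {p p' : D.GlueHE} : (app α p).1 = (app α p').1 ↔ p.1 = p'.1 := by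
  have h1 : edgeSet α = edgeSet (Iso.refl D'.glue) := by
    ext g
    obtain ⟨p, rfl⟩ := exists_rep α g
    rw [mem_edgeSet, ← hi]
    exact (mem_edgeSet (Iso.refl D'.glue)).symm
  have h2 := compRel_edgeSet α (p := p) (p' := p')
  rw [h1] at h2
  exact (compRel_edgeSet (Iso.refl D'.glue)).symm.trans h2

/-- An isomorphism that respects inner half-edges carries components of the inserted subgraph to
components, hence sites to sites; one known prong tells which site is the image. -/
theorem exists_piece_iso (x : D.Site) (x' : D'.Site) (f : D.SiteProng x → D'.SiteProng x')
    (hf : ∀ r, app α (D.att ⟨x, r⟩) = D'.att ⟨x', f r⟩) :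
    ∃ β : Iso (D.piece x).graph (D'.piece x').graph,
      (∀ a, app α ⟨x, a⟩ = ⟨x', β.toEquiv a⟩) ∧
      ∀ r, β.toEquiv ((D.piece x).leg r).1 = ((D'.piece x').leg (f r)).1 := by
  have h1 : ∀ a, ∃ b, app α ⟨x, a⟩ = ⟨x', b⟩ := by
    intro a
    have h2 : (app α ⟨x, a⟩).1 = (app α (D.att ⟨x, Classical.arbitrary _⟩)).1 :=
      (app_site α hi (p := ⟨x, a⟩) (p' := D.att ⟨x, Classical.arbitrary _⟩)).2 rfl
    rw [hf] at h2
    generalize app α ⟨x, a⟩ = p at h2 ⊢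
    obtain ⟨y, b⟩ := p
    obtain rfl : y = x' := h2
    exact ⟨b, rfl⟩
  choose g hg using h1
  have hgl : ∀ a, (D'.piece x').graph.IsLeg (g a) ↔ (D.piece x).graph.IsLeg a := fun a => by
    have := app_mem_inner α hi (p := ⟨x, a⟩)
    rw [hg] at this
    exact not_iff_not.1 this
  refine ⟨⟨Equiv.ofBijective g ⟨fun a b hab => ?_, fun b => ?_⟩, fun a b => ?_, fun a b => ?_⟩,
    hg, fun r => ?_⟩
  · have : app α ⟨x, a⟩ = app α ⟨x, b⟩ := by rw [hg, hg, hab]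
    exact eq_of_heq (Sigma.mk.inj (app_injective α this)).2
  · obtain ⟨⟨y, c⟩, hc⟩ := app_surjective α ⟨x', b⟩
    obtain rfl : y = x := (app_site α hi (p := ⟨y, c⟩) (p' := D.att ⟨x, Classical.arbitrary _⟩)).1
      (by rw [hc, hf]; rfl)
    exact ⟨c, eq_of_heq (Sigma.mk.inj ((hg c).symm.trans hc)).2⟩
  · have h2 := α.vert_iff (⟨x, a⟩ : D.GlueHE) (⟨x, b⟩ : D.GlueHE)
    change D.glue.vert.r ⟨x, a⟩ ⟨x, b⟩ ↔ D'.glue.vert.r (app α ⟨x, a⟩) (app α ⟨x, b⟩) at h2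
    rw [hg, hg, glue_vert_mk, glue_vert_mk] at h2
    exact h2
  · by_cases ha : (D.piece x).graph.IsLeg a
    · constructor
      · intro h
        rw [ha b h]
      · intro h
        have h2 : g b = g a := (hgl a).2 ha _ h
        have : app α ⟨x, b⟩ = app α ⟨x, a⟩ := by rw [hg, hg, h2]
        have h3 : b = a := eq_of_heq (Sigma.mk.inj (app_injective α this)).2
        exact h3 ▸ (D.piece x).graph.line.iseqv.refl _
    · have h2 := α.line_iff (⟨x, a⟩ : D.GlueHE) (⟨x, b⟩ : D.GlueHE)
      change D.glue.line.r ⟨x, a⟩ ⟨x, b⟩ ↔ D'.glue.line.r (app α ⟨x, a⟩) (app α ⟨x, b⟩) at h2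
      rw [hg, hg, D.line_mk_iff ha, D'.line_mk_iff ((hgl a).not.2 ha)] at h2
      exact h2
  · exact eq_of_heq (Sigma.mk.inj ((hg _).symm.trans (hf r))).2

include hp

/-- Induction along the line. If the source of a wire goes to the corresponding source, the other
end of that wire follows. It cannot be the second end of the line of `γ`, since those positions are
fixed, so the other chain continues as well and the entrance of its next graph is hit. The only
remaining prong at that site is the exit, the source of the next wire. -/
theorem app_chain (q : γ.IntLine) (n : ℕ) : ∀ h : n < (D.chain q).length + 1,
    ∃ h' : n < (D'.chain q).length + 1,
      app α (D.att (D.src q ⟨n, h⟩)) = D'.att (D'.src q ⟨n, h'⟩) ∧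
      ∀ j : Fin (D.chain q).length, j.1 + 1 = n → ∃ j' : Fin (D'.chain q).length, j'.1 = j.1 ∧
        ∀ b : Bool, app α (D.att ⟨Sum.inr ⟨q, j⟩, b⟩) = D'.att ⟨Sum.inr ⟨q, j'⟩, b⟩ := by
  induction n with
  | zero =>
    intro h
    exact ⟨Nat.succ_pos _, hp _, fun j hj => absurd hj (Nat.succ_ne_zero _)⟩
  | succ n ih =>
    intro h
    obtain ⟨h1', h1, -⟩ := ih (by omega)
    have hn : n < (D.chain q).length := by omega
    have hne : D.att (D.tgt q ⟨n, by omega⟩) ≠ D.att (D.src q ⟨n, by omega⟩) := fun h =>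
      D.src_ne_tgt _ _ _ _ (D.att_injective h).symm
    have hw : D'.glue.line.r (app α (D.att (D.src q ⟨n, by omega⟩)))
        (app α (D.att (D.tgt q ⟨n, by omega⟩))) := (α.line_iff _ _).1 (D.line_wire q _)
    have h2 : app α (D.att (D.tgt q ⟨n, by omega⟩)) = D'.att (D'.tgt q ⟨n, h1'⟩) := by
      rw [h1] at hw
      rcases D'.line_att_src.1 hw with h3 | h3
      · exact absurd (app_injective α (h3.trans h1.symm)) hne
      · exact h3
    have ht : D.tgt q ⟨n, by omega⟩ = ⟨Sum.inr ⟨q, ⟨n, hn⟩⟩, false⟩ := D.tgt_castSucc q ⟨n, hn⟩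
    have hn' : n < (D'.chain q).length := by
      by_contra hcon
      have hl : (⟨n, h1'⟩ : Fin ((D'.chain q).length + 1)) = Fin.last _ :=
        Fin.ext (by simp only [Fin.val_last]; omega)
      rw [hl, tgt_last, ← hp, ht] at h2
      have h3 := D.att_injective (app_injective α h2)
      exact absurd (congrArg Sigma.fst h3) Sum.inr_ne_inl
    have ht' : D'.tgt q ⟨n, h1'⟩ = ⟨Sum.inr ⟨q, ⟨n, hn'⟩⟩, false⟩ := D'.tgt_castSucc q ⟨n, hn'⟩
    have hf : app α (D.att ⟨Sum.inr ⟨q, ⟨n, hn⟩⟩, false⟩) =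
        D'.att ⟨Sum.inr ⟨q, ⟨n, hn'⟩⟩, false⟩ := by rw [← ht, ← ht', h2]
    have ht : app α (D.att ⟨Sum.inr ⟨q, ⟨n, hn⟩⟩, true⟩) =
        D'.att ⟨Sum.inr ⟨q, ⟨n, hn'⟩⟩, true⟩ := by
      obtain ⟨⟨x, r⟩, hr⟩ := D'.not_inner_iff.1 ((app_mem_inner α hi).not.2
        (D.not_inner_iff.2 ⟨⟨Sum.inr ⟨q, ⟨n, hn⟩⟩, true⟩, rfl⟩))
      have hx : x = Sum.inr ⟨q, ⟨n, hn'⟩⟩ := by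
        have h4 := (app_site α hi (p := D.att ⟨Sum.inr ⟨q, ⟨n, hn⟩⟩, true⟩)
          (p' := D.att ⟨Sum.inr ⟨q, ⟨n, hn⟩⟩, false⟩)).2 rfl
        rw [hr, hf] at h4
        exact h4
      subst hx
      have hr' : ∀ b : Bool, app α (D.att ⟨Sum.inr ⟨q, ⟨n, hn⟩⟩, true⟩) =
          D'.att ⟨Sum.inr ⟨q, ⟨n, hn'⟩⟩, b⟩ → app α (D.att ⟨Sum.inr ⟨q, ⟨n, hn⟩⟩, true⟩) =
          D'.att ⟨Sum.inr ⟨q, ⟨n, hn'⟩⟩, true⟩ := by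
        intro b hb
        cases b
        · have h5 := D.att_injective (app_injective α (hb.trans hf.symm))
          have h6 : (true : Bool) = false := eq_of_heq (Sigma.mk.inj h5).2
          exact Bool.noConfusion h6
        · exact hb
      exact hr' r hr
    refine ⟨by omega, ht, fun j hj => ⟨⟨n, hn'⟩, by simp only; omega, fun b => ?_⟩⟩
    obtain rfl : j = ⟨n, hn⟩ := Fin.ext (by simp only; omega)
    cases b
    · exact hf
    · exact ht

theorem chain_length_le (q : γ.IntLine) : (D.chain q).length ≤ (D'.chain q).length := by
  obtain ⟨h, -⟩ := app_chain α hi hp q (D.chain q).length (Nat.lt_succ_self _)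
  omega

theorem vtx_eq (v : γ.Vertex) : D.vtx v = D'.vtx v := by
  obtain ⟨β, -, hβ⟩ := exists_piece_iso α hi (Sum.inl v) (Sum.inl v) id (by
    intro r
    have h1 := D.inl_prong v r
    have h2 := D'.inl_prong v r
    rw [h1]
    exact (hp _).trans (congrArg D'.att h2.symm))
  cases h : D.vtx v with
  | none =>
    cases h' : D'.vtx v with
    | none => rfl
    | some q' =>
      have : (D'.piece (Sum.inl v)).graph.IsOnePI := by
        rw [D'.piece_some h']
        exact q'.rep_onePI
      obtain ⟨d, hd⟩ := (β.symm.isOnePI this).exists_internal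
      revert d
      rw [D.piece_none h]
      exact fun d hd => absurd (corolla_isLeg d) hd
  | some q =>
    have hq : (D.piece (Sum.inl v)).graph.IsOnePI := by
      rw [D.piece_some h]
      exact q.rep_onePI
    cases h' : D'.vtx v with
    | none =>
      obtain ⟨d, hd⟩ := (β.isOnePI hq).exists_internal
      revert d
      rw [D'.piece_none h']
      exact fun d hd => absurd (corolla_isLeg d) hd
    | some q' =>
      have key : Nonempty (Legged.Iso (P := γ.Prong v) (D.piece (Sum.inl v))
          (D'.piece (Sum.inl v))) := ⟨⟨β, hβ⟩⟩
      rw [D.piece_some h, D'.piece_some h'] at key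
      rw [LGraph.eq_of_iso key]

end Unique

/-- The isomorphism respects sites and the order along each line, so it restricts to leg-preserving
isomorphisms of corresponding pieces. Its inverse is needed only to see that chains have equal
length. -/
theorem eq_of_iso (α : Iso D.glue D'.glue)
    (hi : ∀ p : D.GlueHE, α.toEquiv p ∈ D'.inner ↔ p ∈ D.inner)
    (hp : ∀ d, α.toEquiv (D.att (D.pr d)) = D'.att (D'.pr d)) : D = D' := by
  have hi' : ∀ p : D'.GlueHE, α.symm.toEquiv p ∈ D.inner ↔ p ∈ D'.inner := by
    intro p
    obtain ⟨p, rfl⟩ := app_surjective α p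
    rw [app_mem_inner α hi]
    have : α.symm.toEquiv (app α p) = p := α.symm_apply_apply p
    rw [this]
    exact Iff.rfl
  have hp' : ∀ d, α.symm.toEquiv (D'.att (D'.pr d)) = D.att (D.pr d) := by
    intro d
    rw [← hp]
    exact α.symm_apply_apply _
  have hv : D.vtx = D'.vtx := funext fun v => vtx_eq α hi hp v
  have hc : D.chain = D'.chain := by
    funext q
    refine List.ext_getElem (le_antisymm (chain_length_le α hi hp q)
      (chain_length_le α.symm hi' hp' q)) fun i h h' => ?_
    obtain ⟨-, -, hj⟩ := app_chain α hi hp q (i + 1) (by omega)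
    obtain ⟨j', hj', hb⟩ := hj ⟨i, h⟩ rfl
    obtain rfl : j' = ⟨i, h'⟩ := Fin.ext hj'
    obtain ⟨β, -, hβ⟩ := exists_piece_iso α hi (Sum.inr ⟨q, ⟨i, h⟩⟩) (Sum.inr ⟨q, ⟨i, h'⟩⟩) id hb
    exact LGraph.eq_of_iso ⟨⟨β, hβ⟩⟩
  cases D
  cases D'
  cases hv
  cases hc
  rfl

/-! ### Automorphisms that fix the insertion -/

section Aut

theorem app_att (α : Iso D.glue D.glue) (hi : ∀ p : D.GlueHE, α.toEquiv p ∈ D.inner ↔ p ∈ D.inner)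
    (hp : ∀ d, α.toEquiv (D.att (D.pr d)) = D.att (D.pr d)) (r : Σ x, D.SiteProng x) :
    app α (D.att r) = D.att r := by
  rcases r with ⟨v | ⟨q, j⟩, r⟩
  · rw [inl_prong]
    exact hp _
  · obtain ⟨-, -, h⟩ := app_chain α hi hp q (j.1 + 1) (by omega)
    obtain ⟨j', hj', hb⟩ := h j rfl
    obtain rfl : j' = j := Fin.ext hj'
    exact hb r

variable (β : ∀ x, Legged.Iso (D.piece x) (D.piece x))

/-- Automorphisms of the pieces act on the glued graph. -/
def glueMap (p : D.GlueHE) : D.GlueHE := ⟨p.1, (β p.1).iso.toEquiv p.2⟩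

theorem glueMap_att (r : Σ x, D.SiteProng x) : glueMap β (D.att r) = D.att r :=
  congrArg (Sigma.mk r.1) ((β r.1).fix r.2)

theorem glueMap_line {p p' : D.GlueHE} (h : D.glue.line.r p p') :
    D.glue.line.r (glueMap β p) (glueMap β p') := by
  rcases D.glue_line_iff.1 h with ⟨x, a, b, rfl, rfl, h1⟩ | ⟨q, i, rfl, rfl⟩ | ⟨q, i, rfl, rfl⟩
  · exact D.line_of_piece (((β x).iso.line_iff a b).1 h1)
  · rw [glueMap_att, glueMap_att]
    exact D.line_wire q i
  · rw [glueMap_att, glueMap_att]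
    exact D.glue.line.iseqv.symm (D.line_wire q i)

theorem glueMap_vert {p p' : D.GlueHE} (h : D.glue.vert.r p p') :
    D.glue.vert.r (glueMap β p) (glueMap β p') := by
  obtain ⟨x, a⟩ := p
  obtain ⟨y, b⟩ := p'
  obtain rfl : x = y := D.glue_vert_site h
  exact D.glue_vert_mk.2 (((β x).iso.vert_iff a b).1 (D.glue_vert_mk.1 h))

theorem glueMap_symm (p : D.GlueHE) : glueMap (fun x => (β x).symm) (glueMap β p) = p :=
  congrArg (Sigma.mk p.1) ((β p.1).iso.symm_apply_apply p.2)

theorem glueMap_symm' (p : D.GlueHE) : glueMap β (glueMap (fun x => (β x).symm) p) = p :=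
  congrArg (Sigma.mk p.1) ((β p.1).iso.apply_symm_apply p.2)

/-- Automorphisms of the pieces give an automorphism of the glued graph. -/
def glueAut : Iso D.glue D.glue where
  toEquiv := ⟨glueMap β, glueMap fun x => (β x).symm, glueMap_symm β, glueMap_symm' β⟩
  vert_iff p p' := ⟨glueMap_vert β, fun h => by
    have h1 := glueMap_vert (fun x => (β x).symm) (p := glueMap β p) (p' := glueMap β p') h
    have h2 : glueMap (fun x => (β x).symm) (glueMap β p) = p := glueMap_symm β p
    have h3 : glueMap (fun x => (β x).symm) (glueMap β p') = p' := glueMap_symm β p'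
    rw [h2, h3] at h1
    exact h1⟩
  line_iff p p' := ⟨glueMap_line β, fun h => by
    have h1 := glueMap_line (fun x => (β x).symm) (p := glueMap β p) (p' := glueMap β p') h
    have h2 : glueMap (fun x => (β x).symm) (glueMap β p) = p := glueMap_symm β p
    have h3 : glueMap (fun x => (β x).symm) (glueMap β p') = p' := glueMap_symm β p'
    rw [h2, h3] at h1
    exact h1⟩

theorem glueMap_mem_inner (p : D.GlueHE) : glueMap β p ∈ D.inner ↔ p ∈ D.inner :=
  ((β p.1).iso.isLeg_iff p.2).not

variable {Γ : PreGraph}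

variable (D) in
/-- The product of the symmetry factors of the inserted graphs. -/
def symProd : ℕ := ∏ᶠ x, Nat.card (Legged.Iso (D.piece x) (D.piece x))

theorem symProd_pos : 0 < D.symProd := by
  classical
  have := Fintype.ofFinite D.Site
  rw [symProd, finprod_eq_prod_of_fintype]
  refine Finset.prod_pos fun x _ => ?_
  have : Nonempty (Legged.Iso (D.piece x) (D.piece x)) := ⟨Legged.Iso.refl _⟩
  exact Nat.card_pos

/-- The identifications of the result of an insertion with a graph, for a given subgraph and a
given identification of the contracted graph. -/
theorem card_identifications (φ0 : Iso D.glue Γ) :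
    Nat.card {φ : Iso D.glue Γ // edgeSet φ = edgeSet φ0 ∧
      ∀ d, φ.toEquiv (D.att (D.pr d)) = φ0.toEquiv (D.att (D.pr d))} = D.symProd := by
  classical
  have := Fintype.ofFinite D.Site
  rw [symProd, finprod_eq_prod_of_fintype, ← Nat.card_pi]
  symm
  -- Two such identifications differ by an automorphism of the glued graph that fixes every prong
  -- and preserves every piece, that is, by one leg-fixing automorphism for each piece.
  refine Nat.card_congr (Equiv.ofBijective (fun β => ⟨(glueAut β).trans φ0, ?_, ?_⟩) ⟨?_, ?_⟩)
  · ext g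
    obtain ⟨p, rfl⟩ := exists_rep ((glueAut β).trans φ0) g
    rw [mem_edgeSet]
    have : ((glueAut β).trans φ0).toEquiv p = φ0.toEquiv (glueMap β p) := rfl
    rw [this, mem_edgeSet, glueMap_mem_inner]
  · intro d
    exact congrArg φ0.toEquiv (glueMap_att β _)
  · intro β β' h
    funext x
    refine Legged.Iso.ext_apply fun a => ?_
    have h1 := congrArg (fun φ => φ.1.toEquiv ⟨x, a⟩) h
    have h2 : glueMap β ⟨x, a⟩ = glueMap β' ⟨x, a⟩ := φ0.toEquiv.injective h1
    exact eq_of_heq (Sigma.mk.inj h2).2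
  · rintro ⟨φ, hφ, hp⟩
    let α : Iso D.glue D.glue := φ.trans φ0.symm
    have hα : ∀ p : D.GlueHE, φ0.toEquiv (app α p) = φ.toEquiv p := fun p =>
      φ0.apply_symm_apply _
    have hi : ∀ p : D.GlueHE, α.toEquiv p ∈ D.inner ↔ p ∈ D.inner := by
      intro p
      rw [← mem_edgeSet φ, ← hα, hφ, mem_edgeSet]
      rfl
    have hp' : ∀ d, α.toEquiv (D.att (D.pr d)) = D.att (D.pr d) := by
      intro d
      exact φ0.toEquiv.injective ((hα _).trans (hp d))
    have hex := fun x => exists_piece_iso α hi x x id fun r => app_att α hi hp' ⟨x, r⟩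
    choose β hβ hβ' using hex
    refine ⟨fun x => ⟨β x, hβ' x⟩, Subtype.ext (Iso.ext_toEquiv (Equiv.ext fun p => ?_))⟩
    change φ0.toEquiv (glueMap (fun x => ⟨β x, hβ' x⟩) p) = φ.toEquiv p
    refine Eq.trans ?_ (hα p)
    exact congrArg φ0.toEquiv (hβ p.1 p.2).symm

end Aut

end PreGraph.Insertion

/-! ### Double counting of insertions and subgraphs -/

namespace Legged

variable {P : Type} {γ Γ : Legged P}

/-- The result of an insertion, with its external legs. -/
def glue (γ : Legged P) (hL : γ.graph.LineLE) (D : γ.graph.Insertion) : Legged P :=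
  ⟨D.glue, γ.leg.trans (D.glueLegEquiv hL)⟩

/-- The proper subgraphs, the empty one included. -/
def Sub (Γ : Legged P) : Type := {S // Γ.graph.IsSubgraph S ∧ S ≠ Γ.graph.internal}

instance : Finite Γ.Sub := inferInstanceAs (Finite (Subtype _))

variable (h : Γ.graph.IsOnePI)

/-- The contracted graph, with its external legs. -/
def contract (h : Γ.graph.IsOnePI) (S : Γ.Sub) : Legged P where
  graph := Γ.graph.contract S.1
  leg := Equiv.ofBijective
    (fun p => ⟨⟨(Γ.leg p).1, fun hp => S.2.1.subset_internal hp (Γ.leg p).2, fun h2 =>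
      PreGraph.not_isLeg_of_isTwo h S.2.1 S.2.2
        (fun hp => S.2.1.subset_internal hp (Γ.leg p).2) h2 (Γ.leg p).2⟩,
      (PreGraph.contract_isLeg_iff h S.2.1 S.2.2 _).2 (Γ.leg p).2⟩) <| by
    constructor
    · intro p q hpq
      exact Γ.leg.injective (Subtype.ext (congrArg (fun l => PreGraph.ofContract l.1) hpq))
    · rintro ⟨d, hd⟩
      obtain ⟨p, hp⟩ := Γ.leg.surjective
        ⟨PreGraph.ofContract d, (PreGraph.contract_isLeg_iff h S.2.1 S.2.2 _).1 hd⟩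
      have h1 : (Γ.leg p).1 = PreGraph.ofContract d := congrArg Subtype.val hp
      exact ⟨p, Subtype.ext (PreGraph.ofContract_injective h1)⟩

/-- The class of the contracted graph. -/
def quotient (S : Γ.Sub) : LGraph P :=
  LGraph.mk (contract h S) (PreGraph.contract_isOnePI h S.2.1 S.2.2)

/-- A graph together with an insertion into it. -/
abbrev InsPair (P : Type) : Type 1 := Σ q : LGraph P, q.rep.graph.Insertion

/-- The result of an insertion. -/
def InsPair.result (v : InsPair P) : Legged P := v.1.rep.glue v.1.rep_onePI.lineLE v.2

/-- Subgraphs with an identification of the contracted graph. -/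
def Contr (h : Γ.graph.IsOnePI) : Type 1 :=
  Σ q : LGraph P, Σ S : Γ.Sub, Legged.Iso q.rep (contract h S)

/-- Subgraphs with an identification of the contracted graph with a representative. -/
def contrMk (x : Σ S : Γ.Sub, Legged.Iso (quotient h S).rep (contract h S)) : Contr h :=
  ⟨quotient h x.1, x.1, x.2⟩

theorem contrMk_bijective : Function.Bijective (contrMk h) := by
  constructor
  · rintro ⟨S, ψ⟩ ⟨S', ψ'⟩ hx
    have h1 : S = S' := congrArg (fun x : Contr h => x.2.1) hx
    subst h1
    have h2 := eq_of_heq (Sigma.mk.inj hx).2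
    have h3 := eq_of_heq (Sigma.mk.inj h2).2
    exact congrArg (Sigma.mk S) h3
  · rintro ⟨q, S, ψ⟩
    have h1 : q = quotient h S := by
      rw [← LGraph.mk_rep q]
      exact LGraph.mk_eq_mk.2 ⟨ψ⟩
    subst h1
    exact ⟨⟨S, ψ⟩, rfl⟩

instance : Finite (Contr h) := Finite.of_surjective _ (contrMk_bijective h).2

/-- The half-edges of a contracted graph as half-edges of the graph. -/
def contrBase (x : Contr h) : Σ q : LGraph P, Set Γ.graph.HE × (q.rep.graph.HE → Γ.graph.HE) :=
  ⟨x.1, x.2.1.1, fun d => PreGraph.ofContract (x.2.2.iso.toEquiv d)⟩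

/-- The identifications for different subgraphs have different targets. Viewed as maps into the
half-edges of `Γ` they can be compared directly. -/
theorem contrBase_injective : Function.Injective (contrBase h) := by
  rintro ⟨q, ⟨S, hS⟩, ψ⟩ ⟨q', ⟨S', hS'⟩, ψ'⟩ hx
  have h1 : q = q' := congrArg Sigma.fst hx
  subst h1
  have h2 := eq_of_heq (Sigma.mk.inj hx).2
  have h3 : S = S' := congrArg Prod.fst h2
  subst h3
  have h4 : ψ = ψ' := Legged.Iso.ext_apply fun a =>
    PreGraph.ofContract_injective (congrFun (congrArg Prod.snd h2) a)
  rw [h4]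

/-- The insertion that gives back the graph. -/
def contrPair (x : Contr h) : InsPair P :=
  ⟨x.1, PreGraph.decomp h x.2.1.2.1 x.2.1.2.2 x.2.2.iso⟩

/-- The insertion that gives back the graph gives back the graph with its legs. -/
def contrIso (x : Contr h) : Legged.Iso (contrPair h x).result Γ :=
  ⟨PreGraph.decompIso h x.2.1.2.1 x.2.1.2.2 x.2.2.iso, fun p => by
    refine (PreGraph.decompIso_pr h x.2.1.2.1 x.2.1.2.2 x.2.2.iso _).trans ?_
    exact congrArg PreGraph.ofContract (x.2.2.fix p)⟩

/-- The subgraph that was inserted, with the identification of the contracted graph. -/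
def ofResult {v : InsPair P} (φ : Legged.Iso v.result Γ) : Contr h :=
  ⟨v.1, ⟨PreGraph.Insertion.edgeSet φ.iso, PreGraph.Insertion.isSubgraph_edgeSet φ.iso,
      PreGraph.Insertion.edgeSet_ne_internal φ.iso v.1.rep_onePI.exists_internal⟩,
    ⟨PreGraph.Insertion.contractIso φ.iso v.1.rep_onePI.three_le_valence v.1.rep_onePI.lineLE,
      fun p => PreGraph.ofContract_injective (φ.fix p)⟩⟩

theorem contrBase_ofResult {v : InsPair P} (φ : Legged.Iso v.result Γ) :
    contrBase h (ofResult h φ) = ⟨v.1, PreGraph.Insertion.edgeSet φ.iso,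
      fun d => φ.iso.toEquiv (v.2.att (v.2.pr d))⟩ := rfl

/-- The reconstructed insertion and the given one have results isomorphic to `Γ` with the same inner
half-edges and the same positions of the half-edges of the base graph, so
`PreGraph.Insertion.eq_of_iso` applies. -/
theorem contrPair_ofResult {v : InsPair P} (φ : Legged.Iso v.result Γ) :
    contrPair h (ofResult h φ) = v := by
  obtain ⟨q, D⟩ := v
  refine Sigma.ext rfl (heq_of_eq ?_)
  let ψ := PreGraph.decompIso h (ofResult h φ).2.1.2.1 (ofResult h φ).2.1.2.2
    (ofResult h φ).2.2.iso
  refine PreGraph.Insertion.eq_of_iso (ψ.trans φ.iso.symm) (fun p => ?_) fun d => ?_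
  · obtain ⟨p', hp'⟩ := PreGraph.Insertion.exists_rep φ.iso (ψ.toEquiv p)
    have h1 : (ψ.trans φ.iso.symm).toEquiv p = p' := by
      change φ.iso.symm.toEquiv (ψ.toEquiv p) = p'
      rw [← hp']
      exact PreGraph.Insertion.symm_apply_rep φ.iso p'
    refine (iff_of_eq (congrArg (· ∈ D.inner) h1)).trans ?_
    change p' ∈ D.inner ↔ _
    rw [← PreGraph.Insertion.mem_edgeSet φ.iso, hp']
    refine Iff.trans ?_ (PreGraph.Insertion.mem_edgeSet ψ (p := p))
    exact iff_of_eq (congrArg (ψ.toEquiv p ∈ ·) (PreGraph.decompIso_edgeSet h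
      (ofResult h φ).2.1.2.1 (ofResult h φ).2.1.2.2 (ofResult h φ).2.2.iso).symm)
  · have h1 : ψ.toEquiv _ = φ.iso.toEquiv (D.att (D.pr d)) :=
      PreGraph.decompIso_pr h (ofResult h φ).2.1.2.1 (ofResult h φ).2.1.2.2
        (ofResult h φ).2.2.iso d
    exact (congrArg φ.iso.symm.toEquiv h1).trans (PreGraph.Insertion.symm_apply_rep φ.iso _)

/-- Fixing the subgraph and the identification of its cograph leaves exactly the freedom counted in
`PreGraph.Insertion.card_identifications`. -/
theorem card_ofResult (x : Contr h) :
    Nat.card {φ : Legged.Iso (contrPair h x).result Γ // ofResult h φ = x} =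
      (contrPair h x).2.symProd := by
  have h0 : ∀ φ : Legged.Iso (contrPair h x).result Γ, ofResult h φ = x ↔
      PreGraph.Insertion.edgeSet φ.iso = PreGraph.Insertion.edgeSet (contrIso h x).iso ∧
      ∀ d, φ.iso.toEquiv ((contrPair h x).2.att ((contrPair h x).2.pr d)) =
        (contrIso h x).iso.toEquiv ((contrPair h x).2.att ((contrPair h x).2.pr d)) := by
    intro φ
    have h1 : contrBase h x = ⟨(contrPair h x).1,
        PreGraph.Insertion.edgeSet (contrIso h x).iso,
        fun d => (contrIso h x).iso.toEquiv
          ((contrPair h x).2.att ((contrPair h x).2.pr d))⟩ := by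
      refine Sigma.ext rfl (heq_of_eq (Prod.ext ?_ ?_))
      · exact (PreGraph.decompIso_edgeSet h x.2.1.2.1 x.2.1.2.2 x.2.2.iso).symm
      · funext d
        exact (PreGraph.decompIso_pr h x.2.1.2.1 x.2.1.2.2 x.2.2.iso d).symm
    rw [← (contrBase_injective h).eq_iff, contrBase_ofResult, h1]
    constructor
    · intro h2
      have h3 := eq_of_heq (Sigma.mk.inj h2).2
      exact ⟨congrArg Prod.fst h3, fun d => congrFun (congrArg Prod.snd h3) d⟩
    · rintro ⟨h2, h3⟩
      exact Sigma.ext rfl (heq_of_eq (Prod.ext h2 (funext h3)))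
  rw [← PreGraph.Insertion.card_identifications (contrIso h x).iso]
  refine Nat.card_congr ⟨fun φ => ⟨φ.1.iso, (h0 _).1 φ.2⟩, fun φ => ⟨⟨φ.1, fun p => ?_⟩, ?_⟩,
    fun φ => rfl, fun φ => rfl⟩
  · exact (φ.2.2 _).trans ((contrIso h x).fix p)
  · exact (h0 _).2 φ.2

/-- The insertions with a given result. -/
def Ins (Γ : Legged P) : Type 1 := {v : InsPair P // Nonempty (Legged.Iso v.result Γ)}

/-- The insertion that gives back the graph. -/
def toIns (x : Contr h) : Γ.Ins := ⟨contrPair h x, ⟨contrIso h x⟩⟩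

theorem toIns_surjective : Function.Surjective (toIns h) := by
  rintro ⟨v, ⟨φ⟩⟩
  exact ⟨ofResult h φ, Subtype.ext (contrPair_ofResult h φ)⟩

theorem finite_ins (h : Γ.graph.IsOnePI) : Finite Γ.Ins := Finite.of_surjective _ (toIns_surjective h)

/-- There are as many identifications of the result with `Γ` as automorphisms of `Γ`. Sorted by the
subgraph and the identification of the cograph that they induce, they fall into classes of size
`symProd`. -/
theorem card_toIns (v : Γ.Ins) :
    Nat.card (Legged.Iso Γ Γ) = v.1.2.symProd * Nat.card {x // toIns h x = v} := by
  classical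
  have := Fintype.ofFinite (Legged.Iso v.1.result Γ)
  have := Fintype.ofFinite {x // toIns h x = v}
  obtain ⟨φ0⟩ := v.2
  have h1 := sum_eq_sum_card_fiber (A := Legged.Iso v.1.result Γ) (B := {x // toIns h x = v})
    (fun φ => ⟨ofResult h φ, Subtype.ext (contrPair_ofResult h φ)⟩) (fun _ => (1 : ℕ))
  rw [← Legged.Iso.card_congr φ0, Nat.card_eq_fintype_card]
  rw [Finset.sum_const, Finset.card_univ, smul_eq_mul, mul_one] at h1
  rw [h1, Nat.card_eq_fintype_card, mul_comm, ← smul_eq_mul, ← Finset.card_univ,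
    ← Finset.sum_const]
  refine Finset.sum_congr rfl ?_
  rintro ⟨x, rfl⟩ -
  rw [smul_eq_mul, mul_one]
  refine Eq.trans ?_ (card_ofResult h x)
  refine Nat.card_congr (Equiv.subtypeEquivRight fun φ => ?_)
  exact Subtype.ext_iff

variable {M : Type*} [AddCommGroup M] [Module ℂ M]

theorem sym_pos (q : LGraph P) : 0 < q.sym := by
  have : Nonempty (Legged.Iso q.rep q.rep) := ⟨Legged.Iso.refl _⟩
  exact Nat.card_pos

/-- Insertions into all graphs with a given result correspond to the proper subgraphs of the
result. -/
theorem sum_ins (T : InsPair P → M) (T' : Γ.Sub → M) (hT : ∀ x : Contr h, T (contrPair h x) = T' x.2.1) :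
    ∑ᶠ v : Γ.Ins, ((v.1.1.sym : ℂ)⁻¹ * (v.1.2.symProd : ℂ)⁻¹) • T v.1 =
      (Nat.card (Legged.Iso Γ Γ) : ℂ)⁻¹ • ∑ᶠ S : Γ.Sub, T' S := by
  classical
  have := finite_ins h
  have := Fintype.ofFinite Γ.Ins
  have := Fintype.ofFinite Γ.Sub
  have := Fintype.ofFinite (Contr h)
  have := fun S : Γ.Sub => Fintype.ofFinite (Legged.Iso (quotient h S).rep (contract h S))
  rw [finsum_eq_sum_of_fintype, finsum_eq_sum_of_fintype]
  -- Pairs of a subgraph and an identification of its cograph are summed in two ways. Sorted by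
  -- insertion, `card_toIns` gives the multiplicity; sorted by subgraph, the number of
  -- identifications is the symmetry factor of the cograph and cancels its inverse.
  have h1 := sum_eq_sum_card_fiber (toIns h) (fun v => ((v.1.1.sym : ℂ)⁻¹) • T v.1)
  have h2 : ∑ x : Contr h, (((toIns h x).1.1.sym : ℂ)⁻¹) • T (toIns h x).1 = ∑ S : Γ.Sub, T' S := by
    rw [← (Equiv.ofBijective _ (contrMk_bijective h)).sum_comp, Fintype.sum_sigma]
    refine Finset.sum_congr rfl fun S _ => ?_
    have h3 : ∀ ψ : Legged.Iso (quotient h S).rep (contract h S),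
        (((toIns h (Equiv.ofBijective _ (contrMk_bijective h) ⟨S, ψ⟩)).1.1.sym : ℂ)⁻¹) •
          T (toIns h (Equiv.ofBijective _ (contrMk_bijective h) ⟨S, ψ⟩)).1 =
        (((quotient h S).sym : ℂ)⁻¹) • T' S := fun ψ =>
      congrArg (fun t => (((quotient h S).sym : ℂ)⁻¹) • t) (hT (contrMk h ⟨S, ψ⟩))
    rw [Finset.sum_congr rfl fun ψ _ => h3 ψ, Finset.sum_const, Finset.card_univ,
      ← Nat.card_eq_fintype_card, ← Nat.cast_smul_eq_nsmul ℂ, smul_smul]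
    have h4 : Nat.card (Legged.Iso (quotient h S).rep (contract h S)) = (quotient h S).sym :=
      (Legged.Iso.card_congr_right (LGraph.repIso _ _)).symm
    rw [h4, mul_inv_cancel₀ (Nat.cast_ne_zero.2 (sym_pos _).ne'), one_smul]
  rw [← h2, h1, Finset.smul_sum]
  refine Finset.sum_congr rfl fun v _ => ?_
  rw [card_toIns h v, ← Nat.cast_smul_eq_nsmul ℂ, smul_smul, smul_smul]
  congr 1
  have h5 : (v.1.2.symProd : ℂ) ≠ 0 := Nat.cast_ne_zero.2 v.1.2.symProd_pos.ne'
  have h6 : (Nat.card {x // toIns h x = v} : ℂ) ≠ 0 := by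
    obtain ⟨x, hx⟩ := toIns_surjective h v
    have : Nonempty {x // toIns h x = v} := ⟨⟨x, hx⟩⟩
    exact Nat.cast_ne_zero.2 Nat.card_pos.ne'
  have h7 : (v.1.1.sym : ℂ) ≠ 0 := Nat.cast_ne_zero.2 (sym_pos _).ne'
  push_cast
  field_simp

end Legged

/-! ### Invariants of unlabelled graphs and contents of insertions -/

namespace Graph

theorem onePI (c : Graph) : c.rep.IsOnePI := (Quotient.out c).2

theorem mk_eq_mk {G K : PreGraph} {hG : G.IsOnePI} {hK : K.IsOnePI} :
    mk G hG = mk K hK ↔ Nonempty (PreGraph.Iso G K) :=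
  ⟨fun h => Quotient.exact h, fun h => Quotient.sound h⟩

theorem mk_rep (c : Graph) : mk c.rep c.onePI = c := Quotient.out_eq c

/-- A representative is isomorphic to the graph. -/
def repIso (G : PreGraph) (h : G.IsOnePI) : PreGraph.Iso (mk G h).rep G :=
  (mk_eq_mk.1 (mk_rep (mk G h))).some

/-- The number of loops. -/
def loops (c : Graph) : ℕ := c.rep.loops

theorem loops_mk (G : PreGraph) (h : G.IsOnePI) : (mk G h).loops = G.loops := (repIso G h).loops_eq

theorem loops_pos (c : Graph) : 0 < c.loops := c.onePI.not_tree

/-- The number of automorphisms that fix the external legs. -/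
def sym (c : Graph) : ℕ :=
  Nat.card {f : PreGraph.Iso c.rep c.rep // ∀ d, c.rep.IsLeg d → f.toEquiv d = d}

end Graph

namespace LGraph

variable {P : Type}

/-- A representative of a labelled graph as a labelling of the representative. -/
def forgetIso (q : LGraph P) : PreGraph.Iso q.forget.rep q.rep.graph := Graph.repIso _ _

theorem forget_mk (G : Legged P) (h : G.graph.IsOnePI) : (mk G h).forget = Graph.mk G.graph h :=
  Graph.mk_eq_mk.2 ⟨(repIso G h).iso⟩

theorem loops_mk (G : Legged P) (h : G.graph.IsOnePI) : (mk G h).loops = G.graph.loops :=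
  (repIso G h).iso.loops_eq

theorem loops_forget (q : LGraph P) : q.forget.loops = q.loops := q.forgetIso.loops_eq

theorem numLegs_forget (q : LGraph P) : q.forget.numLegs = Nat.card P :=
  q.forgetIso.numLegs_eq.trans (Nat.card_congr q.rep.leg).symm

/-- A labelling of the representative of the graph. -/
def toLegged (q : LGraph P) : Legged P := ⟨q.forget.rep, q.rep.leg.trans q.forgetIso.symm.legEquiv⟩

theorem toLegged_onePI (q : LGraph P) : q.toLegged.graph.IsOnePI := q.forget.onePI

/-- The labelling of the representative of the graph is isomorphic to the labelled graph. -/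
def toLeggedIso (q : LGraph P) : Legged.Iso q.rep q.toLegged := ⟨q.forgetIso.symm, fun _ => rfl⟩

theorem mk_toLegged (q : LGraph P) : mk q.toLegged q.toLegged_onePI = q := by
  conv_rhs => rw [← mk_rep q]
  exact mk_eq_mk.2 ⟨q.toLeggedIso.symm⟩

theorem card_toLegged (q : LGraph P) : Nat.card (Legged.Iso q.toLegged q.toLegged) = q.sym :=
  (Legged.Iso.card_congr q.toLeggedIso).symm.trans
    (Legged.Iso.card_congr_right q.toLeggedIso).symm

theorem sym_forget (q : LGraph P) : q.forget.sym = q.sym := by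
  rw [← card_toLegged]
  refine Nat.card_congr ⟨fun f => ⟨f.1, fun p => f.2 _ (q.toLegged.leg p).2⟩,
    fun f => ⟨f.iso, fun d hd => ?_⟩, fun _ => rfl, fun _ => rfl⟩
  obtain ⟨p, hp⟩ := q.toLegged.leg.surjective ⟨d, hd⟩
  have := f.fix p
  rw [hp] at this
  exact this

end LGraph

theorem gen_of_onePI {G : PreGraph} (h : G.IsOnePI) : gen G = MvPolynomial.X (Graph.mk G h) :=
  dif_pos h

theorem gen_congr {G K : PreGraph} (f : PreGraph.Iso G K) : gen G = gen K := by
  by_cases h : G.IsOnePI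
  · rw [gen_of_onePI h, gen_of_onePI (f.isOnePI h)]
    exact congrArg _ (Graph.mk_eq_mk.2 ⟨f⟩)
  · have h' : ¬ K.IsOnePI := fun h' => h (f.symm.isOnePI h')
    rw [gen, gen, dif_neg h, dif_neg h']

/-- The number of loops of a product of graphs. -/
def degree : (Graph →₀ ℕ) →+ ℕ := Finsupp.weight Graph.loops

theorem degree_single (c : Graph) : degree (Finsupp.single c 1) = c.loops := by
  simp [degree, Finsupp.weight_single]

/-- A multiplicative function on products of graphs. -/
def mulFun {R : Type*} [CommSemiring R] (t : Graph → R) : Multiplicative (Graph →₀ ℕ) →* R where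
  toFun h := (Multiplicative.toAdd h).prod fun c k => t c ^ k
  map_one' := Finsupp.prod_zero_index
  map_mul' _ _ := Finsupp.prod_add_index' (fun _ => pow_zero _) fun _ _ _ => pow_add _ _ _

theorem mulFun_single {R : Type*} [CommSemiring R] (t : Graph → R) (c : Graph) :
    mulFun t (Multiplicative.ofAdd (Finsupp.single c 1)) = t c := by
  simp [mulFun, Finsupp.prod_single_index]

theorem mulFun_apply {R : Type*} [CommSemiring R] (t : Graph → R) (h : Graph →₀ ℕ) :
    mulFun t (Multiplicative.ofAdd h) = h.prod fun c k => t c ^ k := rfl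

theorem mulFun_X (h : Graph →₀ ℕ) : mulFun (fun c => (MvPolynomial.X c : H)) (Multiplicative.ofAdd h) =
    MvPolynomial.monomial h 1 := by
  rw [mulFun_apply, MvPolynomial.monomial_eq, map_one, one_mul]

namespace PreGraph.Insertion

variable {γ : PreGraph} (D : γ.Insertion)

/-- The graph that is inserted at a site, if any. -/
def siteGraph : D.Site → Option Graph
  | Sum.inl v => (D.vtx v).map LGraph.forget
  | Sum.inr y => some ((D.chain y.1).get y.2).forget

/-- The contribution of a site to the product of the inserted graphs. -/
def siteContent (x : D.Site) : Graph →₀ ℕ := (D.siteGraph x).elim 0 fun c => Finsupp.single c 1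

theorem content_eq_sum [Fintype D.Site] : D.content = ∑ x, D.siteContent x := by
  classical
  have := Fintype.ofFinite γ.Vertex
  have := Fintype.ofFinite γ.IntLine
  have h : ∀ (i : Fintype D.Site), ∑ x, D.siteContent x = D.content := by
    intro i
    have : i = instFintypeSum γ.Vertex (Σ q : γ.IntLine, Fin (D.chain q).length) :=
      Subsingleton.elim _ _
    subst this
    rw [Fintype.sum_sum_type, Fintype.sum_sigma, content, finsum_eq_sum_of_fintype,
      finsum_eq_sum_of_fintype]
    congr 1
    · refine Finset.sum_congr rfl fun v _ => ?_
      rw [siteContent, siteGraph]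
      cases D.vtx v <;> rfl
    · refine Finset.sum_congr rfl fun q _ => ?_
      rw [← Fin.sum_univ_getElem]
      refine Fintype.sum_equiv (finCongr (List.length_map _).symm) _ _ fun i => ?_
      simp [siteContent, siteGraph]
  exact (h _).symm

theorem mulFun_content {R : Type*} [CommSemiring R] (t : Graph → R) [Fintype D.Site] :
    mulFun t (Multiplicative.ofAdd D.content) = ∏ x, (D.siteGraph x).elim 1 t := by
  rw [content_eq_sum, ofAdd_sum, map_prod]
  refine Finset.prod_congr rfl fun x _ => ?_
  rw [siteContent]
  cases D.siteGraph x with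
  | none => exact map_one _
  | some c => exact mulFun_single t c

theorem siteGraph_cases (x : D.Site) :
    (∃ q : LGraph (D.SiteProng x), D.piece x = q.rep ∧ D.siteGraph x = some q.forget) ∨
    (D.piece x = corolla (D.SiteProng x) ∧ D.siteGraph x = none) := by
  rcases x with v | y
  · cases h : D.vtx v with
    | none => exact Or.inr ⟨D.piece_none h, by rw [siteGraph, h]; rfl⟩
    | some q => exact Or.inl ⟨q, D.piece_some h, by rw [siteGraph, h]; rfl⟩
  · exact Or.inl ⟨_, rfl, rfl⟩

theorem siteGraph_of_onePI {x : D.Site} (h : (D.piece x).graph.IsOnePI) :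
    D.siteGraph x = some (Graph.mk _ h) := by
  rcases D.siteGraph_cases x with ⟨q, h1, h2⟩ | ⟨h1, -⟩
  · rw [h2]
    refine congrArg some (Graph.mk_eq_mk.2 ?_)
    rw [h1]
    exact ⟨Iso.refl _⟩
  · exfalso
    obtain ⟨d, hd⟩ := h.exists_internal
    revert d
    rw [h1]
    exact fun d hd => absurd (corolla_isLeg d) hd

theorem corolla_loops {P : Type} [Finite P] [Nonempty P] : (corolla P).graph.loops = 0 := by
  rw [loops, corolla_numInt, corolla_numVerts]

theorem sum_loops [Fintype D.Site] : ∑ x, (D.piece x).graph.loops = degree D.content := by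
  rw [content_eq_sum, map_sum]
  refine Finset.sum_congr rfl fun x _ => ?_
  rw [siteContent]
  rcases D.siteGraph_cases x with ⟨q, h1, h2⟩ | ⟨h1, h2⟩
  · rw [h1, h2]
    exact q.loops_forget.symm.trans (degree_single _).symm
  · rw [h1, h2, corolla_loops]
    exact (map_zero degree).symm

theorem glue_loops_eq (h : γ.IsOnePI) : D.glue.loops = γ.loops + degree D.content := by
  have := Fintype.ofFinite D.Site
  rw [← sum_loops]
  refine D.glue_loops h.lineLE ?_
  have := h.not_tree
  unfold loops at this
  omega

/-- A corolla has only the identity as leg-fixing automorphism, so vertices without insertion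
contribute one. Consequently this product depends on the inserted graphs alone and not on where they
are placed. -/
theorem symProd_eq : (D.symProd : ℂ) =
    mulFun (fun c => (c.sym : ℂ)) (Multiplicative.ofAdd D.content) := by
  classical
  have := Fintype.ofFinite D.Site
  rw [mulFun_content, symProd, finprod_eq_prod_of_fintype, Nat.cast_prod]
  refine Finset.prod_congr rfl fun x _ => ?_
  rcases D.siteGraph_cases x with ⟨q, h1, h2⟩ | ⟨h1, h2⟩
  · rw [h1, h2]
    exact congrArg Nat.cast q.sym_forget.symm
  · rw [h1, h2]
    have : Nat.card (Legged.Iso (corolla (D.SiteProng x)) (corolla (D.SiteProng x))) = 1 := by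
      have : Unique (Legged.Iso (corolla (D.SiteProng x)) (corolla (D.SiteProng x))) :=
        ⟨⟨Legged.Iso.refl _⟩, fun f => Legged.Iso.ext_apply fun a => f.fix a⟩
      exact Nat.card_unique
    rw [this]
    exact Nat.cast_one

/-- Each component of the subgraph is the piece at one site; the sites that meet no component are
the vertices with nothing inserted, and they contribute one. -/
theorem subMonomial_edgeSet {Γ : PreGraph} (φ : Iso D.glue Γ) :
    subMonomial Γ (edgeSet φ) = MvPolynomial.monomial D.content 1 := by
  classical
  have := Fintype.ofFinite D.Site
  have : Finite (Γ.SubComp (edgeSet φ)) := inferInstanceAs (Finite (Subtype _))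
  have := Fintype.ofFinite (Γ.SubComp (edgeSet φ))
  rw [← mulFun_X, mulFun_content, subMonomial, finprod_eq_prod_of_fintype]
  have hs : ∀ c : Γ.SubComp (edgeSet φ), ∃ x : D.Site, ∃ a,
      ¬ (D.piece x).graph.IsLeg a ∧ c.1 = Quotient.mk _ (φ.toEquiv ⟨x, a⟩) := by
    rintro ⟨_, g, hg, rfl⟩
    obtain ⟨⟨x, a⟩, rfl⟩ := exists_rep φ g
    exact ⟨x, a, (mem_edgeSet φ).1 hg, rfl⟩
  choose s a ha hc using hs
  have hinj : Function.Injective s := fun c c' h =>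
    Subtype.ext (by rw [hc, hc]; exact (mk_edgeSet_eq φ).2 h)
  rw [← Finset.prod_subset (Finset.subset_univ (Finset.univ.image s)), Finset.prod_image hinj.injOn]
  · refine Finset.prod_congr rfl fun c _ => ?_
    rw [hc c, ← gen_congr (compIso φ (s c) (a c)), gen_of_onePI (D.piece_isOnePI (ha c))]
    rw [D.siteGraph_of_onePI (D.piece_isOnePI (ha c))]
    rfl
  · intro x _ hx
    rcases D.siteGraph_cases x with ⟨q, h1, h2⟩ | ⟨h1, h2⟩
    · exfalso
      obtain ⟨b, hb⟩ : ∃ b, ¬ (D.piece x).graph.IsLeg b := by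
        rw [h1]
        exact q.rep_onePI.exists_internal
      let c : Γ.SubComp (edgeSet φ) := ⟨_, _, (mem_edgeSet φ (p := ⟨x, b⟩)).2 hb, rfl⟩
      exact hx (Finset.mem_image.2 ⟨c, Finset.mem_univ _,
        (mk_edgeSet_eq φ (p := ⟨s c, a c⟩) (p' := ⟨x, b⟩)).1 (hc c).symm⟩)
    · rw [h2]
      rfl

end PreGraph.Insertion

/-! ### Relabelling of legs, and finiteness in each loop order -/

namespace LGraph

variable {P R : Type}

/-- Change of the labels of the external legs. -/
def relabel (e : P ≃ R) (q : LGraph P) : LGraph R := mk ⟨q.rep.graph, e.symm.trans q.rep.leg⟩ q.rep_onePI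

theorem forget_relabel (e : P ≃ R) (q : LGraph P) : (q.relabel e).forget = q.forget := forget_mk _ _

theorem relabel_symm_relabel (e : P ≃ R) (q : LGraph P) : (q.relabel e).relabel e.symm = q := by
  conv_rhs => rw [← mk_rep q]
  have f := repIso ⟨q.rep.graph, e.symm.trans q.rep.leg⟩ q.rep_onePI
  refine mk_eq_mk.2 ⟨⟨f.iso, fun p => ?_⟩⟩
  have := f.fix (e p)
  simp only [Equiv.trans_apply, Equiv.symm_apply_apply] at this
  exact this

/-- Change of the labels of the external legs. -/
def relabelEquiv (e : P ≃ R) : LGraph P ≃ LGraph R :=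
  ⟨relabel e, relabel e.symm, relabel_symm_relabel e, relabel_symm_relabel e.symm⟩

/-- Valences of at least three bound the vertices by a third of the half-edges, while the half-edges
number `2 I + E` with `I = L + V - 1`. Eliminating `I` and `V` leaves a bound in `L` and `E`. -/
theorem card_HE_le (q : LGraph P) : Nat.card q.rep.graph.HE ≤ 6 * q.loops + 3 * Nat.card P := by
  classical
  have := Fintype.ofFinite q.rep.graph.Vertex
  have h := q.rep_onePI
  have h1 := h.lineLE.card_HE
  have h2 : q.rep.graph.numVerts * 3 ≤ Nat.card q.rep.graph.HE := by
    rw [PreGraph.card_HE_eq_sum_valence, PreGraph.numVerts, Nat.card_eq_fintype_card,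
      ← smul_eq_mul, ← Finset.card_univ, ← Finset.sum_const]
    exact Finset.sum_le_sum fun v _ => h.three_le_valence v
  have h3 : q.rep.graph.numLegs = Nat.card P := (Nat.card_congr q.rep.leg).symm
  have h4 := h.not_tree
  unfold loops
  unfold PreGraph.loops at *
  omega

/-- The structure of a graph on numbered half-edges. -/
def code {N : ℕ} (q : LGraph P) (e : q.rep.graph.HE → Fin N) :
    Set (Fin N × Fin N) × Set (Fin N × Fin N) × (P → Fin N) :=
  ({x | ∃ a b, q.rep.graph.vert.r a b ∧ x = (e a, e b)},
    {x | ∃ a b, q.rep.graph.line.r a b ∧ x = (e a, e b)}, fun p => e (q.rep.leg p).1)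

theorem eq_of_code {N : ℕ} {q q' : LGraph P} {e : q.rep.graph.HE → Fin N}
    {e' : q'.rep.graph.HE → Fin N} (he : Function.Injective e) (he' : Function.Injective e')
    (h : q.code e = q'.code e') : q = q' := by
  have hv := congrArg Prod.fst h
  have hl := congrArg (fun x => x.2.1) h
  have hp := congrArg (fun x => x.2.2) h
  have key : ∀ {G : PreGraph} {f : G.HE → Fin N} (_ : Function.Injective f) (s : Setoid G.HE) {a b},
      s.r a b ↔ (f a, f b) ∈ {x | ∃ a b, s.r a b ∧ x = (f a, f b)} := by
    intro G f hf s a b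
    constructor
    · exact fun h => ⟨a, b, h, rfl⟩
    · rintro ⟨a', b', h1, h2⟩
      rwa [hf (Prod.mk.inj h2).1, hf (Prod.mk.inj h2).2]
  have hr : Set.range e = Set.range e' := by
    have : ∀ {G : PreGraph} {f : G.HE → Fin N}, Set.range f =
        {i | (i, i) ∈ {x | ∃ a b, G.vert.r a b ∧ x = (f a, f b)}} := by
      intro G f
      ext i
      constructor
      · rintro ⟨a, rfl⟩
        exact ⟨a, a, G.vert.iseqv.refl a, rfl⟩
      · rintro ⟨a, b, -, h⟩
        exact ⟨a, (Prod.mk.inj h).1.symm⟩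
    rw [this, this]
    exact congrArg (fun s => {i | (i, i) ∈ s}) hv
  let τ := ((Equiv.ofInjective e he).trans (Equiv.setCongr hr)).trans (Equiv.ofInjective e' he').symm
  have hτ : ∀ a, e' (τ a) = e a := fun a =>
    congrArg Subtype.val ((Equiv.ofInjective e' he').apply_symm_apply _)
  refine eq_of_iso ⟨⟨⟨τ, fun a b => ?_, fun a b => ?_⟩, fun p => he' ?_⟩⟩
  · rw [key he, key he', hτ, hτ]
    exact iff_of_eq (congrArg (fun s => (e a, e b) ∈ s) hv)
  · rw [key he, key he', hτ, hτ]
    exact iff_of_eq (congrArg (fun s => (e a, e b) ∈ s) hl)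
  · rw [hτ]
    exact congrFun hp p

/-- Graphs with boundedly many half-edges are encoded by two relations on a finite set and a
labelling. This finiteness gives content to the sums over graphs, as `finsum` is zero on infinite
supports. -/
instance finite_loops [Finite P] (L : ℕ) : Finite {q : LGraph P // q.loops = L} := by
  have h : ∀ q : {q : LGraph P // q.loops = L}, ∃ e : q.1.rep.graph.HE → Fin (6 * L + 3 * Nat.card P),
      Function.Injective e := by
    rintro ⟨q, rfl⟩
    have := Fintype.ofFinite q.rep.graph.HE
    have h := q.card_HE_le
    rw [Nat.card_eq_fintype_card, ← Fintype.card_fin (6 * q.loops + 3 * Nat.card P)] at h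
    obtain ⟨f⟩ := Function.Embedding.nonempty_of_card_le h
    exact ⟨f, f.injective⟩
  choose e he using h
  exact Finite.of_injective (fun q => q.1.code (e q)) fun q q' h =>
    Subtype.ext (eq_of_code (he q) (he q') h)

end LGraph

theorem finsum_sigma_of_finite {A M : Type*} {B : A → Type*} [Finite A] [∀ a, Finite (B a)]
    [AddCommMonoid M] (f : (Σ a, B a) → M) : ∑ᶠ x, f x = ∑ᶠ a, ∑ᶠ b, f ⟨a, b⟩ := by
  classical
  have := Fintype.ofFinite A
  have := fun a => Fintype.ofFinite (B a)
  rw [finsum_eq_sum_of_fintype, finsum_eq_sum_of_fintype, Fintype.sum_sigma]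
  exact Finset.sum_congr rfl fun a _ => (finsum_eq_sum_of_fintype _).symm

/-! ### Insertions with a given number of loops of the result -/

namespace Legged.InsPair

variable {P : Type}

theorem result_onePI (v : InsPair P) : v.result.graph.IsOnePI := v.2.glue_isOnePI v.1.rep_onePI

/-- The number of loops of the result of an insertion. -/
def loops (v : InsPair P) : ℕ := v.1.loops + degree v.2.content

theorem result_loops (v : InsPair P) : v.result.graph.loops = v.loops :=
  v.2.glue_loops_eq v.1.rep_onePI

/-- The class of the result of an insertion. -/
def cls (v : InsPair P) : LGraph P := LGraph.mk v.result v.result_onePI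

theorem loops_cls (v : InsPair P) : v.cls.loops = v.loops :=
  (LGraph.loops_mk _ _).trans v.result_loops

theorem nonempty_iso_iff {v : InsPair P} {q : LGraph P} :
    Nonempty (Legged.Iso v.result q.toLegged) ↔ v.cls = q := by
  conv_rhs => rw [← q.mk_toLegged]
  exact LGraph.mk_eq_mk.symm

/-- Insertions with a given number of loops of the result, by their result. -/
def equivResult (L : ℕ) :
    (Σ q : {q : LGraph P // q.loops = L}, Legged.Ins q.1.toLegged) ≃ {v : InsPair P // v.loops = L} where
  toFun x := ⟨x.2.1, by rw [← loops_cls, nonempty_iso_iff.1 x.2.2, x.1.2]⟩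
  invFun v := ⟨⟨v.1.cls, v.1.loops_cls.trans v.2⟩, v.1, nonempty_iso_iff.2 rfl⟩
  left_inv := by
    rintro ⟨⟨q, hq⟩, v, hv⟩
    obtain rfl := nonempty_iso_iff.1 hv
    rfl
  right_inv _ := rfl

instance (q : LGraph P) : Finite (Legged.Ins q.toLegged) := finite_ins q.toLegged_onePI

instance [Finite P] (L : ℕ) : Finite {v : InsPair P // v.loops = L} :=
  Finite.of_equiv _ (equivResult L)

instance finite_insertion [Finite P] (q : LGraph P) (k : ℕ) :
    Finite {D : q.rep.graph.Insertion // degree D.content = k} :=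
  Finite.of_injective (β := {v : InsPair P // v.loops = q.loops + k})
    (fun D => ⟨⟨q, D.1⟩, congrArg (q.loops + ·) D.2⟩) fun D D' h =>
      Subtype.ext (eq_of_heq (Sigma.mk.inj (congrArg Subtype.val h)).2)

/-- Insertions with a given number of loops of the result, by the graph into which they are. -/
def equivBase (L : ℕ) : (Σ l : Fin (L + 1), Σ q : {q : LGraph P // q.loops = l},
    {D : q.1.rep.graph.Insertion // degree D.content = L - l}) ≃ {v : InsPair P // v.loops = L} where
  toFun x := ⟨⟨x.2.1.1, x.2.2.1⟩, by
    have h1 := x.2.1.2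
    have h2 := x.2.2.2
    have h3 := x.1.2
    unfold loops
    simp only
    omega⟩
  invFun v := ⟨⟨v.1.1.loops, by have := v.2; unfold loops at this; omega⟩, ⟨v.1.1, rfl⟩, v.1.2, by
    have := v.2
    unfold loops at this
    simp only
    omega⟩
  left_inv := by
    rintro ⟨⟨l, hl⟩, ⟨q, hq⟩, ⟨D, hD⟩⟩
    change q.loops = l at hq
    subst hq
    rfl
  right_inv _ := rfl

/-- The same set of pairs is grouped once by result and once by base graph. The grouping by base
graph is possible because the loops of the base and of the inserted graphs add up to those of the
result. -/
theorem finsum_result_eq [Finite P] {M : Type*} [AddCommMonoid M] (L : ℕ) (f : InsPair P → M) :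
    ∑ᶠ q : {q : LGraph P // q.loops = L}, ∑ᶠ v : Legged.Ins q.1.toLegged, f v.1 =
    ∑ l ∈ Finset.range (L + 1), ∑ᶠ q : {q : LGraph P // q.loops = l},
      ∑ᶠ D : {D : q.1.rep.graph.Insertion // degree D.content = L - l}, f ⟨q.1, D.1⟩ := by
  have h1 := finsum_comp_equiv (equivResult (P := P) L) (f := fun v => f v.1)
  have h2 := finsum_comp_equiv (equivBase (P := P) L) (f := fun v => f v.1)
  rw [← h1, finsum_sigma_of_finite, finsum_sigma_of_finite, finsum_eq_sum_of_fintype] at h2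
  refine Eq.trans h2.symm ?_
  rw [← Fin.sum_univ_eq_sum_range (fun l => ∑ᶠ q : {q : LGraph P // q.loops = l},
      ∑ᶠ D : {D : q.1.rep.graph.Insertion // degree D.content = L - l}, f ⟨q.1, D.1⟩)]
  exact Finset.sum_congr rfl fun l _ => finsum_sigma_of_finite _

end Legged.InsPair

/-! ### Cographs with one loop, and primitive graphs -/

namespace PreGraph

variable {G : PreGraph}

theorem IsOnePI.internal_ne_empty (h : G.IsOnePI) : (∅ : Set G.HE) ≠ G.internal := by
  obtain ⟨d, hd⟩ := h.exists_internal
  intro h1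
  exact (Set.mem_empty_iff_false d).1 (h1 ▸ hd)

theorem isSubgraph_empty (G : PreGraph) : G.IsSubgraph ∅ :=
  ⟨Set.empty_subset _, fun _ _ _ h => h, fun c => absurd c.2.choose_spec.1 (Set.notMem_empty _)⟩

theorem subMonomial_empty (G : PreGraph) : subMonomial G ∅ = 1 := by
  have : IsEmpty (G.SubComp ∅) := ⟨fun c => Set.notMem_empty _ c.2.choose_spec.1⟩
  exact finprod_of_isEmpty _

/-- Nothing is contracted by the empty subgraph. -/
def IsOnePI.contractEmptyIso (h : G.IsOnePI) : Iso G (G.contract ∅) where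
  toEquiv :=
    { toFun := fun d => ⟨d, Set.notMem_empty d, fun h2 => by
        obtain ⟨e, he, -⟩ := exists_mem_of_isTwo h (isSubgraph_empty G) h.internal_ne_empty
          (z := d) h2
        exact Set.notMem_empty _ he⟩
      invFun := fun d => d.1
      left_inv := fun _ => rfl
      right_inv := fun _ => rfl }
  vert_iff a b := by
    change G.vert.r a b ↔ (G.compRel ∅).r a b
    rw [compRel_empty]
  line_iff a b := by
    change G.line.r a b ↔ (G.line ⊔ G.through ∅).r a b
    have : G.through ∅ ≤ G.line := by
      rintro x y (rfl | ⟨-, -, -, h2⟩)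
      · exact Setoid.refl' _ _
      · obtain ⟨e, he, -⟩ := exists_mem_of_isTwo h (isSubgraph_empty G) h.internal_ne_empty
          (z := x) h2
        exact absurd he (Set.notMem_empty _)
    rw [sup_eq_left.2 this]

/-- The product of the components of a subgraph. -/
theorem IsOnePI.exists_content (h : G.IsOnePI) {S : Set G.HE} (hS : G.IsSubgraph S)
    (hne : S ≠ G.internal) : ∃ k, subMonomial G S = MvPolynomial.monomial k 1 ∧
      G.loops = (G.contract S).loops + degree k ∧ (S ≠ ∅ → 0 < degree k) ∧
      S.ncard + 2 * G.numComps S = 2 * degree k + 2 * G.numVerts := by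
  classical
  let φ := decompIso h hS hne (Iso.refl _)
  let D := decomp h hS hne (Iso.refl _)
  have := Fintype.ofFinite D.Site
  have hφ : Insertion.edgeSet φ = S := decompIso_edgeSet h hS hne (Iso.refl _)
  refine ⟨D.content, ?_, ?_, fun hS0 => ?_, ?_⟩
  · have h1 := Insertion.subMonomial_edgeSet D φ
    rwa [hφ] at h1
  · rw [← φ.loops_eq]
    exact D.glue_loops_eq (contract_isOnePI h hS hne)
  · obtain ⟨g, hg⟩ := Set.nonempty_iff_ne_empty.2 hS0
    rw [← hφ] at hg
    obtain ⟨⟨x, a⟩, rfl⟩ := Insertion.exists_rep φ g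
    have h1 := D.piece_isOnePI ((Insertion.mem_edgeSet φ).1 hg)
    rw [← D.sum_loops]
    exact h1.not_tree.trans_le (Finset.single_le_sum (f := fun x => (D.piece x).graph.loops)
      (fun _ _ => Nat.zero_le _) (Finset.mem_univ x))
  · have h1 := Insertion.edgeSet_loops φ
    rwa [hφ, D.sum_loops] at h1

/-- There is a subgraph such that the contracted graph has one loop. -/
theorem IsOnePI.exists_contract_loops (h : G.IsOnePI) :
    ∃ S, G.IsSubgraph S ∧ S ≠ G.internal ∧ (G.contract S).loops = 1 := by
  -- This `S` has loop number `I - V`, one less than the graph, and loops of a subgraph and its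
  -- cograph add up to those of the graph.
  obtain ⟨S, hS, hne, h1⟩ := h.exists_subgraph
  obtain ⟨k, -, h2, -, h3⟩ := h.exists_content hS hne
  refine ⟨S, hS, hne, ?_⟩
  have h4 := h.not_tree
  have h5 : G.loops = G.numInt + 1 - G.numVerts := rfl
  omega

end PreGraph

/-- The term with the graph on the right is the term of the empty subgraph: the empty product is one
and nothing is contracted. The remaining sum then runs over all proper subgraphs, as in the
correspondence with insertions. -/
theorem Δ_X (c : Graph) : Δ (MvPolynomial.X c) = (MvPolynomial.X c : H) ⊗ₜ[ℂ] (1 : H) +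
    ∑ᶠ S : {S : Set c.rep.HE // c.rep.IsSubgraph S ∧ S ≠ c.rep.internal},
      subMonomial c.rep S.1 ⊗ₜ[ℂ] gen (c.rep.contract S.1) := by
  classical
  let A := {S : Set c.rep.HE // c.rep.IsSubgraph S ∧ S ≠ c.rep.internal}
  let B := {S : Set c.rep.HE // c.rep.IsSubgraph S ∧ S ≠ ∅ ∧ S ≠ c.rep.internal}
  let e : A ≃ Option B :=
    { toFun := fun S => if hS : S.1 = ∅ then none else some ⟨S.1, S.2.1, hS, S.2.2⟩
      invFun := fun S => S.elim ⟨∅, PreGraph.isSubgraph_empty _, c.onePI.internal_ne_empty⟩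
        fun S => ⟨S.1, S.2.1, S.2.2.2⟩
      left_inv := by
        rintro ⟨S, hS, hne⟩
        by_cases h : S = ∅
        · subst h
          simp
        · simp [h]
      right_inv := by
        rintro (_ | ⟨S, hS, h0, hne⟩)
        · exact dif_pos rfl
        · exact dif_neg h0 }
  have := Fintype.ofFinite B
  rw [Δ, MvPolynomial.aeval_X, add_assoc]
  congr 1
  rw [← finsum_comp_equiv e.symm, finsum_eq_sum_of_fintype, finsum_eq_sum_of_fintype,
    Fintype.sum_option]
  congr 1
  have h1 : gen (c.rep.contract ∅) = MvPolynomial.X c := by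
    rw [← gen_congr c.onePI.contractEmptyIso, gen_of_onePI c.onePI, c.mk_rep]
  change _ = subMonomial c.rep ∅ ⊗ₜ[ℂ] gen (c.rep.contract ∅)
  rw [h1, PreGraph.subMonomial_empty]

namespace Graph

theorem loops_contract (c : Graph) {S : Set c.rep.HE} (hS : c.rep.IsSubgraph S)
    (hne : S ≠ c.rep.internal) (h0 : S ≠ ∅) : (c.rep.contract S).loops < c.loops := by
  obtain ⟨k, -, h1, h2, -⟩ := c.onePI.exists_content hS hne
  have := h2 h0
  unfold loops
  omega

/-- A graph is primitive if and only if it has one loop. -/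
theorem isPrimitive_iff (c : Graph) : c.IsPrimitive ↔ c.loops = 1 := by
  classical
  let B := {S : Set c.rep.HE // c.rep.IsSubgraph S ∧ S ≠ ∅ ∧ S ≠ c.rep.internal}
  have := Fintype.ofFinite B
  have h0 : c.IsPrimitive ↔ IsEmpty B := by
    unfold IsPrimitive Δ
    rw [MvPolynomial.aeval_X, add_eq_left, finsum_eq_sum_of_fintype]
    constructor
    · intro h
      -- Counting every graph as one sends each term of the reduced coproduct to one. So the terms
      -- cannot cancel, and the reduced coproduct vanishes only if the sum is empty.
      let ε : H →ₐ[ℂ] ℂ := MvPolynomial.aeval fun _ => 1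
      have h1 := congrArg (Algebra.TensorProduct.lmul' ℂ ∘
        Algebra.TensorProduct.map ε ε) h
      simp only [Function.comp_apply, map_sum, map_zero, Algebra.TensorProduct.map_tmul,
        Algebra.TensorProduct.lmul'_apply_tmul] at h1
      have h2 : ∀ S : B, ε (subMonomial c.rep S.1) * ε (gen (c.rep.contract S.1)) = 1 := by
        rintro ⟨S, hS, -, hne⟩
        obtain ⟨k, hk, -⟩ := c.onePI.exists_content hS hne
        simp only
        rw [hk, gen_of_onePI (PreGraph.contract_isOnePI c.onePI hS hne), MvPolynomial.aeval_X,
          MvPolynomial.aeval_monomial]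
        simp
      rw [Finset.sum_congr rfl fun S _ => h2 S] at h1
      simpa [Fintype.card_eq_zero_iff] using h1
    · intro h
      exact Finset.sum_of_isEmpty _
  rw [h0]
  constructor
  · intro h
    -- With no proper nonempty subgraph available, the subgraph with one-loop cograph is empty, and
    -- the graph is its own cograph.
    obtain ⟨S, hS, hne, hl⟩ := c.onePI.exists_contract_loops
    by_cases hS0 : S = ∅
    · subst hS0
      rw [loops, c.onePI.contractEmptyIso.loops_eq, hl]
    · exact (h.false ⟨S, hS, hS0, hne⟩).elim
  · rintro h
    -- A nonempty subgraph takes away at least one loop, but the cograph is 1PI and needs one.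
    refine ⟨fun ⟨S, hS, hS0, hne⟩ => ?_⟩
    have h1 := c.loops_contract hS hne hS0
    have h2 := (PreGraph.contract_isOnePI c.onePI hS hne).not_tree
    omega

end Graph

theorem PreGraph.isPrimitive_iff {G : PreGraph} (h : G.IsOnePI) : G.IsPrimitive ↔ G.loops = 1 := by
  rw [← Graph.loops_mk G h, ← Graph.isPrimitive_iff]
  exact ⟨fun h => h.2, fun h' => ⟨h, h'⟩⟩

/-- There is a subgraph with one-loop, hence primitive, cograph. So the factor `1 / maxf` in the
grafting operators is never a division by zero. -/
theorem maxf_pos (c : Graph) : 0 < maxf c := by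
  obtain ⟨S, hS, hne, hl⟩ := c.onePI.exists_contract_loops
  exact Nat.card_pos_iff.2 ⟨⟨S, hS, hne,
    (PreGraph.isPrimitive_iff (PreGraph.contract_isOnePI c.onePI hS hne)).2 hl⟩, inferInstance⟩

/-! ### Coproduct and maximal forests as sums over insertions -/

namespace LGraph

variable {P : Type}

theorem forget_contr {q : LGraph P} (x : Legged.Contr q.toLegged_onePI) :
    (MvPolynomial.X x.1.forget : H) = gen (q.toLegged.graph.contract x.2.1.1) := by
  rw [gen_of_onePI (PreGraph.contract_isOnePI q.toLegged_onePI x.2.1.2.1 x.2.1.2.2)]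
  exact congrArg _ (Graph.mk_eq_mk.2 ⟨x.2.2.iso⟩)

/-- The coproduct of a graph as a sum over the insertions that yield the graph. -/
theorem smul_Δ_forget (q : LGraph P) : (q.sym : ℂ)⁻¹ • Δ (MvPolynomial.X q.forget) =
    (q.sym : ℂ)⁻¹ • (MvPolynomial.X q.forget : H) ⊗ₜ[ℂ] (1 : H) +
    ∑ᶠ v : Legged.Ins q.toLegged, ((v.1.1.sym : ℂ)⁻¹ * (v.1.2.symProd : ℂ)⁻¹) •
      ((MvPolynomial.monomial v.1.2.content 1 : H) ⊗ₜ[ℂ] (MvPolynomial.X v.1.1.forget : H)) := by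
  rw [Δ_X, smul_add]
  congr 1
  rw [Legged.sum_ins q.toLegged_onePI (fun v => (MvPolynomial.monomial v.2.content 1 : H) ⊗ₜ[ℂ]
    (MvPolynomial.X v.1.forget : H)) (fun S => subMonomial q.toLegged.graph S.1 ⊗ₜ[ℂ]
      gen (q.toLegged.graph.contract S.1)), q.card_toLegged]
  · rfl
  · intro x
    rw [← forget_contr x]
    congr 1
    have h1 := PreGraph.Insertion.subMonomial_edgeSet _ (PreGraph.decompIso q.toLegged_onePI
      x.2.1.2.1 x.2.1.2.2 x.2.2.iso)
    exact h1.symm.trans (congrArg (subMonomial q.toLegged.graph) (PreGraph.decompIso_edgeSet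
      q.toLegged_onePI x.2.1.2.1 x.2.1.2.2 x.2.2.iso))

/-- The number of maximal forests as a sum over the insertions into primitive graphs that yield
the graph. -/
theorem smul_maxf (q : LGraph P) : (q.sym : ℂ)⁻¹ * (maxf q.forget : ℂ) =
    ∑ᶠ v : Legged.Ins q.toLegged, ((v.1.1.sym : ℂ)⁻¹ * (v.1.2.symProd : ℂ)⁻¹) *
      (if v.1.1.loops = 1 then 1 else 0) := by
  classical
  have h := Legged.sum_ins q.toLegged_onePI (fun v => if v.1.loops = 1 then (1 : ℂ) else 0)
    (fun S => if (q.toLegged.graph.contract S.1).loops = 1 then 1 else 0) (fun x => by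
      have : x.1.loops = (q.toLegged.graph.contract x.2.1.1).loops := x.2.2.iso.loops_eq
      change (if x.1.loops = 1 then (1 : ℂ) else 0) = _
      rw [this])
  simp only [smul_eq_mul] at h
  rw [h, q.card_toLegged]
  congr 1
  have := Fintype.ofFinite q.toLegged.Sub
  rw [finsum_eq_sum_of_fintype, Finset.sum_boole, ← Fintype.card_subtype,
    ← Nat.card_eq_fintype_card]
  congr 1
  refine Nat.card_congr ⟨fun S => ⟨⟨S.1, S.2.1, S.2.2.1⟩, ?_⟩, fun S => ⟨S.1.1, S.1.2.1, S.1.2.2, ?_⟩,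
    fun _ => rfl, fun _ => rfl⟩
  · exact (PreGraph.isPrimitive_iff
      (PreGraph.contract_isOnePI q.toLegged_onePI S.2.1 S.2.2.1)).1 S.2.2.2
  · exact (PreGraph.isPrimitive_iff
      (PreGraph.contract_isOnePI q.toLegged_onePI S.1.2.1 S.1.2.2)).2 S.2

end LGraph

/-! ## Powers of power series with complex exponents -/

section PolyFun

variable {R : Type*} [CommRing R] [Algebra ℂ R]

/-- Functions of a complex number that are given by a polynomial. -/
def IsPolyFun (f : ℂ → R) : Prop := ∃ p : Polynomial R, ∀ a, f a = p.eval (algebraMap ℂ R a)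

namespace IsPolyFun

variable {f g : ℂ → R}

theorem const (r : R) : IsPolyFun fun _ => r := ⟨Polynomial.C r, fun _ => (Polynomial.eval_C).symm⟩

theorem mul (hf : IsPolyFun f) (hg : IsPolyFun g) : IsPolyFun fun a => f a * g a := by
  obtain ⟨p, hp⟩ := hf
  obtain ⟨q, hq⟩ := hg
  exact ⟨p * q, fun a => by simp only [Polynomial.eval_mul, hp, hq]⟩

theorem sub (hf : IsPolyFun f) (hg : IsPolyFun g) : IsPolyFun fun a => f a - g a := by
  obtain ⟨p, hp⟩ := hf
  obtain ⟨q, hq⟩ := hg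
  exact ⟨p - q, fun a => by simp only [Polynomial.eval_sub, hp, hq]⟩

theorem sum {ι : Type*} (s : Finset ι) {f : ι → ℂ → R} (hf : ∀ i, IsPolyFun (f i)) :
    IsPolyFun fun a => ∑ i ∈ s, f i a := by
  choose p hp using hf
  exact ⟨∑ i ∈ s, p i, fun a => by
    rw [Polynomial.eval_finsetSum]; exact Finset.sum_congr rfl fun i _ => hp i a⟩

theorem comp_affine (hf : IsPolyFun f) (b c : ℂ) : IsPolyFun fun a => f (b + c * a) := by
  obtain ⟨p, hp⟩ := hf
  refine ⟨p.comp (Polynomial.C (algebraMap ℂ R b) + Polynomial.C (algebraMap ℂ R c) *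
    Polynomial.X), fun a => ?_⟩
  simp only [hp, Polynomial.eval_comp]
  simp

theorem choose_smul (k : ℕ) (r : R) : IsPolyFun fun a : ℂ => Ring.choose a k • r := by
  refine ⟨Polynomial.C (algebraMap ℂ R (k.factorial : ℂ)⁻¹ * r) *
    (descPochhammer ℤ k).map (Int.castRingHom R), fun a => ?_⟩
  have h : (descPochhammer ℤ k).smeval a =
      ((descPochhammer ℤ k).map (Int.castRingHom ℂ)).eval a := by
    rw [← Polynomial.aeval_eq_smeval, Polynomial.aeval_def, Polynomial.eval_map]
    rfl
  simp only
  rw [Ring.choose_eq_smul, h, Polynomial.eval_mul, Polynomial.eval_C, Algebra.smul_def, smul_eq_mul,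
    map_mul, Polynomial.eval_map, Polynomial.eval_map, Polynomial.hom_eval₂,
    RingHom.ext_int ((algebraMap ℂ R).comp (Int.castRingHom ℂ)) (Int.castRingHom R)]
  ring

/-- `R` need not be a domain, so infinitely many roots do not by themselves make a polynomial over
`R` vanish. Linear functionals separate the points of the complex vector space `R`, and each of them
turns the claim into one about complex polynomials. -/
theorem eq_zero_of_nat (hf : IsPolyFun f) (h : ∀ n : ℕ, f n = 0) (a : ℂ) : f a = 0 := by
  obtain ⟨p, hp⟩ := hf
  rw [← Module.forall_dual_apply_eq_zero_iff ℂ]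
  intro φ
  let P : Polynomial ℂ := ∑ i ∈ Finset.range (p.natDegree + 1), Polynomial.C (φ (p.coeff i)) *
    Polynomial.X ^ i
  have hP : ∀ a, P.eval a = φ (f a) := by
    intro a
    rw [hp, Polynomial.eval_finsetSum, Polynomial.eval_eq_sum_range, map_sum]
    refine Finset.sum_congr rfl fun i _ => ?_
    rw [← map_pow, mul_comm (p.coeff i), ← Algebra.smul_def, map_smul]
    rw [Polynomial.eval_mul, Polynomial.eval_C, Polynomial.eval_pow, Polynomial.eval_X,
      smul_eq_mul, mul_comm]
  have h0 : P = 0 := by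
    refine Polynomial.eq_zero_of_infinite_isRoot _ ((Set.infinite_range_of_injective
      (Nat.cast_injective (R := ℂ))).mono ?_)
    rintro _ ⟨n, rfl⟩
    rw [Set.mem_ofPred_eq, Polynomial.IsRoot.def, hP, h, map_zero]
  rw [← hP, h0, Polynomial.eval_zero]

theorem eq_of_nat (hf : IsPolyFun f) (hg : IsPolyFun g) (h : ∀ n : ℕ, f n = g n) (a : ℂ) :
    f a = g a :=
  sub_eq_zero.1 ((hf.sub hg).eq_zero_of_nat (fun n => sub_eq_zero.2 (h n)) a)

end IsPolyFun

/-- Families of power series whose coefficients are polynomial functions. -/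
def IsPolySeries (F : ℂ → PowerSeries R) : Prop := ∀ N, IsPolyFun fun a => PowerSeries.coeff N (F a)

namespace IsPolySeries

variable {F G : ℂ → PowerSeries R}

theorem const (f : PowerSeries R) : IsPolySeries fun _ => f := fun _ => IsPolyFun.const _

theorem mul (hF : IsPolySeries F) (hG : IsPolySeries G) : IsPolySeries fun a => F a * G a := by
  intro N
  simp only [PowerSeries.coeff_mul]
  exact IsPolyFun.sum _ fun i => (hF _).mul (hG _)

theorem comp_affine (hF : IsPolySeries F) (b c : ℂ) : IsPolySeries fun a => F (b + c * a) :=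
  fun N => (hF N).comp_affine b c

theorem eq_of_nat (hF : IsPolySeries F) (hG : IsPolySeries G) (h : ∀ n : ℕ, F n = G n) (a : ℂ) :
    F a = G a :=
  PowerSeries.ext fun N => (hF N).eq_of_nat (hG N) (fun n => by rw [h]) a

end IsPolySeries

/-- The power of a power series with constant coefficient one. -/
def cpow (f : PowerSeries R) (a : ℂ) : PowerSeries R :=
  PowerSeries.mk fun N =>
    ∑ k ∈ Finset.range (N + 1), Ring.choose a k • PowerSeries.coeff N ((f - 1) ^ k)

theorem fpow_eq_cpow (f : PowerSeries H) (a : ℂ) : fpow f a = cpow f a := rfl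

theorem coeff_cpow (f : PowerSeries R) (a : ℂ) (N : ℕ) : PowerSeries.coeff N (cpow f a) =
    ∑ k ∈ Finset.range (N + 1), Ring.choose a k • PowerSeries.coeff N ((f - 1) ^ k) :=
  PowerSeries.coeff_mk _ _

theorem isPolySeries_cpow (f : PowerSeries R) : IsPolySeries (cpow f) := fun N => by
  simp only [coeff_cpow]
  exact IsPolyFun.sum _ fun k => IsPolyFun.choose_smul k _

theorem constantCoeff_cpow (f : PowerSeries R) (a : ℂ) :
    PowerSeries.constantCoeff (cpow f a) = 1 := by
  rw [← PowerSeries.coeff_zero_eq_constantCoeff_apply, coeff_cpow]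
  simp

variable {f g : PowerSeries R}

/-- The binomial theorem. The truncation of the series at the order of the coefficient loses
nothing, since `(f - 1) ^ k` has order at least `k`. -/
theorem cpow_natCast (hf : PowerSeries.constantCoeff f = 1) (n : ℕ) : cpow f n = f ^ n := by
  ext N
  have h1 : f ^ n = ∑ k ∈ Finset.range (n + 1), n.choose k • (f - 1) ^ k := by
    conv_lhs => rw [← sub_add_cancel f 1, add_pow]
    exact Finset.sum_congr rfl fun k _ => by rw [one_pow, mul_one, nsmul_eq_mul, mul_comm]
  have h2 : ∀ k, N < k → PowerSeries.coeff N ((f - 1) ^ k) = 0 := fun k hk =>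
    PowerSeries.coeff_of_lt_order _ ((Nat.cast_lt.2 hk).trans_le
      (PowerSeries.le_order_pow_of_constantCoeff_eq_zero k (by rw [map_sub, hf, map_one, sub_self])))
  rw [h1, map_sum, coeff_cpow]
  simp only [Ring.choose_natCast, map_nsmul, Nat.cast_smul_eq_nsmul]
  rw [Finset.sum_subset (Finset.range_subset_range.2 (show N + 1 ≤ N + n + 1 by omega)),
    Finset.sum_subset (Finset.range_subset_range.2 (show n + 1 ≤ N + n + 1 by omega))]
  · intro k _ hk
    rw [Nat.choose_eq_zero_of_lt (by simpa using hk), zero_smul]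
  · intro k _ hk
    rw [h2 k (by simpa using hk), smul_zero]

theorem cpow_one (hf : PowerSeries.constantCoeff f = 1) : cpow f 1 = f := by
  have := cpow_natCast hf 1
  rwa [Nat.cast_one, pow_one] at this

theorem cpow_zero (hf : PowerSeries.constantCoeff f = 1) : cpow f 0 = 1 := by
  have := cpow_natCast hf 0
  rwa [Nat.cast_zero, pow_zero] at this

/-- True for natural exponents; as both sides are polynomial in each exponent, it extends to complex
values, first in one exponent and then in the other. -/
theorem cpow_add (hf : PowerSeries.constantCoeff f = 1) (a b : ℂ) :
    cpow f (a + b) = cpow f a * cpow f b := by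
  have h1 : ∀ (n : ℕ) (b : ℂ), cpow f (n + b) = cpow f n * cpow f b := by
    intro n b
    have h2 := (isPolySeries_cpow f).comp_affine n 1
    simp only [one_mul] at h2
    refine h2.eq_of_nat ((IsPolySeries.const (cpow f n)).mul (isPolySeries_cpow f)) (fun m => ?_) b
    rw [← Nat.cast_add, cpow_natCast hf, cpow_natCast hf, cpow_natCast hf, pow_add]
  have h2 := (isPolySeries_cpow f).comp_affine b 1
  simp only [one_mul] at h2
  rw [add_comm a b]
  exact h2.eq_of_nat ((isPolySeries_cpow f).mul (IsPolySeries.const (cpow f b)))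
    (fun n => by rw [add_comm, h1]) a

theorem cpow_pow (hf : PowerSeries.constantCoeff f = 1) (a : ℂ) (n : ℕ) :
    cpow f a ^ n = cpow f (a * n) := by
  induction n with
  | zero => rw [Nat.cast_zero, mul_zero, cpow_zero hf, pow_zero]
  | succ n ih => rw [pow_succ, ih, Nat.cast_succ, mul_add, mul_one, cpow_add hf]

theorem cpow_cpow (hf : PowerSeries.constantCoeff f = 1) (a b : ℂ) :
    cpow (cpow f a) b = cpow f (a * b) := by
  have h2 := (isPolySeries_cpow f).comp_affine 0 a
  simp only [zero_add] at h2
  exact (isPolySeries_cpow (cpow f a)).eq_of_nat h2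
    (fun n => by rw [cpow_natCast (constantCoeff_cpow f a), cpow_pow hf]) b

theorem cpow_mul (hf : PowerSeries.constantCoeff f = 1) (hg : PowerSeries.constantCoeff g = 1)
    (a : ℂ) : cpow (f * g) a = cpow f a * cpow g a :=
  (isPolySeries_cpow _).eq_of_nat ((isPolySeries_cpow f).mul (isPolySeries_cpow g))
    (fun n => by
      rw [cpow_natCast (by rw [map_mul, hf, hg, one_mul]), cpow_natCast hf, cpow_natCast hg,
        mul_pow]) a

theorem one_cpow (a : ℂ) : cpow (1 : PowerSeries R) a = 1 :=
  (isPolySeries_cpow (1 : PowerSeries R)).eq_of_nat (IsPolySeries.const _)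
    (fun n => by rw [cpow_natCast (map_one _), one_pow]) a

/-- Ring homomorphisms that respect polynomial families respect powers. -/
theorem map_cpow {S : Type*} [CommRing S] [Algebra ℂ S] (φ : PowerSeries R →+* PowerSeries S)
    (hφ : ∀ F, IsPolySeries F → IsPolySeries fun a => φ (F a))
    (hf : PowerSeries.constantCoeff f = 1) (h1 : PowerSeries.constantCoeff (φ f) = 1) (a : ℂ) :
    φ (cpow f a) = cpow (φ f) a :=
  (hφ _ (isPolySeries_cpow f)).eq_of_nat (isPolySeries_cpow _)
    (fun n => by rw [cpow_natCast hf, cpow_natCast h1, map_pow]) a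

theorem IsPolyFun.map {S : Type*} [CommRing S] [Algebra ℂ S] (φ : R →ₐ[ℂ] S) {f : ℂ → R}
    (hf : IsPolyFun f) : IsPolyFun fun a => φ (f a) := by
  obtain ⟨p, hp⟩ := hf
  refine ⟨p.map φ.toRingHom, fun a => ?_⟩
  simp only
  rw [hp, Polynomial.eval_map, ← AlgHom.commutes φ]
  exact Polynomial.hom_eval₂ p (RingHom.id R) φ.toRingHom _

theorem map_algHom_cpow {S : Type*} [CommRing S] [Algebra ℂ S] (φ : R →ₐ[ℂ] S)
    (hf : PowerSeries.constantCoeff f = 1) (a : ℂ) :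
    PowerSeries.map φ.toRingHom (cpow f a) = cpow (PowerSeries.map φ.toRingHom f) a := by
  refine map_cpow _ (fun F hF N => ?_) hf ?_ a
  · simp only [PowerSeries.coeff_map]
    exact (hF N).map φ
  · rw [← PowerSeries.coeff_zero_eq_constantCoeff_apply, PowerSeries.coeff_map,
      PowerSeries.coeff_zero_eq_constantCoeff_apply, hf, map_one]

end PolyFun

/-! ## Generating functions -/

section GeneratingFunction

universe u

variable {C R : Type*} [AddCommMonoid C] [CommRing R] (w : C →+ ℕ) (T : Multiplicative C →* R)

/-- Finitely many elements of each weight. -/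
def FinFib {A : Type*} (κ : A → C) : Prop := ∀ L, Finite {a // w (κ a) = L}

/-- The generating function of a type whose elements have contents in `C`. -/
def gf {A : Type*} (κ : A → C) : PowerSeries R :=
  PowerSeries.mk fun L => ∑ᶠ a : {a // w (κ a) = L}, T (Multiplicative.ofAdd (κ a.1))

variable {w}

theorem FinFib.of_equiv {A B : Type*} {κ : A → C} {κ' : B → C} (hκ : FinFib w κ) (e : B ≃ A)
    (h : ∀ b, κ (e b) = κ' b) : FinFib w κ' := fun L => by
  have := hκ L
  exact Finite.of_injective (β := {a // w (κ a) = L}) (fun b => ⟨e b.1, by rw [h, b.2]⟩)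
    fun b b' hb => Subtype.ext (e.injective (congrArg Subtype.val hb))

theorem gf_congr {A B : Type*} {κ : A → C} {κ' : B → C} (e : B ≃ A)
    (h : ∀ b, κ (e b) = κ' b) : gf w T κ' = gf w T κ := by
  ext L
  simp only [gf, PowerSeries.coeff_mk]
  refine finsum_eq_of_bijective (fun b => ⟨e b.1, by rw [h, b.2]⟩)
    (Equiv.bijective (e.subtypeEquiv fun b => by rw [h])) fun b => ?_
  rw [h]

theorem gf_of_unique {A : Type*} [Unique A] {κ : A → C} (h : κ default = 0) : gf w T κ = 1 := by
  ext L
  simp only [gf, PowerSeries.coeff_mk]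
  rw [PowerSeries.coeff_one]
  split_ifs with hL
  · subst hL
    have : Unique {a // w (κ a) = 0} :=
      ⟨⟨⟨default, by rw [h, map_zero]⟩⟩, fun a => Subtype.ext (Subsingleton.elim _ _)⟩
    rw [finsum_unique, show (default : {a // w (κ a) = 0}).1 = default from
      Subsingleton.elim _ _, h]
    exact map_one T
  · have : IsEmpty {a // w (κ a) = L} := ⟨fun a => hL (by
      rw [← a.2, Subsingleton.elim a.1 default, h, map_zero])⟩
    exact finsum_of_isEmpty _

theorem FinFib.sum {A B : Type*} {κ : A → C} {κ' : B → C} (h : FinFib w κ) (h' : FinFib w κ') :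
    FinFib w (Sum.elim κ κ') := fun L => by
  have := h L
  have := h' L
  exact Finite.of_equiv ({a // w (κ a) = L} ⊕ {b // w (κ' b) = L})
    (Equiv.subtypeSum (p := fun c => w (Sum.elim κ κ' c) = L)).symm

theorem gf_sum {A B : Type*} {κ : A → C} {κ' : B → C} (h : FinFib w κ) (h' : FinFib w κ') :
    gf w T (Sum.elim κ κ') = gf w T κ + gf w T κ' := by
  ext L
  rw [map_add]
  simp only [gf, PowerSeries.coeff_mk]
  have := h L
  have := h' L
  have := Fintype.ofFinite {a // w (κ a) = L}
  have := Fintype.ofFinite {a // w (κ' a) = L}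
  let e : {c // w (Sum.elim κ κ' c) = L} ≃ {a // w (κ a) = L} ⊕ {b // w (κ' b) = L} :=
    Equiv.subtypeSum
  rw [← finsum_comp_equiv e.symm, finsum_eq_sum_of_fintype, finsum_eq_sum_of_fintype,
    finsum_eq_sum_of_fintype, Fintype.sum_sum_type]
  rfl

theorem finFib_of_finite {A : Type*} [Finite A] (κ : A → C) : FinFib w κ := fun _ => inferInstance

theorem FinFib.option {A : Type*} {κ : A → C} (h : FinFib w κ) :
    FinFib w (fun o : Option A => o.elim 0 κ) :=
  (h.sum (finFib_of_finite fun _ : PUnit.{1} => 0)).of_equiv (Equiv.optionEquivSumPUnit A) <| by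
    rintro (_ | a) <;> rfl

theorem gf_option {A : Type*} {κ : A → C} (h : FinFib w κ) :
    gf w T (fun o : Option A => o.elim 0 κ) = 1 + gf w T κ := by
  rw [gf_congr T (κ := Sum.elim κ fun _ : PUnit.{1} => (0 : C)) (Equiv.optionEquivSumPUnit A)
    (by rintro (_ | a) <;> rfl), gf_sum T h (finFib_of_finite _),
    gf_of_unique T (κ := fun _ : PUnit.{1} => (0 : C)) rfl, add_comm]

/-- Pairs of a given weight. -/
def prodEquiv {A B : Type*} (κ : A → C) (κ' : B → C) (L : ℕ) :
    {x : A × B // w (κ x.1 + κ' x.2) = L} ≃ Σ p : {p // p ∈ Finset.HasAntidiagonal.antidiagonal L},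
      {a // w (κ a) = p.1.1} × {b // w (κ' b) = p.1.2} where
  toFun x := ⟨⟨(w (κ x.1.1), w (κ' x.1.2)), Finset.HasAntidiagonal.mem_antidiagonal.2 ((map_add w _ _).symm.trans x.2)⟩,
    ⟨x.1.1, rfl⟩, ⟨x.1.2, rfl⟩⟩
  invFun y := ⟨(y.2.1.1, y.2.2.1), by
    rw [map_add, y.2.1.2, y.2.2.2]; exact Finset.HasAntidiagonal.mem_antidiagonal.1 y.1.2⟩
  left_inv _ := rfl
  right_inv := by
    rintro ⟨⟨⟨i, j⟩, hij⟩, ⟨a, ha⟩, ⟨b, hb⟩⟩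
    change w (κ a) = i at ha
    change w (κ' b) = j at hb
    subst ha hb
    rfl

theorem FinFib.prod {A B : Type*} {κ : A → C} {κ' : B → C} (h : FinFib w κ) (h' : FinFib w κ') :
    FinFib w (fun x : A × B => κ x.1 + κ' x.2) := fun L => by
  have := fun i => h i
  have := fun i => h' i
  exact Finite.of_equiv _ (prodEquiv κ κ' L).symm

theorem gf_prod {A B : Type*} {κ : A → C} {κ' : B → C} (h : FinFib w κ) (h' : FinFib w κ') :
    gf w T (fun x : A × B => κ x.1 + κ' x.2) = gf w T κ * gf w T κ' := by
  classical
  ext L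
  rw [PowerSeries.coeff_mul]
  simp only [gf, PowerSeries.coeff_mk]
  have := fun i => h i
  have := fun i => h' i
  have := fun i => Fintype.ofFinite {a // w (κ a) = i}
  have := fun i => Fintype.ofFinite {a // w (κ' a) = i}
  rw [← finsum_comp_equiv (prodEquiv κ κ' L).symm, finsum_eq_sum_of_fintype, Fintype.sum_sigma]
  refine Eq.trans (Finset.sum_congr rfl fun p _ => ?_) (Finset.sum_coe_sort
    (Finset.HasAntidiagonal.antidiagonal L)
    fun p => (∑ᶠ a : {a // w (κ a) = p.1}, T (Multiplicative.ofAdd (κ a.1))) *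
      ∑ᶠ b : {b // w (κ' b) = p.2}, T (Multiplicative.ofAdd (κ' b.1)))
  rw [finsum_eq_sum_of_fintype, finsum_eq_sum_of_fintype, Finset.sum_mul_sum, Fintype.sum_prod_type]
  exact Finset.sum_congr rfl fun a _ => Finset.sum_congr rfl fun b _ => map_mul T _ _

/-- Induction over the index type, one factor at a time. Finiteness in each weight has to be carried
along, because the product formula for two factors needs it. -/
theorem finFib_pi_and_gf_pi {ι : Type} [Fintype ι] : ∀ (A : ι → Type u) (κ : ∀ i, A i → C)
    (_ : ∀ i, FinFib w (κ i)), FinFib w (fun a : ∀ i, A i => ∑ i, κ i (a i)) ∧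
      gf w T (fun a : ∀ i, A i => ∑ i, κ i (a i)) = ∏ i, gf w T (κ i) := by
  let P : ∀ (ι : Type) [Fintype ι], Prop := fun ι _ => ∀ (A : ι → Type u) (κ : ∀ i, A i → C)
    (_ : ∀ i, FinFib w (κ i)), FinFib w (fun a : ∀ i, A i => ∑ i, κ i (a i)) ∧
      gf w T (fun a : ∀ i, A i => ∑ i, κ i (a i)) = ∏ i, gf w T (κ i)
  refine Fintype.induction_empty_option (P := P) ?_ ?_ ?_ ι
  · intro α β _ e ih A κ h
    letI := Fintype.ofEquiv β e.symm
    obtain ⟨h1, h2⟩ := ih _ (fun i => κ (e i)) (fun i => h (e i))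
    have h3 : ∀ a : (∀ i, A i), ∑ i, κ (e i) ((Equiv.piCongrLeft A e).symm a i) = ∑ i, κ i (a i) :=
      fun a => Fintype.sum_equiv e _ _ fun i => rfl
    refine ⟨h1.of_equiv (Equiv.piCongrLeft A e).symm h3, ?_⟩
    rw [gf_congr T (κ := fun a : ∀ i, A (e i) => ∑ i, κ (e i) (a i)) (Equiv.piCongrLeft A e).symm h3,
      h2]
    exact Fintype.prod_equiv e _ _ fun i => rfl
  · intro A κ h
    exact ⟨finFib_of_finite _, gf_of_unique T rfl⟩
  · intro α _ ih A κ h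
    obtain ⟨h1, h2⟩ := ih _ (fun i => κ (some i)) (fun i => h (some i))
    have h3 : ∀ a : (∀ i, A i), κ none (Equiv.piOptionEquivProd a).1 +
        ∑ i, κ (some i) ((Equiv.piOptionEquivProd a).2 i) = ∑ i, κ i (a i) :=
      fun a => (Fintype.sum_option fun i => κ i (a i)).symm
    refine ⟨((h none).prod h1).of_equiv Equiv.piOptionEquivProd h3, ?_⟩
    rw [gf_congr T (κ := fun x : A none × ∀ i, A (some i) => κ none x.1 + ∑ i, κ (some i) (x.2 i))
      Equiv.piOptionEquivProd h3, gf_prod T (h none) h1, h2, Fintype.prod_option]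

/-- Every entry has positive weight, so removing the first one leaves a list of smaller weight, with
finitely many choices for the entry removed. -/
theorem FinFib.list {B : Type*} {κ : B → C} (h : FinFib w κ) (hpos : ∀ b, 0 < w (κ b)) :
    FinFib w (fun l : List B => (l.map κ).sum) := by
  intro L
  change Set.Finite {l : List B | w (l.map κ).sum = L}
  induction L using Nat.strong_induction_on with
  | _ L ih =>
    refine Set.Finite.subset (s := {[]} ∪ ⋃ i : Fin L, Set.image2 List.cons
      {b | w (κ b) = L - i} {l | w (l.map κ).sum = i}) ((Set.finite_singleton _).union
        (Set.finite_iUnion fun i => Set.Finite.image2 _ (h _) (ih i i.2))) ?_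
    rintro (_ | ⟨b, l⟩) hl
    · exact Or.inl rfl
    · have h1 : w (κ b) + w (l.map κ).sum = L := by
        rw [← map_add]
        exact hl
      have h2 := hpos b
      refine Or.inr (Set.mem_iUnion.2 ⟨⟨w (l.map κ).sum, by omega⟩, b, ?_, l, rfl, rfl⟩)
      simp only [Set.mem_ofPred_eq]
      omega

/-- A list is empty or an entry followed by a list. This gives the functional equation of the
geometric series. -/
theorem gf_list {B : Type*} {κ : B → C} (h : FinFib w κ) (hpos : ∀ b, 0 < w (κ b)) :
    gf w T (fun l : List B => (l.map κ).sum) * (1 - gf w T κ) = 1 := by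
  let e : List B ≃ Option (B × List B) :=
    { toFun := fun l => l.casesOn none fun b l => some (b, l)
      invFun := fun o => o.elim [] fun x => x.1 :: x.2
      left_inv := by rintro (_ | ⟨b, l⟩) <;> rfl
      right_inv := by rintro (_ | ⟨b, l⟩) <;> rfl }
  have h1 := gf_congr T (w := w) (κ' := fun l : List B => (l.map κ).sum)
    (κ := fun o : Option (B × List B) => o.elim 0 fun x => κ x.1 + (x.2.map κ).sum) e
    (by rintro (_ | ⟨b, l⟩) <;> simp [e])
  rw [gf_option T (h.prod (h.list hpos)), gf_prod T h (h.list hpos)] at h1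
  linear_combination h1

end GeneratingFunction

/-! ## Insertions and Green's functions -/

theorem finFib_place_and_gf_place {C R : Type*} [AddCommMonoid C] [CommRing R] {w : C →+ ℕ}
    (T : Multiplicative C →* R) {ι E : Type} [Fintype ι] [Fintype E] {A : ι → Type*} {B : Type*}
    (κ : ∀ i, A i → C) (κ' : B → C) (h : ∀ i, FinFib w (κ i)) (h' : FinFib w κ')
    (hpos : ∀ b, 0 < w (κ' b)) :
    FinFib w (fun x : (∀ i, Option (A i)) × (E → List B) =>
      ∑ i, (x.1 i).elim 0 (κ i) + ∑ e, ((x.2 e).map κ').sum) ∧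
    gf w T (fun x : (∀ i, Option (A i)) × (E → List B) =>
      ∑ i, (x.1 i).elim 0 (κ i) + ∑ e, ((x.2 e).map κ').sum) =
      (∏ i, (1 + gf w T (κ i))) * (gf w T fun l : List B => (l.map κ').sum) ^ Fintype.card E := by
  obtain ⟨h1, h2⟩ := finFib_pi_and_gf_pi T (fun i => Option (A i)) (fun i o => o.elim 0 (κ i))
    fun i => (h i).option
  obtain ⟨h3, h4⟩ := finFib_pi_and_gf_pi T (fun _ : E => List B) (fun _ l => (l.map κ').sum)
    fun _ => h'.list hpos
  refine ⟨h1.prod h3, ?_⟩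
  rw [gf_prod T h1 h3, h2, h4, Finset.prod_const, Finset.card_univ]
  congr 1
  exact Finset.prod_congr rfl fun i _ => gf_option T (h i)

/-- A graph as a product of graphs. -/
def Graph.single (c : Graph) : Graph →₀ ℕ := Finsupp.single c 1

/-- Products of graphs with a weight. -/
def wmon (t : Graph → ℂ) : Multiplicative (Graph →₀ ℕ) →* H :=
  mulFun fun c => t c • (MvPolynomial.X c : H)

theorem wmon_single (t : Graph → ℂ) (c : Graph) :
    wmon t (Multiplicative.ofAdd c.single) = t c • (MvPolynomial.X c : H) := mulFun_single _ _

theorem wmon_apply (t : Graph → ℂ) (h : Graph →₀ ℕ) : wmon t (Multiplicative.ofAdd h) =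
    mulFun t (Multiplicative.ofAdd h) • (MvPolynomial.monomial h 1 : H) := by
  rw [← mulFun_X, wmon, mulFun_apply, mulFun_apply, mulFun_apply]
  simp only [Finsupp.prod, smul_pow]
  rw [Finset.prod_smul]

/-- Numbers of elements with a given content can thus be compared through generating functions,
where products over vertices and lines are easy. -/
theorem coeff_gf {A : Type*} {κ : A → Graph →₀ ℕ} (hκ : FinFib degree κ) (t : Graph → ℂ)
    (h : Graph →₀ ℕ) : MvPolynomial.coeff h (PowerSeries.coeff (degree h) (gf degree (wmon t) κ)) =
      Nat.card {a // κ a = h} * mulFun t (Multiplicative.ofAdd h) := by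
  classical
  have := hκ (degree h)
  have := Fintype.ofFinite {a // degree (κ a) = degree h}
  simp only [gf, PowerSeries.coeff_mk]
  rw [finsum_eq_sum_of_fintype, MvPolynomial.coeff_sum]
  simp only [wmon_apply, MvPolynomial.coeff_smul, MvPolynomial.coeff_monomial]
  have h1 : Nat.card {a // κ a = h} = (Finset.univ.filter
      fun a : {a // degree (κ a) = degree h} => κ a.1 = h).card := by
    rw [← Fintype.card_subtype, ← Nat.card_eq_fintype_card]
    exact Nat.card_congr ⟨fun a => ⟨⟨a.1, by rw [a.2]⟩, a.2⟩, fun a => ⟨a.1.1, a.2⟩,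
      fun _ => rfl, fun _ => rfl⟩
  rw [h1, ← nsmul_eq_mul, ← Finset.sum_const, Finset.sum_filter]
  refine Finset.sum_congr rfl fun a _ => ?_
  split_ifs with h2
  · rw [h2, smul_eq_mul, mul_one]
  · rw [smul_zero]

/-- The content of a labelled graph. -/
def lcontent (P : Type) (q : LGraph P) : Graph →₀ ℕ := q.forget.single

/-- The content of a graph with a given number of external legs. -/
def gcontent (m : ℕ) (c : {c : Graph // c.numLegs = m}) : Graph →₀ ℕ := c.1.single

theorem degree_lcontent {P : Type} (q : LGraph P) : degree (lcontent P q) = q.loops :=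
  (degree_single _).trans q.loops_forget

theorem degree_gcontent {m : ℕ} (c : {c : Graph // c.numLegs = m}) :
    degree (gcontent m c) = c.1.loops := degree_single _

theorem finFib_lcontent (P : Type) [Finite P] : FinFib degree (lcontent P) := fun L => by
  have := LGraph.finite_loops (P := P) L
  exact Finite.of_injective (β := {q : LGraph P // q.loops = L})
    (fun q => ⟨q.1, by rw [← degree_lcontent, q.2]⟩)
    fun q q' h => Subtype.ext (Subtype.mk.inj h)

theorem Graph.exists_labelled {m : ℕ} (c : Graph) (hc : c.numLegs = m) :
    ∃ q : LGraph (Fin m), q.forget = c := by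
  have : Finite c.rep.Leg := inferInstanceAs (Finite (Subtype _))
  let e : Fin m ≃ c.rep.Leg := (Finite.equivFinOfCardEq hc).symm
  exact ⟨LGraph.mk ⟨c.rep, e⟩ c.onePI, (LGraph.forget_mk _ _).trans c.mk_rep⟩

theorem finFib_gcontent (m : ℕ) : FinFib degree (gcontent m) := fun L => by
  have := LGraph.finite_loops (P := Fin m) L
  refine Finite.of_surjective (α := {q : LGraph (Fin m) // q.loops = L}) (fun q =>
    ⟨⟨q.1.forget, q.1.numLegs_forget.trans (Nat.card_eq_fintype_card.trans (Fintype.card_fin m))⟩,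
      by rw [degree_gcontent, q.1.loops_forget, q.2]⟩) ?_
  rintro ⟨⟨c, hc⟩, hL⟩
  obtain ⟨q, rfl⟩ := c.exists_labelled hc
  rw [degree_gcontent] at hL
  exact ⟨⟨q, q.loops_forget.symm.trans hL⟩, rfl⟩

theorem card_forget_eq {m : ℕ} (c : Graph) (hc : c.numLegs = m) :
    Nat.card {q : LGraph (Fin m) // q.forget = c} = c.vee := by
  subst hc
  rfl

/-- A graph with `m` legs comes from exactly `vee` labelled graphs, so this factor in the weight
compensates for forgetting the labels. -/
theorem gf_gcontent (t : Graph → ℂ) (m : ℕ) :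
    gf degree (wmon fun c => c.vee * t c) (gcontent m) = gf degree (wmon t) (lcontent (Fin m)) := by
  classical
  ext1 L
  have := finFib_gcontent m L
  have := finFib_lcontent (Fin m) L
  have := Fintype.ofFinite {c // degree (gcontent m c) = L}
  have := Fintype.ofFinite {c // degree (lcontent (Fin m) c) = L}
  simp only [gf, PowerSeries.coeff_mk]
  rw [finsum_eq_sum_of_fintype, finsum_eq_sum_of_fintype]
  let f : {q // degree (lcontent (Fin m) q) = L} → {c // degree (gcontent m c) = L} := fun q =>
    ⟨⟨q.1.forget, q.1.numLegs_forget.trans (Nat.card_eq_fintype_card.trans (Fintype.card_fin m))⟩,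
      q.2⟩
  refine Eq.trans (Finset.sum_congr rfl fun c _ => ?_) (sum_eq_sum_card_fiber f
    fun c => wmon t (Multiplicative.ofAdd (gcontent m c.1))).symm
  have h1 : Nat.card {q // f q = c} = c.1.1.vee := by
    rw [← card_forget_eq c.1.1 c.1.2]
    refine Nat.card_congr ⟨fun q => ⟨q.1.1, congrArg (fun c => c.1.1) q.2⟩, fun q => ⟨⟨q.1, ?_⟩, ?_⟩,
      fun _ => rfl, fun _ => rfl⟩
    · rw [lcontent, q.2]
      exact c.2
    · exact Subtype.ext (Subtype.ext q.2)
  rw [h1, gcontent, wmon_single, wmon_single, mul_smul, Nat.cast_smul_eq_nsmul]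

theorem gf_lcontent_congr (t : Graph → ℂ) {P R : Type} (e : P ≃ R) :
    gf degree (wmon t) (lcontent P) = gf degree (wmon t) (lcontent R) :=
  gf_congr _ (LGraph.relabelEquiv e) fun q => congrArg Graph.single (q.forget_relabel e)

namespace PreGraph

variable (G : PreGraph)

theorem finFib_insertion_and_gf_insertion (t : Graph → ℂ) [Fintype G.Vertex] :
    FinFib degree (Insertion.content (G := G)) ∧
    gf degree (wmon t) (Insertion.content (G := G)) =
      (∏ v, (1 + gf degree (wmon t) (lcontent (Fin (G.valence v))))) *
        (gf degree (wmon t) fun l : List (LGraph Bool) => (l.map (lcontent Bool)).sum) ^ G.numInt := by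
  have := Fintype.ofFinite G.IntLine
  obtain ⟨h1, h2⟩ := finFib_place_and_gf_place (wmon t) (E := G.IntLine)
    (fun v => lcontent (G.Prong v)) (lcontent Bool) (fun v => finFib_lcontent _)
    (finFib_lcontent _) (fun q => by rw [degree_lcontent]; exact q.rep_onePI.not_tree)
  let e : G.Insertion ≃ (∀ v, Option (LGraph (G.Prong v))) × (G.IntLine → List (LGraph Bool)) :=
    ⟨fun D => (D.vtx, D.chain), fun x => ⟨x.1, x.2⟩, fun _ => rfl, fun _ => rfl⟩
  have h3 : ∀ D : G.Insertion, ∑ v, ((e D).1 v).elim 0 (lcontent (G.Prong v)) +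
      ∑ q, (((e D).2 q).map (lcontent Bool)).sum = D.content := fun D => by
    rw [Insertion.content, finsum_eq_sum_of_fintype, finsum_eq_sum_of_fintype]
    rfl
  refine ⟨h1.of_equiv e h3, ?_⟩
  refine (gf_congr (wmon t) e h3).trans (h2.trans ?_)
  rw [numInt, Nat.card_eq_fintype_card]
  congr 1
  refine Finset.prod_congr rfl fun v _ => ?_
  rw [gf_lcontent_congr t (Finite.equivFinOfCardEq (α := G.Prong v) (n := G.valence v) rfl)]

theorem finFib_place_and_gf_place (t : Graph → ℂ) [Fintype G.Vertex] :
    FinFib degree (Place.content (G := G)) ∧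
    gf degree (wmon t) (Place.content (G := G)) =
      (∏ v, (1 + gf degree (wmon t) (gcontent (G.valence v)))) *
        (gf degree (wmon t) fun l : List {c : Graph // c.numLegs = 2} =>
          (l.map (gcontent 2)).sum) ^ G.numInt := by
  have := Fintype.ofFinite G.IntLine
  obtain ⟨h1, h2⟩ := CoreHopf.finFib_place_and_gf_place (wmon t) (E := G.IntLine)
    (fun v => gcontent (G.valence v)) (gcontent 2) (fun v => finFib_gcontent _)
    (finFib_gcontent _) (fun c => by rw [degree_gcontent]; exact c.1.loops_pos)
  let e : G.Place ≃ (∀ v, Option {c : Graph // c.numLegs = G.valence v}) ×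
      (G.IntLine → List {c : Graph // c.numLegs = 2}) :=
    ⟨fun D => (D.vtx, D.chain), fun x => ⟨x.1, x.2⟩, fun _ => rfl, fun _ => rfl⟩
  have h3 : ∀ D : G.Place, ∑ v, ((e D).1 v).elim 0 (gcontent (G.valence v)) +
      ∑ q, (((e D).2 q).map (gcontent 2)).sum = D.content := fun D => by
    rw [Place.content, finsum_eq_sum_of_fintype, finsum_eq_sum_of_fintype]
    rfl
  refine ⟨h1.of_equiv e h3, ?_⟩
  refine (gf_congr (wmon t) e h3).trans (h2.trans ?_)
  rw [numInt, Nat.card_eq_fintype_card]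

theorem finFib_insertion : FinFib degree (Insertion.content (G := G)) := by
  have := Fintype.ofFinite G.Vertex
  exact (G.finFib_insertion_and_gf_insertion 1).1

/-- The number of insertions in terms of the number of insertion places. -/
theorem card_insertion (h : Graph →₀ ℕ) :
    (Nat.card {D : G.Insertion // D.content = h} : ℂ) = places G h * vee h := by
  have := Fintype.ofFinite G.Vertex
  -- Insertions with weight one and insertion places with weight `vee` have the same generating
  -- function, factor by factor over vertices and lines. The claim is the equality of their
  -- coefficients at `h`.
  obtain ⟨h1, h2⟩ := G.finFib_insertion_and_gf_insertion 1
  obtain ⟨h3, h4⟩ := G.finFib_place_and_gf_place fun c => c.vee * (1 : Graph → ℂ) c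
  have h5 := coeff_gf h1 1 h
  have h6 := coeff_gf h3 (fun c => c.vee * (1 : Graph → ℂ) c) h
  have h7 : (gf degree (wmon fun c => c.vee * (1 : Graph → ℂ) c)
      fun l : List {c : Graph // c.numLegs = 2} => (l.map (gcontent 2)).sum) =
      gf degree (wmon 1) fun l : List (LGraph Bool) => (l.map (lcontent Bool)).sum := by
    have h8 := gf_list (wmon fun c => c.vee * (1 : Graph → ℂ) c) (finFib_gcontent 2)
      fun c => by rw [degree_gcontent]; exact c.1.loops_pos
    -- The two series for lines are inverses of the same series, hence equal.
    have h9 := gf_list (wmon 1) (finFib_lcontent Bool)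
      fun q => by rw [degree_lcontent]; exact q.rep_onePI.not_tree
    rw [gf_gcontent, ← gf_lcontent_congr 1 finTwoEquiv.symm] at h8
    exact eq_comm.1 (left_inv_eq_right_inv h9 ((mul_comm _ _).trans h8))
  rw [h4, h7] at h6
  simp only [gf_gcontent] at h6
  rw [h2, h6] at h5
  have h10 : mulFun (1 : Graph → ℂ) (Multiplicative.ofAdd h) = 1 := by
    simp [mulFun_apply, Finsupp.prod]
  have h11 : mulFun (fun c => c.vee * (1 : Graph → ℂ) c) (Multiplicative.ofAdd h) = (vee h : ℂ) := by
    simp [mulFun_apply, vee, Finsupp.prod]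
  rw [h10, h11, mul_one] at h5
  exact h5.symm

end PreGraph

/-- The weight of a graph in the Green's functions. -/
def symWeight (c : Graph) : ℂ := (c.sym : ℂ)⁻¹

theorem X_eq (n : ℕ) : X n = 1 + sgn n • gf degree (wmon symWeight) (lcontent (Fin n)) := by
  rw [X]
  congr 2
  ext1 L
  simp only [gf, PowerSeries.coeff_mk]
  refine finsum_eq_of_bijective (fun q => ⟨q.1, by rw [degree_lcontent, q.2]⟩)
    (Equiv.bijective (Equiv.subtypeEquivRight fun q => by rw [degree_lcontent])) fun q => ?_
  rw [lcontent, wmon_single, symWeight, LGraph.sym_forget]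

theorem constantCoeff_gf_lcontent (t : Graph → ℂ) (P : Type) :
    PowerSeries.constantCoeff (gf degree (wmon t) (lcontent P)) = 0 := by
  rw [← PowerSeries.coeff_zero_eq_constantCoeff_apply]
  simp only [gf, PowerSeries.coeff_mk]
  have : IsEmpty {q // degree (lcontent P q) = 0} := ⟨fun q => by
    have h1 := q.2
    have h2 := q.1.rep_onePI.not_tree
    rw [degree_lcontent] at h1
    exact h2.ne' h1⟩
  exact finsum_of_isEmpty _

theorem constantCoeff_X (n : ℕ) : PowerSeries.constantCoeff (X n) = 1 := by
  rw [X_eq, map_add, map_one, PowerSeries.constantCoeff_smul, constantCoeff_gf_lcontent, smul_zero,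
    add_zero]

/-- The sign of the propagator makes `X 2` one minus the sum over graphs with two legs, so sequences
of such graphs on a line sum up to its inverse. -/
theorem gf_list_lcontent : (gf degree (wmon symWeight) fun l : List (LGraph Bool) =>
    (l.map (lcontent Bool)).sum) = cpow (X 2) (-1) := by
  have h1 := gf_list (wmon symWeight) (finFib_lcontent Bool)
    fun q => by rw [degree_lcontent]; exact q.rep_onePI.not_tree
  have h2 : 1 - gf degree (wmon symWeight) (lcontent Bool) = X 2 := by
    rw [X_eq, sgn, if_pos rfl, gf_lcontent_congr _ finTwoEquiv, neg_smul, one_smul, sub_eq_add_neg]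
  have h3 : X 2 * cpow (X 2) (-1) = 1 := by
    nth_rewrite 1 [← cpow_one (constantCoeff_X 2)]
    rw [← cpow_add (constantCoeff_X 2), add_neg_cancel, cpow_zero (constantCoeff_X 2)]
  rw [h2] at h1
  exact left_inv_eq_right_inv h1 h3

/-- The product of Green's functions that fits a graph is the sum over all insertions. -/
theorem fitted_eq {n : ℕ} (γ : LGraph (Fin n)) :
    fitted γ = gf degree (wmon symWeight) (PreGraph.Insertion.content (G := γ.rep.graph)) := by
  have := Fintype.ofFinite γ.rep.graph.Vertex
  rw [(γ.rep.graph.finFib_insertion_and_gf_insertion symWeight).2, gf_list_lcontent,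
    cpow_pow (constantCoeff_X 2), fitted, finprod_eq_prod_of_fintype, fpow_eq_cpow, neg_one_mul]
  congr 1
  refine Finset.prod_congr rfl fun v _ => ?_
  have h := γ.rep_onePI.three_le_valence v
  rw [X_eq, sgn, if_neg (by omega), one_smul]

theorem wmon_symWeight {γ : PreGraph} (D : γ.Insertion) :
    wmon symWeight (Multiplicative.ofAdd D.content) =
      (D.symProd : ℂ)⁻¹ • (MvPolynomial.monomial D.content 1 : H) := by
  rw [wmon_apply, D.symProd_eq, mulFun_apply, mulFun_apply]
  simp [symWeight, Finsupp.prod]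

theorem coeff_fitted {n : ℕ} (γ : LGraph (Fin n)) (k : ℕ) : PowerSeries.coeff k (fitted γ) =
    ∑ᶠ D : {D : γ.rep.graph.Insertion // degree D.content = k},
      (D.1.symProd : ℂ)⁻¹ • (MvPolynomial.monomial D.1.content 1 : H) := by
  rw [fitted_eq]
  simp only [gf, PowerSeries.coeff_mk, wmon_symWeight]

/-! ## The coproduct and the grafting operators on Green's functions -/

/-- The sum over graphs with `n` fixed legs and `L` loops, weighted by symmetry factors. -/
def green (n L : ℕ) : H :=
  ∑ᶠ q : {q : LGraph (Fin n) // q.loops = L}, ((q.1.sym : ℂ)⁻¹) • (MvPolynomial.X q.1.forget : H)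

theorem coeff_X (n L : ℕ) : PowerSeries.coeff L (X n) =
    PowerSeries.coeff L (1 : PowerSeries H) + sgn n • green n L := by
  rw [X, map_add, PowerSeries.coeff_smul, PowerSeries.coeff_mk, green]

theorem coeff_succ_X (n k : ℕ) : PowerSeries.coeff (k + 1) (X n) = sgn n • green n (k + 1) := by
  rw [coeff_X, PowerSeries.coeff_one, if_neg (Nat.succ_ne_zero k), zero_add]

theorem map_finsum_of_finite {A M N : Type*} [Finite A] [AddCommMonoid M] [AddCommMonoid N]
    (φ : M →+ N) (f : A → M) : φ (∑ᶠ a, f a) = ∑ᶠ a, φ (f a) :=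
  φ.map_finsum (Set.toFinite _)

/-- The subgraphs of all graphs with `L` loops, weighted by symmetry factors, become weighted
insertions. For a fixed base graph with `l` loops these are the insertions of degree `L - l`, whose
sum is the coefficient of the fitted product. The right tensor factor remembers only the base graph.
-/
theorem Δ_green (n L : ℕ) : Δ (green n L) = green n L ⊗ₜ[ℂ] (1 : H) +
    ∑ l ∈ Finset.range (L + 1), ∑ᶠ γ : {γ : LGraph (Fin n) // γ.loops = l},
      (γ.1.sym : ℂ)⁻¹ • (PowerSeries.coeff (L - l) (fitted γ.1) ⊗ₜ[ℂ]
        (MvPolynomial.X γ.1.forget : H)) := by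
  have h1 := map_finsum_of_finite (Δ : H →ₐ[ℂ] H ⊗[ℂ] H).toRingHom.toAddMonoidHom
    (fun q : {q : LGraph (Fin n) // q.loops = L} =>
      ((q.1.sym : ℂ)⁻¹) • (MvPolynomial.X q.1.forget : H))
  have h2 := map_finsum_of_finite (((TensorProduct.mk ℂ H H).flip 1).toAddMonoidHom)
    (fun q : {q : LGraph (Fin n) // q.loops = L} =>
      ((q.1.sym : ℂ)⁻¹) • (MvPolynomial.X q.1.forget : H))
  have h3 : ∀ q : {q : LGraph (Fin n) // q.loops = L},
      Δ (((q.1.sym : ℂ)⁻¹) • (MvPolynomial.X q.1.forget : H)) =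
      (((q.1.sym : ℂ)⁻¹) • (MvPolynomial.X q.1.forget : H)) ⊗ₜ[ℂ] (1 : H) +
      ∑ᶠ v : Legged.Ins q.1.toLegged, ((v.1.1.sym : ℂ)⁻¹ * (v.1.2.symProd : ℂ)⁻¹) •
        ((MvPolynomial.monomial v.1.2.content 1 : H) ⊗ₜ[ℂ] (MvPolynomial.X v.1.1.forget : H)) :=
    fun q => by rw [map_smul, LGraph.smul_Δ_forget, TensorProduct.smul_tmul']
  change Δ (green n L) = _ at h1
  change green n L ⊗ₜ[ℂ] (1 : H) = _ at h2
  rw [h1, h2]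
  refine (finsum_congr h3).trans ?_
  rw [finsum_add_distrib (Set.toFinite _) (Set.toFinite _)]
  congr 1
  rw [Legged.InsPair.finsum_result_eq L fun v => ((v.1.sym : ℂ)⁻¹ * (v.2.symProd : ℂ)⁻¹) •
    ((MvPolynomial.monomial v.2.content 1 : H) ⊗ₜ[ℂ] (MvPolynomial.X v.1.forget : H))]
  refine Finset.sum_congr rfl fun l _ => finsum_congr fun γ => ?_
  rw [coeff_fitted]
  have h4 := map_finsum_of_finite ((((γ.1.sym : ℂ)⁻¹) •
      (TensorProduct.mk ℂ H H).flip (MvPolynomial.X γ.1.forget)).toAddMonoidHom)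
    (fun D : {D : γ.1.rep.graph.Insertion // degree D.content = L - l} =>
      (D.1.symProd : ℂ)⁻¹ • (MvPolynomial.monomial D.1.content 1 : H))
  refine Eq.trans (finsum_congr fun D => ?_) h4.symm
  change _ = ((γ.1.sym : ℂ)⁻¹) • (((D.1.symProd : ℂ)⁻¹ •
    (MvPolynomial.monomial D.1.content 1 : H)) ⊗ₜ[ℂ] (MvPolynomial.X γ.1.forget : H))
  rw [mul_smul, TensorProduct.smul_tmul']

theorem finsum_card_fiber {A B M : Type*} [Fintype A] [AddCommMonoid M] (f : A → B) (g : B → M) :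
    ∑ᶠ b, Nat.card {a // f a = b} • g b = ∑ a, g (f a) := by
  classical
  rw [finsum_eq_sum_of_support_subset (s := Finset.univ.image f)]
  · rw [← Finset.sum_fiberwise_of_maps_to' (t := Finset.univ.image f)
      (fun a _ => Finset.mem_image_of_mem f (Finset.mem_univ a)) g]
    refine Finset.sum_congr rfl fun b _ => ?_
    rw [Finset.sum_const, Nat.card_eq_fintype_card, Fintype.card_subtype]
  · intro b hb
    by_contra hcon
    refine hb ?_
    have : IsEmpty {a // f a = b} := ⟨fun a => hcon (Finset.mem_coe.2
      (Finset.mem_image.2 ⟨a.1, Finset.mem_univ _, a.2⟩))⟩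
    simp only
    rw [Nat.card_of_isEmpty, zero_smul]

section Graft

variable {n : ℕ} (γ : LGraph (Fin n))

/-- The result of an insertion, without labels. -/
def resultGraph (D : γ.rep.graph.Insertion) : Graph := Graph.mk D.glue (D.glue_isOnePI γ.rep_onePI)

/-- The contribution of an insertion to the grafting operator. -/
def graftTerm (D : γ.rep.graph.Insertion) : H :=
  (maxf (resultGraph γ D) : ℂ)⁻¹ • (MvPolynomial.X (resultGraph γ D) : H)

theorem finite_content (h : Graph →₀ ℕ) : Finite {D : γ.rep.graph.Insertion // D.content = h} := by
  have := γ.rep.graph.finFib_insertion (degree h)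
  exact Finite.of_injective (β := {D : γ.rep.graph.Insertion // degree D.content = degree h})
    (fun D => ⟨D.1, by rw [D.2]⟩) fun D D' h => Subtype.ext (Subtype.mk.inj h)

/-- By `PreGraph.card_insertion` the two denominators multiply to the number of insertions with
content `h`. So the operator is the average, over these insertions, of the result divided by its
number of maximal forests. -/
theorem graft_monomial (h : Graph →₀ ℕ) : graft γ (MvPolynomial.monomial h 1) =
    ∑ᶠ D : {D : γ.rep.graph.Insertion // D.content = h},
      ((Nat.card {D : γ.rep.graph.Insertion // D.content = h} : ℂ)⁻¹) • graftTerm γ D.1 := by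
  have := finite_content γ h
  have := Fintype.ofFinite {D : γ.rep.graph.Insertion // D.content = h}
  have h1 : graft γ (MvPolynomial.monomial h 1) = _ :=
    (MvPolynomial.basisMonomials Graph ℂ).constr_basis ℂ _ h
  rw [h1]
  refine Eq.trans ?_ ((finsum_card_fiber (fun D :
    {D : γ.rep.graph.Insertion // D.content = h} => resultGraph γ D.1)
    fun c => ((Nat.card {D : γ.rep.graph.Insertion // D.content = h} : ℂ)⁻¹) •
      ((maxf c : ℂ)⁻¹ • (MvPolynomial.X c : H))).trans (finsum_eq_sum_of_fintype _).symm)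
  refine finsum_congr fun c => ?_
  have h2 : bij γ.rep.graph h c =
      Nat.card {D : {D : γ.rep.graph.Insertion // D.content = h} // resultGraph γ D.1 = c} := by
    have h3 : ∀ D : γ.rep.graph.Insertion,
        Nonempty (PreGraph.Iso D.glue c.rep) ↔ resultGraph γ D = c := fun D => by
      conv_rhs => rw [← c.mk_rep]
      exact Graph.mk_eq_mk.symm
    exact Nat.card_congr ⟨fun D => ⟨⟨D.1, D.2.1⟩, (h3 _).1 D.2.2⟩,
      fun D => ⟨D.1.1, D.1.2, (h3 _).2 D.2⟩, fun _ => rfl, fun _ => rfl⟩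
  rw [h2, ← Nat.cast_smul_eq_nsmul ℂ, smul_smul, smul_smul, γ.rep.graph.card_insertion h]
  congr 1
  rw [mul_inv, one_div, one_div]
  ring

/-- The fitted product is a sum over insertions with weights depending only on the content.
Replacing each summand by the average over insertions of the same content does not change such a
sum. -/
theorem graft_coeff_fitted (k : ℕ) : graft γ (PowerSeries.coeff k (fitted γ)) =
    ∑ᶠ D : {D : γ.rep.graph.Insertion // degree D.content = k},
      (D.1.symProd : ℂ)⁻¹ • graftTerm γ D.1 := by
  classical
  have := γ.rep.graph.finFib_insertion k
  have := Fintype.ofFinite {D : γ.rep.graph.Insertion // degree D.content = k}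
  let K := {D : γ.rep.graph.Insertion // degree D.content = k}
  let N : (Graph →₀ ℕ) → ℂ := fun h => Nat.card {D : γ.rep.graph.Insertion // D.content = h}
  let s : (Graph →₀ ℕ) → ℂ := fun h => mulFun (fun c => (c.sym : ℂ)) (Multiplicative.ofAdd h)
  have hN : ∀ D : K, N D.1.content = (Finset.univ.filter
      fun D' : K => D'.1.content = D.1.content).card := fun D => by
    rw [← Fintype.card_subtype, ← Nat.card_eq_fintype_card]
    exact congrArg Nat.cast (Nat.card_congr ⟨fun D' => ⟨⟨D'.1, by rw [D'.2, D.2]⟩, D'.2⟩,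
      fun D' => ⟨D'.1.1, D'.2⟩, fun _ => rfl, fun _ => rfl⟩)
  have hN0 : ∀ D : K, N D.1.content ≠ 0 := fun D => by
    rw [hN]
    exact Nat.cast_ne_zero.2 (Finset.card_ne_zero.2
      ⟨D, Finset.mem_filter.2 ⟨Finset.mem_univ _, rfl⟩⟩)
  have h1 : ∀ D : K, graft γ (MvPolynomial.monomial D.1.content 1) =
      ∑ D' : K, if D'.1.content = D.1.content then (N D.1.content)⁻¹ • graftTerm γ D'.1 else 0 := by
    intro D
    have := finite_content γ D.1.content
    have := Fintype.ofFinite {D' : γ.rep.graph.Insertion // D'.content = D.1.content}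
    rw [graft_monomial, finsum_eq_sum_of_fintype, ← Finset.sum_filter]
    exact Finset.sum_bij' (fun D' _ => ⟨D'.1, by rw [D'.2, D.2]⟩)
      (fun D' hD' => ⟨D'.1, (Finset.mem_filter.1 hD').2⟩)
      (fun D' _ => Finset.mem_filter.2 ⟨Finset.mem_univ _, D'.2⟩) (fun _ _ => Finset.mem_univ _)
      (fun _ _ => rfl) (fun _ _ => rfl) (fun _ _ => rfl)
  rw [coeff_fitted, finsum_eq_sum_of_fintype, finsum_eq_sum_of_fintype, map_sum]
  have h2 : ∀ D : K, graft γ ((D.1.symProd : ℂ)⁻¹ • MvPolynomial.monomial D.1.content 1) =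
      ∑ D' : K, if D'.1.content = D.1.content then
        ((s D'.1.content)⁻¹ * (N D'.1.content)⁻¹) • graftTerm γ D'.1 else 0 := fun D => by
    rw [map_smul, h1, Finset.smul_sum]
    refine Finset.sum_congr rfl fun D' _ => ?_
    split_ifs with h
    · rw [smul_smul, h, D.1.symProd_eq]
    · rw [smul_zero]
  -- After the exchange, `D'` occurs once for each insertion with the same content, which cancels
  -- the denominator of the average.
  rw [Finset.sum_congr rfl fun D _ => h2 D, Finset.sum_comm]
  refine Finset.sum_congr rfl fun D' _ => ?_
  rw [← Finset.sum_filter, Finset.sum_const, ← Nat.cast_smul_eq_nsmul ℂ, smul_smul,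
    D'.1.symProd_eq]
  congr 1
  have h3 : ((Finset.univ.filter fun D : K => D'.1.content = D.1.content).card : ℂ) =
      N D'.1.content := by
    rw [hN]
    congr 2
    ext D
    simp only [Finset.mem_filter, Finset.mem_univ, true_and]
    exact eq_comm
  rw [h3]
  have := hN0 D'
  field_simp
  rfl

end Graft

theorem graftTerm_eq {n : ℕ} (v : Legged.InsPair (Fin n)) : graftTerm v.1 v.2 =
    (maxf v.cls.forget : ℂ)⁻¹ • (MvPolynomial.X v.cls.forget : H) := by
  have h : resultGraph v.1 v.2 = v.cls.forget :=
    (LGraph.forget_mk v.result v.result_onePI).symm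
  rw [graftTerm, h]

theorem Prim.loops_eq {l n : ℕ} (γ : Prim l n) : l = 1 := by
  rw [← γ.2.2, ← LGraph.loops_forget]
  exact (Graph.isPrimitive_iff _).1 γ.2.1

/-- Primitive graphs are the graphs with one loop. -/
def primEquiv (n : ℕ) : Prim 1 n ≃ {γ : LGraph (Fin n) // γ.loops = 1} :=
  Equiv.subtypeEquivRight fun γ => by
    rw [Graph.isPrimitive_iff, LGraph.loops_forget, and_self]

instance (n : ℕ) : Finite (Prim 1 n) := Finite.of_equiv _ (primEquiv n).symm

/-- For a fixed result the insertions into one-loop graphs have total weight `maxf / Sym` by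
`LGraph.smul_maxf`; the factor `1 / maxf` in the grafting operator reduces this to `1 / Sym`. As
`maxf` is positive, every graph with `k + 1` loops is obtained. -/
theorem graftSum_one (n k : ℕ) : graftSum 1 n k = green n (k + 1) := by
  classical
  have h1 := Legged.InsPair.finsum_result_eq (P := Fin n) (k + 1) fun v =>
    if v.1.loops = 1 then ((v.1.sym : ℂ)⁻¹ * (v.2.symProd : ℂ)⁻¹) • graftTerm v.1 v.2 else 0
  have h2 : ∀ q : {q : LGraph (Fin n) // q.loops = k + 1},
      (∑ᶠ v : Legged.Ins q.1.toLegged, if v.1.1.loops = 1 then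
        ((v.1.1.sym : ℂ)⁻¹ * (v.1.2.symProd : ℂ)⁻¹) • graftTerm v.1.1 v.1.2 else 0) =
      (q.1.sym : ℂ)⁻¹ • (MvPolynomial.X q.1.forget : H) := by
    intro q
    have h3 := map_finsum_of_finite (LinearMap.toSpanSingleton ℂ H
      ((maxf q.1.forget : ℂ)⁻¹ • (MvPolynomial.X q.1.forget : H))).toAddMonoidHom
      fun v : Legged.Ins q.1.toLegged => ((v.1.1.sym : ℂ)⁻¹ * (v.1.2.symProd : ℂ)⁻¹) *
        (if v.1.1.loops = 1 then 1 else 0)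
    rw [← LGraph.smul_maxf] at h3
    have h4 : ((q.1.sym : ℂ)⁻¹ * (maxf q.1.forget : ℂ)) •
        ((maxf q.1.forget : ℂ)⁻¹ • (MvPolynomial.X q.1.forget : H)) = _ := h3
    have h5 : (maxf q.1.forget : ℂ) ≠ 0 := Nat.cast_ne_zero.2 (maxf_pos _).ne'
    rw [smul_smul, mul_assoc, mul_inv_cancel₀ h5, mul_one] at h4
    rw [h4]
    refine finsum_congr fun v => ?_
    have h6 : v.1.cls = q.1 := Legged.InsPair.nonempty_iso_iff.1 v.2
    change _ = (((v.1.1.sym : ℂ)⁻¹ * (v.1.2.symProd : ℂ)⁻¹) *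
      (if v.1.1.loops = 1 then (1 : ℂ) else 0)) •
      ((maxf q.1.forget : ℂ)⁻¹ • (MvPolynomial.X q.1.forget : H))
    rw [graftTerm_eq, h6]
    split_ifs
    · rw [mul_one]
    · rw [mul_zero, zero_smul]
  rw [finsum_congr h2] at h1
  -- Among the possible loop numbers of the base graph only one is primitive; the inserted graphs
  -- then have `k` loops in all.
  rw [green, h1, Finset.sum_eq_single_of_mem 1 (Finset.mem_range.2 (by omega))]
  · rw [graftSum, ← finsum_comp_equiv (primEquiv n).symm]
    refine finsum_congr fun γ => ?_
    change (γ.1.sym : ℂ)⁻¹ • graft γ.1 (PowerSeries.coeff k (fitted γ.1)) = _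
    rw [graft_coeff_fitted]
    have h7 := map_finsum_of_finite (LinearMap.lsmul ℂ H (γ.1.sym : ℂ)⁻¹).toAddMonoidHom
      fun D : {D : γ.1.rep.graph.Insertion // degree D.content = k} =>
        (D.1.symProd : ℂ)⁻¹ • graftTerm γ.1 D.1
    refine h7.trans (finsum_congr fun D => ?_)
    change (γ.1.sym : ℂ)⁻¹ • ((D.1.symProd : ℂ)⁻¹ • graftTerm γ.1 D.1) = _
    rw [if_pos γ.2, smul_smul]
  · intro l _ hl
    refine (finsum_congr fun γ => (finsum_congr fun D => if_neg ?_).trans finsum_zero).trans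
      finsum_zero
    change ¬ γ.1.loops = 1
    rw [γ.2]
    exact hl

theorem graftSum_of_ne_one {l : ℕ} (hl : l ≠ 1) (n k : ℕ) : graftSum l n k = 0 := by
  have : IsEmpty (Prim l n) := ⟨fun γ => hl γ.loops_eq⟩
  exact finsum_of_isEmpty _

theorem graftSumΔ_of_ne_one {l : ℕ} (hl : l ≠ 1) (n k : ℕ) : graftSumΔ l n k = 0 := by
  have : IsEmpty (Prim l n) := ⟨fun γ => hl γ.loops_eq⟩
  exact finsum_of_isEmpty _

/-! ## The quotient algebra -/

theorem cpow_sum {R ι : Type*} [CommRing R] [Algebra ℂ R] {f : PowerSeries R}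
    (hf : PowerSeries.constantCoeff f = 1) (s : Finset ι) (a : ι → ℂ) :
    ∏ i ∈ s, cpow f (a i) = cpow f (∑ i ∈ s, a i) := by
  classical
  induction s using Finset.induction_on with
  | empty => rw [Finset.prod_empty, Finset.sum_empty, cpow_zero hf]
  | insert i s hi ih => rw [Finset.prod_insert hi, Finset.sum_insert hi, ih, cpow_add hf]

theorem Q_eq (m : ℕ) : Q m = cpow (X m * cpow (X 2) (-((m : ℂ) / 2))) (1 / ((m : ℂ) - 2)) := rfl

theorem constantCoeff_Q (m : ℕ) : PowerSeries.constantCoeff (Q m) = 1 := constantCoeff_cpow _ _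

theorem coeff_projS (N : ℕ) (F : PowerSeries H) :
    PowerSeries.coeff N (projS F) = proj (PowerSeries.coeff N F) := PowerSeries.coeff_map _ _ _

theorem constantCoeff_projS {F : PowerSeries H} (hF : PowerSeries.constantCoeff F = 1) :
    PowerSeries.constantCoeff (projS F) = 1 := by
  rw [← PowerSeries.coeff_zero_eq_constantCoeff_apply, coeff_projS,
    PowerSeries.coeff_zero_eq_constantCoeff_apply, hF, map_one]

theorem projS_cpow {F : PowerSeries H} (hF : PowerSeries.constantCoeff F = 1) (a : ℂ) :
    projS (cpow F a) = cpow (projS F) a := map_algHom_cpow proj hF a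

/-- All couplings have the same class. -/
theorem projS_Q {m : ℕ} (hm : 3 ≤ m) : projS (Q m) = projS (Q 3) := by
  ext N
  rw [coeff_projS, coeff_projS]
  exact Ideal.Quotient.eq.2 (Ideal.subset_span ⟨m, 3, N, hm, le_rfl, rfl⟩)

/-- The common class of the couplings. -/
def coupling : PowerSeries Ht := projS (Q 3)

theorem constantCoeff_coupling : PowerSeries.constantCoeff coupling = 1 :=
  constantCoeff_projS (constantCoeff_Q 3)

/-- The definition of the coupling solved for the Green's function. For `m = 2` both exponents are
trivial, so no coupling is needed there. -/
theorem projS_X {m : ℕ} (hm : 2 ≤ m) :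
    projS (X m) = cpow coupling ((m : ℂ) - 2) * cpow (projS (X 2)) ((m : ℂ) / 2) := by
  have h2 := constantCoeff_projS (constantCoeff_X 2)
  rcases hm.eq_or_lt with rfl | hm
  · rw [Nat.cast_ofNat, sub_self, cpow_zero constantCoeff_coupling, one_mul,
      div_self two_ne_zero, cpow_one h2]
  · have h0 : (m : ℂ) - 2 ≠ 0 := by
      rw [sub_ne_zero]
      exact_mod_cast hm.ne'
    have h1 : PowerSeries.constantCoeff (X m * cpow (X 2) (-((m : ℂ) / 2))) = 1 := by
      rw [map_mul, constantCoeff_X, constantCoeff_cpow, one_mul]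
    rw [coupling, ← projS_Q hm, ← projS_cpow (constantCoeff_Q m), Q_eq, cpow_cpow h1,
      one_div_mul_cancel h0, cpow_one h1, map_mul, projS_cpow (constantCoeff_X 2), mul_assoc,
      ← cpow_add h2, neg_add_cancel, cpow_zero h2, mul_one]

/-- The product of Green's functions that fits a graph is a lift of `Xl`. -/
theorem projS_fitted {n : ℕ} (hn : 2 ≤ n) (γ : LGraph (Fin n)) :
    projS (fitted γ) = Xl γ.loops n := by
  have h2 := constantCoeff_projS (constantCoeff_X 2)
  have := Fintype.ofFinite γ.rep.graph.Vertex
  have h := γ.rep_onePI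
  have h3 : ∀ v, projS (X (γ.rep.graph.valence v)) = cpow coupling ((γ.rep.graph.valence v : ℂ) - 2) *
      cpow (projS (X 2)) ((γ.rep.graph.valence v : ℂ) / 2) := fun v =>
    projS_X (Nat.le_of_succ_le (h.three_le_valence v))
  -- Valences add up to the number of half-edges. The exponent of the coupling is therefore `2 I + n
  -- - 2 V = (n - 2) + 2 l`, and that of the propagator is `(2 I + n) / 2 - I = n / 2`: together
  -- these are `X n` times the coupling to the power `2 l`.
  have h4 : (∑ v, (γ.rep.graph.valence v : ℂ)) = 2 * γ.rep.graph.numInt + n := by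
    have h5 := h.lineLE.card_HE
    rw [PreGraph.card_HE_eq_sum_valence] at h5
    have h6 : γ.rep.graph.numLegs = n :=
      (Nat.card_congr γ.rep.leg).symm.trans (Nat.card_eq_fintype_card.trans (Fintype.card_fin n))
    rw [h6] at h5
    exact_mod_cast h5
  have h7 : (γ.loops : ℂ) = γ.rep.graph.numInt + 1 - γ.rep.graph.numVerts := by
    have h8 := h.not_tree
    have h9 : γ.loops + γ.rep.graph.numVerts = γ.rep.graph.numInt + 1 := by
      unfold LGraph.loops
      unfold PreGraph.loops at *
      omega
    rw [eq_sub_iff_add_eq]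
    exact_mod_cast h9
  have h8 : (γ.rep.graph.numVerts : ℂ) = Fintype.card γ.rep.graph.Vertex := by
    rw [PreGraph.numVerts, Nat.card_eq_fintype_card]
  rw [fitted, finprod_eq_prod_of_fintype, map_mul, map_prod, Finset.prod_congr rfl fun v _ => h3 v,
    Finset.prod_mul_distrib, cpow_sum constantCoeff_coupling, cpow_sum h2, fpow_eq_cpow,
    projS_cpow (constantCoeff_X 2), mul_assoc, ← cpow_add h2, Xl, projS_X hn]
  change _ = _ * coupling ^ (2 * γ.loops)
  rw [← cpow_natCast constantCoeff_coupling, mul_right_comm, ← cpow_add constantCoeff_coupling,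
    Finset.sum_sub_distrib, ← Finset.sum_div, h4, Finset.sum_const, Finset.card_univ, nsmul_eq_mul,
    ← h8]
  congr 2
  · push_cast
    rw [h7]
    ring
  · ring

/-! ### Substitution of the coupling -/

section Scale

variable {R : Type*} [CommRing R] (u : PowerSeries R)

theorem hasSubst_X_mul : PowerSeries.HasSubst (PowerSeries.X * u ^ 2) :=
  PowerSeries.HasSubst.of_constantCoeff_zero' (by simp)

/-- The substitution `g ↦ g u²`. -/
def scale : PowerSeries R →+* PowerSeries R :=
  (PowerSeries.substAlgHom (R := R) (hasSubst_X_mul u)).toRingHom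

theorem coeff_scale (F : PowerSeries R) (N : ℕ) : PowerSeries.coeff N (scale u F) =
    ∑ l ∈ Finset.range (N + 1), PowerSeries.coeff (N - l) (u ^ (2 * l)) * PowerSeries.coeff l F := by
  have h1 : scale u F = PowerSeries.subst (PowerSeries.X * u ^ 2) F :=
    congrFun (PowerSeries.coe_substAlgHom (hasSubst_X_mul u)) F
  rw [h1, PowerSeries.coeff_subst' (hasSubst_X_mul u),
    finsum_eq_sum_of_support_subset (s := Finset.range (N + 1))]
  · refine Finset.sum_congr rfl fun l hl => ?_
    rw [mul_pow, ← pow_mul, PowerSeries.coeff_X_pow_mul', if_pos (Finset.mem_range_succ_iff.1 hl),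
      smul_eq_mul, mul_comm]
  · intro l hl
    by_contra hcon
    refine hl ?_
    simp only
    rw [mul_pow, PowerSeries.coeff_X_pow_mul', if_neg (by simpa using hcon), smul_zero]

end Scale

/-! ### The coproduct in terms of the coupling -/

section Grouplike

variable {S A B : Type*} [CommRing S] [CommRing A] [CommRing B] [Algebra ℂ S] [Algebra ℂ A]
  [Algebra ℂ B] (π : S →ₐ[ℂ] A) (i : A →ₐ[ℂ] B) (j D : S →ₐ[ℂ] B) (u : PowerSeries A)

/-- The map `j` on coefficients, with a rescaled coupling constant. -/
def scaledMap : PowerSeries S →+* PowerSeries B :=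
  (scale (PowerSeries.map i.toRingHom u)).comp (PowerSeries.map j.toRingHom)

theorem coeff_scaledMap (N : ℕ) (F : PowerSeries S) : PowerSeries.coeff N (scaledMap i j u F) =
    ∑ l ∈ Finset.range (N + 1), i (PowerSeries.coeff (N - l) (u ^ (2 * l))) *
      j (PowerSeries.coeff l F) := by
  change PowerSeries.coeff N (scale (PowerSeries.map i.toRingHom u) _) = _
  rw [coeff_scale]
  refine Finset.sum_congr rfl fun l _ => ?_
  rw [← map_pow, PowerSeries.coeff_map, PowerSeries.coeff_map]
  rfl

theorem coeff_map_mul_scaledMap (N : ℕ) (F : PowerSeries A) (K : PowerSeries S) :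
    PowerSeries.coeff N (PowerSeries.map i.toRingHom F * scaledMap i j u K) =
      ∑ l ∈ Finset.range (N + 1),
        i (PowerSeries.coeff (N - l) (F * u ^ (2 * l))) * j (PowerSeries.coeff l K) := by
  rw [PowerSeries.coeff_mul]
  simp only [coeff_scaledMap, PowerSeries.coeff_mul, PowerSeries.coeff_map, Finset.mul_sum, map_sum,
    map_mul, Finset.sum_mul]
  rw [Finset.sum_sigma', Finset.sum_sigma']
  refine Finset.sum_bij' (fun x _ => ⟨x.2, (x.1.1, x.1.2 - x.2)⟩)
    (fun y _ => ⟨(y.2.1, y.2.2 + y.1), y.1⟩) ?_ ?_ ?_ ?_ ?_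
  · rintro ⟨⟨i, j⟩, l⟩ hx
    simp only [Finset.mem_sigma, Finset.HasAntidiagonal.mem_antidiagonal, Finset.mem_range] at hx ⊢
    omega
  · rintro ⟨l, ⟨i, j⟩⟩ hx
    simp only [Finset.mem_sigma, Finset.HasAntidiagonal.mem_antidiagonal, Finset.mem_range] at hx ⊢
    omega
  · rintro ⟨⟨i, j⟩, l⟩ hx
    simp only [Finset.mem_sigma, Finset.HasAntidiagonal.mem_antidiagonal, Finset.mem_range] at hx
    have : j - l + l = j := by omega
    simp only [this]
  · rintro ⟨l, ⟨i, j⟩⟩ hx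
    simp only [Nat.add_sub_cancel]
  · rintro ⟨⟨a, b⟩, l⟩ hx
    exact (mul_assoc _ _ _).symm

/-- Series on which `D` acts by a rescaling of the coupling constant. -/
def IsGrouplike (F : PowerSeries S) : Prop := PowerSeries.map D.toRingHom F =
  PowerSeries.map i.toRingHom (PowerSeries.map π.toRingHom F) * scaledMap i j u F

namespace IsGrouplike

variable {π i j D u}

theorem iff_coeff {F : PowerSeries S} : IsGrouplike π i j D u F ↔
    ∀ N, D (PowerSeries.coeff N F) = ∑ l ∈ Finset.range (N + 1),
      i (PowerSeries.coeff (N - l) (PowerSeries.map π.toRingHom F * u ^ (2 * l))) *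
        j (PowerSeries.coeff l F) := by
  unfold IsGrouplike
  rw [PowerSeries.ext_iff]
  refine forall_congr' fun N => ?_
  rw [coeff_map_mul_scaledMap, PowerSeries.coeff_map]
  rfl

/-- All maps involved, the rescaling included, are ring homomorphisms, so both sides of the defining
identity are multiplicative in the series. -/
theorem mul {F K : PowerSeries S} (hF : IsGrouplike π i j D u F) (hK : IsGrouplike π i j D u K) :
    IsGrouplike π i j D u (F * K) := by
  unfold IsGrouplike at *
  rw [map_mul, map_mul, map_mul, map_mul, hF, hK]
  ring

theorem one : IsGrouplike π i j D u 1 := by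
  unfold IsGrouplike
  rw [map_one, map_one, map_one, map_one, one_mul]

/-- Each map commutes with complex powers, because it takes families with polynomial coefficients to
such families; for the rescaling this holds since each coefficient is a finite sum. -/
theorem cpow {F : PowerSeries S} (h : IsGrouplike π i j D u F)
    (hF : PowerSeries.constantCoeff F = 1) (a : ℂ) : IsGrouplike π i j D u (cpow F a) := by
  have h1 := map_algHom_cpow D hF a
  have h0 := map_algHom_cpow π hF a
  have h30 : PowerSeries.constantCoeff (PowerSeries.map π.toRingHom F) = 1 := by
    rw [← PowerSeries.coeff_zero_eq_constantCoeff_apply, PowerSeries.coeff_map,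
      PowerSeries.coeff_zero_eq_constantCoeff_apply, hF, map_one]
  have h2 := map_algHom_cpow i h30 a
  have h3 : PowerSeries.constantCoeff
      (PowerSeries.map i.toRingHom (PowerSeries.map π.toRingHom F)) = 1 := by
    rw [← PowerSeries.coeff_zero_eq_constantCoeff_apply, PowerSeries.coeff_map,
      PowerSeries.coeff_zero_eq_constantCoeff_apply, h30, map_one]
  have h4 : PowerSeries.constantCoeff (scaledMap i j u F) = 1 := by
    rw [← PowerSeries.coeff_zero_eq_constantCoeff_apply, coeff_scaledMap, zero_add,
      Finset.sum_range_one, mul_zero, pow_zero, PowerSeries.coeff_zero_eq_constantCoeff_apply,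
      PowerSeries.coeff_zero_eq_constantCoeff_apply, map_one, hF, map_one, map_one, mul_one]
  have h5 : scaledMap i j u (CoreHopf.cpow F a) = CoreHopf.cpow (scaledMap i j u F) a := by
    refine map_cpow (scaledMap i j u) (fun K hK N => ?_) hF h4 a
    simp only [coeff_scaledMap]
    exact IsPolyFun.sum _ fun l => (IsPolyFun.const _).mul ((hK l).map j)
  unfold IsGrouplike at *
  rw [h1, h0, h2, h5, h, cpow_mul h3 h4]

end IsGrouplike

end Grouplike

/-- The coproduct with the left factor in the quotient. -/
def Δl : H →ₐ[ℂ] Ht ⊗[ℂ] H := (Algebra.TensorProduct.map proj (AlgHom.id ℂ H)).comp Δ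

/-- Series on which the coproduct acts by a rescaling of the coupling constant. -/
def Grouplike (F : PowerSeries H) : Prop :=
  IsGrouplike (S := H) (A := Ht) (B := Ht ⊗[ℂ] H) proj Algebra.TensorProduct.includeLeft
    Algebra.TensorProduct.includeRight Δl coupling F

theorem grouplike_iff {F : PowerSeries H} : Grouplike F ↔ ∀ N,
    Δl (PowerSeries.coeff N F) = ∑ l ∈ Finset.range (N + 1),
      PowerSeries.coeff (N - l) (projS F * coupling ^ (2 * l)) ⊗ₜ[ℂ] PowerSeries.coeff l F := by
  refine (IsGrouplike.iff_coeff (S := H) (A := Ht) (B := Ht ⊗[ℂ] H)).trans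
    (forall_congr' fun N => ?_)
  have h : ∀ (a : Ht) (x : H), (Algebra.TensorProduct.includeLeft : Ht →ₐ[ℂ] Ht ⊗[ℂ] H) a *
      (Algebra.TensorProduct.includeRight : H →ₐ[ℂ] Ht ⊗[ℂ] H) x = a ⊗ₜ[ℂ] x := fun a x =>
    (Algebra.TensorProduct.tmul_mul_tmul a 1 1 x).trans (by rw [mul_one, one_mul])
  refine Eq.congr_right (Finset.sum_congr rfl fun l _ => ?_)
  exact h _ _

theorem Grouplike.mul {F K : PowerSeries H} (hF : Grouplike F) (hK : Grouplike K) :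
    Grouplike (F * K) :=
  IsGrouplike.mul (S := H) (A := Ht) (B := Ht ⊗[ℂ] H) hF hK

theorem Grouplike.one : Grouplike 1 := IsGrouplike.one (S := H) (A := Ht) (B := Ht ⊗[ℂ] H)

theorem Grouplike.cpow {F : PowerSeries H} (h : Grouplike F)
    (hF : PowerSeries.constantCoeff F = 1) (a : ℂ) : Grouplike (cpow F a) :=
  IsGrouplike.cpow (S := H) (A := Ht) (B := Ht ⊗[ℂ] H) h hF a

theorem green_zero (n : ℕ) : green n 0 = 0 := by
  have : IsEmpty {q : LGraph (Fin n) // q.loops = 0} :=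
    ⟨fun q => q.1.rep_onePI.not_tree.ne' q.2⟩
  exact finsum_of_isEmpty _

/-- In the quotient the left factor depends on the base graph only through its loop number, so the
sum over base graphs reassembles to a Green's function on the right. Only the left factor has to be
projected. -/
theorem Δl_green {n : ℕ} (hn : 2 ≤ n) (N : ℕ) : Δl (green n N) = proj (green n N) ⊗ₜ[ℂ] (1 : H) +
    ∑ l ∈ Finset.range (N + 1), PowerSeries.coeff (N - l) (Xl l n) ⊗ₜ[ℂ] green n l := by
  change Algebra.TensorProduct.map proj (AlgHom.id ℂ H) (Δ (green n N)) = _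
  rw [Δ_green, map_add, map_sum]
  congr 1
  refine Finset.sum_congr rfl fun l _ => ?_
  have h1 := map_finsum_of_finite
    (Algebra.TensorProduct.map proj (AlgHom.id ℂ H)).toRingHom.toAddMonoidHom
    (fun γ : {γ : LGraph (Fin n) // γ.loops = l} => (γ.1.sym : ℂ)⁻¹ •
      (PowerSeries.coeff (N - l) (fitted γ.1) ⊗ₜ[ℂ] (MvPolynomial.X γ.1.forget : H)))
  have h2 := map_finsum_of_finite
    ((TensorProduct.mk ℂ Ht H) (PowerSeries.coeff (N - l) (Xl l n))).toAddMonoidHom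
    (fun γ : {γ : LGraph (Fin n) // γ.loops = l} =>
      (γ.1.sym : ℂ)⁻¹ • (MvPolynomial.X γ.1.forget : H))
  refine Eq.trans h1 (Eq.trans (finsum_congr fun γ => ?_) h2.symm)
  change Algebra.TensorProduct.map proj (AlgHom.id ℂ H) ((γ.1.sym : ℂ)⁻¹ •
      (PowerSeries.coeff (N - l) (fitted γ.1) ⊗ₜ[ℂ] (MvPolynomial.X γ.1.forget : H))) =
    PowerSeries.coeff (N - l) (Xl l n) ⊗ₜ[ℂ] ((γ.1.sym : ℂ)⁻¹ • (MvPolynomial.X γ.1.forget : H))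
  rw [map_smul, TensorProduct.tmul_smul, Algebra.TensorProduct.map_tmul, ← coeff_projS,
    projS_fitted hn, γ.2]
  rfl

/-- The term with `1` on the right and the unit on the left together form the summand `l = 0`,
because the zeroth coefficient of `X n` is one; the rest is `Δl_green`. -/
theorem grouplike_X {n : ℕ} (hn : 2 ≤ n) : Grouplike (X n) := by
  refine grouplike_iff.2 fun N => ?_
  rw [coeff_X, map_add, map_smul, Δl_green hn, smul_add, ← add_assoc]
  simp only [coeff_X n, TensorProduct.tmul_add, TensorProduct.tmul_smul]
  rw [Finset.sum_add_distrib, Finset.smul_sum]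
  congr 1
  rw [Finset.sum_eq_single_of_mem 0 (Finset.mem_range.2 (Nat.succ_pos N))]
  · rw [mul_zero, pow_zero, mul_one, Nat.sub_zero, coeff_projS, coeff_X, map_add, map_smul,
      PowerSeries.coeff_one, PowerSeries.coeff_one, if_pos rfl, TensorProduct.add_tmul,
      TensorProduct.smul_tmul']
    congr 1
    split_ifs
    · rw [map_one proj]
      exact Δl.map_one'
    · rw [map_zero, map_zero, TensorProduct.zero_tmul]
  · intro l _ hl
    rw [PowerSeries.coeff_one, if_neg hl, TensorProduct.tmul_zero]

theorem grouplike_Q {m : ℕ} (hm : 3 ≤ m) : Grouplike (Q m) :=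
  ((grouplike_X (by omega)).mul ((grouplike_X le_rfl).cpow (constantCoeff_X 2) _)).cpow
    (by rw [map_mul, constantCoeff_X, constantCoeff_cpow, one_mul]) _

theorem grouplike_fitted {n : ℕ} (γ : LGraph (Fin n)) : Grouplike (fitted γ) := by
  have := Fintype.ofFinite γ.rep.graph.Vertex
  rw [fitted, finprod_eq_prod_of_fintype]
  refine Grouplike.mul ?_ ((grouplike_X le_rfl).cpow (constantCoeff_X 2) _)
  exact Finset.prod_induction _ Grouplike (fun _ _ => Grouplike.mul) Grouplike.one fun v _ =>
    grouplike_X (Nat.le_of_succ_le (γ.rep_onePI.three_le_valence v))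

/-- The coproduct with both factors in the quotient. -/
def Δr : H →ₐ[ℂ] Ht ⊗[ℂ] Ht := (Algebra.TensorProduct.map proj proj).comp Δ

theorem Δr_eq (x : H) : Δr x = Algebra.TensorProduct.map (AlgHom.id ℂ Ht) proj (Δl x) := by
  have h : (Algebra.TensorProduct.map proj proj : H ⊗[ℂ] H →ₐ[ℂ] Ht ⊗[ℂ] Ht) =
      (Algebra.TensorProduct.map (AlgHom.id ℂ Ht) proj).comp
        (Algebra.TensorProduct.map proj (AlgHom.id ℂ H)) :=
    Algebra.TensorProduct.ext' fun _ _ => rfl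
  exact congrFun (congrArg DFunLike.coe h) _

theorem Grouplike.Δr_coeff {F : PowerSeries H} (h : Grouplike F) (N : ℕ) :
    Δr (PowerSeries.coeff N F) = ∑ l ∈ Finset.range (N + 1),
      PowerSeries.coeff (N - l) (projS F * coupling ^ (2 * l)) ⊗ₜ[ℂ]
        PowerSeries.coeff l (projS F) := by
  rw [Δr_eq, grouplike_iff.1 h, map_sum]
  refine Finset.sum_congr rfl fun l _ => ?_
  rw [Algebra.TensorProduct.map_tmul, coeff_projS]
  rfl

/-- Each coupling has a coproduct that, with both factors projected, is expressed by its class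
alone. The classes agree, so the coproducts of a difference of couplings cancel. -/
theorem Δr_eq_zero {x : H} (hx : x ∈ I) : Δr x = 0 := by
  have h : I ≤ RingHom.ker Δr := by
    refine Ideal.span_le.2 ?_
    rintro _ ⟨m, n, l, hm, hn, rfl⟩
    change Δr _ = 0
    rw [map_sub, (grouplike_Q hm).Δr_coeff, (grouplike_Q hn).Δr_coeff, projS_Q hm, projS_Q hn,
      sub_self]
  exact h hx

/-- The coproduct of the quotient. -/
def Δt : Ht →ₐ[ℂ] Ht ⊗[ℂ] Ht := Ideal.Quotient.liftₐ I Δr fun _ h => Δr_eq_zero h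

theorem Δt_proj (x : H) : Δt (proj x) = Δr x := rfl

theorem Grouplike.Δt_coeff {F : PowerSeries H} (h : Grouplike F) (N : ℕ) :
    Δt (PowerSeries.coeff N (projS F)) = ∑ l ∈ Finset.range (N + 1),
      PowerSeries.coeff (N - l) (projS F * coupling ^ (2 * l)) ⊗ₜ[ℂ]
        PowerSeries.coeff l (projS F) := by
  rw [coeff_projS, Δt_proj, h.Δr_coeff]

/-! ### Characters and the operators of the quotient -/

theorem sgn_mul_self (n : ℕ) : sgn n * sgn n = 1 := by
  unfold sgn
  split_ifs <;> norm_num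

/-- The graph with one vertex, `m` external legs and `L` loops. -/
def bouquet (m L : ℕ) : PreGraph where
  HE := Fin m ⊕ Fin L × Bool
  vert := ⊤
  line := Setoid.ker (Sum.map id Prod.fst : Fin m ⊕ Fin L × Bool → Fin m ⊕ Fin L)

theorem bouquet_isLeg {m L : ℕ} (d : Fin m ⊕ Fin L × Bool) :
    (bouquet m L).IsLeg d ↔ ∃ p, d = Sum.inl p := by
  constructor
  · intro h
    rcases d with p | ⟨i, b⟩
    · exact ⟨p, rfl⟩
    · have h1 : (Sum.inr (i, !b) : Fin m ⊕ Fin L × Bool) = Sum.inr (i, b) := h _ rfl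
      simp at h1
  · rintro ⟨p, rfl⟩ (e | e) h
    · exact congrArg Sum.inl (Sum.inl.inj h).symm
    · exact absurd h Sum.inl_ne_inr

/-- The external legs of the graph with one vertex. -/
def bouquetLeg (m L : ℕ) : Fin m ≃ (bouquet m L).Leg :=
  Equiv.ofBijective (fun p => ⟨Sum.inl p, (bouquet_isLeg _).2 ⟨p, rfl⟩⟩)
    ⟨fun _ _ h => Sum.inl.inj (Subtype.mk.inj h), fun d => by
      obtain ⟨d, hd⟩ := d
      obtain ⟨p, rfl⟩ := (bouquet_isLeg d).1 hd
      exact ⟨p, rfl⟩⟩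

theorem bouquet_onePI {m L : ℕ} (hm : 2 ≤ m) (hL : 1 ≤ L) :
    (bouquet m L).IsOnePI ∧ (bouquet m L).loops = L := by
  have : Unique (bouquet m L).Vertex := by
    haveI : Subsingleton (bouquet m L).Vertex := Quotient.subsingleton_iff.2 rfl
    exact uniqueOfSubsingleton (Quotient.mk _ (Sum.inl (⟨0, by omega⟩ : Fin m)))
  have : Fintype (bouquet m L).Vertex := Fintype.ofFinite _
  have h1 : (bouquet m L).numLegs = m :=
    (Nat.card_congr (bouquetLeg m L)).symm.trans (Nat.card_eq_fintype_card.trans (Fintype.card_fin m))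
  have h2 : (bouquet m L).LineLE := by
    rintro (p | ⟨i, b⟩)
    · refine (Set.ncard_le_ncard (t := {Sum.inl p}) ?_ (Set.toFinite _)).trans
        ((Set.ncard_singleton _).le.trans one_le_two)
      rintro (e | e) h
      · exact congrArg Sum.inl (Sum.inl.inj h).symm
      · exact absurd h Sum.inl_ne_inr
    · refine (Set.ncard_le_ncard (t := {Sum.inr (i, false), Sum.inr (i, true)}) ?_
        (Set.toFinite _)).trans ((Set.ncard_insert_le _ _).trans
          (Nat.succ_le_succ (Set.ncard_singleton _).le))
      rintro (e | ⟨e, c⟩) h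
      · exact absurd h Sum.inr_ne_inl
      · obtain rfl : i = e := Sum.inr.inj h
        cases c
        · exact Or.inl rfl
        · exact Or.inr rfl
  have h3 : Nat.card (bouquet m L).HE = m + L * 2 := by
    change Nat.card (Fin m ⊕ Fin L × Bool) = _
    simp
  have h4 := h2.card_HE
  rw [h1, h3] at h4
  have h5 : (bouquet m L).loops = L := by
    unfold PreGraph.loops PreGraph.numVerts
    rw [Nat.card_unique]
    omega
  refine ⟨⟨h2, fun v => ?_, top_sup_eq _, by omega, fun _ _ => top_sup_eq _, by omega⟩, h5⟩
  have h6 : ∑ v, (bouquet m L).valence v = m + L * 2 :=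
    PreGraph.card_HE_eq_sum_valence.symm.trans h3
  rw [Fintype.sum_subsingleton _ v] at h6
  omega

/-- The number of graphs with `m` fixed legs and `L` loops, weighted by symmetry factors. -/
def weight (m L : ℕ) : ℂ := ∑ᶠ q : {q : LGraph (Fin m) // q.loops = L}, (q.1.sym : ℂ)⁻¹

/-- All summands are positive, and the graph with one vertex and `L` lines from it to itself shows
that there is one. -/
theorem weight_ne_zero {m L : ℕ} (hm : 2 ≤ m) (hL : 1 ≤ L) : weight m L ≠ 0 := by
  have := Fintype.ofFinite {q : LGraph (Fin m) // q.loops = L}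
  obtain ⟨h1, h2⟩ := bouquet_onePI hm hL
  have h3 : weight m L = ((∑ q : {q : LGraph (Fin m) // q.loops = L}, (q.1.sym : ℝ)⁻¹ : ℝ) : ℂ) := by
    rw [weight, finsum_eq_sum_of_fintype]
    push_cast
    rfl
  rw [h3, Complex.ofReal_ne_zero]
  refine (Finset.sum_pos (fun q _ => inv_pos.2 (Nat.cast_pos.2 ?_)) ?_).ne'
  · have : Nonempty (Legged.Iso q.1.rep q.1.rep) := ⟨Legged.Iso.refl _⟩
    exact Nat.card_pos
  · exact ⟨⟨LGraph.mk ⟨bouquet m L, bouquetLeg m L⟩ h1, (LGraph.loops_mk _ _).trans h2⟩,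
      Finset.mem_univ _⟩

/-- Green's functions are independent: their values under a character can be prescribed. -/
theorem exists_character (f : ℕ → PowerSeries ℂ) (hf : ∀ m, PowerSeries.constantCoeff (f m) = 1) :
    ∃ φ : H →ₐ[ℂ] ℂ, ∀ m, 2 ≤ m → PowerSeries.map φ.toRingHom (X m) = f m := by
  -- All graphs with the same numbers of legs and loops get the same value, namely the prescribed
  -- coefficient divided by their total weight and multiplied by the sign, which is its own inverse.
  let φ : H →ₐ[ℂ] ℂ := MvPolynomial.aeval fun c : Graph =>
    (sgn c.numLegs * PowerSeries.coeff c.loops (f c.numLegs)) * (weight c.numLegs c.loops)⁻¹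
  refine ⟨φ, fun m hm => PowerSeries.ext fun N => ?_⟩
  rw [PowerSeries.coeff_map]
  change φ (PowerSeries.coeff N (X m)) = _
  rcases Nat.eq_zero_or_pos N with rfl | hN
  · rw [PowerSeries.coeff_zero_eq_constantCoeff_apply, PowerSeries.coeff_zero_eq_constantCoeff_apply,
      constantCoeff_X, hf, map_one]
  · obtain ⟨k, rfl⟩ := Nat.exists_eq_add_of_lt hN
    rw [zero_add, coeff_succ_X, map_smul]
    have h1 := map_finsum_of_finite φ.toRingHom.toAddMonoidHom
      (fun q : {q : LGraph (Fin m) // q.loops = k + 1} =>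
        (q.1.sym : ℂ)⁻¹ • (MvPolynomial.X q.1.forget : H))
    have h2 := map_finsum_of_finite (AddMonoidHom.mulRight
      ((sgn m * PowerSeries.coeff (k + 1) (f m)) * (weight m (k + 1))⁻¹))
      (fun q : {q : LGraph (Fin m) // q.loops = k + 1} => (q.1.sym : ℂ)⁻¹)
    change weight m (k + 1) * _ = _ at h2
    have h3 : φ (green m (k + 1)) = weight m (k + 1) *
        ((sgn m * PowerSeries.coeff (k + 1) (f m)) * (weight m (k + 1))⁻¹) := by
      refine h1.trans ((finsum_congr fun q => ?_).trans h2.symm)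
      change φ ((q.1.sym : ℂ)⁻¹ • (MvPolynomial.X q.1.forget : H)) = (q.1.sym : ℂ)⁻¹ * _
      rw [map_smul, MvPolynomial.aeval_X, LGraph.numLegs_forget, LGraph.loops_forget, q.2,
        Nat.card_eq_fintype_card, Fintype.card_fin, smul_eq_mul]
    rw [h3, mul_comm (weight _ _), inv_mul_cancel_right₀ (weight_ne_zero hm (Nat.succ_pos k)),
      smul_eq_mul, ← mul_assoc, sgn_mul_self, one_mul]

/-- Send each Green's function `X m` to the power `m / n` of `u`. The exponents in every coupling
then cancel, so all couplings go to one. Hence the character vanishes on the ideal, and `Xl 1 n`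
goes to the image of `X n`, which is `u`. -/
theorem exists_character_Xl {n : ℕ} (hn : 2 ≤ n) {u : PowerSeries ℂ}
    (hu : PowerSeries.constantCoeff u = 1) :
    ∃ φ : Ht →ₐ[ℂ] ℂ, ∀ j, φ (PowerSeries.coeff j (Xl 1 n)) = PowerSeries.coeff j u := by
  have hn0 : (n : ℂ) ≠ 0 := Nat.cast_ne_zero.2 (by omega)
  obtain ⟨φ, hφ⟩ := exists_character (fun m => cpow u ((m : ℂ) / n))
    fun m => constantCoeff_cpow _ _
  have hQ : ∀ m, 3 ≤ m → PowerSeries.map φ.toRingHom (Q m) = 1 := by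
    intro m hm
    have h1 : PowerSeries.constantCoeff (X m * cpow (X 2) (-((m : ℂ) / 2))) = 1 := by
      rw [map_mul, constantCoeff_X, constantCoeff_cpow, one_mul]
    rw [Q_eq, map_algHom_cpow φ h1, map_mul, map_algHom_cpow φ (constantCoeff_X 2), hφ m (by omega),
      hφ 2 le_rfl, cpow_cpow hu, ← cpow_add hu]
    have h2 : (m : ℂ) / n + ((2 : ℕ) : ℂ) / n * -((m : ℂ) / 2) = 0 := by
      push_cast
      field_simp
      ring
    rw [h2, cpow_zero hu, one_cpow]
  have hI : I ≤ RingHom.ker φ := by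
    refine Ideal.span_le.2 ?_
    rintro _ ⟨m, m', l, hm, hm', rfl⟩
    change φ _ = 0
    have h1 : ∀ m, 3 ≤ m → φ (PowerSeries.coeff l (Q m)) =
        PowerSeries.coeff l (1 : PowerSeries ℂ) := fun m hm => by
      rw [← hQ m hm, PowerSeries.coeff_map]
      rfl
    rw [map_sub, h1 m hm, h1 m' hm', sub_self]
  refine ⟨Ideal.Quotient.liftₐ I φ fun _ h => hI h, fun j => ?_⟩
  have h1 : Xl 1 n = projS (X n * Q 3 ^ (2 * 1)) := by
    rw [map_mul, map_pow]
    rfl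
  have h2 : PowerSeries.map φ.toRingHom (X n * Q 3 ^ (2 * 1)) = u := by
    rw [map_mul, map_pow, hQ 3 le_rfl, one_pow, mul_one, hφ n hn, div_self hn0, cpow_one hu]
  rw [h1, coeff_projS]
  change φ _ = _
  rw [← h2, PowerSeries.coeff_map]
  rfl

/-- A linear relation would hold between the coefficients of every series with constant coefficient
one. The series `1` isolates the zeroth coefficient of the relation, and the difference between `1 +
g ^ k` and `1` isolates the `k`-th. -/
theorem linearIndependent_coeff_Xl {n : ℕ} (hn : 2 ≤ n) :
    LinearIndependent ℂ fun k => PowerSeries.coeff k (Xl 1 n) := by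
  rw [linearIndependent_iff']
  intro s a h
  have h1 : ∀ u : PowerSeries ℂ, PowerSeries.constantCoeff u = 1 →
      ∑ i ∈ s, a i * PowerSeries.coeff i u = 0 := fun u hu => by
    obtain ⟨φ, hφ⟩ := exists_character_Xl hn hu
    have h2 := congrArg φ h
    rw [map_sum, map_zero] at h2
    rw [← h2]
    refine Finset.sum_congr rfl fun i _ => ?_
    rw [map_smul, hφ, smul_eq_mul]
  have h0 : ∑ i ∈ s, a i * PowerSeries.coeff i (1 : PowerSeries ℂ) = 0 := h1 1 (map_one _)
  intro k hk
  rcases Nat.eq_zero_or_pos k with rfl | hpos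
  · simpa [PowerSeries.coeff_one, hk] using h0
  · have h2 := h1 (1 + PowerSeries.X ^ k) (by simp [hpos.ne'])
    simp only [map_add, mul_add, Finset.sum_add_distrib, h0, zero_add] at h2
    simpa [PowerSeries.coeff_X_pow, hk] using h2

/-- Independence makes arbitrary values on these coefficients consistent, and a linear map on their
span extends to the whole space. Off the span the extension is arbitrary. -/
theorem exists_graftOperator {n : ℕ} (hn : 2 ≤ n) :
    ∃ B : Ht →ₗ[ℂ] Ht, ∀ k, B (PowerSeries.coeff k (Xl 1 n)) = proj (green n (k + 1)) := by
  have h := linearIndependent_coeff_Xl hn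
  obtain ⟨B, hB⟩ := LinearMap.exists_extend
    ((Module.Basis.span h).constr ℂ fun k => proj (green n (k + 1)))
  refine ⟨B, fun k => ?_⟩
  have h1 := (Module.Basis.span h).constr_basis ℂ (fun k => proj (green n (k + 1))) k
  rw [← h1, ← hB, LinearMap.comp_apply, Submodule.subtype_apply, Module.Basis.span_apply]

/-- The grafting operators of the quotient. -/
def graftOperator (l n : ℕ) : Ht →ₗ[ℂ] Ht := by
  classical exact if h : l = 1 ∧ 2 ≤ n then (exists_graftOperator h.2).choose else 0

theorem graftOperator_one {n : ℕ} (hn : 2 ≤ n) (k : ℕ) :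
    graftOperator 1 n (PowerSeries.coeff k (Xl 1 n)) = proj (green n (k + 1)) := by
  rw [graftOperator, dif_pos ⟨rfl, hn⟩]
  exact (exists_graftOperator hn).choose_spec k

theorem graftOperator_of_ne_one {l : ℕ} (hl : l ≠ 1) (n : ℕ) : graftOperator l n = 0 :=
  dif_neg fun h => hl h.1

theorem graftOperator_eq_graftSum {n : ℕ} (hn : 2 ≤ n) (l k : ℕ) :
    graftOperator l n (PowerSeries.coeff k (Xl l n)) = proj (graftSum l n k) := by
  by_cases hl : l = 1
  · subst hl
    rw [graftOperator_one hn, graftSum_one]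
  · rw [graftOperator_of_ne_one hl, graftSum_of_ne_one hl, LinearMap.zero_apply, map_zero]

/-! ### The cocycle identity -/

theorem Xl_mul_coupling (n l i : ℕ) : Xl l n * coupling ^ (2 * i) = Xl (i + l) n := by
  rw [Xl, Xl, coupling, mul_assoc, ← pow_add, ← mul_add, add_comm]

/-- The series lifts to a product of powers of series on which the coproduct acts by rescaling, so
it has the same property. The factor of the coupling on the left raises the loop index. -/
theorem Δt_coeff_Xl {n : ℕ} (hn : 2 ≤ n) (l k : ℕ) : Δt (PowerSeries.coeff k (Xl l n)) =
    ∑ i ∈ Finset.range (k + 1), PowerSeries.coeff (k - i) (Xl (i + l) n) ⊗ₜ[ℂ]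
      PowerSeries.coeff i (Xl l n) := by
  have h1 : Xl l n = projS (X n * cpow (Q 3) ((2 * l : ℕ) : ℂ)) := by
    rw [cpow_natCast (constantCoeff_Q 3), map_mul, map_pow]
    rfl
  have h2 : Grouplike (X n * cpow (Q 3) ((2 * l : ℕ) : ℂ)) :=
    (grouplike_X hn).mul ((grouplike_Q le_rfl).cpow (constantCoeff_Q 3) _)
  have h3 := h2.Δt_coeff k
  rw [← h1] at h3
  rw [h3]
  exact Finset.sum_congr rfl fun i _ => by rw [Xl_mul_coupling]

theorem Δt_green {n : ℕ} (hn : 2 ≤ n) (k : ℕ) : Δt (proj (green n (k + 1))) =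
    proj (green n (k + 1)) ⊗ₜ[ℂ] (1 : Ht) + ∑ i ∈ Finset.range (k + 1),
      PowerSeries.coeff (k - i) (Xl (i + 1) n) ⊗ₜ[ℂ] proj (green n (i + 1)) := by
  rw [Δt_proj, Δr_eq, Δl_green hn, map_add, map_sum, Finset.sum_range_succ', green_zero,
    TensorProduct.tmul_zero, map_zero, add_zero, Algebra.TensorProduct.map_tmul, map_one]
  congr 1
  refine Finset.sum_congr rfl fun i _ => ?_
  rw [Algebra.TensorProduct.map_tmul, Nat.add_sub_add_right]
  rfl

theorem map_graftOperator {n : ℕ} (hn : 2 ≤ n) (k : ℕ) :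
    TensorProduct.map LinearMap.id (graftOperator 1 n) (Δt (PowerSeries.coeff k (Xl 1 n))) =
      ∑ i ∈ Finset.range (k + 1), PowerSeries.coeff (k - i) (Xl (i + 1) n) ⊗ₜ[ℂ]
        proj (green n (i + 1)) := by
  rw [Δt_coeff_Xl hn, map_sum]
  refine Finset.sum_congr rfl fun i _ => ?_
  rw [TensorProduct.map_tmul, graftOperator_one hn]
  rfl

/-- For `l = 1` the operator replaces, in each summand of the coproduct of its argument, the right
factor of order `i` by the Green's function coefficient of order `i + 1`. The left factors already
carry the index `i + 1`, so this is the coproduct of the result without its last term. For other `l`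
everything vanishes. -/
theorem graftOperator_cocycle {n : ℕ} (hn : 2 ≤ n) (l k : ℕ) :
    Δt (graftOperator l n (PowerSeries.coeff k (Xl l n))) =
      graftOperator l n (PowerSeries.coeff k (Xl l n)) ⊗ₜ[ℂ] (1 : Ht) +
        TensorProduct.map LinearMap.id (graftOperator l n)
          (Δt (PowerSeries.coeff k (Xl l n))) := by
  by_cases hl : l = 1
  · subst hl
    rw [map_graftOperator hn, graftOperator_one hn, Δt_green hn]
  · rw [graftOperator_of_ne_one hl, TensorProduct.map_zero_right, LinearMap.zero_apply,
      LinearMap.zero_apply, map_zero, TensorProduct.zero_tmul, add_zero]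

/-- The grafting operator acts only on the right factor, so the left one may be projected
beforehand. The right one may not, as this operator lives on `H`. -/
theorem proj_graft_Δ {n : ℕ} (γ : LGraph (Fin n)) (x : H) :
    Algebra.TensorProduct.map proj proj (TensorProduct.map LinearMap.id (graft γ) (Δ x)) =
      TensorProduct.map LinearMap.id (proj.toLinearMap ∘ₗ graft γ) (Δl x) := by
  change Algebra.TensorProduct.map proj proj (TensorProduct.map LinearMap.id (graft γ) (Δ x)) =
    TensorProduct.map LinearMap.id (proj.toLinearMap ∘ₗ graft γ)
      (Algebra.TensorProduct.map proj (AlgHom.id ℂ H) (Δ x))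
  induction Δ x using TensorProduct.induction_on with
  | zero => simp only [map_zero]
  | tmul a b => rfl
  | add a b ha hb => rw [map_add, map_add, map_add, map_add, ha, hb]

/-- With the left factor projected, the coproduct of the fitted product has coefficients of that
same fitted product on the right, and left factors that do not depend on the graph. So the sum over
graphs acts on the right alone, where `graftSum_one` evaluates it. -/
theorem map_graftSumΔ {n : ℕ} (hn : 2 ≤ n) (k : ℕ) :
    Algebra.TensorProduct.map proj proj (graftSumΔ 1 n k) =
      ∑ i ∈ Finset.range (k + 1), PowerSeries.coeff (k - i) (Xl (i + 1) n) ⊗ₜ[ℂ]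
        proj (green n (i + 1)) := by
  have := Fintype.ofFinite (Prim 1 n)
  have h1 : ∀ γ : Prim 1 n, Algebra.TensorProduct.map proj proj (((γ.1.sym : ℂ)⁻¹) •
      TensorProduct.map LinearMap.id (graft γ.1) (Δ (PowerSeries.coeff k (fitted γ.1)))) =
      ∑ i ∈ Finset.range (k + 1), PowerSeries.coeff (k - i) (Xl (i + 1) n) ⊗ₜ[ℂ]
        proj ((γ.1.sym : ℂ)⁻¹ • graft γ.1 (PowerSeries.coeff i (fitted γ.1))) := fun γ => by
    rw [map_smul, proj_graft_Δ, grouplike_iff.1 (grouplike_fitted γ.1), map_sum, Finset.smul_sum]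
    refine Finset.sum_congr rfl fun i _ => ?_
    rw [projS_fitted hn, γ.2.2, Xl_mul_coupling, TensorProduct.map_tmul, map_smul,
      TensorProduct.tmul_smul]
    rfl
  rw [graftSumΔ, finsum_eq_sum_of_fintype, map_sum, Finset.sum_congr rfl fun γ _ => h1 γ,
    Finset.sum_comm]
  refine Finset.sum_congr rfl fun i _ => ?_
  rw [← TensorProduct.tmul_sum, ← map_sum, ← finsum_eq_sum_of_fintype]
  exact congrArg (fun x => PowerSeries.coeff (k - i) (Xl (i + 1) n) ⊗ₜ[ℂ] proj x) (graftSum_one n i)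

theorem map_graftOperator_eq {n : ℕ} (hn : 2 ≤ n) (l k : ℕ) :
    TensorProduct.map LinearMap.id (graftOperator l n) (Δt (PowerSeries.coeff k (Xl l n))) =
      Algebra.TensorProduct.map proj proj (graftSumΔ l n k) := by
  by_cases hl : l = 1
  · subst hl
    rw [map_graftOperator hn, map_graftSumΔ hn]
  · rw [graftOperator_of_ne_one hl, TensorProduct.map_zero_right, LinearMap.zero_apply,
      graftSumΔ_of_ne_one hl, map_zero]

/-- The Dyson–Schwinger equation. -/
theorem dysonSchwinger {n : ℕ} (hn : 2 ≤ n) : projS (X n) = 1 + sgn n • PowerSeries.mk fun L =>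
    ∑ l ∈ Finset.Icc 1 L, graftOperator l n (PowerSeries.coeff (L - l) (Xl l n)) := by
  ext L
  rw [coeff_projS, map_add, PowerSeries.coeff_smul, PowerSeries.coeff_mk, coeff_X, map_add, map_smul]
  congr 1
  · rw [PowerSeries.coeff_one, PowerSeries.coeff_one]
    split_ifs
    · rw [map_one]
    · rw [map_zero]
  · congr 1
    rcases L with _ | k
    · rw [green_zero, map_zero, Finset.Icc_eq_empty (by omega), Finset.sum_empty]
    · rw [Finset.sum_eq_single_of_mem 1 (Finset.mem_Icc.2 ⟨le_rfl, by omega⟩), Nat.add_sub_cancel,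
        graftOperator_one hn]
      intro l _ hl
      rw [graftOperator_of_ne_one hl, LinearMap.zero_apply]

/-! ### The coefficients as polynomials -/

/-- Power series whose coefficients are homogeneous of the same degree. -/
def IsHomogeneousSeries (F : PowerSeries (MvPolynomial (ℕ × ℕ) ℂ)) : Prop :=
  ∀ N, (PowerSeries.coeff N F).IsWeightedHomogeneous (fun i : ℕ × ℕ => i.2) N

namespace IsHomogeneousSeries

variable {F G : PowerSeries (MvPolynomial (ℕ × ℕ) ℂ)}

theorem one : IsHomogeneousSeries 1 := fun N => by
  rw [PowerSeries.coeff_one]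
  split_ifs with h
  · rw [h]
    exact MvPolynomial.isWeightedHomogeneous_one ℂ _
  · exact MvPolynomial.isWeightedHomogeneous_zero ℂ _ _

theorem sub (hF : IsHomogeneousSeries F) (hG : IsHomogeneousSeries G) :
    IsHomogeneousSeries (F - G) := fun N => by
  rw [map_sub]
  exact (MvPolynomial.weightedHomogeneousSubmodule ℂ _ N).sub_mem (hF N) (hG N)

theorem mul (hF : IsHomogeneousSeries F) (hG : IsHomogeneousSeries G) :
    IsHomogeneousSeries (F * G) := fun N => by
  rw [PowerSeries.coeff_mul]
  refine (MvPolynomial.weightedHomogeneousSubmodule ℂ _ N).sum_mem fun x hx => ?_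
  rw [← Finset.HasAntidiagonal.mem_antidiagonal.1 hx]
  exact (hF _).mul (hG _)

theorem pow (hF : IsHomogeneousSeries F) (n : ℕ) : IsHomogeneousSeries (F ^ n) := by
  induction n with
  | zero => rw [pow_zero]; exact one
  | succ n ih => rw [pow_succ]; exact ih.mul hF

theorem cpow (hF : IsHomogeneousSeries F) (a : ℂ) : IsHomogeneousSeries (cpow F a) := fun N => by
  rw [coeff_cpow]
  exact (MvPolynomial.weightedHomogeneousSubmodule ℂ _ N).sum_mem fun k _ =>
    (MvPolynomial.weightedHomogeneousSubmodule ℂ _ N).smul_mem _ ((hF.sub one).pow k N)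

end IsHomogeneousSeries

/-- Green's functions with indeterminate coefficients. -/
def freeX (n : ℕ) : PowerSeries (MvPolynomial (ℕ × ℕ) ℂ) :=
  PowerSeries.mk fun m => if m = 0 then 1 else MvPolynomial.X (n - 2, m)

/-- The coupling as a function of Green's functions. -/
def freeQ : PowerSeries (MvPolynomial (ℕ × ℕ) ℂ) :=
  cpow (freeX 3 * cpow (freeX 2) (-(((3 : ℕ) : ℂ) / 2))) (1 / (((3 : ℕ) : ℂ) - 2))

theorem constantCoeff_freeX (n : ℕ) : PowerSeries.constantCoeff (freeX n) = 1 := by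
  rw [← PowerSeries.coeff_zero_eq_constantCoeff_apply, freeX, PowerSeries.coeff_mk, if_pos rfl]

theorem isHomogeneousSeries_freeX (n : ℕ) : IsHomogeneousSeries (freeX n) := fun N => by
  rw [freeX, PowerSeries.coeff_mk]
  split_ifs with h
  · rw [h]
    exact MvPolynomial.isWeightedHomogeneous_one ℂ _
  · exact MvPolynomial.isWeightedHomogeneous_X ℂ _ _

theorem isHomogeneousSeries_freeQ : IsHomogeneousSeries freeQ :=
  ((isHomogeneousSeries_freeX 3).mul ((isHomogeneousSeries_freeX 2).cpow _)).cpow _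

/-- The evaluation at Green's functions. -/
def evalX : MvPolynomial (ℕ × ℕ) ℂ →ₐ[ℂ] Ht :=
  MvPolynomial.aeval fun i : ℕ × ℕ => proj (PowerSeries.coeff i.2 (X (i.1 + 2)))

theorem map_evalX_freeX {n : ℕ} (hn : 2 ≤ n) :
    PowerSeries.map evalX.toRingHom (freeX n) = projS (X n) := by
  ext N
  rw [PowerSeries.coeff_map, coeff_projS, freeX, PowerSeries.coeff_mk]
  change evalX _ = _
  split_ifs with h
  · rw [h, PowerSeries.coeff_zero_eq_constantCoeff_apply, constantCoeff_X, map_one, map_one]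
  · rw [evalX, MvPolynomial.aeval_X, Nat.sub_add_cancel hn]

theorem map_evalX_freeQ : PowerSeries.map evalX.toRingHom freeQ = projS (Q 3) := by
  have h1 : PowerSeries.constantCoeff (freeX 3 * cpow (freeX 2) (-(((3 : ℕ) : ℂ) / 2))) = 1 := by
    rw [map_mul, constantCoeff_freeX, constantCoeff_cpow, one_mul]
  have h2 : PowerSeries.constantCoeff (X 3 * cpow (X 2) (-(((3 : ℕ) : ℂ) / 2))) = 1 := by
    rw [map_mul, constantCoeff_X, constantCoeff_cpow, one_mul]
  rw [freeQ, map_algHom_cpow evalX h1, map_mul, map_algHom_cpow evalX (constantCoeff_freeX 2),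
    map_evalX_freeX (by norm_num), map_evalX_freeX le_rfl, Q_eq, projS_cpow h2, map_mul,
    projS_cpow (constantCoeff_X 2)]

/-- The polynomials are coefficients of the same expression in Green's functions with indeterminate
coefficients. An indeterminate has the degree of the power of the coupling constant at which it
stands, so homogeneity survives products and powers. The variable `(i, m)` stands for the
coefficient of order `m` of `X (i + 2)`. In the coproduct the order of summation is reversed, so
that `j` is the order of the left factor. -/
theorem exists_polynomials {n : ℕ} (hn : 2 ≤ n) (l : ℕ) : ∃ P : ℕ → MvPolynomial (ℕ × ℕ) ℂ,
    (∀ j ≤ l, (P j).IsWeightedHomogeneous (fun i : ℕ × ℕ => i.2) j ∧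
      evalX (P j) = PowerSeries.coeff j (Xl (l - j) n)) ∧
    Δt (proj (PowerSeries.coeff l (X n))) = ∑ j ∈ Finset.range (l + 1),
      evalX (P j) ⊗ₜ[ℂ] proj (PowerSeries.coeff (l - j) (X n)) := by
  have h1 : ∀ j, evalX (PowerSeries.coeff j (freeX n * freeQ ^ (2 * (l - j)))) =
      PowerSeries.coeff j (Xl (l - j) n) := fun j => by
    rw [Xl, ← map_evalX_freeX hn, ← map_evalX_freeQ, ← map_pow, ← map_mul, PowerSeries.coeff_map]
    rfl
  refine ⟨fun j => PowerSeries.coeff j (freeX n * freeQ ^ (2 * (l - j))), fun j _ =>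
    ⟨(isHomogeneousSeries_freeX n).mul (isHomogeneousSeries_freeQ.pow _) j, h1 j⟩, ?_⟩
  rw [← coeff_projS, (grouplike_X hn).Δt_coeff, ← Finset.sum_flip]
  refine Finset.sum_congr rfl fun j hj => ?_
  rw [h1, Nat.sub_sub_self (Finset.mem_range_succ_iff.1 hj), coeff_projS]
  rfl

end CoreHopf

end

/-! ### The theorem -/

theorem mainTheorem2 :
    ∃ (Δt : CoreHopf.Ht →ₐ[ℂ] TensorProduct ℂ CoreHopf.Ht CoreHopf.Ht)
      (B : ℕ → ℕ → CoreHopf.Ht →ₗ[ℂ] CoreHopf.Ht),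
      -- the coproduct of the quotient is induced by the coproduct of the core Hopf algebra
      (∀ x : CoreHopf.H, Δt (CoreHopf.proj x) =
        Algebra.TensorProduct.map CoreHopf.proj CoreHopf.proj (CoreHopf.Δ x)) ∧
      -- all couplings agree in the quotient
      (∀ m : ℕ, 3 ≤ m → CoreHopf.projS (CoreHopf.Q m) = CoreHopf.projS (CoreHopf.Q 3)) ∧
      ∀ n : ℕ, 2 ≤ n →
        -- the arguments on which the grafting operators act represent `X_{l,n}`
        (∀ γ : CoreHopf.LGraph (Fin n),
          CoreHopf.projS (CoreHopf.fitted γ) = CoreHopf.Xl γ.loops n) ∧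
        -- `B l n` is the sum of the grafting operators over primitive graphs, acting on `X_{l,n}`
        (∀ l k : ℕ, B l n (PowerSeries.coeff k (CoreHopf.Xl l n)) =
          CoreHopf.proj (CoreHopf.graftSum l n k)) ∧
        -- Dyson-Schwinger equation
        CoreHopf.projS (CoreHopf.X n) = 1 + CoreHopf.sgn n • PowerSeries.mk (fun L =>
          ∑ l ∈ Finset.Icc 1 L, B l n (PowerSeries.coeff (L - l) (CoreHopf.Xl l n))) ∧
        -- Hochschild 1-cocycle identity
        (∀ l k : ℕ, Δt (B l n (PowerSeries.coeff k (CoreHopf.Xl l n))) =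
          TensorProduct.tmul ℂ (B l n (PowerSeries.coeff k (CoreHopf.Xl l n))) 1 +
            TensorProduct.map LinearMap.id (B l n)
              (Δt (PowerSeries.coeff k (CoreHopf.Xl l n)))) ∧
        -- the last term is the one given by the grafting operators on graphs
        (∀ l k : ℕ, TensorProduct.map LinearMap.id (B l n)
              (Δt (PowerSeries.coeff k (CoreHopf.Xl l n))) =
          Algebra.TensorProduct.map CoreHopf.proj CoreHopf.proj (CoreHopf.graftSumΔ l n k)) ∧
        -- coproduct of the loop-order pieces
        (∀ l : ℕ, ∃ P : ℕ → MvPolynomial (ℕ × ℕ) ℂ,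
          (∀ j ≤ l, (P j).IsWeightedHomogeneous (fun i : ℕ × ℕ => i.2) j ∧
            MvPolynomial.aeval (fun i : ℕ × ℕ =>
              CoreHopf.proj (PowerSeries.coeff i.2 (CoreHopf.X (i.1 + 2)))) (P j) =
              PowerSeries.coeff j (CoreHopf.Xl (l - j) n)) ∧
          Δt (CoreHopf.proj (PowerSeries.coeff l (CoreHopf.X n))) =
            ∑ j ∈ Finset.range (l + 1), TensorProduct.tmul ℂ
              (MvPolynomial.aeval (fun i : ℕ × ℕ =>
                CoreHopf.proj (PowerSeries.coeff i.2 (CoreHopf.X (i.1 + 2)))) (P j))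
              (CoreHopf.proj (PowerSeries.coeff (l - j) (CoreHopf.X n)))) := by
  refine ⟨CoreHopf.Δt, CoreHopf.graftOperator, fun _ => rfl, fun m hm => CoreHopf.projS_Q hm,
    fun n hn => ⟨fun γ => CoreHopf.projS_fitted hn γ,
      fun l k => CoreHopf.graftOperator_eq_graftSum hn l k, CoreHopf.dysonSchwinger hn,
      fun l k => CoreHopf.graftOperator_cocycle hn l k,
      fun l k => CoreHopf.map_graftOperator_eq hn l k, fun l => CoreHopf.exists_polynomials hn l⟩⟩
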